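/- **Theorem 3.1 (Local existence).** Let $0<s<1$ and consider the non-cutoff Kac operator on functions of $v\in\mathbb R$, $$K(F,G)(v)=\int_{|\theta|\le\pi/4}\beta(\theta)\Big(\int_{\mathbb R}\big(F(v_*')G(v')-F(v_*)G(v)\big)\,dv_*\Big)d\theta,\qquad \beta(\theta)=\frac{|\cos\frac\theta2|}{|\sin\frac\theta2|^{1+2s}},$$ with $v'=v\cos\theta-v_*\sin\theta$, $v_*'=v\sin\theta+v_*\cos\theta$, the integral in $\theta$ being a finite part (i.e. $\beta$ is integrated against the even part in $\theta$ of the inner integral). Let $\mu(v)=(2\pi)^{-1/2}e^{-v^2/2}$, $$\Gamma(f,g)=\mu^{-1/2}K(\mu^{1/2}f,\mu^{1/2}g),\qquad \mathcal Kg=-\mu^{-1/2}K(\mu,\mu^{1/2}g)-\mu^{-1/2}K(\mu^{1/2}g,\mu),$$ and consider the Cauchy problem $$\partial_tg+v\,\partial_xg+\mathcal Kg=\Gamma(g,g),\qquad g|_{t=0}=g_0,\qquad (x,v)\in\mathbb R^2. \tag{1}$$ Let $\mathcal H=-\partial_v^2+\frac{v^2}4$, and $\mathcal H^{r}=\sum_{k\ge0}(k+\frac12)^{r}\mathbb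 P_k$, where $\mathbb P_k$ is the orthogonal projection onto the Hermite function $e_k=\frac1{\sqrt{k!}}\big(\frac v2-\frac d{dv}\big)^k\sqrt\mu$. Let $\chi,\varphi\in C^\infty(\mathbb R;[0,1])$ be supported in $\{|\xi|\le\frac43\}$ and $\{\frac34\le|\xi|\le\frac83\}$ respectively, with $\chi(\xi)+\sum_{q\ge0}\varphi(2^{-q}\xi)=1$ for all $\xi$; put $\Delta_{-1}=\chi(D_x)$ and $\Delta_q=\varphi(2^{-q}D_x)$ for $q\ge0$, and $$\|u\|_{\widetilde L^2_v(B^{1/2}_{2,1})}=\sum_{q\ge-1}2^{q/2}\|\Delta_qu\|_{L^2_{x,v}},\qquad \|u\|_{\widetilde L^{a}_T\widetilde L^2_v(B^{1/2}_{2,1})}=\sum_{q\ge-1}2^{q/2}\|\Delta_qu\|_{L^{a}([0,T];L^2_{x,v})}\quad(a\in\{2,\infty\}).$$ Functions are complex-valued, and $\widetilde L^2_v(B^{1/2}_{2,1})$ consists of the $u\in L^2(\mathbb R^2_{x,v})$ with finite norm. A *weak solution* of (1) on $[0,T]$ is a $g\in L^\infty([0,T];L^2(\mathbb R^2_{x,v}))$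 such that for all $h\in C_c^\infty([0,T)\times\mathbb R^2)$ $$\int_0^T\!\!\iint g\,(\partial_th+v\,\partial_xh)\,dv\,dx\,dt+\iint g_0\,h(0,x,v)\,dv\,dx=\int_0^T\!\!\int\big\langle \mathcal Kg-\Gamma(g,g),\,h\big\rangle\,dx\,dt,$$ where the brackets are the bilinear duality in $v$, defined through $$\langle K(F,G),\psi\rangle=\iint F(v_*)G(v)\int_{|\theta|\le\pi/4}\beta(\theta)\Big[\tfrac12\psi(v\cos\theta+v_*\sin\theta)+\tfrac12\psi(v\cos\theta-v_*\sin\theta)-\psi(v)\Big]d\theta\,dv_*\,dv .$$ Then there is a constant $c_0>1$, depending only on $s$ and $(\chi,\varphi)$, such that for every $0<T<\infty$ there is $\varepsilon_0>0$ with the following property. For every $g_0\in\widetilde L^2_v(B^{1/2}_{2,1})$ with $\|g_0\|_{\widetilde L^2_v(B^{1/2}_{2,1})}\le\varepsilon_0$: 1. (existence) problem (1) has a weak solution $g\in L^\infty([0,T];L^2(\mathbb R^2_{x,v}))$ on $[0,T]$ satisfying $$\|g\|_{\widetilde L^\infty_T\widetilde L^2_v(B^{1/2}_{2,1})}+\|\mathcal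 H^{s/2}g\|_{\widetilde L^2_T\widetilde L^2_v(B^{1/2}_{2,1})}\le c_0e^{T}\|g_0\|_{\widetilde L^2_v(B^{1/2}_{2,1})}; \tag{2}$$ 2. (uniqueness) any two weak solutions of (1) on $[0,T]$ with initial datum $g_0$ that both satisfy (2) agree almost everywhere on $[0,T]\times\mathbb R^2$. -/

import Mathlib

open MeasureTheory Set
open scoped ENNReal ContDiff

namespace Kac

noncomputable section

/-! ## Littlewood-Paley theory in the position variable -/

/-- A pair `(χ, φ)` generating an inhomogeneous dyadic partition of unity on the frequency line. -/
structure IsLittlewoodPaleyPair (χ φ : ℝ → ℝ) : Prop where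
  smooth_low : ContDiff ℝ ∞ χ
  smooth_shell : ContDiff ℝ ∞ φ
  range_low : ∀ ξ, χ ξ ∈ Icc (0 : ℝ) 1
  range_shell : ∀ ξ, φ ξ ∈ Icc (0 : ℝ) 1
  supp_low : ∀ ξ, χ ξ ≠ 0 → |ξ| ≤ 4 / 3
  supp_shell : ∀ ξ, φ ξ ≠ 0 → 3 / 4 ≤ |ξ| ∧ |ξ| ≤ 8 / 3
  partition : ∀ ξ, χ ξ + ∑' q : ℕ, φ (ξ / 2 ^ q) = 1

/-- The Fourier multiplier `m(D)`, `D = -i d/dx`, on functions of one real variable, for a smooth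
compactly supported symbol `m`: convolution with the inverse Fourier transform
`x ↦ (2π)⁻¹ ∫ exp(i x ξ) m(ξ) dξ` of the symbol, which is a Schwartz function. The convolution
converges absolutely for `u ∈ L²(ℝ)`. -/
def multiplierKernel (m : ℝ → ℝ) (x : ℝ) : ℂ :=
  (2 * Real.pi : ℂ)⁻¹ * ∫ ξ : ℝ, Complex.exp (Complex.I * x * ξ) * (m ξ : ℂ)

def fourierMultiplier (m : ℝ → ℝ) (u : ℝ → ℂ) (x : ℝ) : ℂ :=
  ∫ y : ℝ, multiplierKernel m (x - y) * u y

/-- The symbol of the dyadic block `Δ_q` with `q = j - 1 ≥ -1`: it is `χ(ξ)` for `q = -1`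
and `φ(2^{-q} ξ)` for `q ≥ 0`. -/
def blockSymbol (χ φ : ℝ → ℝ) : ℕ → ℝ → ℝ
  | 0 => χ
  | q + 1 => fun ξ => φ (ξ / 2 ^ q)

/-- The dyadic block `Δ_{j-1} u` for `u = u(x)`. -/
def block (χ φ : ℝ → ℝ) (j : ℕ) (u : ℝ → ℂ) : ℝ → ℂ :=
  fourierMultiplier (blockSymbol χ φ j) u

/-! ## Function spaces; functions are written `u x v` and `u t x v` -/

/-- The norm of `L^p(ℝ_v; L^r(ℝ_x))`. -/
def normVX (p r : ℝ≥0∞) (u : ℝ → ℝ → ℂ) : ℝ≥0∞ :=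
  eLpNorm (fun v => eLpNorm (fun x => u x v) r volume) p volume

/-- The norm of `L^a([0,T]; L^p(ℝ_v; L^r(ℝ_x)))`. -/
def normTVX (T : ℝ) (a p r : ℝ≥0∞) (u : ℝ → ℝ → ℝ → ℂ) : ℝ≥0∞ :=
  eLpNorm (fun t => normVX p r (u t)) a (volume.restrict (Icc 0 T))

/-- The norm of `L̃^p_v(B^σ_{r,1})`: the sum over `q = j - 1 ≥ -1` of
`2^{qσ} ‖Δ_q u‖_{L^p_v L^r_x}`. -/
def besovNorm (χ φ : ℝ → ℝ) (p r : ℝ≥0∞) (σ : ℝ) (u : ℝ → ℝ → ℂ) : ℝ≥0∞ :=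
  ∑' j : ℕ, (2 : ℝ≥0∞) ^ (((j : ℝ) - 1) * σ) *
    normVX p r (fun x v => block χ φ j (fun y => u y v) x)

/-- The norm of the Chemin-Lerner space `L̃^a_T L̃^p_v(B^σ_{r,1})`: the sum over `q = j - 1 ≥ -1`
of `2^{qσ} ‖Δ_q u‖_{L^a_T L^p_v L^r_x}`. -/
def cheminLernerNorm (χ φ : ℝ → ℝ) (T : ℝ) (a p r : ℝ≥0∞) (σ : ℝ) (u : ℝ → ℝ → ℝ → ℂ) : ℝ≥0∞ :=
  ∑' j : ℕ, (2 : ℝ≥0∞) ^ (((j : ℝ) - 1) * σ) *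
    normTVX T a p r (fun t x v => block χ φ j (fun y => u t y v) x)

/-- Lebesgue measure on the slab `[0,T] × ℝ_x × ℝ_v`. -/
def slab (T : ℝ) : Measure (ℝ × ℝ × ℝ) :=
  (volume.restrict (Icc 0 T)).prod (volume : Measure (ℝ × ℝ))

/-- `u ∈ L^a([0,T]; L²(ℝ²_{x,v}))`. -/
def MemTime (T : ℝ) (a : ℝ≥0∞) (u : ℝ → ℝ → ℝ → ℂ) : Prop :=
  AEStronglyMeasurable (fun p : ℝ × ℝ × ℝ => u p.1 p.2.1 p.2.2) (slab T) ∧ normTVX T a 2 2 u < ⊤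

/-! ## Maxwellian, Hermite basis, fractional harmonic oscillator -/

/-- `μ(v) = (2π)^{-1/2} exp(-v²/2)`. -/
def maxwellian (v : ℝ) : ℝ := (√(2 * Real.pi))⁻¹ * Real.exp (-v ^ 2 / 2)

/-- `√μ`. -/
def sqrtMaxwellian (v : ℝ) : ℝ := √(maxwellian v)

/-- The Hermite basis `e_n = (n!)^{-1/2} (v/2 - d/dv)^n √μ` of `L²(ℝ_v)`, which is
`(n!)^{-1/2} He_n(v) √μ(v)` for the probabilists' Hermite polynomial `He_n`. -/
def hermiteFun (n : ℕ) (v : ℝ) : ℝ :=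
  (√(n.factorial : ℝ))⁻¹ * (Polynomial.aeval v (Polynomial.hermite n)) * sqrtMaxwellian v

/-- `h = 𝓗^r g` on `[0,T] × ℝ²`, where `𝓗 = -∂_v² + v²/4` and `𝓗^r = ∑ₖ (k + 1/2)^r ℙₖ`, with
`h ∈ L²([0,T] × ℝ²)`: every Hermite coefficient of `h` in `v` is `(k + 1/2)^r` times that
of `g`. -/
def IsHarmonicPower (T r : ℝ) (g h : ℝ → ℝ → ℝ → ℂ) : Prop :=
  MemTime T 2 h ∧
    ∀ k : ℕ, ∀ᵐ p : ℝ × ℝ ∂((volume.restrict (Icc 0 T)).prod (volume : Measure ℝ)),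
      (∫ v : ℝ, h p.1 p.2 v * (hermiteFun k v : ℂ)) =
        ((((k : ℝ) + 1 / 2) ^ r : ℝ) : ℂ) * ∫ v : ℝ, g p.1 p.2 v * (hermiteFun k v : ℂ)

/-! ## The Kac collision operator, tested against functions of the velocity -/

/-- The cross section `β(θ) = |cos(θ/2)| / |sin(θ/2)|^{1+2s}`. -/
def crossSection (s θ : ℝ) : ℝ :=
  |Real.cos (θ / 2)| / |Real.sin (θ / 2)| ^ (1 + 2 * s)

/-- The finite part integral over `|θ| ≤ π/4` of `β(θ) (ψ(v cos θ + w sin θ) - ψ(v))`, i.e. the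
absolutely convergent integral of `β` against the even part in `θ`. -/
def collisionKernel (s : ℝ) (ψ : ℝ → ℂ) (v w : ℝ) : ℂ :=
  ∫ θ in (-(Real.pi / 4))..(Real.pi / 4),
    (crossSection s θ : ℂ) *
      ((ψ (v * Real.cos θ + w * Real.sin θ) + ψ (v * Real.cos θ - w * Real.sin θ)) / 2 - ψ v)

/-- `⟨K(F,G), ψ⟩` for the Kac operator
`K(F,G)(v) = ∫_{|θ| ≤ π/4} β(θ) ∫ (F(v_*') G(v') - F(v_*) G(v)) dv_* dθ` (finite part in `θ`),
`v' = v cos θ - v_* sin θ`, `v_*' = v sin θ + v_* cos θ`. The measure-preserving rotation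
`(v, v_*) ↦ (v', v_*')` has been undone so as to put the difference on the test function. -/
def kacPairing (s : ℝ) (F G ψ : ℝ → ℂ) : ℂ :=
  ∫ v : ℝ, ∫ w : ℝ, F w * G v * collisionKernel s ψ v w

/-- `⟨Γ(f,g), h⟩` with `Γ(f,g) = μ^{-1/2} K(μ^{1/2} f, μ^{1/2} g)`. -/
def gammaPairing (s : ℝ) (f g h : ℝ → ℂ) : ℂ :=
  kacPairing s (fun v => (sqrtMaxwellian v : ℂ) * f v) (fun v => (sqrtMaxwellian v : ℂ) * g v)
    (fun v => (sqrtMaxwellian v : ℂ)⁻¹ * h v)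

/-- `⟨𝒦 g, h⟩` with `𝒦 g = - μ^{-1/2} K(μ, μ^{1/2} g) - μ^{-1/2} K(μ^{1/2} g, μ)`. -/
def linearPairing (s : ℝ) (g h : ℝ → ℂ) : ℂ :=
  - kacPairing s (fun v => (maxwellian v : ℂ)) (fun v => (sqrtMaxwellian v : ℂ) * g v)
      (fun v => (sqrtMaxwellian v : ℂ)⁻¹ * h v)
  - kacPairing s (fun v => (sqrtMaxwellian v : ℂ) * g v) (fun v => (maxwellian v : ℂ))
      (fun v => (sqrtMaxwellian v : ℂ)⁻¹ * h v)

/-! ## Weak solutions -/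

/-- Test functions: restrictions to `t ≥ 0` are the elements of `C_c^∞([0,T) × ℝ²)`. -/
structure IsTest (T : ℝ) (h : ℝ × ℝ × ℝ → ℂ) : Prop where
  smooth : ContDiff ℝ ∞ h
  compact : HasCompactSupport h
  before : ∀ p ∈ tsupport h, p.1 < T

/-- `g ∈ L^∞([0,T]; L²(ℝ²_{x,v}))` is a weak solution on `[0,T]` of
`∂_t g + v ∂_x g + 𝒦 g = Γ(g,g)`, `g|_{t=0} = g₀`. For such `g` every integral below converges
absolutely. -/
def IsWeakSolution (s T : ℝ) (g₀ : ℝ → ℝ → ℂ) (g : ℝ → ℝ → ℝ → ℂ) : Prop :=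
  MemTime T ⊤ g ∧
    ∀ h : ℝ × ℝ × ℝ → ℂ, IsTest T h →
      (∫ t in Icc 0 T, ∫ x : ℝ, ∫ v : ℝ,
          g t x v * (deriv (fun τ => h (τ, x, v)) t + (v : ℂ) * deriv (fun y => h (t, y, v)) x))
        + (∫ x : ℝ, ∫ v : ℝ, g₀ x v * h (0, x, v))
      = ∫ t in Icc 0 T, ∫ x : ℝ,
          (linearPairing s (g t x) (fun v => h (t, x, v))
            - gammaPairing s (g t x) (g t x) (fun v => h (t, x, v)))

/-- The a priori bound
`‖g‖_{L̃^∞_T L̃²_v(B^{1/2}_{2,1})} + ‖𝓗^{s/2} g‖_{L̃²_T L̃²_v(B^{1/2}_{2,1})}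
  ≤ c₀ e^T ‖g₀‖_{L̃²_v(B^{1/2}_{2,1})}`. -/
def SatisfiesBound (χ φ : ℝ → ℝ) (s T c₀ : ℝ) (g₀ : ℝ → ℝ → ℂ) (g : ℝ → ℝ → ℝ → ℂ) : Prop :=
  ∃ h : ℝ → ℝ → ℝ → ℂ, IsHarmonicPower T (s / 2) g h ∧
    cheminLernerNorm χ φ T ⊤ 2 2 (1 / 2) g + cheminLernerNorm χ φ T 2 2 2 (1 / 2) h
      ≤ ENNReal.ofReal (c₀ * Real.exp T) * besovNorm χ φ 2 2 (1 / 2) g₀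

end

end Kac

namespace Kac

noncomputable section

open Filter hiding map_map
open scoped ComplexConjugate InnerProductSpace Topology Real Polynomial
open Finset.HasAntidiagonal (antidiagonal)
open Complex (I exp norm_real conj_conj conj_ofReal sub_re ofReal_re add_re exp_add conj_re mul_conj)
open Real (sin cos norm_of_nonneg norm_eq_abs sq_sqrt pi_pos rpow_add rpow_pos_of_pos rpow_neg sqrt_mul rpow_le_rpow sqrt_sq mul_self_sqrt mul_rpow rpow_one)
open ENNReal (ofReal mul_ne_top tsum_le_tsum ofReal_mul ofReal_le_ofReal ofReal_pow pow_ne_top ofReal_ne_top sum_le_tsum rpow_mul summable_toReal tsum_add mul_lt_top le_tsum ofReal_add toReal_ofNat rpow_natCast pow_lt_top ofReal_one ofReal_ofNat ofReal_tsum_of_nonneg toReal_ofReal mul_top)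
open Finset (sum_congr mul_sum)

local notation "vol" => (volume : Measure ℝ)

local notation "vol₂" => Measure.prod (volume : Measure ℝ) (volume : Measure ℝ)

lemma ne_top_of_le_mul {a b c : ℝ≥0∞} (hb : b ≠ ⊤) (hc : c ≠ ⊤) (h : a ≤ b * c) : a ≠ ⊤ := ne_top_of_le_ne_top (ENNReal.mul_ne_top hb hc) h

abbrev IsLP := IsLittlewoodPaleyPair

lemma integral_ext {α E : Type*} [MeasurableSpace α] [NormedAddCommGroup E] [NormedSpace ℝ E] {μ : Measure α} {f g : α → E}
    (h : ∀ x, f x = g x) : ∫ x, f x ∂μ = ∫ x, g x ∂μ := integral_congr_ae (.of_forall h)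

variable {χ φ : ℝ → ℝ} {m f g h : ℝ → ℂ} {T s : ℝ} {F : ℝ → ℝ → ℂ}

section

open Polynomial (X C hermite derivative eval eval_mul eval_map aeval_def eval_X derivative_mul aeval eval_C eval_add hermite_succ)

/-! ## Hermite polynomials and Gaussian integrals -/

/-- The probabilists' Hermite polynomial as a function. -/
def herm (n : ℕ) (x : ℝ) : ℝ := aeval x (hermite n)

lemma derivative_hermite_succ (n : ℕ) : derivative (hermite (n + 1)) = ((n : Polynomial ℤ) + 1) * hermite n := by
  induction n with
  | zero => simp
  | succ n ih =>
    rw [hermite_succ (n + 1), Polynomial.derivative_sub, derivative_mul, ih, Polynomial.derivative_X, derivative_mul]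
    have h := hermite_succ n
    simp only [Polynomial.derivative_add, Polynomial.derivative_natCast, Polynomial.derivative_one]; push_cast
    rw [h]; ring

@[simp] lemma herm_zero (x : ℝ) : herm 0 x = 1 := by simp [herm]

lemma hasDerivAt_herm_succ (n : ℕ) (x : ℝ) : HasDerivAt (herm (n + 1)) ((n + 1) * herm n x) x := by
  have h := Polynomial.hasDerivAt_aeval (hermite (n + 1)) x
  rw [derivative_hermite_succ] at h
  have e : aeval x (((n : Polynomial ℤ) + 1) * hermite n) = (n + 1) * herm n x := by simp [herm]
  rw [e] at h
  exact h

lemma hasDerivAt_herm (n : ℕ) (x : ℝ) : HasDerivAt (herm n) (n * herm (n - 1) x) x := by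
  cases n with
  | zero =>
    have : herm 0 = fun _ => 1 := by ext; simp
    rw [this]; simpa using hasDerivAt_const x (1 : ℝ)
  | succ n => simpa using hasDerivAt_herm_succ n x

lemma herm_succ (n : ℕ) (x : ℝ) : herm (n + 1) x = x * herm n x - n * herm (n - 1) x := by
  have h1 : herm (n + 1) x = x * herm n x - aeval x (derivative (hermite n)) := by simp [herm, hermite_succ]
  rw [h1]
  congr 1
  exact (Polynomial.hasDerivAt_aeval (hermite n) x).unique (hasDerivAt_herm n x)

/-- The functions that are polynomials. -/
def IsPoly (f : ℝ → ℝ) : Prop := ∃ p : ℝ[X], ∀ x, f x = p.eval x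

lemma IsPoly.mul {f g : ℝ → ℝ} (hf : IsPoly f) (hg : IsPoly g) : IsPoly (fun x => f x * g x) := by
  obtain ⟨p, hp⟩ := hf; obtain ⟨q, hq⟩ := hg
  exact ⟨p * q, fun x => by simp [hp, hq]⟩

lemma IsPoly.add {f g : ℝ → ℝ} (hf : IsPoly f) (hg : IsPoly g) : IsPoly (fun x => f x + g x) := by
  obtain ⟨p, hp⟩ := hf; obtain ⟨q, hq⟩ := hg
  exact ⟨p + q, fun x => by simp [hp, hq]⟩

lemma IsPoly.const (c : ℝ) : IsPoly (fun _ => c) := ⟨C c, fun x => by simp⟩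

lemma IsPoly.id : IsPoly (fun x => x) := ⟨X, fun x => by simp⟩

lemma IsPoly.comp {f g : ℝ → ℝ} (hf : IsPoly f) (hg : IsPoly g) : IsPoly (fun x => f (g x)) := by
  obtain ⟨p, hp⟩ := hf; obtain ⟨q, hq⟩ := hg
  exact ⟨p.comp q, fun x => by simp [hp, hq]⟩

lemma isPoly_herm (n : ℕ) : IsPoly (herm n) :=
  ⟨(hermite n).map (Int.castRingHom ℝ), fun x => by simp [herm, aeval_def, eval_map]⟩

lemma IsPoly.continuous {f : ℝ → ℝ} (hf : IsPoly f) : Continuous f := by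
  obtain ⟨p, hp⟩ := hf
  rw [show f = fun x => p.eval x from funext hp]; exact p.continuous

lemma IsPoly.integrable_mul_exp {f : ℝ → ℝ} (hf : IsPoly f) {b : ℝ} (hb : 0 < b) : Integrable (fun x => f x * Real.exp (-b * x ^ 2)) := by
  obtain ⟨p, hp⟩ := hf
  simp_rw [hp]
  clear hp
  induction p using Polynomial.induction_on' with
  | add p q h1 h2 =>
    refine (h1.add h2).congr (.of_forall fun x => ?_)
    simp [add_mul]
  | monomial n a =>
    have := (integrable_rpow_mul_exp_neg_mul_sq hb (s := n) (by
      have : (0 : ℝ) ≤ n := n.cast_nonneg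
      linarith)).const_mul a
    simpa [mul_assoc, Real.rpow_natCast] using this

lemma maxwellian_pos (v : ℝ) : 0 < maxwellian v := by unfold maxwellian; positivity

lemma maxwellian_eq (v : ℝ) : maxwellian v = (√(2 * π))⁻¹ * Real.exp (-(1 / 2) * v ^ 2) := by
  unfold maxwellian; ring_nf

lemma sqrtMaxwellian_pos (v : ℝ) : 0 < sqrtMaxwellian v := Real.sqrt_pos.2 (maxwellian_pos v)

lemma sqrtMaxwellian_mul_self (v : ℝ) : sqrtMaxwellian v * sqrtMaxwellian v = maxwellian v :=
  mul_self_sqrt (maxwellian_pos v).le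

lemma sqrtMaxwellian_eq (v : ℝ) : sqrtMaxwellian v = √((√(2 * π))⁻¹) * Real.exp (-(1 / 4) * v ^ 2) := by
  unfold sqrtMaxwellian
  rw [maxwellian_eq, sqrt_mul (by positivity)]
  congr 1
  rw [Real.sqrt_eq_iff_mul_self_eq (by positivity) (by positivity), ← Real.exp_add]
  ring_nf

lemma hasDerivAt_maxwellian (v : ℝ) : HasDerivAt maxwellian (-v * maxwellian v) v := by
  have h : HasDerivAt (fun x : ℝ => (√(2 * π))⁻¹ * Real.exp (-(1 / 2) * x ^ 2)) ((√(2 * π))⁻¹ * (Real.exp (-(1 / 2) * v ^ 2) * (-(1 / 2) * (2 * v)))) v := by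
    have := (((hasDerivAt_pow 2 v).const_mul (-(1 / 2) : ℝ)).exp).const_mul (√(2 * π))⁻¹
    simpa using this
  rw [show maxwellian = _ from funext maxwellian_eq]
  refine h.congr_deriv ?_
  ring

lemma hasDerivAt_sqrtMaxwellian (v : ℝ) : HasDerivAt sqrtMaxwellian (-(v / 2) * sqrtMaxwellian v) v := by
  have h := (((hasDerivAt_pow 2 v).const_mul (-(1 / 4) : ℝ)).exp).const_mul (√((√(2 * π))⁻¹))
  rw [show sqrtMaxwellian = _ from funext sqrtMaxwellian_eq]
  refine h.congr_deriv ?_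
  push_cast
  ring

lemma contDiff_sqrtMaxwellian : ContDiff ℝ ∞ sqrtMaxwellian := by
  rw [show sqrtMaxwellian = _ from funext sqrtMaxwellian_eq]
  fun_prop

lemma continuous_sqrtMaxwellian : Continuous sqrtMaxwellian := contDiff_sqrtMaxwellian.continuous

lemma IsPoly.integrable_maxwellian {f : ℝ → ℝ} (hf : IsPoly f) : Integrable (fun x => f x * maxwellian x) := by
  have := (hf.integrable_mul_exp (b := 1 / 2) (by norm_num)).const_mul (√(2 * π))⁻¹
  refine this.congr (.of_forall fun x => ?_)
  simp only [maxwellian_eq]; ring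

lemma integral_maxwellian : ∫ v, maxwellian v = 1 := by
  simp_rw [maxwellian_eq]
  rw [integral_const_mul, integral_gaussian]
  have : π / (1 / 2) = 2 * π := by ring
  rw [this]
  exact inv_mul_cancel₀ (by positivity)

/-- Gaussian integration by parts. -/
lemma integral_mul_self_maxwellian {f f' : ℝ → ℝ} (hf : IsPoly f) (hf' : IsPoly f') (hd : ∀ x, HasDerivAt f (f' x) x) :
    ∫ x, x * f x * maxwellian x = ∫ x, f' x * maxwellian x := by
  have h := integral_eq_zero_of_hasDerivAt_of_integrable (f := fun x => f x * maxwellian x) (f' := fun x => f' x * maxwellian x + f x * (-x * maxwellian x))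
    (fun x => (hd x).mul (hasDerivAt_maxwellian x))
    (by
      refine hf'.integrable_maxwellian.add ?_
      have := ((IsPoly.id.mul hf).mul (IsPoly.const (-1))).integrable_maxwellian
      refine this.congr (.of_forall fun x => ?_)
      ring) hf.integrable_maxwellian
  have h2 : ∀ x, f' x * maxwellian x + f x * (-x * maxwellian x) = f' x * maxwellian x - x * f x * maxwellian x := fun x => by ring
  simp_rw [h2] at h
  rw [integral_sub hf'.integrable_maxwellian (IsPoly.id.mul hf).integrable_maxwellian] at h
  linarith

lemma integral_hermite_mul_hermite (m n : ℕ) : ∫ x, herm m x * herm n x * maxwellian x = if m = n then (n.factorial : ℝ) else 0 := by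
  induction m generalizing n with
  | zero =>
    cases n with
    | zero => simp [integral_maxwellian]
    | succ n =>
      have hd := integral_mul_self_maxwellian (isPoly_herm n) ((IsPoly.const n).mul (isPoly_herm (n - 1))) (hasDerivAt_herm n)
      simp only [herm_zero, one_mul, herm_succ, sub_mul]
      rw [integral_sub ((IsPoly.id.mul (isPoly_herm n)).integrable_maxwellian) (((IsPoly.const n).mul (isPoly_herm (n - 1))).integrable_maxwellian), hd]
      simp
  | succ m ih =>
    have hd := integral_mul_self_maxwellian ((isPoly_herm m).mul (isPoly_herm n)) ((((IsPoly.const m).mul (isPoly_herm (m - 1))).mul (isPoly_herm n)).add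
        ((isPoly_herm m).mul ((IsPoly.const n).mul (isPoly_herm (n - 1)))))
      (fun x => (hasDerivAt_herm m x).mul (hasDerivAt_herm n x))
    have e : ∀ x, herm (m + 1) x * herm n x * maxwellian x = x * (herm m x * herm n x) * maxwellian x
          - m * herm (m - 1) x * herm n x * maxwellian x := fun x => by
      rw [herm_succ]; ring
    simp_rw [e]
    rw [integral_sub ((IsPoly.id.mul ((isPoly_herm m).mul (isPoly_herm n))).integrable_maxwellian) ((((IsPoly.const m).mul (isPoly_herm (m - 1))).mul
      (isPoly_herm n)).integrable_maxwellian), hd]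
    simp_rw [add_mul]
    rw [integral_add ((((IsPoly.const m).mul (isPoly_herm (m - 1))).mul (isPoly_herm n)).integrable_maxwellian) (((isPoly_herm m).mul
      ((IsPoly.const n).mul (isPoly_herm (n - 1)))).integrable_maxwellian), add_sub_cancel_left]
    have e2 : ∀ x, herm m x * (n * herm (n - 1) x) * maxwellian x = n * (herm m x * herm (n - 1) x * maxwellian x) := fun x => by ring
    simp_rw [e2]
    rw [integral_const_mul, ih]
    cases n with
    | zero => simp
    | succ n => simp [Nat.factorial_succ]

lemma integral_linear_comb {f g h : ℝ → ℝ} (hf : Integrable f) (hg : Integrable g) (hh : Integrable h) (a b c : ℝ) :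
    ∫ x, (a * f x + b * g x + c * h x) = a * (∫ x, f x) + b * (∫ x, g x) + c * ∫ x, h x := by
  rw [integral_add (f := fun x => a * f x + b * g x) ((hf.const_mul a).add (hg.const_mul b))
    (hh.const_mul c), integral_add (hf.const_mul a) (hg.const_mul b), integral_const_mul,
    integral_const_mul, integral_const_mul]

/-- Rotation of a product of Hermite polynomials, averaged in one variable. -/
lemma integral_hermite_rotation (c σ : ℝ) (hcs : σ ^ 2 + c ^ 2 = 1) (i j : ℕ) (v : ℝ) :
    ∫ w, herm i (v * σ + w * c) * herm j (v * c - w * σ) * maxwellian w = σ ^ i * c ^ j * herm (i + j) v := by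
  have P1 : ∀ n v, IsPoly (fun w => herm n (v * σ + w * c)) := fun n v =>
    (isPoly_herm n).comp ((IsPoly.const (v * σ)).add (IsPoly.id.mul (IsPoly.const c)))
  have P2 : ∀ n v, IsPoly (fun w => herm n (v * c - w * σ)) := fun n v => by
    have := (isPoly_herm n).comp ((IsPoly.const (v * c)).add (IsPoly.id.mul (IsPoly.const (-σ))))
    simpa [sub_eq_add_neg] using this
  have D1 : ∀ n (v w : ℝ), HasDerivAt (fun w => herm n (v * σ + w * c)) (n * herm (n - 1) (v * σ + w * c) * c) w := fun n v w => by
    have := (hasDerivAt_herm n (v * σ + w * c)).comp w (((hasDerivAt_id w).mul_const c).const_add (v * σ))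
    simpa [Function.comp_def] using this
  have D2 : ∀ n (v w : ℝ), HasDerivAt (fun w => herm n (v * c - w * σ)) (n * herm (n - 1) (v * c - w * σ) * (-σ)) w := fun n v w => by
    have := (hasDerivAt_herm n (v * c - w * σ)).comp w (((hasDerivAt_id w).mul_const σ).const_sub (v * c))
    simpa [Function.comp_def] using this
  set I : ℕ → ℕ → ℝ := fun i j =>
    ∫ w, herm i (v * σ + w * c) * herm j (v * c - w * σ) * maxwellian w with hI
  have int : ∀ i j, Integrable (fun w =>
      herm i (v * σ + w * c) * herm j (v * c - w * σ) * maxwellian w) := fun i j =>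
    ((P1 i v).mul (P2 j v)).integrable_maxwellian
  have intw : ∀ i j, Integrable (fun w =>
      w * (herm i (v * σ + w * c) * herm j (v * c - w * σ)) * maxwellian w) := fun i j =>
    (IsPoly.id.mul ((P1 i v).mul (P2 j v))).integrable_maxwellian
  have stein : ∀ i j, ∫ w, w * (herm i (v * σ + w * c) * herm j (v * c - w * σ))
      * maxwellian w = c * (i * I (i - 1) j) - σ * (j * I i (j - 1)) := fun i j => by
    have hd := integral_mul_self_maxwellian ((P1 i v).mul (P2 j v)) (((((IsPoly.const i).mul (P1 (i - 1) v)).mul (IsPoly.const c)).mul (P2 j v)).add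
      ((P1 i v).mul (((IsPoly.const j).mul (P2 (j - 1) v)).mul (IsPoly.const (-σ)))))
      (fun w => (D1 i v w).mul (D2 j v w))
    rw [hd]
    have e : ∀ w, (i * herm (i - 1) (v * σ + w * c) * c * herm j (v * c - w * σ) + herm i (v * σ + w * c) * (j * herm (j - 1) (v * c - w * σ) * -σ))
        * maxwellian w
        = (c * i) * (herm (i - 1) (v * σ + w * c) * herm j (v * c - w * σ) * maxwellian w) - (σ * j) * (herm i (v * σ + w * c)
          * herm (j - 1) (v * c - w * σ) * maxwellian w) := fun w => by ring
    simp_rw [e]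
    rw [integral_sub ((int _ _).const_mul _) ((int _ _).const_mul _), integral_const_mul, integral_const_mul]
    ring
  have stepi : ∀ i j, I (i + 1) j = σ * (v * I i j - (c * (j * I i (j - 1)) + σ * (i * I (i - 1) j))) := fun i j => by
    have e : ∀ w, herm (i + 1) (v * σ + w * c) * herm j (v * c - w * σ) * maxwellian w
        = (σ * v) * (herm i (v * σ + w * c) * herm j (v * c - w * σ) * maxwellian w)
        + c * (w * (herm i (v * σ + w * c) * herm j (v * c - w * σ)) * maxwellian w)
        + -i * (herm (i - 1) (v * σ + w * c) * herm j (v * c - w * σ) * maxwellian w) :=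
      fun w => by rw [herm_succ]; ring
    have e' := integral_congr_ae (μ := volume) (.of_forall e)
    rw [integral_linear_comb (int _ _) (intw _ _) (int _ _), stein] at e'
    refine e'.trans ?_
    linear_combination ((i : ℝ) * I (i - 1) j) * hcs
  have stepj : ∀ j, I 0 (j + 1) = c * (v * I 0 j - c * (j * I 0 (j - 1))) := fun j => by
    have e : ∀ w, herm 0 (v * σ + w * c) * herm (j + 1) (v * c - w * σ) * maxwellian w
        = (c * v) * (herm 0 (v * σ + w * c) * herm j (v * c - w * σ) * maxwellian w)
        + -σ * (w * (herm 0 (v * σ + w * c) * herm j (v * c - w * σ)) * maxwellian w)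
        + -j * (herm 0 (v * σ + w * c) * herm (j - 1) (v * c - w * σ) * maxwellian w) :=
      fun w => by rw [herm_succ]; ring
    have e' := integral_congr_ae (μ := volume) (.of_forall e)
    rw [integral_linear_comb (int _ _) (intw _ _) (int _ _), stein] at e'
    refine e'.trans ?_
    push_cast; linear_combination ((j : ℝ) * I 0 (j - 1)) * hcs
  have base : I 0 0 = 1 := by simp [hI, integral_maxwellian]
  have zero_j : ∀ j, I 0 j = c ^ j * herm j v := by
    intro j
    induction j using Nat.strong_induction_on with
    | _ j ih =>
      cases j with
      | zero => simp [base]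
      | succ j =>
        rw [stepj, ih j (by omega), herm_succ]
        cases j with
        | zero => simp
        | succ j => rw [Nat.add_sub_cancel, ih j (by omega)]; ring
  have main : ∀ n, ∀ i j, i + j = n → I i j = σ ^ i * c ^ j * herm n v := by
    intro n
    induction n using Nat.strong_induction_on with
    | _ n ih =>
      intro i j hij
      cases i with
      | zero =>
        have : j = n := by omega
        subst this; simpa using zero_j j
      | succ i =>
        obtain ⟨m, rfl⟩ : ∃ m, n = m + 1 := ⟨n - 1, by omega⟩
        rw [stepi, ih m (by omega) i j (by omega), herm_succ]
        have h1 : (j : ℝ) * I i (j - 1) = j * (σ ^ i * c ^ (j - 1) * herm (m - 1) v) := by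
          cases j with
          | zero => simp
          | succ j => rw [ih (m - 1) (by omega) i (j + 1 - 1) (by omega)]
        have h2 : (i : ℝ) * I (i - 1) j = i * (σ ^ (i - 1) * c ^ j * herm (m - 1) v) := by
          cases i with
          | zero => simp
          | succ i => rw [ih (m - 1) (by omega) (i + 1 - 1) j (by omega)]
        have h3 : c * ((j : ℝ) * c ^ (j - 1)) = j * c ^ j := by
          cases j with
          | zero => simp
          | succ j => simp [pow_succ]; ring
        have h4 : σ * ((i : ℝ) * σ ^ (i - 1)) = i * σ ^ i := by
          cases i with
          | zero => simp
          | succ i => simp [pow_succ]; ring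
        have hm : (m : ℝ) = i + j := by
          have : m = i + j := by omega
          subst this; push_cast; ring
        rw [h1, h2, hm]; linear_combination (-(σ * σ ^ i * herm (m - 1) v)) * h3
          - σ * c ^ j * herm (m - 1) v * h4
  exact main (i + j) i j rfl

/-! ## The Hermite basis of `L²(ℝ)` -/

/-- The Hilbert space `L²(ℝ; ℂ)`. -/
abbrev L2R : Type := Lp ℂ 2 vol

/-- The class in `L²(ℝ)` of a square integrable function (zero for other functions). -/
def toL2 (f : ℝ → ℂ) : L2R := open Classical in if h : MemLp f 2 volume then h.toLp f else 0

lemma toL2_of_memLp (h : MemLp f 2 volume) : toL2 f = h.toLp f := by simp [toL2, h]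

lemma coeFn_toL2 (h : MemLp f 2 volume) : toL2 f =ᵐ[volume] f := by
  rw [toL2_of_memLp h]; exact h.coeFn_toLp

lemma toL2_congr (h : f =ᵐ[volume] g) : toL2 f = toL2 g := by
  by_cases hf : MemLp f 2 volume
  · rw [toL2_of_memLp hf, toL2_of_memLp ((memLp_congr_ae h).1 hf)]
    exact (MemLp.toLp_eq_toLp_iff _ _).2 h
  · have hg : ¬ MemLp g 2 volume := fun hg => hf ((memLp_congr_ae h).2 hg)
    simp [toL2, hf, hg]

@[simp] lemma toL2_coeFn (f : L2R) : toL2 f = f := by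
  rw [toL2_of_memLp (Lp.memLp f)]; exact Lp.toLp_coeFn f _

lemma toL2_add (hf : MemLp f 2 volume) (hg : MemLp g 2 volume) : toL2 (fun x => f x + g x) = toL2 f + toL2 g := by
  rw [toL2_of_memLp hf, toL2_of_memLp hg, toL2_of_memLp (f := fun x => f x + g x) (hf.add hg)]
  exact MemLp.toLp_add hf hg

lemma toL2_sub (hf : MemLp f 2 volume) (hg : MemLp g 2 volume) : toL2 (fun x => f x - g x) = toL2 f - toL2 g := by
  rw [toL2_of_memLp hf, toL2_of_memLp hg, toL2_of_memLp (f := fun x => f x - g x) (hf.sub hg)]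
  exact MemLp.toLp_sub hf hg

lemma toL2_const_mul (c : ℂ) (hf : MemLp f 2 volume) : toL2 (fun x => c * f x) = c • toL2 f := by
  rw [toL2_of_memLp hf, toL2_of_memLp (f := fun x => c * f x) (hf.const_mul c)]
  exact MemLp.toLp_const_smul c hf

lemma inner_toL2 (hf : MemLp f 2 volume) (hg : MemLp g 2 volume) : ⟪toL2 f, toL2 g⟫_ℂ = ∫ x, conj (f x) * g x := by
  rw [L2.inner_def]
  refine integral_congr_ae ?_
  filter_upwards [coeFn_toL2 hf, coeFn_toL2 hg] with x h1 h2
  rw [h1, h2, RCLike.inner_apply, mul_comm]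

lemma norm_toL2_sq (hf : MemLp f 2 volume) : ‖toL2 f‖ ^ 2 = ∫ x, ‖f x‖ ^ 2 := by
  have h := inner_toL2 hf hf
  rw [inner_self_eq_norm_sq_to_K] at h
  have h2 : ∀ x, conj (f x) * f x = ((‖f x‖ ^ 2 : ℝ) : ℂ) := fun x => by rw [mul_comm, mul_conj, Complex.normSq_eq_norm_sq]
  simp_rw [h2] at h
  rw [integral_complex_ofReal] at h
  refine Complex.ofReal_injective ?_
  rw [← h]; push_cast; rfl

lemma enorm_toL2 (hf : MemLp f 2 volume) : ‖toL2 f‖ₑ = eLpNorm f 2 volume := by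
  rw [toL2_of_memLp hf, Lp.enorm_def]
  exact eLpNorm_congr_ae hf.coeFn_toLp

lemma memLp_conj {α : Type*} [MeasurableSpace α] {μ : Measure α} {p : ℝ≥0∞} {f : α → ℂ} (hf : MemLp f p μ) : MemLp (fun x => conj (f x)) p μ :=
  hf.star

lemma hermiteFun_eq (n : ℕ) (v : ℝ) : hermiteFun n v = (√(n.factorial : ℝ))⁻¹ * herm n v * sqrtMaxwellian v := rfl

lemma continuous_hermiteFun (n : ℕ) : Continuous (hermiteFun n) := by
  rw [show hermiteFun n = _ from funext (hermiteFun_eq n)]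
  exact (continuous_const.mul (isPoly_herm n).continuous).mul continuous_sqrtMaxwellian

lemma sqrt_factorial_pos (n : ℕ) : 0 < √(n.factorial : ℝ) :=
  Real.sqrt_pos.2 (by exact_mod_cast n.factorial_pos)

lemma hermiteFun_mul (m n : ℕ) (v : ℝ) : hermiteFun m v * hermiteFun n v = (√(m.factorial : ℝ))⁻¹ * (√(n.factorial : ℝ))⁻¹ *
      (herm m v * herm n v * maxwellian v) := by
  rw [hermiteFun_eq, hermiteFun_eq, ← sqrtMaxwellian_mul_self]; ring

lemma integral_hermiteFun_mul (m n : ℕ) : ∫ v, hermiteFun m v * hermiteFun n v = if m = n then 1 else 0 := by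
  simp_rw [hermiteFun_mul]
  rw [integral_const_mul, integral_hermite_mul_hermite]
  split_ifs with h
  · subst h
    have := sqrt_factorial_pos m
    have h2 : (m.factorial : ℝ) = √(m.factorial : ℝ) * √(m.factorial : ℝ) :=
      (mul_self_sqrt (by positivity)).symm
    rw [h2]; field_simp; rw [sqrt_sq this.le]
  · simp

lemma IsPoly.memLp_sqrtMaxwellian {f : ℝ → ℝ} (hf : IsPoly f) : MemLp (fun v => ((f v * sqrtMaxwellian v : ℝ) : ℂ)) 2 volume := by
  rw [memLp_two_iff_integrable_sq_norm]
  · refine ((hf.mul hf).integrable_maxwellian).congr (.of_forall fun x => ?_)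
    simp only [norm_real, norm_eq_abs, sq_abs]
    rw [← sqrtMaxwellian_mul_self]; ring
  · exact (Complex.continuous_ofReal.comp
      (hf.continuous.mul continuous_sqrtMaxwellian)).aestronglyMeasurable

lemma memLp_hermiteFun (n : ℕ) : MemLp (fun v => (hermiteFun n v : ℂ)) 2 volume := by
  have := ((IsPoly.const (√(n.factorial : ℝ))⁻¹).mul (isPoly_herm n)).memLp_sqrtMaxwellian
  exact this

/-- The Hermite coefficient of a function of the velocity. -/
def coef (k : ℕ) (f : ℝ → ℂ) : ℂ := ∫ v, f v * (hermiteFun k v : ℂ)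

lemma coef_congr (k : ℕ) (h : f =ᵐ[volume] g) : coef k f = coef k g :=
  integral_congr_ae (by filter_upwards [h] with x hx; rw [hx])

lemma inner_hermite_toL2 (k : ℕ) (hf : MemLp f 2 volume) : ⟪toL2 (fun v => (hermiteFun k v : ℂ)), toL2 f⟫_ℂ = coef k f := by
  rw [inner_toL2 (memLp_hermiteFun k) hf]
  refine integral_ext fun x => ?_
  simp [mul_comm]

lemma orthonormal_hermite : Orthonormal ℂ (fun n => toL2 (fun v => (hermiteFun n v : ℂ))) := by
  rw [orthonormal_iff_ite]
  intro i j
  rw [inner_hermite_toL2 i (memLp_hermiteFun j), coef]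
  have h : ∀ v, (hermiteFun j v : ℂ) * (hermiteFun i v : ℂ) = ((hermiteFun j v * hermiteFun i v : ℝ) : ℂ) := fun v => by push_cast; rfl
  simp_rw [h]
  rw [integral_complex_ofReal, integral_hermiteFun_mul]
  by_cases hij : i = j
  · simp [hij]
  · simp [hij, Ne.symm hij]

/-- A function all of whose Gaussian-weighted exponential moments vanish is zero. -/
lemma ae_eq_zero_of_integral_exp {F : ℝ → ℂ} (hF : Integrable F) (h : ∀ ξ : ℝ, ∫ v, F v * exp (I * ξ * v) = 0) : F =ᵐ[volume] 0 := by
  have hfour : FourierTransform.fourier F = 0 := by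
    ext ξ; rw [Real.fourier_real_eq_integral_exp_smul, Pi.zero_apply, ← h (-2 * π * ξ)]
    refine integral_ext fun v => ?_
    simp only [smul_eq_mul]; rw [mul_comm]; congr 2
    push_cast; ring
  refine ae_eq_zero_of_integral_contDiff_smul_eq_zero hF.locallyIntegrable ?_
  intro g hg hgc
  let ψ : SchwartzMap ℝ ℂ := HasCompactSupport.toSchwartzMap (f := fun x => (g x : ℂ))
    (hgc.comp_left (g := fun x : ℝ => (x : ℂ)) (by simp)) (Complex.ofRealCLM.contDiff.comp hg)
  have h1 : (ψ : ℝ → ℂ) = FourierTransform.fourier (FourierTransform.fourierInv ψ : SchwartzMap ℝ ℂ) := by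
    have := congrArg (fun q : SchwartzMap ℝ ℂ => (q : ℝ → ℂ)) (FourierTransform.fourier_fourierInv_eq (F := SchwartzMap ℝ ℂ) ψ)
    exact this.symm
  have h2 : ∫ x, g x • F x = ∫ x, ψ x • F x := by
    refine integral_ext fun x => ?_
    show g x • F x = (g x : ℂ) • F x
    simp
  rw [h2, h1]
  have h3 := VectorFourier.integral_fourierIntegral_smul_eq_flip (μ := volume) (ν := volume) (L := innerₗ ℝ) (e := Real.fourierChar)
    (f := (FourierTransform.fourierInv ψ : SchwartzMap ℝ ℂ)) (g := F)
    Real.continuous_fourierChar continuous_inner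
    (SchwartzMap.integrable _) hF
  have e : VectorFourier.fourierIntegral Real.fourierChar volume (innerₗ ℝ).flip F = FourierTransform.fourier F := by
    rw [flip_innerₗ]; rfl
  rw [e, hfour] at h3
  refine h3.trans ?_
  simp

lemma integral_mul_poly_eq_zero (hf : MemLp f 2 volume) (h : ∀ n, coef n f = 0) (p : ℝ[X]) : ∫ v, f v * ((p.eval v * sqrtMaxwellian v : ℝ) : ℂ) = 0 := by
  have hint : ∀ q : ℝ[X], Integrable (fun v => f v * ((q.eval v * sqrtMaxwellian v : ℝ) : ℂ)) :=
    fun q => hf.integrable_mul (IsPoly.memLp_sqrtMaxwellian ⟨q, fun _ => rfl⟩)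
  induction hn : p.natDegree using Nat.strong_induction_on generalizing p with
  | _ n ih =>
    set H : ℝ[X] := (hermite n).map (Int.castRingHom ℝ) with hH
    have hHm : H.Monic := (Polynomial.hermite_monic n).map _
    have hHd : H.natDegree = n := by rw [hH, (Polynomial.hermite_monic n).natDegree_map, Polynomial.natDegree_hermite]
    have hHv : ∀ v, H.eval v = herm n v := fun v => by simp [hH, herm, aeval_def, eval_map]
    have hH0 : ∫ v, f v * ((H.eval v * sqrtMaxwellian v : ℝ) : ℂ) = 0 := by
      have h1 := h n
      unfold coef at h1
      have : ∀ v, f v * (hermiteFun n v : ℂ) = ((√(n.factorial : ℝ))⁻¹ : ℂ) * (f v * ((H.eval v * sqrtMaxwellian v : ℝ) : ℂ)) := fun v => by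
        rw [hermiteFun_eq, hHv]; push_cast; ring
      simp_rw [this] at h1
      rw [integral_const_mul] at h1
      refine (mul_eq_zero.1 h1).resolve_left ?_
      have := (sqrt_factorial_pos n).ne'
      exact_mod_cast inv_ne_zero this
    set q := p - C p.leadingCoeff * H with hq
    have hq0 : ∫ v, f v * ((q.eval v * sqrtMaxwellian v : ℝ) : ℂ) = 0 := by
      rcases Nat.eq_zero_or_pos n with h0 | h0
      · have : q = 0 := by
          have hp : p = C (p.coeff 0) := Polynomial.eq_C_of_natDegree_eq_zero (by omega)
          have hH1 : H = 1 := hHm.natDegree_eq_zero.1 (by omega)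
          rw [hq, hH1, mul_one, Polynomial.leadingCoeff, hn, h0, ← hp, sub_self]
        simp [this]
      · by_cases hp0 : p = 0
        · have : q = 0 := by rw [hq, hp0]; simp
          simp [this]
        refine ih q.natDegree ?_ q rfl
        by_cases hqz : q = 0
        · rw [hqz]; simpa using h0
        rw [← hn]
        refine Polynomial.natDegree_lt_natDegree hqz ?_
        refine Polynomial.degree_sub_lt_left ?_ hp0 ?_
        · rw [Polynomial.degree_C_mul (Polynomial.leadingCoeff_ne_zero.2 hp0),
            Polynomial.degree_eq_natDegree hp0, Polynomial.degree_eq_natDegree hHm.ne_zero, hHd, hn]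
        · simp [hHm.leadingCoeff]
    have hsplit : ∀ v, f v * ((p.eval v * sqrtMaxwellian v : ℝ) : ℂ) = f v * ((q.eval v * sqrtMaxwellian v : ℝ) : ℂ)
          + (p.leadingCoeff : ℂ) * (f v * ((H.eval v * sqrtMaxwellian v : ℝ) : ℂ)) := fun v => by
      simp only [hq, Polynomial.eval_sub, eval_mul, eval_C]
      push_cast; ring
    simp_rw [hsplit]
    rw [integral_add (hint q) ((hint H).const_mul _), hq0, integral_const_mul, hH0]; simp

lemma memLp_exp_mul_sqrtMaxwellian (ξ : ℝ) : MemLp (fun v => ((Real.exp |ξ * v| * sqrtMaxwellian v : ℝ) : ℂ)) 2 volume := by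
  have hb : MemLp (fun v : ℝ => ((Real.exp (2 * ξ ^ 2) * √((√(2 * π))⁻¹)) * Real.exp (-(1 / 8) * v ^ 2) : ℝ)) 2 volume := by
    refine MemLp.const_mul ?_ _
    rw [memLp_two_iff_integrable_sq (by fun_prop)]
    refine (integrable_exp_neg_mul_sq (b := 1 / 4) (by norm_num)).congr
      (.of_forall fun x => ?_)
    simp only
    rw [← Real.exp_nat_mul]; congr 1; push_cast; ring
  refine hb.of_le ?_ (.of_forall fun v => ?_)
  · refine (Complex.continuous_ofReal.comp ?_).aestronglyMeasurable
    exact (by fun_prop : Continuous fun v : ℝ => Real.exp |ξ * v|).mul continuous_sqrtMaxwellian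
  · rw [norm_real, norm_of_nonneg (mul_nonneg (Real.exp_pos _).le
      (sqrtMaxwellian_pos v).le), norm_of_nonneg (by positivity), sqrtMaxwellian_eq]
    have h1 : Real.exp |ξ * v| * Real.exp (-(1 / 4) * v ^ 2) ≤ Real.exp (2 * ξ ^ 2) * Real.exp (-(1 / 8) * v ^ 2) := by
      rw [← Real.exp_add, ← Real.exp_add]
      refine Real.exp_le_exp.2 ?_
      rw [abs_mul]; nlinarith [sq_nonneg (4 * |ξ| - |v|), sq_abs ξ, sq_abs v]
    calc _ = √((√(2 * π))⁻¹) * (Real.exp |ξ * v| * Real.exp (-(1 / 4) * v ^ 2)) := by ring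
      _ ≤ √((√(2 * π))⁻¹) * (Real.exp (2 * ξ ^ 2) * Real.exp (-(1 / 8) * v ^ 2)) := by gcongr
      _ = _ := by ring

/-- Completeness of the Hermite functions. -/
lemma ae_eq_zero_of_coef (hf : MemLp f 2 volume) (h : ∀ n, coef n f = 0) : f =ᵐ[volume] 0 := by
  have hF : Integrable (fun v => f v * (sqrtMaxwellian v : ℂ)) := by
    refine (hf.integrable_mul (IsPoly.memLp_sqrtMaxwellian (IsPoly.const 1))).congr (.of_forall fun v => ?_)
    simp
  have key := ae_eq_zero_of_integral_exp hF fun ξ => by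
    have hs : HasSum (fun n : ℕ => ∫ v, f v * (sqrtMaxwellian v : ℂ) * ((I * ξ * v) ^ n / (n.factorial : ℂ)))
        (∫ v, f v * (sqrtMaxwellian v : ℂ) * exp (I * ξ * v)) := by
      refine hasSum_integral_of_dominated_convergence (fun n v => ‖f v‖ * sqrtMaxwellian v * (|ξ * v| ^ n / n.factorial)) ?_ ?_ ?_ ?_ ?_
      · intro n
        refine hF.aestronglyMeasurable.mul (Continuous.aestronglyMeasurable ?_)
        fun_prop
      · intro n
        refine .of_forall fun v => le_of_eq ?_
        simp only [norm_mul, norm_div, norm_pow, norm_real, Complex.norm_I, one_mul,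
          Complex.norm_natCast, norm_of_nonneg (sqrtMaxwellian_pos v).le, norm_eq_abs,
          abs_mul]
      · refine .of_forall fun v => ?_
        exact (Real.summable_pow_div_factorial |ξ * v|).mul_left _
      · have h1 : ∀ v, ∑' n : ℕ, ‖f v‖ * sqrtMaxwellian v * (|ξ * v| ^ n / n.factorial)
            = ‖f v * ((Real.exp |ξ * v| * sqrtMaxwellian v : ℝ) : ℂ)‖ := fun v => by
          rw [tsum_mul_left, norm_mul, norm_real, norm_of_nonneg (mul_nonneg (Real.exp_pos _).le (sqrtMaxwellian_pos v).le), Real.exp_eq_exp_ℝ,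
            NormedSpace.exp_eq_tsum_div]
          ring
        simp_rw [h1]
        exact (hf.integrable_mul (memLp_exp_mul_sqrtMaxwellian ξ)).norm
      · refine .of_forall fun v => ?_
        have := (NormedSpace.expSeries_div_hasSum_exp (I * ξ * v))
        rw [← Complex.exp_eq_exp_ℂ] at this; exact this.mul_left _
    have hz : ∀ n : ℕ, ∫ v, f v * (sqrtMaxwellian v : ℂ) * ((I * ξ * v) ^ n / (n.factorial : ℂ)) = 0 := fun n => by
      have h0 := integral_mul_poly_eq_zero hf h (X ^ n)
      have : ∀ v : ℝ, f v * (sqrtMaxwellian v : ℂ) * ((I * ξ * v) ^ n / (n.factorial : ℂ)) = ((I * ξ) ^ n / (n.factorial : ℂ)) *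
            (f v * (((X ^ n : ℝ[X]).eval v * sqrtMaxwellian v : ℝ) : ℂ)) :=
        fun v => by simp [mul_pow]; ring
      simp_rw [this]
      rw [integral_const_mul, h0, mul_zero]
    simp_rw [hz] at hs
    exact hs.unique hasSum_zero
  filter_upwards [key] with v hv
  have := (sqrtMaxwellian_pos v).ne'
  simpa [this] using hv

/-- The Hilbert basis of Hermite functions. -/
def hermiteBasis : HilbertBasis ℕ ℂ L2R :=
  HilbertBasis.mkOfOrthogonalEqBot orthonormal_hermite (by
    rw [Submodule.eq_bot_iff]; intro f hf; rw [Submodule.mem_orthogonal] at hf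
    have hc : ∀ n, coef n f = 0 := fun n => by
      have := hf _ (Submodule.subset_span ⟨n, rfl⟩)
      rwa [← toL2_coeFn f, inner_hermite_toL2 n (Lp.memLp f)] at this
    exact (Lp.eq_zero_iff_ae_eq_zero).2 (ae_eq_zero_of_coef (Lp.memLp f) hc))

lemma hermiteBasis_apply (n : ℕ) : hermiteBasis n = toL2 (fun v => (hermiteFun n v : ℂ)) := by simp [hermiteBasis]

lemma inner_hermiteBasis (n : ℕ) (hf : MemLp f 2 volume) : ⟪hermiteBasis n, toL2 f⟫_ℂ = coef n f := by
  rw [hermiteBasis_apply, inner_hermite_toL2 n hf]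

lemma coef_conj (k : ℕ) (f : ℝ → ℂ) : coef k (fun v => conj (f v)) = conj (coef k f) := by
  unfold coef
  rw [← integral_conj]
  simp

/-- Parseval's identity. -/
lemma hasSum_coef_mul (hf : MemLp f 2 volume) (hg : MemLp g 2 volume) : HasSum (fun k => coef k f * coef k g) (∫ v, f v * g v) := by
  have h := hermiteBasis.hasSum_inner_mul_inner (toL2 (fun v => conj (f v))) (toL2 g)
  rw [inner_toL2 (memLp_conj hf) hg] at h
  simp only [inner_hermiteBasis _ hg, conj_conj] at h
  refine h.congr_fun fun k => ?_
  rw [← inner_conj_symm, inner_hermiteBasis _ (memLp_conj hf), coef_conj, conj_conj]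

lemma hasSum_norm_coef_sq (hf : MemLp f 2 volume) : HasSum (fun k => ‖coef k f‖ ^ 2) (∫ v, ‖f v‖ ^ 2) := by
  have h := hasSum_coef_mul hf (memLp_conj hf)
  have h1 : ∀ k, coef k f * coef k (fun v => conj (f v)) = ((‖coef k f‖ ^ 2 : ℝ) : ℂ) := fun k => by
    rw [coef_conj, mul_conj, Complex.normSq_eq_norm_sq]
  have h2 : ∀ v, f v * conj (f v) = ((‖f v‖ ^ 2 : ℝ) : ℂ) := fun v => by rw [mul_conj, Complex.normSq_eq_norm_sq]
  simp_rw [h1, h2] at h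
  rw [integral_complex_ofReal] at h
  exact Complex.hasSum_ofReal.1 h

/-! ## The harmonic oscillator -/

/-- Polynomials times `√μ`. -/
def gpoly (p : ℝ[X]) (v : ℝ) : ℝ := p.eval v * sqrtMaxwellian v

/-- The action of `d/dv` on the polynomial factor. -/
def gderiv (p : ℝ[X]) : ℝ[X] :=
  derivative p - C (1 / 2) * X * p

lemma hasDerivAt_gpoly (p : ℝ[X]) (v : ℝ) : HasDerivAt (gpoly p) (gpoly (gderiv p) v) v := by
  have h := (p.hasDerivAt v).mul (hasDerivAt_sqrtMaxwellian v)
  refine h.congr_deriv ?_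
  simp [gpoly, gderiv]; ring

lemma continuous_gpoly (p : ℝ[X]) : Continuous (gpoly p) :=
  p.continuous.mul continuous_sqrtMaxwellian

lemma contDiff_gpoly (p : ℝ[X]) : ContDiff ℝ ∞ (gpoly p) :=
  (Polynomial.contDiff_aeval p _).mul contDiff_sqrtMaxwellian

lemma memLp_gpoly (p : ℝ[X]) : MemLp (fun v => (gpoly p v : ℂ)) 2 volume :=
  IsPoly.memLp_sqrtMaxwellian ⟨p, fun _ => rfl⟩

lemma memLp_gpoly_real (p : ℝ[X]) : MemLp (gpoly p) 2 volume := by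
  refine (memLp_gpoly p).of_le (continuous_gpoly p).aestronglyMeasurable ?_
  exact .of_forall fun v => by simp

/-- The polynomial factor of the Hermite function. -/
def hermitePoly (k : ℕ) : ℝ[X] :=
  C (√(k.factorial : ℝ))⁻¹ * (hermite k).map (Int.castRingHom ℝ)

lemma eval_hermitePoly (k : ℕ) (v : ℝ) : (hermitePoly k).eval v = (√(k.factorial : ℝ))⁻¹ * herm k v := by
  simp [hermitePoly, herm, aeval_def, eval_map]

lemma hermiteFun_eq_gpoly (k : ℕ) : hermiteFun k = gpoly (hermitePoly k) := by
  ext v; rw [gpoly, eval_hermitePoly, hermiteFun_eq]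

lemma mul_hermiteFun (k : ℕ) (v : ℝ) : v * hermiteFun k v = √(k + 1) * hermiteFun (k + 1) v + √k * hermiteFun (k - 1) v := by
  have h := herm_succ k v
  have h1 : √((k + 1 : ℕ).factorial : ℝ) = √(k + 1) * √(k.factorial : ℝ) := by
    rw [Nat.factorial_succ]; push_cast; rw [sqrt_mul (by positivity)]
  have hp : 0 < √((k : ℝ) + 1) := Real.sqrt_pos.2 (by positivity)
  have hk := sqrt_factorial_pos k
  simp only [hermiteFun_eq]
  rw [h1, h]
  cases k with
  | zero => simp
  | succ k =>
    have h2 : √((k + 1 : ℕ).factorial : ℝ) = √((k + 1 : ℕ) : ℝ) * √(k.factorial : ℝ) := by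
      rw [Nat.factorial_succ]; push_cast; rw [sqrt_mul (by positivity)]
    have hp2 : 0 < √((k + 1 : ℕ) : ℝ) := Real.sqrt_pos.2 (by positivity)
    have hk2 := sqrt_factorial_pos k
    have hs : √((k + 1 : ℕ) : ℝ) * √((k + 1 : ℕ) : ℝ) = ((k + 1 : ℕ) : ℝ) :=
      mul_self_sqrt (by positivity)
    rw [Nat.add_sub_cancel]; rw [h2]; field_simp; rw [sq, hs]; ring

lemma hermiteFun_oscillator (k : ℕ) (v : ℝ) : -gpoly (gderiv (gderiv (hermitePoly k))) v + v ^ 2 / 4 * hermiteFun k v = (k + 1 / 2) * hermiteFun k v := by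
  have hd : ∀ n : ℕ, eval v (derivative ((hermite n).map (Int.castRingHom ℝ))) = n * herm (n - 1) v := fun n => by
    have h1 := (((hermite n).map (Int.castRingHom ℝ))).hasDerivAt v
    have h2 := hasDerivAt_herm n v
    have : (fun x => eval x ((hermite n).map (Int.castRingHom ℝ))) = herm n := by
      ext x; simp [herm, aeval_def, eval_map]
    rw [this] at h1; exact h1.unique h2
  have hdd : eval v (derivative (derivative ((hermite k).map (Int.castRingHom ℝ)))) = v * (k * herm (k - 1) v) - k * herm k v := by
    cases k with
    | zero => simp
    | succ k =>
      have e1 : derivative ((hermite (k + 1)).map (Int.castRingHom ℝ)) = ((k : ℝ[X]) + 1) * ((hermite k).map (Int.castRingHom ℝ)) := by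
        rw [Polynomial.derivative_map, derivative_hermite_succ]; simp
      rw [e1, derivative_mul]
      simp only [Polynomial.derivative_add, Polynomial.derivative_natCast, Polynomial.derivative_one, add_zero, zero_mul, zero_add, eval_mul,
        eval_add, Polynomial.eval_natCast, Polynomial.eval_one, hd,
        Nat.add_sub_cancel, herm_succ k v]
      push_cast; ring
  have hv : eval v ((hermite k).map (Int.castRingHom ℝ)) = herm k v := by simp [herm, aeval_def, eval_map]
  simp only [gpoly, gderiv, hermitePoly, Polynomial.derivative_sub, derivative_mul, Polynomial.derivative_C, Polynomial.derivative_X,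
    Polynomial.eval_sub, eval_mul, eval_add, eval_C,
    eval_X, zero_mul, zero_add, mul_one, hd, hdd, hv, hermiteFun_eq]
  ring

/-- Smooth compactly supported functions of the velocity. -/
structure IsBump (h : ℝ → ℂ) : Prop where
  smooth : ContDiff ℝ ∞ h
  compact : HasCompactSupport h

lemma IsBump.memLp (hh : IsBump h) (p : ℝ≥0∞) : MemLp h p volume :=
  hh.smooth.continuous.memLp_of_hasCompactSupport hh.compact

lemma IsBump.deriv (hh : IsBump h) : IsBump (deriv h) :=
  ⟨((contDiff_infty_iff_deriv (𝕜 := ℝ)).1 hh.smooth).2, hh.compact.deriv⟩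

lemma IsBump.mul_left (hh : IsBump h) (hf : ContDiff ℝ ∞ f) : IsBump (fun v => f v * h v) :=
  ⟨hf.mul hh.smooth, hh.compact.mul_left⟩

lemma IsBump.add (hh : IsBump h) (hg : IsBump g) : IsBump (fun v => h v + g v) :=
  ⟨hh.smooth.add hg.smooth, hh.compact.add hg.compact⟩

lemma IsBump.neg (hh : IsBump h) : IsBump (fun v => - h v) :=
  ⟨hh.smooth.neg, hh.compact.neg⟩

lemma IsBump.hasDerivAt (hh : IsBump h) (v : ℝ) : HasDerivAt h (_root_.deriv h v) v :=
  ((hh.smooth.differentiable (by simp)) v).hasDerivAt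

lemma contDiff_ofReal_sq_div : ContDiff ℝ ∞ (fun v : ℝ => (v : ℂ) ^ 2 / 4) :=
  (Complex.ofRealCLM.contDiff.pow 2).div_const 4

/-- The harmonic oscillator `-∂_v² + v²/4`. -/
def oscillator (h : ℝ → ℂ) (v : ℝ) : ℂ := - deriv (deriv h) v + (v : ℂ) ^ 2 / 4 * h v

lemma IsBump.oscillator (hh : IsBump h) : IsBump (oscillator h) := by
  have h1 : IsBump (fun v => ((v : ℂ) ^ 2 / 4) * h v) := hh.mul_left contDiff_ofReal_sq_div
  exact hh.deriv.deriv.neg.add h1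

lemma hasDerivAt_gpoly_complex (p : ℝ[X]) (v : ℝ) : HasDerivAt (fun v => (gpoly p v : ℂ)) (gpoly (gderiv p) v : ℂ) v :=
  (hasDerivAt_gpoly p v).ofReal_comp

lemma integral_deriv_mul_gpoly (hh : IsBump h) (p : ℝ[X]) : ∫ v, deriv h v * (gpoly p v : ℂ) = - ∫ v, h v * (gpoly (gderiv p) v : ℂ) := by
  have h0 := integral_mul_deriv_eq_deriv_mul_of_integrable (u := h) (v := fun v => (gpoly p v : ℂ)) (u' := deriv h)
    (v' := fun v => (gpoly (gderiv p) v : ℂ)) (fun v _ => hh.hasDerivAt v)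
    (fun v _ => hasDerivAt_gpoly_complex p v)
    ((hh.memLp 2).integrable_mul (memLp_gpoly _))
    ((hh.deriv.memLp 2).integrable_mul (memLp_gpoly _))
    ((hh.memLp 2).integrable_mul (memLp_gpoly _))
  rw [h0, neg_neg]

lemma coef_oscillator (hh : IsBump h) (k : ℕ) : coef k (oscillator h) = ((k : ℂ) + 1 / 2) * coef k h := by
  have h1 : ∫ v, deriv (deriv h) v * (hermiteFun k v : ℂ) = ∫ v, h v * (gpoly (gderiv (gderiv (hermitePoly k))) v : ℂ) := by
    rw [hermiteFun_eq_gpoly, integral_deriv_mul_gpoly hh.deriv, integral_deriv_mul_gpoly hh, neg_neg]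
  have e : ∀ v, oscillator h v * (hermiteFun k v : ℂ) = ((v : ℂ) ^ 2 / 4 * h v) * (hermiteFun k v : ℂ)
        - deriv (deriv h) v * (hermiteFun k v : ℂ) := fun v => by
    unfold oscillator; ring
  have i1 : Integrable (fun v : ℝ => ((v : ℂ) ^ 2 / 4 * h v) * (hermiteFun k v : ℂ)) :=
    ((hh.mul_left contDiff_ofReal_sq_div).memLp 2).integrable_mul (memLp_hermiteFun k)
  have i2 : Integrable (fun v => deriv (deriv h) v * (hermiteFun k v : ℂ)) :=
    (hh.deriv.deriv.memLp 2).integrable_mul (memLp_hermiteFun k)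
  have i3 : Integrable (fun v => h v * (gpoly (gderiv (gderiv (hermitePoly k))) v : ℂ)) :=
    (hh.memLp 2).integrable_mul (memLp_gpoly _)
  unfold coef
  simp_rw [e]
  rw [integral_sub i1 i2, h1, ← integral_sub i1 i3, ← integral_const_mul]
  refine integral_ext fun v => ?_
  have := hermiteFun_oscillator k v
  have h2 : (gpoly (gderiv (gderiv (hermitePoly k))) v : ℂ) = (v : ℂ) ^ 2 / 4 * hermiteFun k v - ((k : ℂ) + 1 / 2) * hermiteFun k v := by
    have h3 : gpoly (gderiv (gderiv (hermitePoly k))) v = v ^ 2 / 4 * hermiteFun k v - ((k : ℝ) + 1 / 2) * hermiteFun k v := by linarith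
    rw [h3]; push_cast; ring
  simp only [h2]
  ring

/-! ### Cutoffs -/

/-- A fixed smooth cutoff, equal to one near the origin. -/
def bump : ContDiffBump (0 : ℝ) := ⟨1, 2, by norm_num, by norm_num⟩

/-- The cutoff at scale `n + 1`. -/
def cutoff (n : ℕ) (v : ℝ) : ℝ := bump (v / (n + 1))

lemma contDiff_bump : ContDiff ℝ ∞ (fun v => bump v) := bump.contDiff

lemma contDiff_cutoff (n : ℕ) : ContDiff ℝ ∞ (cutoff n) :=
  contDiff_bump.comp (by fun_prop)

lemma hasCompactSupport_cutoff (n : ℕ) : HasCompactSupport (cutoff n) := by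
  have hn : ((n : ℝ) + 1) ≠ 0 := by positivity
  have := bump.hasCompactSupport.comp_homeomorph (Homeomorph.mulRight₀ ((n : ℝ) + 1)⁻¹ (by positivity))
  exact this

lemma cutoff_mem (n : ℕ) (v : ℝ) : 0 ≤ cutoff n v ∧ cutoff n v ≤ 1 :=
  ⟨bump.nonneg, bump.le_one⟩

lemma tendsto_cutoff (v : ℝ) : Tendsto (fun n => cutoff n v) atTop (nhds 1) := by
  have h : Tendsto (fun n : ℕ => v / ((n : ℝ) + 1)) atTop (nhds 0) :=
    tendsto_const_nhds.div_atTop (tendsto_atTop_add_const_right _ _ tendsto_natCast_atTop_atTop)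
  have h2 := (contDiff_bump.continuous.tendsto 0).comp h
  have h3 : bump (0 : ℝ) = 1 := bump.one_of_mem_closedBall (by simp [bump])
  rwa [h3] at h2

lemma exists_bound_deriv_bump : ∃ C, 0 ≤ C ∧ (∀ v, |deriv bump v| ≤ C) ∧ ∀ v, |deriv (deriv bump) v| ≤ C := by
  have hc : HasCompactSupport (fun v => bump v) := bump.hasCompactSupport
  have h1 : ContDiff ℝ ∞ (deriv bump) := ((contDiff_infty_iff_deriv (𝕜 := ℝ)).1 contDiff_bump).2
  have h2 : ContDiff ℝ ∞ (deriv (deriv bump)) := ((contDiff_infty_iff_deriv (𝕜 := ℝ)).1 h1).2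
  obtain ⟨C1, hC1⟩ := h1.continuous.bounded_above_of_compact_support hc.deriv
  obtain ⟨C2, hC2⟩ := h2.continuous.bounded_above_of_compact_support hc.deriv.deriv
  refine ⟨max 0 (max C1 C2), le_max_left _ _, fun v => ?_, fun v => ?_⟩
  · exact (hC1 v).trans ((le_max_left _ _).trans (le_max_right _ _))
  · exact (hC2 v).trans ((le_max_right _ _).trans (le_max_right _ _))

lemma hasDerivAt_cutoff (n : ℕ) (v : ℝ) : HasDerivAt (cutoff n) (deriv bump (v / (n + 1)) / (n + 1)) v := by
  have h := ((contDiff_bump.differentiable (by simp)) (v / (n + 1))).hasDerivAt.comp v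
    ((hasDerivAt_id v).div_const ((n : ℝ) + 1))
  refine h.congr_deriv ?_
  simp; ring

lemma hasDerivAt_deriv_cutoff (n : ℕ) (v : ℝ) : HasDerivAt (fun v => deriv bump (v / (n + 1)) / ((n : ℝ) + 1))
      (deriv (deriv bump) (v / (n + 1)) / ((n : ℝ) + 1) ^ 2) v := by
  have h1 : ContDiff ℝ ∞ (deriv bump) := ((contDiff_infty_iff_deriv (𝕜 := ℝ)).1 contDiff_bump).2
  have h := (((h1.differentiable (by simp)) (v / (n + 1))).hasDerivAt.comp v
    ((hasDerivAt_id v).div_const ((n : ℝ) + 1))).div_const ((n : ℝ) + 1)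
  refine h.congr_deriv ?_
  rw [sq, div_mul_eq_div_div]; ring

/-- The truncated function `κ(v/(n+1)) p(v) √μ(v)`. -/
def cutg (n : ℕ) (p : ℝ[X]) (v : ℝ) : ℂ := ((cutoff n v * gpoly p v : ℝ) : ℂ)

lemma isBump_cutg (n : ℕ) (p : ℝ[X]) : IsBump (cutg n p) := by
  refine ⟨Complex.ofRealCLM.contDiff.comp ((contDiff_cutoff n).mul (contDiff_gpoly p)), ?_⟩
  exact ((hasCompactSupport_cutoff n).mul_right (f' := gpoly p)).comp_left (g := fun x : ℝ => (x : ℂ)) (by simp)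

lemma oscillator_cutg (n : ℕ) (p : ℝ[X]) (v : ℝ) : oscillator (cutg n p) v = ((cutoff n v * (-gpoly (gderiv (gderiv p)) v
      + v ^ 2 / 4 * gpoly p v) - 2 * (deriv bump (v / (n + 1)) / (n + 1)) * gpoly (gderiv p) v
      - deriv (deriv bump) (v / (n + 1)) / (n + 1) ^ 2 * gpoly p v : ℝ) : ℂ) := by
  have d1 : ∀ v, HasDerivAt (cutg n p) ((deriv bump (v / (n + 1)) / (n + 1) * gpoly p v + cutoff n v * gpoly (gderiv p) v : ℝ) : ℂ) v := fun v =>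
    ((hasDerivAt_cutoff n v).mul (hasDerivAt_gpoly p v)).ofReal_comp
  have d2 := (((hasDerivAt_deriv_cutoff n v).mul (hasDerivAt_gpoly p v)).add ((hasDerivAt_cutoff n v).mul (hasDerivAt_gpoly (gderiv p) v))).ofReal_comp
  have e1 : deriv (cutg n p) = _ := funext fun v => (d1 v).deriv
  unfold oscillator
  rw [e1, show deriv (fun v : ℝ => ((deriv bump (v / (n + 1)) / (n + 1) * gpoly p v + cutoff n v * gpoly (gderiv p) v : ℝ) : ℂ)) v = _ from d2.deriv, cutg]
  push_cast
  ring

lemma tendsto_integral_cutoff (p : ℝ[X]) : Tendsto (fun n => ∫ v, ‖cutg n p v - (gpoly p v : ℂ)‖ ^ 2) atTop (nhds 0) := by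
  have key : Tendsto (fun n => ∫ v, ‖cutg n p v - (gpoly p v : ℂ)‖ ^ 2) atTop (nhds (∫ _ : ℝ, (0 : ℝ))) := by
    refine tendsto_integral_of_dominated_convergence (fun v => ‖(gpoly p v : ℂ)‖ ^ 2) ?_ ?_ ?_ ?_
    · intro n
      exact (((isBump_cutg n p).smooth.continuous.sub (Complex.continuous_ofReal.comp (continuous_gpoly p))).norm.pow 2).aestronglyMeasurable
    · exact (memLp_two_iff_integrable_sq_norm (memLp_gpoly p).1).1 (memLp_gpoly p)
    · intro n
      refine .of_forall fun v => ?_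
      rw [norm_pow, norm_norm]
      refine pow_le_pow_left₀ (norm_nonneg _) ?_ 2
      obtain ⟨h0, h1⟩ := cutoff_mem n v
      have : cutg n p v - (gpoly p v : ℂ) = (((cutoff n v - 1) * gpoly p v : ℝ) : ℂ) := by
        unfold cutg; push_cast; ring
      rw [this, norm_real, norm_real, norm_mul]
      refine mul_le_of_le_one_left (norm_nonneg _) ?_
      rw [norm_eq_abs, abs_le]; constructor <;> linarith
    · refine .of_forall fun v => ?_
      have h1 : Tendsto (fun n => cutg n p v - (gpoly p v : ℂ)) atTop (nhds (((1 * gpoly p v : ℝ) : ℂ) - (gpoly p v : ℂ))) :=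
        ((Complex.continuous_ofReal.tendsto _).comp ((tendsto_cutoff v).mul_const _)).sub_const _
      have := (h1.norm.pow 2)
      simpa using this
  simpa using key

lemma tendsto_integral_oscillator_cutoff (p : ℝ[X]) : Tendsto (fun n => ∫ v, ‖oscillator (cutg n p) v -
      ((-gpoly (gderiv (gderiv p)) v + v ^ 2 / 4 * gpoly p v : ℝ) : ℂ)‖ ^ 2)
      atTop (nhds 0) := by
  obtain ⟨B, hC0, hC1, hC2⟩ := exists_bound_deriv_bump
  set q : ℝ[X] := -gderiv (gderiv p) + C (1 / 4) * X ^ 2 * p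
  have hq : ∀ v, -gpoly (gderiv (gderiv p)) v + v ^ 2 / 4 * gpoly p v = gpoly q v := fun v => by simp [gpoly, q]; ring
  have hb : MemLp (fun v => ‖gpoly q v‖ + 2 * B * ‖gpoly (gderiv p) v‖ + B * ‖gpoly p v‖) 2 volume :=
    ((memLp_gpoly_real q).norm.add ((memLp_gpoly_real (gderiv p)).norm.const_mul _)).add ((memLp_gpoly_real p).norm.const_mul _)
  have e : ∀ n v, oscillator (cutg n p) v - ((-gpoly (gderiv (gderiv p)) v + v ^ 2 / 4 * gpoly p v : ℝ) : ℂ) = (((cutoff n v - 1) * gpoly q v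
        - 2 * (deriv bump (v / (n + 1)) / (n + 1)) * gpoly (gderiv p) v
      - deriv (deriv bump) (v / (n + 1)) / (n + 1) ^ 2 * gpoly p v : ℝ) : ℂ) := fun n v => by
    rw [oscillator_cutg, hq]; push_cast; ring
  have bd : ∀ (n : ℕ) v, |deriv bump (v / ((n : ℝ) + 1)) / ((n : ℝ) + 1)| ≤ B / ((n : ℝ) + 1) := fun n v => by
    rw [abs_div, abs_of_pos (by positivity : (0 : ℝ) < (n : ℝ) + 1)]
    gcongr; exact hC1 _
  have bd2 : ∀ (n : ℕ) v, |deriv (deriv bump) (v / ((n : ℝ) + 1)) / ((n : ℝ) + 1) ^ 2| ≤ B / ((n : ℝ) + 1) :=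
    fun n v => by
    rw [abs_div, abs_of_pos (by positivity : (0 : ℝ) < ((n : ℝ) + 1) ^ 2)]
    have h1 : ((n : ℝ) + 1) ≤ ((n : ℝ) + 1) ^ 2 := by
      have : (0 : ℝ) ≤ n := n.cast_nonneg
      nlinarith
    exact div_le_div₀ hC0 (hC2 _) (by positivity) h1
  have bdC : ∀ n : ℕ, B / ((n : ℝ) + 1) ≤ B := fun n =>
    div_le_self hC0 (by have : (0 : ℝ) ≤ n := n.cast_nonneg
                        linarith)
  have t0 : Tendsto (fun n : ℕ => B / ((n : ℝ) + 1)) atTop (nhds 0) :=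
    tendsto_const_nhds.div_atTop (tendsto_atTop_add_const_right _ _ tendsto_natCast_atTop_atTop)
  have key : Tendsto (fun n => ∫ v, ‖oscillator (cutg n p) v - ((-gpoly (gderiv (gderiv p)) v + v ^ 2 / 4 * gpoly p v : ℝ) : ℂ)‖ ^ 2)
      atTop (nhds (∫ _ : ℝ, (0 : ℝ))) := by
    refine tendsto_integral_of_dominated_convergence (fun v => (‖gpoly q v‖ + 2 * B * ‖gpoly (gderiv p) v‖ + B * ‖gpoly p v‖) ^ 2) ?_ ?_ ?_ ?_
    · intro n
      simp_rw [hq]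
      exact (((isBump_cutg n p).oscillator.smooth.continuous.sub (Complex.continuous_ofReal.comp (continuous_gpoly q))).norm.pow 2).aestronglyMeasurable
    · exact (memLp_two_iff_integrable_sq hb.1).1 hb
    · intro n
      refine .of_forall fun v => ?_
      rw [norm_pow, norm_norm, e, norm_real]
      refine pow_le_pow_left₀ (norm_nonneg _) ?_ 2
      obtain ⟨h0, h1⟩ := cutoff_mem n v
      have hk : |cutoff n v - 1| ≤ 1 := by rw [abs_le]; constructor <;> linarith
      refine (norm_sub_le _ _).trans (add_le_add ((norm_sub_le _ _).trans (add_le_add ?_ ?_)) ?_)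
      · rw [norm_mul]; exact mul_le_of_le_one_left (norm_nonneg _) hk
      · rw [norm_mul, norm_mul, norm_of_nonneg (by norm_num : (0 : ℝ) ≤ 2)]
        gcongr; exact (bd n v).trans (bdC n)
      · rw [norm_mul]
        gcongr; exact (bd2 n v).trans (bdC n)
    · refine .of_forall fun v => ?_
      simp_rw [e]
      have h1 : Tendsto (fun n : ℕ => deriv bump (v / ((n : ℝ) + 1)) / ((n : ℝ) + 1)) atTop (nhds 0) := squeeze_zero_norm (fun n => bd n v) t0
      have h2 : Tendsto (fun n : ℕ => deriv (deriv bump) (v / ((n : ℝ) + 1)) / ((n : ℝ) + 1) ^ 2) atTop (nhds 0) := squeeze_zero_norm (fun n => bd2 n v) t0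
      have h3 := ((((tendsto_cutoff v).sub_const 1).mul_const (gpoly q v)).sub ((h1.const_mul 2).mul_const (gpoly (gderiv p) v))).sub
        (h2.mul_const (gpoly p v))
      have h4 := ((Complex.continuous_ofReal.tendsto _).comp h3).norm.pow 2
      simpa [Function.comp_def] using h4
  simpa using key

end

/-! ## The collision operator in the Hermite basis -/

/-- Partial pairing of a square integrable kernel with a square integrable function. -/
lemma eLpNorm_integral_mul_le {α β : Type*} [MeasurableSpace α] [MeasurableSpace β]
    {μ : Measure α} {ν : Measure β} [SFinite μ] [SFinite ν] {Q : α × β → ℂ} {f : β → ℂ}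
    (hQ : AEStronglyMeasurable Q (μ.prod ν)) (hf : AEStronglyMeasurable f ν) :
    eLpNorm (fun x => ∫ y, f y * Q (x, y) ∂ν) 2 μ ≤ eLpNorm f 2 ν * eLpNorm Q 2 (μ.prod ν) := by
  have h2 : (2 : ℝ≥0∞) ≠ 0 := by norm_num
  have h2' : (2 : ℝ≥0∞) ≠ ⊤ := by norm_num
  simp only [eLpNorm_eq_lintegral_rpow_enorm_toReal h2 h2', toReal_ofNat]
  rw [← ENNReal.mul_rpow_of_nonneg _ _ (by norm_num : (0 : ℝ) ≤ 1 / 2)]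
  refine ENNReal.rpow_le_rpow ?_ (by norm_num)
  have hQ2 : AEMeasurable (fun p => ‖Q p‖ₑ ^ (2 : ℝ)) (μ.prod ν) := hQ.enorm.pow_const _
  rw [lintegral_prod _ hQ2, ← lintegral_const_mul'' _ hQ2.lintegral_prod_right']
  refine lintegral_mono_ae ?_
  filter_upwards [hQ.prodMk_left] with x hx
  have h1 : ‖∫ y, f y * Q (x, y) ∂ν‖ₑ ≤ ∫⁻ y, ‖f y‖ₑ * ‖Q (x, y)‖ₑ ∂ν := by
    refine (enorm_integral_le_lintegral_enorm _).trans (le_of_eq ?_)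
    simp
  have h3 := ENNReal.lintegral_mul_le_Lp_mul_Lq ν (Real.HolderConjugate.two_two) hf.enorm hx.enorm
  refine (ENNReal.rpow_le_rpow (h1.trans h3) (by norm_num)).trans (le_of_eq ?_)
  rw [ENNReal.mul_rpow_of_nonneg _ _ (by norm_num), ← rpow_mul, ← rpow_mul]
  norm_num

lemma memLp_integral_mul {α β : Type*} [MeasurableSpace α] [MeasurableSpace β]
    {μ : Measure α} {ν : Measure β} [SFinite μ] [SFinite ν] {Q : α × β → ℂ} {f : β → ℂ}
    (hQ : MemLp Q 2 (μ.prod ν)) (hf : MemLp f 2 ν) :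
    MemLp (fun x => ∫ y, f y * Q (x, y) ∂ν) 2 μ := by
  refine ⟨?_, (eLpNorm_integral_mul_le hQ.1 hf.1).trans_lt (mul_lt_top hf.2 hQ.2)⟩
  exact (AEStronglyMeasurable.mul (hf.1.comp_snd) hQ.1).integral_prod_right'

lemma memLp_mul_prod {α β : Type*} [MeasurableSpace α] [MeasurableSpace β] {μ : Measure α} {ν : Measure β} [SFinite μ] [SFinite ν] {f : α → ℂ} {g : β → ℂ}
    (hf : MemLp f 2 μ) (hg : MemLp g 2 ν) :
    MemLp (fun p : α × β => f p.1 * g p.2) 2 (μ.prod ν) := by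
  have hm : AEStronglyMeasurable (fun p : α × β => f p.1 * g p.2) (μ.prod ν) :=
    (hf.1.comp_fst).mul (hg.1.comp_snd)
  rw [memLp_two_iff_integrable_sq_norm hm]
  have h1 := (memLp_two_iff_integrable_sq_norm hf.1).1 hf
  have h2 := (memLp_two_iff_integrable_sq_norm hg.1).1 hg
  refine (h1.mul_prod h2).congr (.of_forall fun p => ?_)
  simp [mul_pow]

/-! ### The cross section -/

/-- Lebesgue measure on the range of angles. -/
def angles : Measure ℝ := volume.restrict (Ioc (-(π / 4)) (π / 4))

instance : IsFiniteMeasure angles := by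
  unfold angles; infer_instance

lemma ae_angle : ∀ᵐ θ ∂angles, |θ| ≤ π / 4 := by
  unfold angles
  filter_upwards [ae_restrict_mem measurableSet_Ioc] with θ hθ
  exact abs_le.2 ⟨hθ.1.le, hθ.2⟩

lemma collisionKernel_eq (s : ℝ) (ψ : ℝ → ℂ) (v w : ℝ) : collisionKernel s ψ v w = ∫ θ, (crossSection s θ : ℂ) * ((ψ (v * cos θ + w * sin θ)
      + ψ (v * cos θ - w * sin θ)) / 2 - ψ v) ∂angles := by
  unfold collisionKernel angles
  rw [intervalIntegral.integral_of_le (by linarith [pi_pos])]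

lemma crossSection_nonneg (s θ : ℝ) : 0 ≤ crossSection s θ := by
  unfold crossSection; positivity

lemma measurable_crossSection (s : ℝ) : Measurable (crossSection s) := by
  unfold crossSection; fun_prop

lemma abs_sin_half_ge {θ : ℝ} (hθ : |θ| ≤ π / 4) : |θ| / π ≤ |sin (θ / 2)| := by
  have h := Real.mul_abs_le_abs_sin (x := θ / 2) (by
    rw [abs_div, abs_two]; linarith [pi_pos])
  rw [abs_div, abs_two] at h
  calc |θ| / π = 2 / π * (|θ| / 2) := by ring
    _ ≤ _ := h

lemma crossSection_le (hs : 0 < s) {θ : ℝ} (hθ : |θ| ≤ π / 4) (h0 : θ ≠ 0) : crossSection s θ ≤ π ^ (1 + 2 * s) * |θ| ^ (-(1 + 2 * s)) := by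
  have hp : 0 < |θ| := abs_pos.2 h0
  have h1 := abs_sin_half_ge hθ
  unfold crossSection
  have h2 : (|θ| / π) ^ (1 + 2 * s) ≤ |sin (θ / 2)| ^ (1 + 2 * s) :=
    rpow_le_rpow (by positivity) h1 (by linarith)
  have h3 : 0 < (|θ| / π) ^ (1 + 2 * s) :=
    rpow_pos_of_pos (div_pos hp pi_pos) _
  calc |cos (θ / 2)| / |sin (θ / 2)| ^ (1 + 2 * s)
      ≤ 1 / (|θ| / π) ^ (1 + 2 * s) := div_le_div₀ zero_le_one (Real.abs_cos_le_one _) h3 h2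
    _ = _ := by
      rw [Real.div_rpow hp.le pi_pos.le, rpow_neg hp.le]; field_simp

lemma integrable_abs_rpow {r : ℝ} (hr : -1 < r) : Integrable (fun θ : ℝ => |θ| ^ r) angles := by
  have hp : (0 : ℝ) ≤ π / 4 := by positivity
  have h1 : IntervalIntegrable (fun θ : ℝ => |θ| ^ r) volume 0 (π / 4) := by
    refine (intervalIntegral.intervalIntegrable_rpow' hr).congr_ae ?_
    rw [uIoc_of_le hp]
    filter_upwards [ae_restrict_mem measurableSet_Ioc] with θ hθ
    rw [abs_of_pos hθ.1]
  have h2 : IntervalIntegrable (fun θ : ℝ => |θ| ^ r) volume (-(π / 4)) 0 := by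
    have := h1.comp_sub_left 0
    simpa using this.symm
  have h3 := h2.trans h1
  rw [intervalIntegrable_iff_integrableOn_Ioc_of_le (by linarith)] at h3
  exact h3

lemma integrable_crossSection_sq (hs : s ∈ Ioo 0 1) : Integrable (fun θ => crossSection s θ * θ ^ 2) angles := by
  have h := (integrable_abs_rpow (r := 1 - 2 * s) (by linarith [hs.1, hs.2])).const_mul
    (π ^ (1 + 2 * s))
  refine h.mono' ((measurable_crossSection s).mul (by fun_prop)).aestronglyMeasurable ?_
  filter_upwards [ae_angle] with θ hθ
  rw [norm_of_nonneg (mul_nonneg (crossSection_nonneg _ _) (sq_nonneg _))]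
  rcases eq_or_ne θ 0 with rfl | h0
  · simp only [ne_eq, OfNat.ofNat_ne_zero, not_false_eq_true, zero_pow, mul_zero]; positivity
  · have hp : 0 < |θ| := abs_pos.2 h0
    calc _ ≤ π ^ (1 + 2 * s) * |θ| ^ (-(1 + 2 * s)) * θ ^ 2 := by
          gcongr; exact crossSection_le hs.1 hθ h0
      _ = π ^ (1 + 2 * s) * (|θ| ^ (-(1 + 2 * s)) * |θ| ^ (2 : ℝ)) := by
          rw [← sq_abs, Real.rpow_two]; ring
      _ = _ := by rw [← rpow_add hp]; congr 2; ring

/-! ### Second differences along rotations -/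

lemma exists_second_difference_bound {ψ : ℝ → ℂ} (hψ : IsBump ψ) : ∃ M, 0 ≤ M ∧ ∀ v w θ : ℝ, ‖(ψ (v * cos θ + w * sin θ)
      + ψ (v * cos θ - w * sin θ)) / 2 - ψ v‖ ≤ M * (1 + v ^ 2 + w ^ 2) * θ ^ 2 := by
  obtain ⟨C1, hC1⟩ := hψ.deriv.smooth.continuous.bounded_above_of_compact_support hψ.deriv.compact
  obtain ⟨C2, hC2⟩ := hψ.deriv.deriv.smooth.continuous.bounded_above_of_compact_support hψ.deriv.deriv.compact
  have hC1' : 0 ≤ C1 := (norm_nonneg _).trans (hC1 0)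
  have hC2' : 0 ≤ C2 := (norm_nonneg _).trans (hC2 0)
  refine ⟨2 * C2 + 2 * C1, by positivity, fun v w θ => ?_⟩
  set X : ℝ → ℝ := fun t => v * cos t + w * sin t with hX
  set Y : ℝ → ℝ := fun t => -v * sin t + w * cos t with hY
  have dX : ∀ t, HasDerivAt X (Y t) t := fun t => by
    refine (((Real.hasDerivAt_cos t).const_mul v).add ((Real.hasDerivAt_sin t).const_mul w)).congr_deriv ?_
    simp [hY]
  have dY : ∀ t, HasDerivAt Y (-X t) t := fun t => by
    refine (((Real.hasDerivAt_sin t).const_mul (-v)).add ((Real.hasDerivAt_cos t).const_mul w)).congr_deriv ?_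
    simp [hX]; ring
  have bX : ∀ t, |X t| ≤ |v| + |w| := fun t => by
    refine (abs_add_le _ _).trans (add_le_add ?_ ?_) <;> rw [abs_mul]
    · exact mul_le_of_le_one_right (abs_nonneg _) (Real.abs_cos_le_one _)
    · exact mul_le_of_le_one_right (abs_nonneg _) (Real.abs_sin_le_one _)
  have bY : ∀ t, |Y t| ≤ |v| + |w| := fun t => by
    refine (abs_add_le _ _).trans (add_le_add ?_ ?_) <;> rw [abs_mul]
    · rw [abs_neg]; exact mul_le_of_le_one_right (abs_nonneg _) (Real.abs_sin_le_one _)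
    · exact mul_le_of_le_one_right (abs_nonneg _) (Real.abs_cos_le_one _)
  set φ1 : ℝ → ℂ := fun t => (Y t : ℂ) * deriv ψ (X t) with hφ1
  have d1 : ∀ t, HasDerivAt (fun t => ψ (X t)) (φ1 t) t := fun t =>
    (hψ.hasDerivAt (X t)).scomp t (dX t)
  have d2 : ∀ t, HasDerivAt φ1 ((-X t : ℝ) * deriv ψ (X t) + (Y t : ℂ) * ((Y t : ℂ) * deriv (deriv ψ) (X t))) t := fun t =>
    ((dY t).ofReal_comp).mul ((hψ.deriv.hasDerivAt (X t)).scomp t (dX t))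
  set B : ℝ := (2 * C2 + 2 * C1) * (1 + v ^ 2 + w ^ 2) with hB
  have bd2 : ∀ t, ‖((-X t : ℝ) : ℂ) * deriv ψ (X t) + (Y t : ℂ) * ((Y t : ℂ) * deriv (deriv ψ) (X t))‖ ≤ B := fun t => by
    refine (norm_add_le _ _).trans ?_
    rw [norm_mul, norm_mul, norm_mul, norm_real, norm_real, norm_eq_abs, norm_eq_abs, abs_neg]
    have e1 : |X t| * ‖deriv ψ (X t)‖ ≤ (|v| + |w|) * C1 :=
      mul_le_mul (bX t) (hC1 _) (norm_nonneg _) (by positivity)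
    have e2 : |Y t| * (|Y t| * ‖deriv (deriv ψ) (X t)‖) ≤ (|v| + |w|) * ((|v| + |w|) * C2) :=
      mul_le_mul (bY t) (mul_le_mul (bY t) (hC2 _) (norm_nonneg _) (by positivity))
        (by positivity) (by positivity)
    have e3 : |v| + |w| ≤ 2 * (1 + v ^ 2 + w ^ 2) := by nlinarith [sq_nonneg (|v| - 1), sq_nonneg (|w| - 1), sq_abs v, sq_abs w]
    have e4 : (|v| + |w|) * (|v| + |w|) ≤ 2 * (1 + v ^ 2 + w ^ 2) := by nlinarith [sq_nonneg (|v| - |w|), sq_abs v, sq_abs w]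
    have e5 := mul_le_mul_of_nonneg_right e3 hC1'
    have e6 := mul_le_mul_of_nonneg_right e4 hC2'
    rw [hB]; linarith
  have b1 : ∀ a b, ‖φ1 b - φ1 a‖ ≤ B * ‖b - a‖ := fun a b =>
    Convex.norm_image_sub_le_of_norm_hasDerivWithin_le (s := univ)
      (fun t _ => (d2 t).hasDerivWithinAt) (fun t _ => bd2 t) convex_univ (mem_univ a) (mem_univ b)
  have hB0 : 0 ≤ B := by positivity
  set D : ℝ → ℂ := fun t => ψ (X t) + ψ (X (-t)) with hD
  have dD : ∀ t, HasDerivAt D (φ1 t - φ1 (-t)) t := fun t => by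
    have := (d1 t).add ((d1 (-t)).scomp t (hasDerivAt_neg t))
    refine this.congr_deriv ?_
    simp [sub_eq_add_neg]
  have bD : ‖D θ - D 0‖ ≤ (2 * B * |θ|) * ‖θ - 0‖ := by
    refine Convex.norm_image_sub_le_of_norm_hasDerivWithin_le (s := Icc (-|θ|) |θ|)
      (fun t _ => (dD t).hasDerivWithinAt) (fun t ht => ?_) (convex_Icc _ _) ?_ ?_
    · refine (b1 (-t) t).trans ?_
      have : ‖t - -t‖ = 2 * |t| := by rw [sub_neg_eq_add, ← two_mul, norm_mul, norm_eq_abs, norm_eq_abs, abs_two]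
      rw [this]
      have := abs_le.2 ht
      nlinarith
    · exact ⟨by simp, by simp⟩
    · exact ⟨neg_abs_le θ, le_abs_self θ⟩
  have e : (ψ (v * cos θ + w * sin θ) + ψ (v * cos θ - w * sin θ)) / 2 - ψ v = (D θ - D 0) / 2 := by
    simp [hD, hX]; ring_nf
  rw [e, norm_div]
  have : ‖(2 : ℂ)‖ = 2 := by simp
  rw [this, sub_zero, norm_eq_abs] at *
  rw [div_le_iff₀ (by norm_num)]
  refine bD.trans (le_of_eq ?_)
  rw [← sq_abs θ]; ring

/-! ### Rotations of the plane -/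

/-- Rotations of the velocity plane. -/
def rotation (θ : ℝ) : ℝ × ℝ →ₗ[ℝ] ℝ × ℝ :=
  Matrix.toLin (Module.Basis.finTwoProd ℝ) (Module.Basis.finTwoProd ℝ) !![cos θ, -sin θ; sin θ, cos θ]

lemma rotation_apply (θ : ℝ) (p : ℝ × ℝ) : rotation θ p = (p.1 * cos θ - p.2 * sin θ, p.1 * sin θ + p.2 * cos θ) := by
  rw [rotation, Matrix.toLin_finTwoProd_apply]
  ext <;> simp <;> ring

lemma measurePreserving_rotation (θ : ℝ) : MeasurePreserving (rotation θ) (volume : Measure (ℝ × ℝ)) volume := by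
  have hdet : LinearMap.det (rotation θ) = 1 := by
    rw [rotation, LinearMap.det_toLin, Matrix.det_fin_two_of]; nlinarith [Real.sin_sq_add_cos_sq θ]
  refine ⟨(rotation θ).continuous_of_finiteDimensional.measurable, ?_⟩
  rw [Measure.map_linearMap_addHaar_eq_smul_addHaar volume (by rw [hdet]; norm_num), hdet]
  simp

lemma injective_rotation (θ : ℝ) : Function.Injective (rotation θ) := by
  have hdet : LinearMap.det (rotation θ) = 1 := by
    rw [rotation, LinearMap.det_toLin, Matrix.det_fin_two_of]; nlinarith [Real.sin_sq_add_cos_sq θ]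
  have := (LinearMap.isUnit_iff_isUnit_det (rotation θ)).2 (by rw [hdet]; exact isUnit_one)
  exact ((Module.End.isUnit_iff _).1 this).1

lemma integral_comp_rotation (θ : ℝ) (Φ : ℝ × ℝ → ℂ) : ∫ p, Φ (rotation θ p) = ∫ p, Φ p :=
  (measurePreserving_rotation θ).integral_comp ((LinearMap.isClosedEmbedding_of_injective
    (LinearMap.ker_eq_bot.2 (injective_rotation θ))).measurableEmbedding) Φ
section

open Polynomial (X C hermite derivative eval eval_mul eval_map aeval_def eval_X derivative_mul aeval eval_C eval_add hermite_succ)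

/-- The matrix elements of the collision operator: `Γ(e_i, e_j) = α_{ij} e_{i+j}`. -/
def collCoef (s : ℝ) (i j : ℕ) : ℝ :=
  ∫ θ, crossSection s θ * (√((i + j).choose i : ℝ) * ((sin θ ^ i + (-sin θ) ^ i) / 2 * cos θ ^ j) - if i = 0 then 1 else 0) ∂angles

/-- The function `μ^{-1/2} h`. -/
def unweight (h : ℝ → ℂ) (v : ℝ) : ℂ := (sqrtMaxwellian v : ℂ)⁻¹ * h v

lemma IsBump.unweight (hh : IsBump h) : IsBump (unweight h) := by
  refine hh.mul_left (f := fun v => (sqrtMaxwellian v : ℂ)⁻¹) ?_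
  have : ContDiff ℝ ∞ (fun v => (sqrtMaxwellian v)⁻¹) :=
    contDiff_sqrtMaxwellian.inv fun v => (sqrtMaxwellian_pos v).ne'
  have h2 := Complex.ofRealCLM.contDiff.comp this
  have e : (fun v => (sqrtMaxwellian v : ℂ)⁻¹) = Complex.ofRealCLM ∘ fun v => (sqrtMaxwellian v)⁻¹ := by
    ext v; simp
  rw [e]; exact h2

/-- The kernel of the bilinear form `(f, g) ↦ ⟨Γ(f, g), h⟩`. -/
def tkernel (s : ℝ) (h : ℝ → ℂ) (p : ℝ × ℝ) : ℂ :=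
  (sqrtMaxwellian p.1 : ℂ) * sqrtMaxwellian p.2 * collisionKernel s (unweight h) p.1 p.2

lemma gammaPairing_eq (s : ℝ) (f g h : ℝ → ℂ) : gammaPairing s f g h = ∫ v, ∫ w, f w * g v * tkernel s h (v, w) := by
  unfold gammaPairing kacPairing tkernel
  refine integral_ext fun v => integral_congr_ae (.of_forall fun w => ?_)
  ring_nf
  rfl

lemma linearPairing_eq (s : ℝ) (g h : ℝ → ℂ) : linearPairing s g h =
    - gammaPairing s (fun v => (hermiteFun 0 v : ℂ)) g h
    - gammaPairing s g (fun v => (hermiteFun 0 v : ℂ)) h := by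
  have e : (fun v => (maxwellian v : ℂ)) = fun v => (sqrtMaxwellian v : ℂ) * (hermiteFun 0 v : ℂ) := by
    ext v; rw [hermiteFun_eq, ← sqrtMaxwellian_mul_self]; simp
  unfold linearPairing gammaPairing
  rw [e]

lemma stronglyMeasurable_collision_integrand (s : ℝ) {ψ : ℝ → ℂ} (hψ : Continuous ψ) :
    StronglyMeasurable (fun q : (ℝ × ℝ) × ℝ => (crossSection s q.2 : ℂ) * ((ψ (q.1.1 * cos q.2 + q.1.2 * sin q.2)
        + ψ (q.1.1 * cos q.2 - q.1.2 * sin q.2)) / 2 - ψ q.1.1)) := by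
  refine StronglyMeasurable.mul ?_ ?_
  · exact (Complex.measurable_ofReal.comp
      ((measurable_crossSection s).comp measurable_snd)).stronglyMeasurable
  · refine Continuous.stronglyMeasurable ?_
    refine Continuous.sub (Continuous.div_const (Continuous.add (hψ.comp ?_) (hψ.comp ?_)) _) (hψ.comp ?_) <;> fun_prop

lemma norm_collision_integrand_le {ψ : ℝ → ℂ} {M : ℝ} (hM : ∀ v w θ : ℝ, ‖(ψ (v * cos θ + w * sin θ)
      + ψ (v * cos θ - w * sin θ)) / 2 - ψ v‖ ≤ M * (1 + v ^ 2 + w ^ 2) * θ ^ 2)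
    (v w θ : ℝ) : ‖(crossSection s θ : ℂ) * ((ψ (v * cos θ + w * sin θ) + ψ (v * cos θ - w * sin θ)) / 2 - ψ v)‖
      ≤ M * (1 + v ^ 2 + w ^ 2) * (crossSection s θ * θ ^ 2) := by
  rw [norm_mul, norm_real, norm_of_nonneg (crossSection_nonneg s θ)]
  calc _ ≤ crossSection s θ * (M * (1 + v ^ 2 + w ^ 2) * θ ^ 2) :=
        mul_le_mul_of_nonneg_left (hM v w θ) (crossSection_nonneg s θ)
    _ = _ := by ring

lemma memLp_tkernel (hs : s ∈ Ioo 0 1) (hh : IsBump h) : MemLp (tkernel s h) 2 vol₂ := by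
  obtain ⟨M, hM0, hM⟩ := exists_second_difference_bound hh.unweight
  have hmeas : StronglyMeasurable (fun p : ℝ × ℝ => collisionKernel s (unweight h) p.1 p.2) := by
    simp_rw [collisionKernel_eq]
    exact (stronglyMeasurable_collision_integrand s hh.unweight.smooth.continuous).integral_prod_right
  set K := ∫ θ, crossSection s θ * θ ^ 2 ∂angles with hK
  have hK0 : 0 ≤ K := integral_nonneg fun θ => mul_nonneg (crossSection_nonneg _ _) (sq_nonneg _)
  have hb : ∀ v w, ‖collisionKernel s (unweight h) v w‖ ≤ M * (1 + v ^ 2 + w ^ 2) * K := fun v w => by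
    rw [collisionKernel_eq, hK, ← integral_const_mul]
    exact norm_integral_le_of_norm_le ((integrable_crossSection_sq hs).const_mul _) (.of_forall fun θ => norm_collision_integrand_le hM v w θ)
  have hp : MemLp (fun p : ℝ × ℝ => ((M * K : ℝ) : ℂ) * ((gpoly (1 + X ^ 2) p.1 : ℂ) * (gpoly (1 + X ^ 2) p.2 : ℂ))) 2 vol₂ :=
    (memLp_mul_prod (memLp_gpoly _) (memLp_gpoly _)).const_mul _
  refine hp.of_le ?_ (.of_forall fun p => ?_)
  · refine AEStronglyMeasurable.mul (Continuous.aestronglyMeasurable ?_) hmeas.aestronglyMeasurable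
    exact (Complex.continuous_ofReal.comp (continuous_sqrtMaxwellian.comp continuous_fst)).mul
      (Complex.continuous_ofReal.comp (continuous_sqrtMaxwellian.comp continuous_snd))
  · simp only [tkernel, norm_mul, norm_real, norm_of_nonneg (sqrtMaxwellian_pos _).le,
      gpoly, norm_of_nonneg hM0, norm_of_nonneg hK0]
    have h1 : ∀ x : ℝ, eval x (1 + X ^ 2 : ℝ[X]) = 1 + x ^ 2 := by
      intro x; simp
    rw [h1, h1, norm_of_nonneg (by positivity), norm_of_nonneg (by positivity)]
    have h2 := hb p.1 p.2
    have h3 : (1 + p.1 ^ 2 + p.2 ^ 2) ≤ (1 + p.1 ^ 2) * (1 + p.2 ^ 2) := by nlinarith [mul_nonneg (sq_nonneg p.1) (sq_nonneg p.2)]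
    have hpos := mul_nonneg (sqrtMaxwellian_pos p.1).le (sqrtMaxwellian_pos p.2).le
    calc _ ≤ sqrtMaxwellian p.1 * sqrtMaxwellian p.2 * (M * ((1 + p.1 ^ 2) * (1 + p.2 ^ 2)) * K) := by
          refine mul_le_mul_of_nonneg_left (h2.trans ?_) hpos
          gcongr
      _ = _ := by ring

lemma integrable_hermite_mul (i j : ℕ) {A : ℝ × ℝ → ℂ} (hA : AEStronglyMeasurable A vol₂) {C : ℝ} (hC : ∀ p, ‖A p‖ ≤ C) :
    Integrable (fun p : ℝ × ℝ => (hermiteFun i p.2 : ℂ) * (hermiteFun j p.1 : ℂ) * ((sqrtMaxwellian p.1 : ℂ) * sqrtMaxwellian p.2 * A p)) vol₂ := by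
  have h0 : MemLp (fun v => (sqrtMaxwellian v : ℂ)) 2 volume := by simpa using IsPoly.memLp_sqrtMaxwellian (IsPoly.const 1)
  have h1 := memLp_mul_prod (memLp_hermiteFun j) (memLp_hermiteFun i)
  have h2 := memLp_mul_prod h0 h0
  have h3 := (h1.integrable_mul h2).bdd_mul hA (.of_forall hC)
  refine h3.congr (.of_forall fun p => ?_)
  simp only [Pi.mul_apply]
  ring

lemma integral_hermite_rotated (i j : ℕ) (hh : IsBump h) (θ : ℝ) : ∫ p : ℝ × ℝ, (hermiteFun i p.2 : ℂ) * (hermiteFun j p.1 : ℂ) *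
      ((sqrtMaxwellian p.1 : ℂ) * sqrtMaxwellian p.2 * unweight h (p.1 * cos θ + p.2 * sin θ))
      = (√((i + j).choose i : ℝ) * (sin θ ^ i * cos θ ^ j) : ℝ) * coef (i + j) h := by
  set c := cos θ with hc
  set σ := sin θ with hσ
  have hcs : σ ^ 2 + c ^ 2 = 1 := Real.sin_sq_add_cos_sq θ
  set Φ : ℝ × ℝ → ℂ := fun p => (hermiteFun i p.2 : ℂ) * (hermiteFun j p.1 : ℂ) *
      ((sqrtMaxwellian p.1 : ℂ) * sqrtMaxwellian p.2 * unweight h (p.1 * c + p.2 * σ)) with hΦ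
  obtain ⟨C, hC⟩ := hh.unweight.smooth.continuous.bounded_above_of_compact_support hh.unweight.compact
  have hint : Integrable Φ (volume : Measure (ℝ × ℝ)) :=
    integrable_hermite_mul i j (A := fun p => unweight h (p.1 * c + p.2 * σ))
      (hh.unweight.smooth.continuous.comp (by fun_prop)).aestronglyMeasurable (fun p => hC _)
  have hint2 : Integrable (fun p => Φ (rotation θ p)) (volume : Measure (ℝ × ℝ)) :=
    (measurePreserving_rotation θ).integrable_comp_of_integrable hint
  rw [show (∫ p, Φ p) = ∫ p, Φ (rotation θ p) from (integral_comp_rotation θ Φ).symm]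
  have e : ∀ p, Φ (rotation θ p) = ((√(i.factorial : ℝ))⁻¹ * (√(j.factorial : ℝ))⁻¹ : ℝ) * ((sqrtMaxwellian p.1 : ℂ) * h p.1) * ((herm i (p.1 * σ + p.2 * c) *
        herm j (p.1 * c - p.2 * σ) * maxwellian p.2 : ℝ) : ℂ) := fun p => by
    have hm : maxwellian (p.1 * c - p.2 * σ) * maxwellian (p.1 * σ + p.2 * c) = maxwellian p.1 * maxwellian p.2 := by
      have : ∀ a b : ℝ, maxwellian a * maxwellian b = (√(2 * π))⁻¹ ^ 2 * Real.exp (-(1 / 2) * (a ^ 2 + b ^ 2)) := fun a b => by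
        rw [maxwellian_eq, maxwellian_eq, mul_add, Real.exp_add]; ring
      rw [this, this]; congr 3; linear_combination (p.1 ^ 2 + p.2 ^ 2) * hcs
    have hm2 : (sqrtMaxwellian (p.1 * c - p.2 * σ) * sqrtMaxwellian (p.1 * c - p.2 * σ)) *
        (sqrtMaxwellian (p.1 * σ + p.2 * c) * sqrtMaxwellian (p.1 * σ + p.2 * c))
        = sqrtMaxwellian p.1 * sqrtMaxwellian p.1 * maxwellian p.2 := by
      simp only [sqrtMaxwellian_mul_self, hm]
    have hm3 := congrArg (fun x : ℝ => (x : ℂ)) hm2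
    push_cast at hm3
    have hv : (p.1 * c - p.2 * σ) * c + (p.1 * σ + p.2 * c) * σ = p.1 := by linear_combination p.1 * hcs
    have hne : (sqrtMaxwellian p.1 : ℂ) ≠ 0 := by exact_mod_cast (sqrtMaxwellian_pos p.1).ne'
    simp only [hΦ, rotation_apply, ← hc, ← hσ, hv, unweight, hermiteFun_eq]; push_cast
    calc _ = (√(i.factorial : ℝ) : ℂ)⁻¹ * (√(j.factorial : ℝ) : ℂ)⁻¹ *
          (herm i (p.1 * σ + p.2 * c) : ℂ) * (herm j (p.1 * c - p.2 * σ) : ℂ) *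
          ((sqrtMaxwellian (p.1 * c - p.2 * σ) * sqrtMaxwellian (p.1 * c - p.2 * σ)) *
            (sqrtMaxwellian (p.1 * σ + p.2 * c) * sqrtMaxwellian (p.1 * σ + p.2 * c)) : ℂ) *
          ((sqrtMaxwellian p.1 : ℂ)⁻¹ * h p.1) := by ring
      _ = _ := by
        rw [hm3]; field_simp
  simp_rw [e] at hint2 ⊢
  rw [Measure.volume_eq_prod, integral_prod _ hint2]
  simp_rw [integral_const_mul, integral_complex_ofReal, integral_hermite_rotation c σ hcs i j]
  unfold coef
  rw [← integral_const_mul]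
  refine integral_ext fun v => ?_
  have hch : √((i + j).choose i : ℝ) = √((i + j).factorial : ℝ) * ((√(i.factorial : ℝ))⁻¹ * (√(j.factorial : ℝ))⁻¹) := by
    rw [Nat.choose_symm_add, Nat.add_choose, Nat.cast_div (Nat.factorial_mul_factorial_dvd_factorial_add i j)
      (by positivity), Real.sqrt_div (by positivity), Nat.cast_mul, sqrt_mul (by positivity),
      div_eq_mul_inv, mul_inv]
  simp only [hermiteFun_eq]
  rw [hch]
  have hne := (sqrt_factorial_pos (i + j)).ne'
  have hne' : (√((i + j).factorial : ℝ) : ℂ) ≠ 0 := by exact_mod_cast hne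
  push_cast
  field_simp

lemma gammaPairing_hermite (hs : s ∈ Ioo 0 1) (hh : IsBump h)
    (i j : ℕ) : gammaPairing s (fun v => (hermiteFun i v : ℂ)) (fun v => (hermiteFun j v : ℂ)) h = (collCoef s i j : ℂ) * coef (i + j) h := by
  obtain ⟨M, hM0, hM⟩ := exists_second_difference_bound hh.unweight
  have hψ := hh.unweight.smooth.continuous
  obtain ⟨C, hC⟩ := hψ.bounded_above_of_compact_support hh.unweight.compact
  have hint : Integrable (fun p : ℝ × ℝ => (hermiteFun i p.2 : ℂ) * (hermiteFun j p.1 : ℂ) * tkernel s h p) vol₂ := by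
    refine ((memLp_mul_prod (memLp_hermiteFun j) (memLp_hermiteFun i)).integrable_mul (memLp_tkernel hs hh)).congr (.of_forall fun p => ?_)
    simp only [Pi.mul_apply]; ring
  rw [gammaPairing_eq, ← integral_prod (f := fun p : ℝ × ℝ => (hermiteFun i p.2 : ℂ) * (hermiteFun j p.1 : ℂ) * tkernel s h p) hint]
  set Z : (ℝ × ℝ) × ℝ → ℂ := fun q => (hermiteFun i q.1.2 : ℂ) * (hermiteFun j q.1.1 : ℂ) *
    ((sqrtMaxwellian q.1.1 : ℂ) * sqrtMaxwellian q.1.2) * ((crossSection s q.2 : ℂ) * ((unweight h (q.1.1 * cos q.2 + q.1.2 * sin q.2)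
        + unweight h (q.1.1 * cos q.2 - q.1.2 * sin q.2)) / 2 - unweight h q.1.1)) with hZ
  have e1 : ∀ p : ℝ × ℝ, (hermiteFun i p.2 : ℂ) * (hermiteFun j p.1 : ℂ) * tkernel s h p = ∫ θ, Z (p, θ) ∂angles := fun p => by
    simp only [tkernel, collisionKernel_eq, hZ]; rw [← mul_assoc, ← integral_const_mul]
  have hZint : Integrable Z ((vol₂).prod angles) := by
    have hdom : Integrable (fun q : (ℝ × ℝ) × ℝ => (M * (‖hermiteFun j q.1.1‖ * ‖gpoly (1 + X ^ 2) q.1.1‖ * (‖hermiteFun i q.1.2‖ *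
        ‖gpoly (1 + X ^ 2) q.1.2‖))) * (crossSection s q.2 * q.2 ^ 2))
        ((vol₂).prod angles) := by
      have hk : ∀ k, Integrable (fun v => ‖hermiteFun k v‖ * ‖gpoly (1 + X ^ 2) v‖) := fun k => by
        rw [hermiteFun_eq_gpoly]
        exact (memLp_gpoly_real _).norm.integrable_mul (memLp_gpoly_real _).norm
      exact (((hk j).mul_prod (hk i)).const_mul M).mul_prod (integrable_crossSection_sq hs)
    refine hdom.mono' ?_ (.of_forall fun q => ?_)
    · refine AEStronglyMeasurable.mul (Continuous.aestronglyMeasurable ?_)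
        (stronglyMeasurable_collision_integrand s hψ).aestronglyMeasurable
      have h1 := continuous_hermiteFun i
      have h2 := continuous_hermiteFun j
      have h3 := continuous_sqrtMaxwellian
      fun_prop
    · simp only [hZ]; rw [norm_mul]
      have h1 := norm_collision_integrand_le (s := s) hM q.1.1 q.1.2 q.2
      have h3 : (1 + q.1.1 ^ 2 + q.1.2 ^ 2) ≤ (1 + q.1.1 ^ 2) * (1 + q.1.2 ^ 2) := by
        nlinarith [mul_nonneg (sq_nonneg q.1.1) (sq_nonneg q.1.2)]
      have hβ := mul_nonneg (crossSection_nonneg s q.2) (sq_nonneg q.2)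
      have hev : ∀ x : ℝ, eval x (1 + X ^ 2 : ℝ[X]) = 1 + x ^ 2 := by
        intro x; simp
      have hg : ∀ x : ℝ, ‖gpoly (1 + X ^ 2) x‖ = (1 + x ^ 2) * sqrtMaxwellian x :=
        fun x => by
        rw [gpoly, hev, norm_mul, norm_of_nonneg (by positivity),
          norm_of_nonneg (sqrtMaxwellian_pos x).le]
      rw [hg, hg]
      simp only [norm_mul, norm_real, norm_of_nonneg (sqrtMaxwellian_pos _).le] at h1 ⊢
      have hpos : 0 ≤ ‖hermiteFun i q.1.2‖ * ‖hermiteFun j q.1.1‖ * (sqrtMaxwellian q.1.1 * sqrtMaxwellian q.1.2) := by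
        have := (sqrtMaxwellian_pos q.1.1).le
        have := (sqrtMaxwellian_pos q.1.2).le
        positivity
      refine (mul_le_mul_of_nonneg_left h1 hpos).trans ?_
      calc _ ≤ ‖hermiteFun i q.1.2‖ * ‖hermiteFun j q.1.1‖ *
            (sqrtMaxwellian q.1.1 * sqrtMaxwellian q.1.2) *
            (M * ((1 + q.1.1 ^ 2) * (1 + q.1.2 ^ 2)) * (crossSection s q.2 * q.2 ^ 2)) := by
            refine mul_le_mul_of_nonneg_left ?_ hpos
            gcongr
        _ = _ := by ring
  simp_rw [e1]
  rw [integral_integral_swap hZint]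
  have e2 : ∀ θ, ∫ p : ℝ × ℝ, Z (p, θ) ∂vol₂ = ((crossSection s θ * (√((i + j).choose i : ℝ) * ((sin θ ^ i + (-sin θ) ^ i) / 2
        * cos θ ^ j) - if i = 0 then 1 else 0) : ℝ) : ℂ) * coef (i + j) h := fun θ => by
    set J : ℝ → ℝ × ℝ → ℂ := fun θ p => (hermiteFun i p.2 : ℂ) * (hermiteFun j p.1 : ℂ) * ((sqrtMaxwellian p.1 : ℂ) * sqrtMaxwellian p.2 *
        unweight h (p.1 * cos θ + p.2 * sin θ)) with hJ
    have hJi : ∀ θ, Integrable (J θ) vol₂ := fun θ =>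
      integrable_hermite_mul i j (A := fun p => unweight h (p.1 * cos θ + p.2 * sin θ)) (hψ.comp (by fun_prop)).aestronglyMeasurable (fun p => hC _)
    have e3 : ∀ p, Z (p, θ) = (crossSection s θ : ℂ) * ((1 / 2) * (J θ p + J (-θ) p) - J 0 p) := fun p => by
      simp only [hZ, hJ, Real.cos_neg, Real.sin_neg, mul_neg, Real.cos_zero, Real.sin_zero, mul_one, mul_zero, add_zero, ← sub_eq_add_neg]
      ring
    simp_rw [e3]
    have hJv : ∀ θ, ∫ p, J θ p ∂vol₂ = _ := fun θ =>
      integral_hermite_rotated i j hh θ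
    rw [integral_const_mul, integral_sub (f := fun p => 1 / 2 * (J θ p + J (-θ) p)) (((hJi θ).add (hJi (-θ))).const_mul (1 / 2)) (hJi 0),
      integral_const_mul, integral_add (hJi θ) (hJi (-θ)), hJv, hJv, hJv]
    simp only [Real.cos_neg, Real.sin_neg, Real.cos_zero, Real.sin_zero, one_pow, mul_one]
    by_cases hi : i = 0
    · subst hi; simp; ring
    · rw [zero_pow hi, if_neg hi]; push_cast; ring
  simp_rw [e2]
  rw [integral_mul_const, integral_complex_ofReal]
  rfl

/-- The pairing `⟨Γ(f, g), h⟩` in the Hermite basis. -/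
lemma hasSum_gammaPairing (hs : s ∈ Ioo 0 1) (hf : MemLp f 2 volume) (hg : MemLp g 2 volume) (hh : IsBump h) :
    HasSum (fun j => coef j g * ∑' i, coef i f * ((collCoef s i j : ℂ) * coef (i + j) h)) (gammaPairing s f g h) ∧
    ∀ j, Summable fun i => coef i f * ((collCoef s i j : ℂ) * coef (i + j) h) := by
  have hQ := memLp_tkernel hs hh
  have hQs : MemLp (fun p : ℝ × ℝ => tkernel s h (p.2, p.1)) 2 vol₂ :=
    hQ.comp_measurePreserving Measure.measurePreserving_swap
  set P : ℝ → ℂ := fun v => ∫ w, f w * tkernel s h (v, w) with hP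
  have hPm : MemLp P 2 volume := memLp_integral_mul hQ hf
  set R : ℕ → ℝ → ℂ := fun j w => ∫ v, (hermiteFun j v : ℂ) * tkernel s h (v, w) with hR
  have hRm : ∀ j, MemLp (R j) 2 volume := fun j => memLp_integral_mul hQs (memLp_hermiteFun j)
  have h1 : gammaPairing s f g h = ∫ v, g v * P v := by
    rw [gammaPairing_eq]
    refine integral_ext fun v => ?_
    simp only [hP]; rw [← integral_const_mul]
    refine integral_ext fun w => ?_
    ring
  have h2 : ∀ j, coef j P = ∫ w, f w * R j w := fun j => by
    have hint : Integrable (fun p : ℝ × ℝ => f p.2 * (hermiteFun j p.1 : ℂ) * tkernel s h p) vol₂ := by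
      refine ((memLp_mul_prod (memLp_hermiteFun j) hf).integrable_mul hQ).congr (.of_forall fun p => ?_)
      simp only [Pi.mul_apply]; ring
    have := integral_integral_swap (f := fun v w => f w * (hermiteFun j v : ℂ) * tkernel s h (v, w)) hint
    calc coef j P = ∫ v, ∫ w, f w * (hermiteFun j v : ℂ) * tkernel s h (v, w) := by
          unfold coef
          refine integral_ext fun v => ?_
          simp only [hP]; rw [← integral_mul_const]
          refine integral_ext fun w => ?_
          ring
      _ = _ := this
      _ = _ := by
          refine integral_ext fun w => ?_
          simp only [hR]; rw [← integral_const_mul]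
          refine integral_ext fun v => ?_
          ring
  have h3 : ∀ i j, coef i (R j) = (collCoef s i j : ℂ) * coef (i + j) h := fun i j => by
    rw [← gammaPairing_hermite hs hh, gammaPairing_eq]
    have hint : Integrable (fun p : ℝ × ℝ => (hermiteFun i p.2 : ℂ) * (hermiteFun j p.1 : ℂ) * tkernel s h p) vol₂ := by
      refine ((memLp_mul_prod (memLp_hermiteFun j) (memLp_hermiteFun i)).integrable_mul hQ).congr (.of_forall fun p => ?_)
      simp only [Pi.mul_apply]; ring
    rw [integral_integral_swap (f := fun v w => (hermiteFun i w : ℂ) * (hermiteFun j v : ℂ) * tkernel s h (v, w)) hint]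
    unfold coef
    refine integral_ext fun w => ?_
    simp only [hR]; rw [← integral_mul_const]
    refine integral_ext fun v => ?_
    ring
  have h4 : ∀ j, HasSum (fun i => coef i f * ((collCoef s i j : ℂ) * coef (i + j) h)) (coef j P) := fun j => by
    rw [h2]
    have := hasSum_coef_mul hf (hRm j)
    simpa only [h3] using this
  refine ⟨?_, fun j => (h4 j).summable⟩
  rw [h1]
  have := hasSum_coef_mul hg hPm
  refine this.congr_fun fun j => ?_
  rw [(h4 j).tsum_eq]

end

/-! ## Size of the matrix elements -/

/-- The angular profile of the matrix element `α_{ij}`. -/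
def profile (i j : ℕ) (θ : ℝ) : ℝ := √((i + j).choose i : ℝ) * ((sin θ ^ i + (-sin θ) ^ i) / 2 * cos θ ^ j) - if i = 0 then 1 else 0

lemma collCoef_eq (s : ℝ) (i j : ℕ) : collCoef s i j = ∫ θ, crossSection s θ * profile i j θ ∂angles := rfl

lemma continuous_profile (i j : ℕ) : Continuous (profile i j) := by
  unfold profile; fun_prop

lemma one_sub_pow_le {c : ℝ} (hc0 : 0 ≤ c) (n : ℕ) : 1 - c ^ n ≤ n * (1 - c) := by
  have h := one_add_mul_le_pow (a := c - 1) (by linarith) n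
  have : (1 + (c - 1)) = c := by ring
  rw [this] at h
  linarith

lemma binomial_tail {p q : ℝ} (hp : 0 ≤ p) (hq : 0 ≤ q) (hpq : p + q = 1) (n : ℕ) :
    ∑ i ∈ Finset.range n, ((n + 1).choose (i + 2) : ℝ) * (p ^ (i + 2) * q ^ (n - 1 - i)) ≤ (min 1 ((n + 1) * p)) ^ 2 := by
  cases n with
  | zero => simp; positivity
  | succ m =>
    have hsum := add_pow p q (m + 2)
    rw [hpq, one_pow, Finset.sum_range_succ', Finset.sum_range_succ'] at hsum
    simp only [Nat.reduceSubDiff, zero_add, pow_one, Nat.choose_one_right, pow_zero, one_mul, Nat.choose_zero_right, Nat.cast_one, mul_one, tsub_zero] at hsum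
    have e : ∑ i ∈ Finset.range (m + 1), ((m + 1 + 1).choose (i + 2) : ℝ) * (p ^ (i + 2) * q ^ (m + 1 - 1 - i))
        = ∑ i ∈ Finset.range (m + 1), p ^ (i + 1 + 1) * q ^ (m + 2 - (i + 1 + 1)) * ((m + 2).choose (i + 1 + 1) : ℝ) := by
      refine sum_congr rfl fun i hi => ?_
      have : m + 2 - (i + 1 + 1) = m + 1 - 1 - i := by omega
      rw [this]; ring
    have hq1 : q ≤ 1 := by linarith
    set T := ∑ i ∈ Finset.range (m + 1), ((m + 1 + 1).choose (i + 2) : ℝ) * (p ^ (i + 2) * q ^ (m + 1 - 1 - i)) with hT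
    have h1 : T = 1 - q ^ (m + 2) - p * q ^ (m + 1) * ((m : ℝ) + 2) := by
      rw [e]
      have e2 : ∀ x, m + 2 - (x + 1 + 1) = m - x := fun x => by omega
      simp only [e2]
      push_cast at hsum ⊢
      linarith
    have h2 := one_sub_pow_le hq (m + 2)
    have h3 := one_sub_pow_le hq (m + 1)
    have hp1 : 1 - q = p := by linarith
    rw [hp1] at h2 h3
    push_cast at h2 h3 ⊢
    have hm : (0 : ℝ) ≤ m := m.cast_nonneg
    have hqn : 0 ≤ q ^ (m + 1) := by positivity
    rcases le_total 1 (((m : ℝ) + 1 + 1) * p) with h | h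
    · rw [min_eq_left h, h1]
      have : 0 ≤ q ^ (m + 2) := by positivity
      have : 0 ≤ p * q ^ (m + 1) * ((m : ℝ) + 2) := by positivity
      linarith
    · rw [min_eq_right h, h1]
      have h4 : ((m : ℝ) + 2) * p * (1 - q ^ (m + 1)) ≤ ((m : ℝ) + 2) * p * (((m : ℝ) + 1) * p) :=
        mul_le_mul_of_nonneg_left h3 (by positivity)
      have h5 : ((m : ℝ) + 2) * p * (((m : ℝ) + 1) * p) ≤ (((m : ℝ) + 1 + 1) * p) ^ 2 := by
        have : (((m : ℝ) + 1 + 1) * p) ^ 2 = ((m : ℝ) + 2) * p * (((m : ℝ) + 1) * p) + ((m : ℝ) + 2) * p ^ 2 := by ring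
        rw [this]; nlinarith [mul_nonneg hm (sq_nonneg p), sq_nonneg p]
      nlinarith

lemma rpow_neg_half_le (hs : s ∈ Ioo 0 1) (j : ℕ) : ((j : ℝ) + 1 / 2) ^ (-s) ≤ 2 * ((j : ℝ) + 1) ^ (-s) := by
  have hj : (0 : ℝ) ≤ j := j.cast_nonneg
  have h1 : ((j : ℝ) + 1) / 2 ≤ (j : ℝ) + 1 / 2 := by linarith
  calc ((j : ℝ) + 1 / 2) ^ (-s) ≤ (((j : ℝ) + 1) / 2) ^ (-s) :=
        Real.rpow_le_rpow_of_nonpos (by positivity) h1 (by linarith [hs.1, hs.2])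
    _ = (2 : ℝ) ^ s * ((j : ℝ) + 1) ^ (-s) := by
        rw [Real.div_rpow (by positivity) (by norm_num), rpow_neg (by norm_num : (0 : ℝ) ≤ 2)]; field_simp
    _ ≤ 2 * ((j : ℝ) + 1) ^ (-s) := by
        gcongr
        calc (2 : ℝ) ^ s ≤ 2 ^ (1 : ℝ) := Real.rpow_le_rpow_of_exponent_le (by norm_num) hs.2.le
          _ = 2 := by simp

lemma rpow_neg_le_mul_div (hs₁ : s < 1) {j k : ℕ} (hjk : j ≤ k) : ((j : ℝ) + 1) ^ (-s) ≤ ((k : ℝ) + 1) ^ (-s) * (((k : ℝ) + 1) / ((j : ℝ) + 1)) := by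
  have hj : (0 : ℝ) < (j : ℝ) + 1 := by positivity
  have hk : (0 : ℝ) < (k : ℝ) + 1 := by positivity
  have h1 : 1 ≤ ((k : ℝ) + 1) / ((j : ℝ) + 1) := by
    rw [one_le_div hj]
    have : (j : ℝ) ≤ k := by exact_mod_cast hjk
    linarith
  have h2 : (((k : ℝ) + 1) / ((j : ℝ) + 1)) ^ s ≤ ((k : ℝ) + 1) / ((j : ℝ) + 1) := by
    calc _ ≤ (((k : ℝ) + 1) / ((j : ℝ) + 1)) ^ (1 : ℝ) :=
          Real.rpow_le_rpow_of_exponent_le h1 hs₁.le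
      _ = _ := by simp
  calc ((j : ℝ) + 1) ^ (-s)
      = ((k : ℝ) + 1) ^ (-s) * (((k : ℝ) + 1) / ((j : ℝ) + 1)) ^ s := by
        rw [Real.div_rpow hk.le hj.le, rpow_neg hk.le, rpow_neg hj.le]
        have := (rpow_pos_of_pos hk s).ne'
        field_simp
    _ ≤ _ := by gcongr

lemma cos_angle_nonneg {θ : ℝ} (hθ : |θ| ≤ π / 4) : 0 ≤ cos θ := by
  refine Real.cos_nonneg_of_mem_Icc ?_
  have := abs_le.1 hθ
  constructor <;> linarith [pi_pos]

lemma cos_sq_angle_ge {θ : ℝ} (hθ : |θ| ≤ π / 4) : 1 / 2 ≤ cos θ ^ 2 := by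
  have h1 : cos (π / 4) ≤ cos |θ| :=
    Real.cos_le_cos_of_nonneg_of_le_pi (abs_nonneg _) (by linarith [pi_pos]) hθ
  rw [Real.cos_abs, Real.cos_pi_div_four] at h1
  have h2 : (√2 / 2) ^ 2 = 1 / 2 := by rw [div_pow, sq_sqrt (by norm_num)]; norm_num
  rw [← h2]
  exact pow_le_pow_left₀ (by positivity) h1 2

lemma sin_sq_le (θ : ℝ) : sin θ ^ 2 ≤ θ ^ 2 := by
  rw [← sq_abs, ← sq_abs θ]
  exact pow_le_pow_left₀ (abs_nonneg _) (Real.abs_sin_le_abs) 2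

lemma profile_zero (k : ℕ) (θ : ℝ) : profile 0 k θ = cos θ ^ k - 1 := by simp [profile]

lemma profile_one (k : ℕ) (θ : ℝ) : profile 1 k θ = 0 := by simp [profile]

lemma profile_sq_le (i j : ℕ) (hi : i ≠ 0) (θ : ℝ) : profile i j θ ^ 2 ≤ ((i + j).choose i : ℝ) * ((sin θ ^ 2) ^ i * (cos θ ^ 2) ^ j) := by
  have h1 : ((sin θ ^ i + (-sin θ) ^ i) / 2) ^ 2 ≤ (sin θ ^ 2) ^ i := by
    rcases Nat.even_or_odd i with h | h
    · rw [h.neg_pow]; ring_nf; exact le_refl _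
    · rw [h.neg_pow]; simp; positivity
  rw [profile, if_neg hi, sub_zero, mul_pow, sq_sqrt (by positivity), mul_pow]
  have h2 : (cos θ ^ j) ^ 2 = (cos θ ^ 2) ^ j := by ring
  rw [h2]
  gcongr

lemma profile_sum_le (hs : s ∈ Ioo 0 1) (k : ℕ) {θ : ℝ} (hθ : |θ| ≤ π / 4) : ∑ p ∈ antidiagonal k, ((p.2 : ℝ) + 1 / 2) ^ (-s) * profile p.1 p.2 θ ^ 2
      ≤ 6 * ((k : ℝ) + 1) ^ (-s) * (min 1 (((k : ℝ) + 1) * θ ^ 2)) ^ 2 := by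
  set p := sin θ ^ 2 with hp
  set q := cos θ ^ 2 with hq
  have hp0 : 0 ≤ p := sq_nonneg _
  have hq0 : 0 ≤ q := sq_nonneg _
  have hpq : p + q = 1 := Real.sin_sq_add_cos_sq θ
  have hq2 : 1 / 2 ≤ q := cos_sq_angle_ge hθ
  have hW : 0 ≤ ((k : ℝ) + 1) ^ (-s) := by positivity
  have hk0 : (0 : ℝ) ≤ k := k.cast_nonneg
  rw [Finset.Nat.sum_antidiagonal_eq_sum_range_succ (fun i j => ((j : ℝ) + 1 / 2) ^ (-s) * profile i j θ ^ 2)]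
  have first : ((k : ℝ) + 1 / 2) ^ (-s) * profile 0 k θ ^ 2 ≤ 2 * ((k : ℝ) + 1) ^ (-s) * (min 1 (((k : ℝ) + 1) * θ ^ 2)) ^ 2 := by
    rw [profile_zero]
    have hc := cos_angle_nonneg hθ
    have hc1 : cos θ ^ k ≤ 1 := pow_le_one₀ hc (Real.cos_le_one _)
    have hc2 : 1 - cos θ ^ k ≤ min 1 (((k : ℝ) + 1) * θ ^ 2) := by
      refine le_min (by have := pow_nonneg hc k; linarith) ?_
      have h1 := one_sub_pow_le hc k
      have h2 := Real.one_sub_sq_div_two_le_cos (x := θ)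
      have h3 : (k : ℝ) * (1 - cos θ) ≤ k * θ ^ 2 := by
        gcongr; nlinarith [sq_nonneg θ]
      nlinarith [sq_nonneg θ]
    have h4 : (cos θ ^ k - 1) ^ 2 ≤ (min 1 (((k : ℝ) + 1) * θ ^ 2)) ^ 2 := by
      rw [← neg_sq, neg_sub]
      exact pow_le_pow_left₀ (by linarith) hc2 2
    exact mul_le_mul (rpow_neg_half_le hs k) h4 (sq_nonneg _) (by positivity)
  cases k with
  | zero =>
    rw [Finset.sum_range_one]
    refine first.trans ?_
    gcongr; norm_num
  | succ n =>
    rw [Finset.sum_range_succ', Finset.sum_range_succ']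
    have rest : ∑ i ∈ Finset.range n, ((((n + 1) - (i + 1 + 1) : ℕ) : ℝ) + 1 / 2) ^ (-s) * profile (i + 1 + 1) ((n + 1) - (i + 1 + 1)) θ ^ 2
        ≤ 4 * (((n + 1 : ℕ) : ℝ) + 1) ^ (-s) * (min 1 ((((n + 1 : ℕ) : ℝ) + 1) * θ ^ 2)) ^ 2 := by
      have hterm : ∀ i ∈ Finset.range n, ((((n + 1) - (i + 1 + 1) : ℕ) : ℝ) + 1 / 2) ^ (-s) * profile (i + 1 + 1) ((n + 1) - (i + 1 + 1)) θ ^ 2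
          ≤ 4 * (((n + 1 : ℕ) : ℝ) + 1) ^ (-s) * (((n + 1 + 1).choose (i + 2) : ℝ) * (p ^ (i + 2) * q ^ (n + 1 - 1 - i))) := by
        intro i hi
        have hi' := Finset.mem_range.1 hi
        obtain ⟨j, hj⟩ : ∃ j, n + 1 = i + 2 + j := ⟨n + 1 - (i + 2), by omega⟩
        have ej : (n + 1) - (i + 1 + 1) = j := by omega
        have ej2 : n + 1 - 1 - i = j + 1 := by omega
        rw [ej, ej2]
        have h1 := profile_sq_le (i + 1 + 1) j (by omega) θ
        have h2 := (rpow_neg_half_le hs j).trans (mul_le_mul_of_nonneg_left (rpow_neg_le_mul_div hs.2 (show j ≤ n + 1 by omega)) (by norm_num))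
        have h3 := Nat.choose_mul_succ_eq (n + 1) (i + 2)
        have h4 : n + 1 + 1 - (i + 2) = j + 1 := by omega
        rw [h4] at h3
        have h5 : ((n + 1).choose (i + 2) : ℝ) * ((((n + 1 : ℕ) : ℝ) + 1) / ((j : ℝ) + 1)) = ((n + 1 + 1).choose (i + 2) : ℝ) := by
          rw [mul_div_assoc', div_eq_iff (by positivity)]
          exact_mod_cast h3
        have hsum : i + 1 + 1 + j = n + 1 := by omega
        rw [hsum] at h1
        refine (mul_le_mul h2 h1 (sq_nonneg _) (by positivity)).trans ?_
        rw [← h5]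
        have h6 : q ^ j ≤ 2 * q ^ (j + 1) := by
          rw [pow_succ]; nlinarith [pow_nonneg hq0 j]
        calc _ = 2 * (((n + 1 : ℕ) : ℝ) + 1) ^ (-s) * (((n + 1).choose (i + 2) : ℝ) *
              ((((n + 1 : ℕ) : ℝ) + 1) / ((j : ℝ) + 1)) * (p ^ (i + 2))) * q ^ j := by ring
          _ ≤ 2 * (((n + 1 : ℕ) : ℝ) + 1) ^ (-s) * (((n + 1).choose (i + 2) : ℝ) *
              ((((n + 1 : ℕ) : ℝ) + 1) / ((j : ℝ) + 1)) * (p ^ (i + 2))) * (2 * q ^ (j + 1)) := by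
              gcongr
          _ = _ := by ring
      refine (Finset.sum_le_sum hterm).trans ?_
      rw [← mul_sum]
      have hext : ∑ i ∈ Finset.range n, ((n + 1 + 1).choose (i + 2) : ℝ) * (p ^ (i + 2) * q ^ (n + 1 - 1 - i)) ≤ ∑ i ∈ Finset.range (n + 1),
            ((n + 1 + 1).choose (i + 2) : ℝ) * (p ^ (i + 2) * q ^ (n + 1 - 1 - i)) :=
        Finset.sum_le_sum_of_subset_of_nonneg (Finset.range_mono (by omega))
          (fun i _ _ => by positivity)
      have ht := hext.trans (binomial_tail hp0 hq0 hpq (n + 1))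
      have hmono : min 1 ((((n + 1 : ℕ) : ℝ) + 1) * p) ≤ min 1 ((((n + 1 : ℕ) : ℝ) + 1) * θ ^ 2) := by
        refine min_le_min le_rfl ?_
        gcongr; exact sin_sq_le θ
      have hmin0 : 0 ≤ min 1 ((((n + 1 : ℕ) : ℝ) + 1) * p) := le_min zero_le_one (by positivity)
      have := ht.trans (pow_le_pow_left₀ hmin0 hmono 2)
      gcongr
    have h1 : ((((n + 1) - (0 + 1) : ℕ) : ℝ) + 1 / 2) ^ (-s) * profile (0 + 1) ((n + 1) - (0 + 1)) θ ^ 2 = 0 := by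
      rw [zero_add, profile_one]; simp
    rw [h1, add_zero, Nat.sub_zero]
    calc _ ≤ _ := add_le_add rest first
      _ = _ := by ring

/-! ### Angular integrals -/

lemma integrable_comp_abs {f : ℝ → ℝ} (hf : IntegrableOn f (Ioi 0)) : Integrable (fun x => f |x|) := by
  have h : IntegrableOn (fun x => f |x|) (Ioi 0) :=
    hf.congr_fun (fun x hx => by rw [abs_of_pos hx]) measurableSet_Ioi
  have h2 : IntegrableOn (fun x ↦ f |x|) (Iic 0) := by
    rw [← Measure.map_neg_eq_self vol]
    let m : MeasurableEmbedding fun x : ℝ => -x := (Homeomorph.neg ℝ).measurableEmbedding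
    rw [m.integrableOn_map_iff]
    simp_rw [Function.comp_def, abs_neg, neg_preimage, neg_Iic, neg_zero]
    exact Iff.mpr integrableOn_Ici_iff_integrableOn_Ioi h
  rw [← integrableOn_univ, ← Iic_union_Ioi (a := (0 : ℝ))]
  exact h2.union h

lemma integrable_scaled_profile (hs : s ∈ Ioo 0 1) : Integrable (fun t : ℝ => |t| ^ (-(1 + 2 * s)) * min 1 (|t| ^ (2 : ℝ))) := by
  have h1 : IntegrableOn (fun t : ℝ => t ^ (-(1 + 2 * s)) * min 1 (t ^ (2 : ℝ))) (Ioi 0) := by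
    rw [← Ioc_union_Ioi_eq_Ioi (zero_le_one' ℝ)]
    refine IntegrableOn.union ?_ ?_
    · have := (intervalIntegral.intervalIntegrable_rpow' (a := 0) (b := 1)
        (r := 1 - 2 * s) (by linarith [hs.1, hs.2]))
      rw [intervalIntegrable_iff_integrableOn_Ioc_of_le zero_le_one] at this
      refine this.congr_fun (fun t ht => ?_) measurableSet_Ioc
      have h2 : t ^ (2 : ℝ) ≤ 1 := Real.rpow_le_one ht.1.le ht.2 (by norm_num)
      simp only
      rw [min_eq_right h2, ← rpow_add ht.1]; congr 1; ring
    · refine (integrableOn_Ioi_rpow_of_lt (a := -(1 + 2 * s)) (by linarith [hs.1, hs.2]) zero_lt_one).congr_fun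
        (fun t ht => ?_) measurableSet_Ioi
      have h2 : 1 ≤ t ^ (2 : ℝ) := Real.one_le_rpow (le_of_lt ht) (by norm_num)
      simp only; rw [min_eq_left h2, mul_one]
  exact integrable_comp_abs h1

/-- `∫ β min(1, n θ²) ≲ n^s`. -/
lemma exists_angular_bound (hs : s ∈ Ioo 0 1) : ∃ C, 0 < C ∧ ∀ n : ℕ, 0 < n → Integrable (fun θ => crossSection s θ * min 1 ((n : ℝ) * θ ^ 2)) angles ∧
    ∫ θ, crossSection s θ * min 1 ((n : ℝ) * θ ^ 2) ∂angles ≤ C * (n : ℝ) ^ s := by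
  set Φ : ℝ → ℝ := fun t => |t| ^ (-(1 + 2 * s)) * min 1 (|t| ^ (2 : ℝ)) with hΦ
  have hΦi : Integrable Φ := integrable_scaled_profile hs
  have hΦ0 : ∀ t, 0 ≤ Φ t := fun t => by positivity
  set K := ∫ t, Φ t with hK
  have hK0 : 0 ≤ K := integral_nonneg hΦ0
  refine ⟨π ^ (1 + 2 * s) * K + 1, by positivity, fun n hn => ?_⟩
  have hn' : (0 : ℝ) < n := by exact_mod_cast hn
  have hsq : 0 < √(n : ℝ) := Real.sqrt_pos.2 hn'
  have hi1 : Integrable (fun θ => crossSection s θ * min 1 ((n : ℝ) * θ ^ 2)) angles := by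
    refine ((integrable_crossSection_sq hs).const_mul n).mono' ((measurable_crossSection s).mul (by fun_prop)).aestronglyMeasurable
      (.of_forall fun θ => ?_)
    have h0 : 0 ≤ min 1 ((n : ℝ) * θ ^ 2) := le_min zero_le_one (by positivity)
    rw [norm_of_nonneg (mul_nonneg (crossSection_nonneg _ _) h0)]
    calc _ ≤ crossSection s θ * ((n : ℝ) * θ ^ 2) :=
          mul_le_mul_of_nonneg_left (min_le_right _ _) (crossSection_nonneg _ _)
      _ = _ := by ring
  refine ⟨hi1, ?_⟩
  have hi2 : Integrable (fun θ => Φ (√(n : ℝ) * θ)) := hΦi.comp_mul_left' hsq.ne'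
  have hpt : ∀ᵐ θ ∂angles, crossSection s θ * min 1 ((n : ℝ) * θ ^ 2) ≤ (π ^ (1 + 2 * s) * (√(n : ℝ)) ^ (1 + 2 * s)) * Φ (√(n : ℝ) * θ) := by
    filter_upwards [ae_angle] with θ hθ
    rcases eq_or_ne θ 0 with rfl | h0
    · simp
      exact mul_nonneg (by positivity) (hΦ0 _)
    · have hp : 0 < |θ| := abs_pos.2 h0
      have hβ := crossSection_le hs.1 hθ h0
      have e1 : |√(n : ℝ) * θ| ^ (2 : ℝ) = n * θ ^ 2 := by rw [Real.rpow_two, sq_abs, mul_pow, sq_sqrt hn'.le]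
      have e2 : |√(n : ℝ) * θ| ^ (-(1 + 2 * s)) = (√(n : ℝ) ^ (1 + 2 * s))⁻¹ * |θ| ^ (-(1 + 2 * s)) := by
        rw [abs_mul, abs_of_pos hsq, mul_rpow hsq.le hp.le, rpow_neg hsq.le]
      simp only [hΦ]; rw [e1, e2]
      have h0 : 0 ≤ min 1 ((n : ℝ) * θ ^ 2) := le_min zero_le_one (by positivity)
      have hne := (rpow_pos_of_pos hsq (1 + 2 * s)).ne'
      refine (mul_le_mul_of_nonneg_right hβ h0).trans (le_of_eq ?_)
      field_simp
  have h1 := integral_mono_ae hi1 ((hi2.const_mul _).mono_measure Measure.restrict_le_self) hpt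
  refine h1.trans ?_
  rw [integral_const_mul]
  have h2 : ∫ θ, Φ (√(n : ℝ) * θ) ∂angles ≤ (√(n : ℝ))⁻¹ * K := by
    refine (setIntegral_le_integral hi2 (.of_forall fun t => hΦ0 _)).trans (le_of_eq ?_)
    rw [Measure.integral_comp_mul_left, abs_of_pos (inv_pos.2 hsq), smul_eq_mul]
  have h3 : (√(n : ℝ)) ^ (1 + 2 * s) * (√(n : ℝ))⁻¹ = (n : ℝ) ^ s := by
    rw [← Real.rpow_neg_one, ← rpow_add hsq, Real.sqrt_eq_rpow, ← Real.rpow_mul hn'.le]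
    congr 1; ring
  calc _ ≤ (π ^ (1 + 2 * s) * (√(n : ℝ)) ^ (1 + 2 * s)) * ((√(n : ℝ))⁻¹ * K) := by gcongr
    _ = π ^ (1 + 2 * s) * K * ((√(n : ℝ)) ^ (1 + 2 * s) * (√(n : ℝ))⁻¹) := by ring
    _ = π ^ (1 + 2 * s) * K * (n : ℝ) ^ s := by rw [h3]
    _ ≤ _ := by gcongr; linarith

lemma half_le_add_one_rpow (hs : s ∈ Ioo 0 1) (k : ℕ) : ((k : ℝ) + 1) ^ s ≤ 2 * ((k : ℝ) + 1 / 2) ^ s := by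
  have hk : (0 : ℝ) ≤ k := k.cast_nonneg
  calc ((k : ℝ) + 1) ^ s ≤ (2 * ((k : ℝ) + 1 / 2)) ^ s :=
        rpow_le_rpow (by positivity) (by linarith) hs.1.le
    _ = 2 ^ s * ((k : ℝ) + 1 / 2) ^ s := mul_rpow (by norm_num) (by positivity)
    _ ≤ _ := by
        gcongr
        calc (2 : ℝ) ^ s ≤ 2 ^ (1 : ℝ) := Real.rpow_le_rpow_of_exponent_le (by norm_num) hs.2.le
          _ = 2 := by simp

lemma integrable_profile (hs : s ∈ Ioo 0 1) (i j : ℕ) : Integrable (fun θ => crossSection s θ * profile i j θ) angles := by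
  set k := i + j with hk
  set c : ℝ := √(6 * ((k : ℝ) + 1) ^ (-s) * ((j : ℝ) + 1 / 2) ^ s) * ((k : ℝ) + 1) with hc
  refine ((integrable_crossSection_sq hs).const_mul c).mono' ((measurable_crossSection s).mul (continuous_profile i j).measurable).aestronglyMeasurable ?_
  filter_upwards [ae_angle] with θ hθ
  have h1 := profile_sum_le hs k hθ
  have hmem : (i, j) ∈ antidiagonal k := by simp [hk]
  have h2 := (Finset.single_le_sum (f := fun p : ℕ × ℕ => ((p.2 : ℝ) + 1 / 2) ^ (-s) *
    profile p.1 p.2 θ ^ 2) (fun p _ => by positivity) hmem).trans h1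
  have hj : (0 : ℝ) < ((j : ℝ) + 1 / 2) := by positivity
  have hjs := rpow_pos_of_pos hj s
  have h3 : profile i j θ ^ 2 ≤ (c * θ ^ 2) ^ 2 := by
    have h4 : (min 1 (((k : ℝ) + 1) * θ ^ 2)) ^ 2 ≤ (((k : ℝ) + 1) * θ ^ 2) ^ 2 :=
      pow_le_pow_left₀ (le_min zero_le_one (by positivity)) (min_le_right _ _) 2
    simp only at h2
    rw [rpow_neg hj.le, inv_mul_le_iff₀ hjs] at h2
    refine h2.trans ?_
    rw [hc]
    have h5 : (√(6 * ((k : ℝ) + 1) ^ (-s) * ((j : ℝ) + 1 / 2) ^ s)) ^ 2 = 6 * ((k : ℝ) + 1) ^ (-s) * ((j : ℝ) + 1 / 2) ^ s := sq_sqrt (by positivity)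
    calc _ ≤ ((j : ℝ) + 1 / 2) ^ s * (6 * ((k : ℝ) + 1) ^ (-s) * (((k : ℝ) + 1) * θ ^ 2) ^ 2) := by
          gcongr
      _ = (6 * ((k : ℝ) + 1) ^ (-s) * ((j : ℝ) + 1 / 2) ^ s) * (((k : ℝ) + 1) * θ ^ 2) ^ 2 := by ring
      _ = _ := by linear_combination (-((((k:ℝ)+1)*θ^2)^2)) * h5
  have h6 : |profile i j θ| ≤ c * θ ^ 2 := abs_le_of_sq_le_sq h3 (by positivity)
  rw [norm_mul, norm_of_nonneg (crossSection_nonneg _ _), norm_eq_abs]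
  calc _ ≤ crossSection s θ * (c * θ ^ 2) := mul_le_mul_of_nonneg_left h6 (crossSection_nonneg _ _)
    _ = _ := by ring

/-- The weighted square sum of the matrix elements along an antidiagonal. -/
lemma exists_collCoef_bound (hs : s ∈ Ioo 0 1) : ∃ C, 0 < C ∧ ∀ k : ℕ,
    ∑ p ∈ antidiagonal k, ((p.2 : ℝ) + 1 / 2) ^ (-s) * collCoef s p.1 p.2 ^ 2 ≤ C * ((k : ℝ) + 1 / 2) ^ s := by
  obtain ⟨C, hC, hCb⟩ := exists_angular_bound hs
  refine ⟨12 * C ^ 2, by positivity, fun k => ?_⟩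
  obtain ⟨hi, hb⟩ := hCb (k + 1) k.succ_pos
  push_cast at hi hb
  set S := ∑ p ∈ antidiagonal k, ((p.2 : ℝ) + 1 / 2) ^ (-s) * collCoef s p.1 p.2 ^ 2 with hS
  have hS0 : 0 ≤ S := Finset.sum_nonneg fun p _ => by positivity
  have hint : ∀ p : ℕ × ℕ, Integrable (fun θ => ((p.2 : ℝ) + 1 / 2) ^ (-s) * collCoef s p.1 p.2 * (crossSection s θ * profile p.1 p.2 θ)) angles := fun p =>
    (integrable_profile hs p.1 p.2).const_mul _
  have hSe : S = ∫ θ, ∑ p ∈ antidiagonal k, ((p.2 : ℝ) + 1 / 2) ^ (-s) * collCoef s p.1 p.2 * (crossSection s θ * profile p.1 p.2 θ) ∂angles := by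
    rw [integral_finsetSum _ fun p _ => hint p, hS]
    refine sum_congr rfl fun p _ => ?_
    rw [integral_const_mul, ← collCoef_eq]; ring
  set D := √S * √(6 * ((k : ℝ) + 1) ^ (-s)) with hD
  have hpt : ∀ᵐ θ ∂angles, ∑ p ∈ antidiagonal k, ((p.2 : ℝ) + 1 / 2) ^ (-s) * collCoef s p.1 p.2 * (crossSection s θ * profile p.1 p.2 θ)
      ≤ D * (crossSection s θ * min 1 (((k : ℝ) + 1) * θ ^ 2)) := by
    filter_upwards [ae_angle] with θ hθ
    have h1 := profile_sum_le hs k hθ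
    have hw : ∀ p : ℕ × ℕ, √(((p.2 : ℝ) + 1 / 2) ^ (-s)) * √(((p.2 : ℝ) + 1 / 2) ^ (-s))
      = ((p.2 : ℝ) + 1 / 2) ^ (-s) := fun p => mul_self_sqrt (by positivity)
    have h2 := Finset.sum_mul_sq_le_sq_mul_sq (antidiagonal k) (fun p : ℕ × ℕ => √(((p.2 : ℝ) + 1 / 2) ^ (-s)) * collCoef s p.1 p.2)
      (fun p => √(((p.2 : ℝ) + 1 / 2) ^ (-s)) * profile p.1 p.2 θ)
    have e1 : ∑ p ∈ antidiagonal k, (√(((p.2 : ℝ) + 1 / 2) ^ (-s)) * collCoef s p.1 p.2) ^ 2 = S := by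
      refine sum_congr rfl fun p _ => ?_
      linear_combination (collCoef s p.1 p.2 ^ 2) * hw p
    have e2 : ∑ p ∈ antidiagonal k, (√(((p.2 : ℝ) + 1 / 2) ^ (-s)) * profile p.1 p.2 θ) ^ 2
        = ∑ p ∈ antidiagonal k, ((p.2 : ℝ) + 1 / 2) ^ (-s) * profile p.1 p.2 θ ^ 2 := by
      refine sum_congr rfl fun p _ => ?_
      linear_combination (profile p.1 p.2 θ ^ 2) * hw p
    rw [e1, e2] at h2
    have hmin : 0 ≤ min 1 (((k : ℝ) + 1) * θ ^ 2) := le_min zero_le_one (by positivity)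
    have h3 : (∑ p ∈ antidiagonal k, (√(((p.2 : ℝ) + 1 / 2) ^ (-s)) * collCoef s p.1 p.2) * (√(((p.2 : ℝ) + 1 / 2) ^ (-s)) * profile p.1 p.2 θ)) ^ 2
        ≤ (D * min 1 (((k : ℝ) + 1) * θ ^ 2)) ^ 2 := by
      refine (h2.trans (mul_le_mul_of_nonneg_left h1 hS0)).trans (le_of_eq ?_)
      rw [hD, mul_pow, mul_pow, sq_sqrt hS0, sq_sqrt (by positivity)]; ring
    have h4 := abs_le_of_sq_le_sq h3 (by positivity)
    have e3 : ∑ p ∈ antidiagonal k, ((p.2 : ℝ) + 1 / 2) ^ (-s) * collCoef s p.1 p.2 * (crossSection s θ * profile p.1 p.2 θ)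
      = crossSection s θ * ∑ p ∈ antidiagonal k, (√(((p.2 : ℝ) + 1 / 2) ^ (-s)) * collCoef s p.1 p.2) *
        (√(((p.2 : ℝ) + 1 / 2) ^ (-s)) * profile p.1 p.2 θ) := by
      rw [mul_sum]
      refine sum_congr rfl fun p _ => ?_
      linear_combination (-(collCoef s p.1 p.2 * crossSection s θ * profile p.1 p.2 θ)) * hw p
    rw [e3]
    calc _ ≤ crossSection s θ * (D * min 1 (((k : ℝ) + 1) * θ ^ 2)) :=
          mul_le_mul_of_nonneg_left ((le_abs_self _).trans h4) (crossSection_nonneg _ _)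
      _ = _ := by ring
  have h5 : S ≤ D * (C * ((k : ℝ) + 1) ^ s) := by
    rw [hSe]
    refine (integral_mono_ae (integrable_finsetSum _ fun p _ => hint p) (hi.const_mul D) hpt).trans ?_
    rw [integral_const_mul]; gcongr
  have hk1 : (0 : ℝ) < (k : ℝ) + 1 := by positivity
  have h6 : √S ≤ √(6 * ((k : ℝ) + 1) ^ (-s)) * (C * ((k : ℝ) + 1) ^ s) := by
    rcases eq_or_lt_of_le (Real.sqrt_nonneg S) with h | h
    · rw [← h]; positivity
    · have : √S * √S ≤ √S * (√(6 * ((k : ℝ) + 1) ^ (-s)) * (C * ((k : ℝ) + 1) ^ s)) := by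
        rw [mul_self_sqrt hS0]
        refine h5.trans (le_of_eq ?_)
        rw [hD]; ring
      exact le_of_mul_le_mul_left this h
  have h7 : S ≤ 6 * C ^ 2 * ((k : ℝ) + 1) ^ s := by
    have := pow_le_pow_left₀ (Real.sqrt_nonneg S) h6 2
    rw [sq_sqrt hS0, mul_pow, sq_sqrt (by positivity)] at this
    refine this.trans (le_of_eq ?_)
    rw [rpow_neg hk1.le]
    have := (rpow_pos_of_pos hk1 s).ne'
    field_simp
  calc S ≤ 6 * C ^ 2 * ((k : ℝ) + 1) ^ s := h7
    _ ≤ 6 * C ^ 2 * (2 * ((k : ℝ) + 1 / 2) ^ s) := by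
        gcongr; exact half_le_add_one_rpow hs k
    _ = _ := by ring
/-! ## The spectrum of the linearized operator -/

/-- The eigenvalues of the linearized operator. -/
def rate (s : ℝ) (k : ℕ) : ℝ := -collCoef s 0 k - collCoef s k 0

lemma profile_self_zero {k : ℕ} (hk : k ≠ 0) (θ : ℝ) : profile k 0 θ = (sin θ ^ k + (-sin θ) ^ k) / 2 := by simp [profile, hk]

lemma abs_profile_self_zero_le {k : ℕ} (hk : k ≠ 0) (θ : ℝ) :
    |profile k 0 θ| ≤ |sin θ| ^ k := by
  rw [profile_self_zero hk, abs_div, abs_two, div_le_iff₀ two_pos]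
  refine (abs_add_le _ _).trans ?_
  rw [abs_pow, abs_pow, abs_neg]; linarith

lemma profile_self_zero_nonneg {k : ℕ} (hk : k ≠ 0) (θ : ℝ) : 0 ≤ profile k 0 θ := by
  rw [profile_self_zero hk]
  rcases Nat.even_or_odd k with h | h
  · rw [h.neg_pow]; have := h.pow_nonneg (sin θ); linarith
  · rw [h.neg_pow]; simp

lemma rate_eq (hs : s ∈ Ioo 0 1) (k : ℕ) : rate s k = ∫ θ, crossSection s θ * (-profile 0 k θ - profile k 0 θ) ∂angles := by
  rw [rate, collCoef_eq, collCoef_eq, ← integral_neg, ← integral_sub (f := fun θ => -(crossSection s θ * profile 0 k θ))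
      (integrable_profile hs 0 k).neg (integrable_profile hs k 0)]
  exact integral_ext fun θ => by ring

lemma integrable_relax_profile (hs : s ∈ Ioo 0 1) (k : ℕ) : Integrable (fun θ => crossSection s θ * (-profile 0 k θ - profile k 0 θ))
      angles :=
  ((integrable_profile hs 0 k).neg.sub (integrable_profile hs k 0)).congr (.of_forall fun θ => by simp only [Pi.sub_apply, Pi.neg_apply]; ring)

lemma relax_profile_nonneg (k : ℕ) {θ : ℝ} (hθ : |θ| ≤ π / 4) : 0 ≤ -profile 0 k θ - profile k 0 θ := by
  rw [profile_zero]
  rcases Nat.eq_zero_or_pos k with rfl | hk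
  · simp [profile]
  rcases Nat.lt_or_ge k 2 with h2 | h2
  · have : k = 1 := by omega
    subst this
    rw [profile_one]
    have := Real.cos_le_one θ
    linarith
  have h1 := (le_abs_self _).trans (abs_profile_self_zero_le hk.ne' θ)
  have h3 : |sin θ| ^ k ≤ |sin θ| ^ 2 :=
    pow_le_pow_of_le_one (abs_nonneg _) (Real.abs_sin_le_one _) h2
  have h4 : cos θ ^ k ≤ cos θ ^ 2 :=
    pow_le_pow_of_le_one (cos_angle_nonneg hθ) (Real.cos_le_one _) h2
  rw [sq_abs] at h3
  linarith [Real.sin_sq_add_cos_sq θ]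

lemma rate_nonneg (hs : s ∈ Ioo 0 1) (k : ℕ) : 0 ≤ rate s k := by
  rw [rate_eq hs]
  refine integral_nonneg_of_ae ?_
  filter_upwards [ae_angle] with θ hθ
  exact mul_nonneg (crossSection_nonneg _ _) (relax_profile_nonneg k hθ)

lemma exists_rate_le (hs : s ∈ Ioo 0 1) : ∃ C, 0 < C ∧ ∀ k : ℕ, rate s k ≤ C * ((k : ℝ) + 1 / 2) ^ s := by
  obtain ⟨C, hC, h⟩ := exists_collCoef_bound hs
  refine ⟨√C, Real.sqrt_pos.2 hC, fun k => ?_⟩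
  have hk : (0 : ℝ) < (k : ℝ) + 1 / 2 := by positivity
  have hks := rpow_pos_of_pos hk s
  rcases Nat.eq_zero_or_pos k with rfl | hk0
  · have : rate s 0 = 0 := by simp [rate_eq hs, profile]
    rw [this]; positivity
  have h0 : 0 ≤ collCoef s k 0 := by
    rw [collCoef_eq]
    exact integral_nonneg fun θ => mul_nonneg (crossSection_nonneg _ _) (profile_self_zero_nonneg hk0.ne' θ)
  have h1 := (Finset.single_le_sum (f := fun p : ℕ × ℕ => ((p.2 : ℝ) + 1 / 2) ^ (-s) *
    collCoef s p.1 p.2 ^ 2) (fun p _ => by positivity)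
    (show (0, k) ∈ antidiagonal k by simp)).trans (h k)
  simp only at h1
  rw [rpow_neg hk.le, inv_mul_le_iff₀ hks] at h1
  have h2 : collCoef s 0 k ^ 2 ≤ (√C * ((k : ℝ) + 1 / 2) ^ s) ^ 2 := by
    rw [mul_pow, sq_sqrt hC.le]; linarith
  have h3 := abs_le_of_sq_le_sq h2 (by positivity)
  have := neg_abs_le (collCoef s 0 k)
  unfold rate
  linarith

lemma cos_pow_le {k : ℕ} {θ : ℝ} (hθ : |θ| ≤ π / 4) (hk : 1 ≤ k * θ ^ 2) : cos θ ^ k ≤ 5 / 6 := by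
  have hpi := pi_pos
  have h1 := Real.cos_le_one_sub_mul_cos_sq (x := θ) (by linarith)
  have h2 : θ ^ 2 / 5 ≤ 2 / π ^ 2 * θ ^ 2 := by
    rw [div_mul_eq_mul_div, div_le_div_iff₀ (by norm_num) (by positivity)]
    have : π ^ 2 ≤ 10 := by nlinarith [Real.pi_lt_d2, pi_pos]
    nlinarith [sq_nonneg θ]
  have h3 := cos_angle_nonneg hθ
  have h4 := one_add_mul_le_pow (a := θ ^ 2 / 5) (by nlinarith [sq_nonneg θ]) k
  have h5 : cos θ * (1 + θ ^ 2 / 5) ≤ 1 := by nlinarith [sq_nonneg (θ ^ 2)]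
  have h6 : cos θ ^ k * (1 + θ ^ 2 / 5) ^ k ≤ 1 := by
    rw [← mul_pow]; exact pow_le_one₀ (by positivity) h5
  have h7 : 0 ≤ cos θ ^ k := by positivity
  nlinarith

lemma rate_large (hs : s ∈ Ioo 0 1) {k : ℕ} (hk : 100 ≤ k) : (k : ℝ) ^ s ≤ 160 * rate s k := by
  have hk' : (100 : ℝ) ≤ k := by exact_mod_cast hk
  have hk0 : (0 : ℝ) < k := by linarith
  set r := √(k : ℝ) with hr
  have hrr : r ^ 2 = k := sq_sqrt hk0.le
  have hr10 : 10 ≤ r := by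
    rw [hr]; exact Real.le_sqrt_of_sq_le (by norm_num; linarith)
  have hr0 : 0 < r := by linarith
  have hsub : Ioc (1 / r) (2 / r) ⊆ Ioc (-(π / 4)) (π / 4) := by
    refine Ioc_subset_Ioc ?_ ?_
    · have : 0 < 1 / r := by positivity
      linarith [pi_pos]
    · rw [div_le_iff₀ hr0]; nlinarith [Real.pi_gt_three]
  have hlow : ∀ θ ∈ Ioc (1 / r) (2 / r), r ^ (1 + 2 * s) / 160 ≤ crossSection s θ * (-profile 0 k θ - profile k 0 θ) := by
    intro θ hθ
    have hm := hsub hθ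
    have hθ0 : 0 < θ := lt_trans (by positivity) hθ.1
    have habs : |θ| ≤ π / 4 := abs_le.2 ⟨hm.1.le, hm.2⟩
    have hθr : 1 ≤ θ * r := by
      have := hθ.1.le; rwa [div_le_iff₀ hr0] at this
    have hθr2 : θ * r ≤ 2 := by
      have := hθ.2; rwa [le_div_iff₀ hr0] at this
    have hkθ : 1 ≤ k * θ ^ 2 := by rw [← hrr]; nlinarith
    have hkθ2 : k * θ ^ 2 ≤ 4 := by rw [← hrr]; nlinarith
    have h1 := cos_pow_le habs hkθ
    have h2 : |profile k 0 θ| ≤ 1 / 25 := by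
      refine (abs_profile_self_zero_le (by omega) θ).trans ?_
      refine (pow_le_pow_of_le_one (abs_nonneg _) (Real.abs_sin_le_one _) (by omega : 2 ≤ k)).trans ?_
      rw [sq_abs]
      refine (sin_sq_le θ).trans ?_
      nlinarith
    have h3 : (1 : ℝ) / 10 ≤ -profile 0 k θ - profile k 0 θ := by
      rw [profile_zero]
      have := le_abs_self (profile k 0 θ)
      linarith
    have h4 : r ^ (1 + 2 * s) / 16 ≤ crossSection s θ := by
      unfold crossSection
      have hc : 1 / 2 ≤ |cos (θ / 2)| := by
        refine le_trans ?_ (le_abs_self _)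
        have := Real.one_sub_sq_div_two_le_cos (x := θ / 2)
        have h5 : θ ≤ 1 := by nlinarith
        nlinarith
      have hsn : |sin (θ / 2)| ≤ 1 / r := by
        refine Real.abs_sin_le_abs.trans ?_
        rw [abs_of_pos (by positivity), le_div_iff₀ hr0]; linarith
      have hsp : 0 < |sin (θ / 2)| := by
        refine lt_of_lt_of_le ?_ (abs_sin_half_ge habs)
        have := pi_pos
        positivity
      rw [le_div_iff₀ (rpow_pos_of_pos hsp _)]
      have h6 : |sin (θ / 2)| ^ (1 + 2 * s) ≤ (1 / r) ^ (1 + 2 * s) :=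
        rpow_le_rpow hsp.le hsn (by linarith [hs.1, hs.2])
      have h7 : r ^ (1 + 2 * s) * (1 / r) ^ (1 + 2 * s) = 1 := by
        rw [← mul_rpow hr0.le (by positivity)]; rw [mul_one_div_cancel hr0.ne', Real.one_rpow]
      have h8 : 0 < r ^ (1 + 2 * s) := rpow_pos_of_pos hr0 _
      nlinarith [mul_le_mul_of_nonneg_left h6 h8.le]
    have h8 : 0 < r ^ (1 + 2 * s) := rpow_pos_of_pos hr0 _
    calc r ^ (1 + 2 * s) / 160 = r ^ (1 + 2 * s) / 16 * (1 / 10) := by ring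
      _ ≤ _ := mul_le_mul h4 h3 (by norm_num) (crossSection_nonneg _ _)
  have hint := integrable_relax_profile hs k
  have h1 : ∫ θ in Ioc (1 / r) (2 / r), r ^ (1 + 2 * s) / 160 ≤ rate s k := by
    rw [rate_eq hs]
    unfold angles at hint ⊢
    refine (setIntegral_mono_on (by simp) (hint.mono_measure (Measure.restrict_mono hsub le_rfl))
      measurableSet_Ioc hlow).trans ?_
    refine setIntegral_mono_set hint ?_ (.of_forall hsub)
    have := ae_angle
    unfold angles at this
    filter_upwards [this] with θ hθ
    exact mul_nonneg (crossSection_nonneg _ _) (relax_profile_nonneg k hθ)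
  rw [setIntegral_const, Measure.real, Real.volume_Ioc, toReal_ofReal (by rw [← sub_div]; positivity), smul_eq_mul, ← sub_div] at h1
  have h2 : (2 - 1) / r * (r ^ (1 + 2 * s) / 160) = (k : ℝ) ^ s / 160 := by
    rw [rpow_add hr0, rpow_one, Real.rpow_mul hr0.le, Real.rpow_two, hrr]
    field_simp; ring
  rw [h2] at h1
  linarith

/-- Coercivity of the linearized operator. -/
lemma weight_le_rate (hs : s ∈ Ioo 0 1) (k : ℕ) : ((k : ℝ) + 1 / 2) ^ s ≤ 320 * (rate s k + 1) := by
  have hk : (0 : ℝ) ≤ k := k.cast_nonneg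
  have h0 := rate_nonneg hs k
  rcases lt_or_ge k 100 with h | h
  · have h' : (k : ℝ) ≤ 99 := by exact_mod_cast Nat.lt_succ_iff.1 h
    rcases le_total ((k : ℝ) + 1 / 2) 1 with h1 | h1
    · have := Real.rpow_le_one (by positivity) h1 hs.1.le
      linarith
    · have := Real.rpow_le_rpow_of_exponent_le h1 hs.2.le
      rw [rpow_one] at this; linarith
  · have h1 := rate_large hs h
    have h' : (100 : ℝ) ≤ k := by exact_mod_cast h
    have h2 : ((k : ℝ) + 1 / 2) ^ s ≤ 2 * (k : ℝ) ^ s := by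
      calc ((k : ℝ) + 1 / 2) ^ s ≤ (2 * k) ^ s := rpow_le_rpow (by positivity) (by linarith) hs.1.le
        _ = 2 ^ s * (k : ℝ) ^ s := mul_rpow (by norm_num) hk
        _ ≤ _ := by
          gcongr
          calc (2 : ℝ) ^ s ≤ 2 ^ (1 : ℝ) := Real.rpow_le_rpow_of_exponent_le (by norm_num) hs.2.le
            _ = 2 := by simp
    linarith

lemma coef_hermiteFun (j k : ℕ) : coef j (fun v => (hermiteFun k v : ℂ)) = if j = k then 1 else 0 := by
  have h := orthonormal_iff_ite.1 orthonormal_hermite j k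
  rwa [inner_hermite_toL2 j (memLp_hermiteFun k)] at h

lemma hasSum_linearPairing (hs : s ∈ Ioo 0 1) (hg : MemLp g 2 volume) (hh : IsBump h) :
    HasSum (fun k => (rate s k : ℂ) * (coef k g * coef k h)) (linearPairing s g h) := by
  have h1 := (hasSum_gammaPairing hs (memLp_hermiteFun 0) hg hh).1
  have h2 := hasSum_gammaPairing hs hg (memLp_hermiteFun 0) hh
  rw [linearPairing_eq]
  have e1 : ∀ j, coef j g * ∑' i, coef i (fun v => (hermiteFun 0 v : ℂ)) * ((collCoef s i j : ℂ) * coef (i + j) h)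
      = coef j g * ((collCoef s 0 j : ℂ) * coef j h) := fun j => by
    rw [tsum_eq_single 0 fun i hi => by rw [coef_hermiteFun, if_neg hi, zero_mul]]
    rw [coef_hermiteFun, if_pos rfl, one_mul, zero_add]
  have e2 : gammaPairing s g (fun v => (hermiteFun 0 v : ℂ)) h = ∑' i, coef i g * ((collCoef s i 0 : ℂ) * coef i h) := by
    rw [← h2.1.tsum_eq, tsum_eq_single 0 fun i hi => by rw [coef_hermiteFun, if_neg hi, zero_mul]]
    rw [coef_hermiteFun, if_pos rfl, one_mul]; rfl
  have h3 := (h2.2 0).hasSum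
  simp only [add_zero] at h3
  rw [← e2] at h3
  refine (h1.neg.sub h3).congr_fun fun k => ?_
  rw [e1, rate]; push_cast; ring

/-! ## The bilinear estimate on sequences -/

/-- The weight `(k + 1/2)^σ`. -/
def weight (σ : ℝ) (k : ℕ) : ℝ≥0∞ := ofReal (((k : ℝ) + 1 / 2) ^ σ)

lemma weight_ne_top (σ : ℝ) (k : ℕ) : weight σ k ≠ ⊤ := ofReal_ne_top

lemma weight_ne_zero (σ : ℝ) (k : ℕ) : weight σ k ≠ 0 := by
  rw [weight, Ne, ENNReal.ofReal_eq_zero, not_le]; positivity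

lemma weight_add (σ τ : ℝ) (k : ℕ) : weight (σ + τ) k = weight σ k * weight τ k := by
  rw [weight, weight, weight, ← ofReal_mul (by positivity), rpow_add (by positivity)]

@[simp] lemma weight_zero (k : ℕ) : weight 0 k = 1 := by simp [weight]

lemma weight_neg_mul (σ : ℝ) (k : ℕ) : weight (-σ) k * weight σ k = 1 := by
  rw [← weight_add]; simp

lemma sum_mul_sq_le {ι : Type*} (t : Finset ι) (f g : ι → ℝ≥0∞) : (∑ i ∈ t, f i * g i) ^ 2 ≤ (∑ i ∈ t, f i ^ 2) * ∑ i ∈ t, g i ^ 2 := by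
  have h := ENNReal.inner_le_Lp_mul_Lq t f g (Real.HolderConjugate.two_two)
  have h2 := pow_le_pow_left₀ (zero_le) h 2
  refine h2.trans (le_of_eq ?_)
  rw [mul_pow]
  simp only [← rpow_natCast, ← rpow_mul]
  norm_num

lemma exists_bilinear_bound (hs : s ∈ Ioo 0 1) : ∃ C : ℝ, 0 < C ∧ ∀ x y : ℕ → ℝ≥0∞, ∑' k, weight (-s) k *
      (∑ p ∈ antidiagonal k, ‖collCoef s p.1 p.2‖ₑ * (x p.1 * y p.2)) ^ 2
      ≤ ofReal C * ((∑' i, x i ^ 2) * ∑' j, weight s j * y j ^ 2) := by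
  obtain ⟨C, hC, h⟩ := exists_collCoef_bound hs
  refine ⟨C, hC, fun x y => ?_⟩
  have h1 : ∀ k, weight (-s) k * (∑ p ∈ antidiagonal k, ‖collCoef s p.1 p.2‖ₑ * (x p.1 * y p.2)) ^ 2 ≤ ofReal C * ∑ p ∈ antidiagonal k,
        x p.1 ^ 2 * (weight s p.2 * y p.2 ^ 2) := by
    intro k
    have hw : ∀ p : ℕ × ℕ, ‖collCoef s p.1 p.2‖ₑ * (x p.1 * y p.2) = (weight (-s / 2) p.2 * ‖collCoef s p.1 p.2‖ₑ) * (x p.1 * (weight (s / 2) p.2 * y p.2)) :=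
      fun p => by
        have : weight (-s / 2) p.2 * weight (s / 2) p.2 = 1 := by
          rw [← weight_add, ← weight_zero p.2]; ring_nf
        calc _ = (weight (-s / 2) p.2 * weight (s / 2) p.2) *
              (‖collCoef s p.1 p.2‖ₑ * (x p.1 * y p.2)) := by rw [this, one_mul]
          _ = _ := by ring
    have h2 := sum_mul_sq_le (antidiagonal k) (fun p : ℕ × ℕ => weight (-s / 2) p.2 * ‖collCoef s p.1 p.2‖ₑ) (fun p => x p.1 * (weight (s / 2) p.2 * y p.2))
    simp only [← hw] at h2
    have e1 : ∑ p ∈ antidiagonal k, (weight (-s / 2) p.2 * ‖collCoef s p.1 p.2‖ₑ) ^ 2 ≤ ofReal C * weight s k := by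
      rw [weight, ← ofReal_mul hC.le]
      refine le_trans (le_of_eq ?_) (ofReal_le_ofReal (h k))
      rw [ENNReal.ofReal_sum_of_nonneg fun p _ => by positivity]
      refine sum_congr rfl fun p _ => ?_
      rw [ofReal_mul (by positivity), mul_pow, sq, ← weight_add]; congr 1
      · rw [weight]; ring_nf
      · rw [← sq_abs, ofReal_pow (abs_nonneg _), ← norm_eq_abs, ofReal_norm]
    have e2 : ∑ p ∈ antidiagonal k, (x p.1 * (weight (s / 2) p.2 * y p.2)) ^ 2 = ∑ p ∈ antidiagonal k, x p.1 ^ 2 * (weight s p.2 * y p.2 ^ 2) := by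
      refine sum_congr rfl fun p _ => ?_
      rw [mul_pow, mul_pow, sq (weight _ _), ← weight_add]; ring_nf
    rw [e2] at h2
    calc _ ≤ weight (-s) k * ((ofReal C * weight s k) *
          ∑ p ∈ antidiagonal k, x p.1 ^ 2 * (weight s p.2 * y p.2 ^ 2)) := by
          gcongr; exact h2.trans (by gcongr)
      _ = (weight (-s) k * weight s k) * (ofReal C *
          ∑ p ∈ antidiagonal k, x p.1 ^ 2 * (weight s p.2 * y p.2 ^ 2)) := by ring
      _ = _ := by rw [weight_neg_mul, one_mul]
  refine (tsum_le_tsum h1).trans (le_of_eq ?_)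
  rw [ENNReal.tsum_mul_left, ← ENNReal.tsum_mul_right]
  congr 1
  simp_rw [← ENNReal.tsum_mul_left]
  rw [← ENNReal.tsum_prod (f := fun i j => x i ^ 2 * (weight s j * y j ^ 2)),
    ← Finset.HasAntidiagonal.sigmaAntidiagonalEquivProd.tsum_eq, ENNReal.tsum_sigma']
  refine tsum_congr fun k => ?_
  rw [tsum_fintype, Finset.univ_eq_attach, ← Finset.sum_attach]
  rfl
section

/-! ## Fourier multipliers on `L²(ℝ)` -/

/-- The Fourier transform of `L²(ℝ)`. -/
def ft : L2R ≃ₗᵢ[ℂ] L2R := Lp.fourierTransformₗᵢ ℝ ℂ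

/-- A bump function as a Schwartz function. -/
def IsBump.schwartz (hh : IsBump h) : SchwartzMap ℝ ℂ :=
  HasCompactSupport.toSchwartzMap hh.compact hh.smooth

lemma IsBump.schwartz_apply (hh : IsBump h) (x : ℝ) : hh.schwartz x = h x := rfl

lemma ft_symm_schwartz (ψ : SchwartzMap ℝ ℂ) : ft.symm (ψ.toLp 2) = (FourierTransform.fourierInv ψ : SchwartzMap ℝ ℂ).toLp 2 :=
  SchwartzMap.toLp_fourierInv_eq ψ

lemma ft_schwartz (ψ : SchwartzMap ℝ ℂ) : ft (ψ.toLp 2) = (FourierTransform.fourier ψ : SchwartzMap ℝ ℂ).toLp 2 :=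
  SchwartzMap.toLp_fourier_eq ψ

lemma memLp_schwartz (ψ : SchwartzMap ℝ ℂ) : MemLp (fun x => ψ x) 2 vol :=
  ψ.memLp 2 volume

lemma toLp_schwartz (ψ : SchwartzMap ℝ ℂ) : ψ.toLp 2 = toL2 ψ := by
  rw [toL2_of_memLp (ψ.memLp 2)]; rfl

lemma IsBump.exists_bound (hm : IsBump m) : ∃ C, 0 ≤ C ∧ ∀ ξ, ‖m ξ‖ ≤ C := by
  obtain ⟨C, hC⟩ := hm.smooth.continuous.bounded_above_of_compact_support hm.compact
  exact ⟨C, (norm_nonneg _).trans (hC 0), hC⟩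

lemma IsBump.scale (hm : IsBump m) {c : ℝ} (hc : c ≠ 0) : IsBump (fun ζ => m (c * ζ)) :=
  ⟨hm.smooth.comp (contDiff_const.mul contDiff_id), hm.compact.comp_homeomorph (Homeomorph.mulLeft₀ c hc)⟩

lemma IsBump.shift (hm : IsBump m) (c : ℝ) : IsBump (fun ζ => m (ζ + c)) :=
  ⟨hm.smooth.comp (contDiff_id.add contDiff_const), hm.compact.comp_homeomorph (Homeomorph.addRight c)⟩

lemma IsBump.conj (hm : IsBump m) : IsBump (fun ζ => conj (m ζ)) :=
  ⟨Complex.conjCLE.contDiff.comp hm.smooth, hm.compact.comp_left (map_zero _)⟩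

/-- The symbol in the frequency normalisation of Mathlib's Fourier transform. -/
def scaled (m : ℝ → ℂ) (ζ : ℝ) : ℂ := m (2 * π * ζ)

lemma IsBump.scaled (hm : IsBump m) : IsBump (scaled m) :=
  hm.scale (c := 2 * π) (by positivity)

lemma memLp_bdd_mul (hm : Continuous m) {C : ℝ} (hC : ∀ ξ, ‖m ξ‖ ≤ C) (hf : MemLp f 2 volume) : MemLp (fun ξ => m ξ * f ξ) 2 volume :=
  hf.of_le_mul (c := C) (hm.aestronglyMeasurable.mul hf.1) (.of_forall fun ξ => by
    rw [norm_mul]; exact mul_le_mul_of_nonneg_right (hC ξ) (norm_nonneg _))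

lemma IsBump.memLp_mul (hm : IsBump m) (hf : MemLp f 2 volume) : MemLp (fun ξ => m ξ * f ξ) 2 volume := by
  obtain ⟨C, -, hC⟩ := hm.exists_bound
  exact memLp_bdd_mul hm.smooth.continuous hC hf

lemma norm_toL2_bdd_mul_le (hm : Continuous m) {C : ℝ} (hC : ∀ ξ, ‖m ξ‖ ≤ C) (a : L2R) : ‖toL2 (fun ξ => m ξ * a ξ)‖ ≤ C * ‖a‖ := by
  refine Lp.norm_le_mul_norm_of_ae_le_mul ?_
  filter_upwards [coeFn_toL2 (memLp_bdd_mul hm hC (Lp.memLp a))] with x hx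
  rw [hx, norm_mul]
  exact mul_le_mul_of_nonneg_right (hC x) (norm_nonneg _)

/-- The linear map underlying `mult`. -/
def multLin (hm : IsBump m) : L2R →ₗ[ℂ] L2R where
  toFun a := ft.symm (toL2 fun ζ => scaled m ζ * ft a ζ)
  map_add' a b := by
    rw [← map_add, ← toL2_add (hm.scaled.memLp_mul (Lp.memLp _)) (hm.scaled.memLp_mul (Lp.memLp _))]; congr 1
    refine toL2_congr ?_
    rw [map_add]
    filter_upwards [Lp.coeFn_add (ft a) (ft b)] with x hx
    rw [hx, Pi.add_apply, mul_add]
  map_smul' c a := by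
    rw [RingHom.id_apply, ← map_smul, ← toL2_const_mul c (hm.scaled.memLp_mul (Lp.memLp _))]; congr 1
    refine toL2_congr ?_
    rw [map_smul]
    filter_upwards [Lp.coeFn_smul c (ft a)] with x hx
    rw [hx, Pi.smul_apply, smul_eq_mul]; ring

open Classical in
/-- The Fourier multiplier `m(D)` on `L²(ℝ)`, for a bump function `m`. -/
def mult (m : ℝ → ℂ) : L2R →L[ℂ] L2R :=
  if hm : IsBump m then (multLin hm).mkContinuousOfExistsBound (by
    obtain ⟨C, -, hC⟩ := hm.scaled.exists_bound
    exact ⟨C, fun a => by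
      change ‖ft.symm _‖ ≤ _
      rw [LinearIsometryEquiv.norm_map]
      exact (norm_toL2_bdd_mul_le hm.scaled.smooth.continuous hC _).trans
        (by rw [LinearIsometryEquiv.norm_map])⟩) else 0

lemma mult_apply (hm : IsBump m) (a : L2R) : mult m a = ft.symm (toL2 fun ζ => scaled m ζ * ft a ζ) := by
  simp [mult, hm]; rfl

lemma ft_mult (hm : IsBump m) (a : L2R) : ft (mult m a) = toL2 fun ζ => scaled m ζ * ft a ζ := by
  rw [mult_apply hm, LinearIsometryEquiv.apply_symm_apply]

lemma ft_mult_ae (hm : IsBump m) (a : L2R) : ft (mult m a) =ᵐ[volume] fun ζ => scaled m ζ * ft a ζ := by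
  rw [ft_mult hm]; exact coeFn_toL2 (hm.scaled.memLp_mul (Lp.memLp _))

lemma norm_mult_le (hm : IsBump m) {C : ℝ} (hC : ∀ ξ, ‖m ξ‖ ≤ C) (a : L2R) : ‖mult m a‖ ≤ C * ‖a‖ := by
  rw [mult_apply hm, LinearIsometryEquiv.norm_map, ← ft.norm_map a]
  exact norm_toL2_bdd_mul_le hm.scaled.smooth.continuous (fun ξ => hC _) _

lemma inner_mult_mult {n m' n' : ℝ → ℂ} (hm : IsBump m) (hn : IsBump n) (hm' : IsBump m')
    (hn' : IsBump n') (h : ∀ ξ, conj (m ξ) * n ξ = conj (m' ξ) * n' ξ) (a b : L2R) :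
    ⟪mult m a, mult n b⟫_ℂ = ⟪mult m' a, mult n' b⟫_ℂ := by
  rw [← ft.inner_map_map, ← ft.inner_map_map (mult m' a), ft_mult hm, ft_mult hn, ft_mult hm',
    ft_mult hn', inner_toL2 (hm.scaled.memLp_mul (Lp.memLp _)) (hn.scaled.memLp_mul (Lp.memLp _)),
    inner_toL2 (hm'.scaled.memLp_mul (Lp.memLp _)) (hn'.scaled.memLp_mul (Lp.memLp _))]
  refine integral_ext fun ζ => ?_
  have := h (2 * π * ζ)
  simp only [map_mul, Kac.scaled]
  linear_combination (conj (ft a ζ) * ft b ζ) * this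

lemma mult_eq_of_ft (hm : IsBump m) {a b : L2R} (h : (fun ζ => scaled m ζ * ft a ζ) =ᵐ[volume] ft b) : mult m a = b := by
  rw [mult_apply hm, toL2_congr h, toL2_coeFn, LinearIsometryEquiv.symm_apply_apply]

lemma IsBump.zero : IsBump (fun _ => 0) := ⟨contDiff_const, HasCompactSupport.zero⟩

lemma IsBump.sum {ι : Type*} (t : Finset ι) {m : ι → ℝ → ℂ} (hm : ∀ i, IsBump (m i)) : IsBump (fun ξ => ∑ i ∈ t, m i ξ) := by
  classical
  induction t using Finset.induction_on with
  | empty => simpa using IsBump.zero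
  | insert i t hi ih =>
    simp only [Finset.sum_insert hi]
    exact (hm i).add ih

lemma mult_zero_symbol (a : L2R) : mult (fun _ => 0) a = 0 := by
  refine mult_eq_of_ft IsBump.zero ?_
  rw [map_zero]
  filter_upwards [Lp.coeFn_zero ℂ 2 vol] with x hx
  rw [hx]; simp [Kac.scaled]

lemma mult_add_symbol {n : ℝ → ℂ} (hm : IsBump m) (hn : IsBump n) (a : L2R) : mult (fun ξ => m ξ + n ξ) a = mult m a + mult n a := by
  refine mult_eq_of_ft (hm.add hn) ?_
  rw [map_add]
  filter_upwards [ft_mult_ae hm a, ft_mult_ae hn a, Lp.coeFn_add (ft (mult m a)) (ft (mult n a))] with ζ h1 h2 h3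
  rw [h3, Pi.add_apply, h1, h2]; simp only [Kac.scaled]; ring

lemma mult_sum_symbol {ι : Type*} (t : Finset ι) {m : ι → ℝ → ℂ} (hm : ∀ i, IsBump (m i)) (a : L2R) :
    mult (fun ξ => ∑ i ∈ t, m i ξ) a = ∑ i ∈ t, mult (m i) a := by
  classical
  induction t using Finset.induction_on with
  | empty => simpa using mult_zero_symbol a
  | insert i t hi ih =>
    simp only [Finset.sum_insert hi]; rw [mult_add_symbol (hm i) (IsBump.sum t hm), ih]

/-! ## The convolution form of the multipliers -/

/-- The convolution kernel of `m(D)` for a complex valued symbol. -/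
def kernel (m : ℝ → ℂ) (x : ℝ) : ℂ :=
  (2 * π : ℂ)⁻¹ * ∫ ξ : ℝ, exp (I * x * ξ) * m ξ

lemma kernel_eq (m : ℝ → ℂ) (x : ℝ) : kernel m x = ∫ ζ : ℝ, exp (2 * π * I * x * ζ) * scaled m ζ := by
  have h := Measure.integral_comp_mul_left (fun ξ : ℝ => exp (I * x * ξ) * m ξ) (2 * π)
  rw [abs_of_pos (by positivity)] at h
  have e : kernel m x = ((2 * π)⁻¹ : ℝ) • ∫ ξ : ℝ, exp (I * x * ξ) * m ξ := by
    rw [kernel, Complex.real_smul]; push_cast; ring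
  rw [e, ← h]
  refine integral_ext fun ζ => ?_
  simp only [scaled]
  congr 2
  push_cast; ring

lemma fourierInv_apply (ψ : SchwartzMap ℝ ℂ) (x : ℝ) : (FourierTransform.fourierInv ψ : SchwartzMap ℝ ℂ) x = ∫ ζ : ℝ, exp (2 * π * I * x * ζ) * ψ ζ := by
  rw [SchwartzMap.fourierInv_coe, Real.fourierInv_eq']
  refine integral_ext fun ζ => ?_
  simp only [smul_eq_mul, RCLike.inner_apply, conj_trivial]
  congr 2
  push_cast; ring

lemma IsBump.exp_mul (hm : IsBump m) (x : ℝ) : IsBump (fun ζ => exp (2 * π * I * x * ζ) * m ζ) :=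
  hm.mul_left (f := fun ζ : ℝ => exp (2 * π * I * x * ζ)) (Complex.contDiff_exp.comp (contDiff_const.mul Complex.ofRealCLM.contDiff))

/-- `m(D) a` as an absolutely convergent convolution. -/
def conv (m : ℝ → ℂ) (a : ℝ → ℂ) (x : ℝ) : ℂ := ∫ y : ℝ, kernel m (x - y) * a y

lemma fourierMultiplier_eq_conv (m : ℝ → ℝ) (u : ℝ → ℂ) : fourierMultiplier m u = conv (fun ξ => (m ξ : ℂ)) u := rfl

lemma conv_congr (m : ℝ → ℂ) {a b : ℝ → ℂ} (h : a =ᵐ[volume] b) : conv m a = conv m b := by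
  ext x
  exact integral_congr_ae (by filter_upwards [h] with y hy; rw [hy])

lemma kernel_eq_schwartz (hm : IsBump m) (x : ℝ) : kernel m x = (FourierTransform.fourierInv hm.scaled.schwartz : SchwartzMap ℝ ℂ) x := by
  rw [kernel_eq, fourierInv_apply]; rfl

lemma conj_kernel_sub (hm : IsBump m) (x y : ℝ) : conj (kernel m (x - y))
      = (FourierTransform.fourierInv (hm.scaled.exp_mul x).conj.schwartz : SchwartzMap ℝ ℂ) y := by
  rw [fourierInv_apply, kernel_eq, ← integral_conj]
  refine integral_ext fun ζ => ?_
  simp only [IsBump.schwartz_apply, map_mul, ← Complex.exp_conj, conj_ofReal, Complex.conj_I, map_ofNat]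
  rw [← mul_assoc, ← exp_add]
  congr 2
  push_cast; ring

lemma memLp_kernel_sub (hm : IsBump m) (x : ℝ) : MemLp (fun y => kernel m (x - y)) 2 volume := by
  refine (memLp_congr_ae (.of_forall fun y => ?_)).1 (memLp_conj (memLp_schwartz (FourierTransform.fourierInv (hm.scaled.exp_mul x).conj.schwartz)))
  rw [← conj_kernel_sub hm, conj_conj]

lemma conv_eq_inner (hm : IsBump m) (a : L2R) (x : ℝ) : conv m a x = ⟪(hm.scaled.exp_mul x).conj.schwartz.toLp 2, ft a⟫_ℂ := by
  have h1 := ft_symm_schwartz (hm.scaled.exp_mul x).conj.schwartz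
  have h2 := ft.inner_map_map (ft.symm ((hm.scaled.exp_mul x).conj.schwartz.toLp 2)) a
  rw [LinearIsometryEquiv.apply_symm_apply] at h2
  rw [h2, h1, toLp_schwartz, ← toL2_coeFn a, inner_toL2 (memLp_schwartz _) (Lp.memLp _), toL2_coeFn]
  refine integral_ext fun y => ?_
  rw [← conj_kernel_sub hm, conj_conj]

lemma conv_eq_integral (hm : IsBump m) (a : L2R) (x : ℝ) : conv m a x = ∫ ζ : ℝ, exp (2 * π * I * x * ζ) * (scaled m ζ * ft a ζ) := by
  rw [conv_eq_inner hm, toLp_schwartz, ← toL2_coeFn (ft a), inner_toL2 (memLp_schwartz _) (Lp.memLp _), toL2_coeFn]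
  refine integral_ext fun y => ?_
  simp only [IsBump.schwartz_apply, conj_conj]; ring

lemma conv_ae_eq_mult_schwartz (hm : IsBump m) (ψ : SchwartzMap ℝ ℂ) : conv m (ψ.toLp 2 : L2R) =ᵐ[volume] mult m (ψ.toLp 2) := by
  have hb : IsBump (fun ζ => scaled m ζ * (FourierTransform.fourier ψ : SchwartzMap ℝ ℂ) ζ) :=
    ⟨hm.scaled.smooth.mul (SchwartzMap.smooth _ ⊤), hm.scaled.compact.mul_right⟩
  have hae : (fun ζ => scaled m ζ * ft (ψ.toLp 2) ζ) =ᵐ[volume] hb.schwartz := by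
    rw [ft_schwartz]
    filter_upwards [SchwartzMap.coeFn_toLp (FourierTransform.fourier ψ : SchwartzMap ℝ ℂ) 2 vol] with ζ hζ
    rw [hζ]; rfl
  rw [mult_apply hm, toL2_congr hae, ← toLp_schwartz, ft_symm_schwartz]
  refine EventuallyEq.trans ?_ (SchwartzMap.coeFn_toLp _ 2 vol).symm
  refine .of_forall fun x => ?_
  rw [conv_eq_integral hm, fourierInv_apply]
  refine integral_congr_ae ?_
  filter_upwards [hae] with ζ hζ
  rw [hζ]

lemma conv_ae_eq_mult (hm : IsBump m) (a : L2R) : conv m a =ᵐ[volume] mult m a := by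
  have hd := (SchwartzMap.denseRange_toLpCLM (E := ℝ) (F := ℂ) (p := 2) (μ := vol) ENNReal.ofNat_ne_top) a
  obtain ⟨b, hb, hlim⟩ := mem_closure_iff_seq_limit.1 hd
  choose ψ hψ using hb
  have h1 : Tendsto (fun n => mult m (b n)) atTop (nhds (mult m a)) :=
    ((mult m).continuous.tendsto a).comp hlim
  obtain ⟨ns, hns, h2⟩ := (tendstoInMeasure_of_tendsto_Lp h1).exists_seq_tendsto_ae
  have h3 : ∀ᵐ x, ∀ n, conv m (b n) x = mult m (b n) x := by
    rw [ae_all_iff]; intro n; rw [← hψ n]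
    exact conv_ae_eq_mult_schwartz hm (ψ n)
  filter_upwards [h2, h3] with x hx hx3
  have h4 : Tendsto (fun n => conv m (b (ns n)) x) atTop (nhds (conv m a x)) := by
    simp only [conv_eq_inner hm]
    exact ((continuous_const.inner ft.continuous).tendsto a).comp (hlim.comp hns.tendsto_atTop)
  simp only [hx3] at h4
  exact tendsto_nhds_unique h4 hx

lemma memLp_conv (hm : IsBump m) (a : L2R) : MemLp (conv m a) 2 volume :=
  (memLp_congr_ae (conv_ae_eq_mult hm a)).2 (Lp.memLp _)

lemma toL2_conv (hm : IsBump m) {u : ℝ → ℂ} (hu : MemLp u 2 volume) : toL2 (conv m u) = mult m (toL2 u) := by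
  rw [← conv_congr m (coeFn_toL2 hu), toL2_congr (conv_ae_eq_mult hm _), toL2_coeFn]

/-- Bernstein's inequality. -/
lemma norm_conv_le (hm : IsBump m) {R : ℝ} (hR : 0 ≤ R) (hs : ∀ ξ, m ξ ≠ 0 → |ξ| ≤ R) (a : L2R) (x : ℝ) : ‖conv m a x‖ ≤ √R * ‖mult m a‖ := by
  set J : Set ℝ := Icc (-(R / (2 * π))) (R / (2 * π)) with hJ
  have hb := IsBump.scaled hm
  have hmem : MemLp (fun ζ => scaled m ζ * ft a ζ) 2 volume := hb.memLp_mul (Lp.memLp _)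
  have hz : ∀ ζ, ζ ∉ J → scaled m ζ = 0 := by
    intro ζ hζ
    by_contra h
    refine hζ ?_
    have := hs _ h
    rw [abs_mul, abs_of_pos (by positivity), ← le_div_iff₀' (by positivity)] at this; exact abs_le.1 this
  rw [conv_eq_integral hm, ← ft.norm_map (mult m a), ft_mult hm]
  have h1 : ‖∫ ζ : ℝ, exp (2 * π * I * x * ζ) * (scaled m ζ * ft a ζ)‖
      ≤ ∫ ζ, (J.indicator (fun _ => (1 : ℝ)) ζ) * ‖scaled m ζ * ft a ζ‖ := by
    refine (norm_integral_le_integral_norm _).trans (le_of_eq ?_)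
    refine integral_ext fun ζ => ?_
    have e : (2 * π * I * x * ζ : ℂ) = ((2 * π * x * ζ : ℝ) : ℂ) * I := by
      push_cast; ring
    rw [norm_mul, e, Complex.norm_exp_ofReal_mul_I, one_mul]
    by_cases h : ζ ∈ J
    · rw [indicator_of_mem h, one_mul]
    · rw [hz ζ h]; simp
  have hind : MemLp (J.indicator (fun _ => (1 : ℝ))) 2 volume :=
    memLp_indicator_const 2 measurableSet_Icc 1 (Or.inr (by simp))
  have h2 := integral_mul_le_Lp_mul_Lq_of_nonneg (μ := vol) Real.HolderConjugate.two_two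
    (f := J.indicator (fun _ => (1 : ℝ))) (g := fun ζ => ‖scaled m ζ * ft a ζ‖)
    (.of_forall fun ζ => indicator_nonneg (fun _ _ => zero_le_one) ζ)
    (.of_forall fun ζ => norm_nonneg _) (by simpa using hind) (by simpa using hmem.norm)
  refine h1.trans (h2.trans ?_)
  have e1 : ∫ ζ, (J.indicator (fun _ => (1 : ℝ)) ζ) ^ (2 : ℝ) = R / π := by
    have : ∀ ζ, (J.indicator (fun _ => (1 : ℝ)) ζ) ^ (2 : ℝ) = J.indicator (fun _ => (1 : ℝ)) ζ := fun ζ => by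
      by_cases h : ζ ∈ J <;> simp [h]
    simp only [this]
    rw [integral_indicator measurableSet_Icc, setIntegral_const, smul_eq_mul, mul_one, Measure.real, Real.volume_Icc, toReal_ofReal (by
        have : 0 ≤ R / (2 * π) := by positivity
        linarith)]
    field_simp; ring
  have e2 : ∫ ζ, ‖scaled m ζ * ft a ζ‖ ^ (2 : ℝ) = ‖toL2 fun ζ => scaled m ζ * ft a ζ‖ ^ 2 := by
    rw [norm_toL2_sq hmem]; simp
  rw [e1, e2, ← Real.sqrt_eq_rpow, ← Real.sqrt_eq_rpow, sqrt_sq (norm_nonneg _)]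
  gcongr
  exact div_le_self hR (by linarith [Real.pi_gt_three])

end

/-! ## Frequency localization of products and weak derivatives -/

lemma norm_exp_two_pi (x y : ℝ) : ‖exp (2 * π * I * x * y)‖ = 1 := by
  have e : (2 * π * I * x * y : ℂ) = ((2 * π * x * y : ℝ) : ℂ) * I := by
    push_cast; ring
  rw [e, Complex.norm_exp_ofReal_mul_I]

lemma IsBump.integrable_mul (hm : IsBump m) (a : L2R) : Integrable (fun ζ => m ζ * a ζ) volume :=
  (hm.memLp 2).integrable_mul (Lp.memLp a)

lemma kernel_shift (m : ℝ → ℂ) (z η : ℝ) : kernel (fun ξ => m (ξ + 2 * π * η)) z = kernel m z * exp (-(2 * π * I * z * η)) := by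
  rw [kernel_eq, kernel_eq, ← integral_mul_const, ← integral_add_right_eq_self (fun ζ : ℝ => exp (2 * π * I * z * ζ) * scaled m ζ *
      exp (-(2 * π * I * z * η))) η]
  refine integral_ext fun ζ => ?_
  simp only [scaled]
  have e1 : 2 * π * ζ + 2 * π * η = 2 * π * (ζ + η) := by ring
  rw [e1, mul_right_comm (exp _) (m _), ← exp_add]
  congr 2
  push_cast; ring

lemma memLp_mult_mul (hm : IsBump m) (a : L2R) (hf : MemLp f 2 volume) : MemLp (fun x => mult m a x * f x) 2 volume := by
  obtain ⟨R, hR⟩ := hm.compact.isCompact.isBounded.subset_closedBall 0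
  have hs : ∀ ξ, m ξ ≠ 0 → |ξ| ≤ max R 0 := fun ξ h => by
    have := hR (subset_tsupport _ h)
    rw [mem_closedBall_zero_iff, norm_eq_abs] at this; exact this.trans (le_max_left _ _)
  refine hf.of_le_mul (c := √(max R 0) * ‖mult m a‖) ((Lp.aestronglyMeasurable _).mul hf.1) ?_
  filter_upwards [conv_ae_eq_mult hm a] with x hx
  rw [norm_mul, ← hx]
  exact mul_le_mul_of_nonneg_right (norm_conv_le hm (le_max_right _ _) hs a x) (norm_nonneg _)

/-- The frequencies of a product are sums of the frequencies of its factors. -/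
lemma mult_mul_eq_zero {n n' : ℝ → ℂ} (hm : IsBump m) (hn : IsBump n) (hn' : IsBump n') {R : ℝ}
    (h1 : ∀ ξ, n ξ ≠ 0 → |ξ| ≤ R) (h2 : ∀ ξ, n' ξ ≠ 0 → |ξ| ≤ R) (h3 : ∀ ξ, m ξ ≠ 0 → 2 * R < |ξ|)
    (a b : L2R) : mult m (toL2 fun x => mult n a x * mult n' b x) = 0 := by
  have hA := memLp_conv hn a
  have hmem : MemLp (fun x => mult n a x * mult n' b x) 2 volume :=
    memLp_mult_mul hn a (Lp.memLp _)
  rw [← toL2_conv hm hmem]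
  have hae : (fun x => mult n a x * mult n' b x) =ᵐ[volume] fun x => conv n a x * conv n' b x := by
    filter_upwards [conv_ae_eq_mult hn a, conv_ae_eq_mult hn' b] with x h h'
    rw [h, h']
  rw [conv_congr m hae]
  have hc : Integrable (fun η => scaled n' η * ft b η) volume := hn'.scaled.integrable_mul _
  have key : ∀ x, conv m (fun x => conv n a x * conv n' b x) x = 0 := by
    intro x
    have hKA : Integrable (fun y => kernel m (x - y) * conv n a y) volume :=
      (memLp_kernel_sub hm x).integrable_mul hA
    have hint : Integrable (fun p : ℝ × ℝ => (kernel m (x - p.1) * conv n a p.1) * (exp (2 * π * I * p.1 * p.2) * (scaled n' p.2 * ft b p.2))) vol₂ := by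
      refine (hKA.mul_prod hc).mono ?_ (.of_forall fun p => le_of_eq ?_)
      · refine (hKA.1.comp_fst).mul (AEStronglyMeasurable.mul ?_ hc.1.comp_snd)
        exact (by fun_prop : Continuous fun p : ℝ × ℝ =>
          exp (2 * π * I * p.1 * p.2)).aestronglyMeasurable
      · simp only [norm_mul, norm_exp_two_pi, one_mul]
    have e1 : conv m (fun x => conv n a x * conv n' b x) x = ∫ y : ℝ, ∫ η : ℝ, (kernel m (x - y) * conv n a y) *
          (exp (2 * π * I * y * η) * (scaled n' η * ft b η)) := by
      refine integral_ext fun y => ?_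
      rw [integral_const_mul, ← conv_eq_integral hn', mul_assoc]
    rw [e1, integral_integral_swap hint]
    refine integral_eq_zero_of_ae (.of_forall fun η => ?_)
    simp only [Pi.zero_apply]
    by_cases hη : n' (2 * π * η) = 0
    · simp [scaled, hη]
    have hη' := h2 _ hη
    have hms : IsBump (fun ξ => m (ξ + 2 * π * η)) := hm.shift _
    have e2 : ∀ y : ℝ, (kernel m (x - y) * conv n a y) * (exp (2 * π * I * y * η) * (scaled n' η * ft b η))
        = (exp (2 * π * I * x * η) * (scaled n' η * ft b η)) * (kernel (fun ξ => m (ξ + 2 * π * η)) (x - y) * conv n a y) := fun y => by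
      rw [kernel_shift]
      have : exp (2 * π * I * y * η) = exp (2 * π * I * x * η) * exp (-(2 * π * I * ((x - y : ℝ) : ℂ) * η)) := by
        rw [← exp_add]; congr 1; push_cast; ring
      rw [this]; ring
    simp only [e2]; rw [integral_const_mul]
    have e3 : ∫ y, kernel (fun ξ => m (ξ + 2 * π * η)) (x - y) * conv n a y = conv (fun ξ => m (ξ + 2 * π * η)) (mult n a) x := by
      rw [← conv_congr _ (conv_ae_eq_mult hn a)]; rfl
    rw [e3, conv_eq_integral hms, integral_eq_zero_of_ae, mul_zero]
    filter_upwards [ft_mult_ae hn a] with ζ hζ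
    rw [hζ, Pi.zero_apply]
    by_cases hz : n (2 * π * ζ) = 0
    · simp [scaled, hz]
    have hz' := h1 _ hz
    have : m (2 * π * ζ + 2 * π * η) = 0 := by
      by_contra hne
      have h4 := h3 _ hne
      have h5 := abs_add_le (2 * π * ζ) (2 * π * η)
      linarith
    simp [scaled, this]
  have : conv m (fun x => conv n a x * conv n' b x) = fun _ => 0 := funext key
  rw [this, toL2_of_memLp (MemLp.zero' (ε := ℂ))]
  exact MemLp.toLp_zero _

/-- The symbol `iξ m(ξ)` of the derivative of `m(D)`. -/
def dsymbol (m : ℝ → ℂ) (ξ : ℝ) : ℂ := I * ξ * m ξ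

lemma IsBump.dsymbol (hm : IsBump m) : IsBump (dsymbol m) :=
  hm.mul_left (f := fun ξ : ℝ => I * ξ) (contDiff_const.mul Complex.ofRealCLM.contDiff)

lemma hasDerivAt_kernel (hm : IsBump m) (x : ℝ) : HasDerivAt (kernel m) (kernel (dsymbol m) x) x := by
  have hint : ∀ {n : ℝ → ℂ}, IsBump n → ∀ y : ℝ, Integrable (fun ξ : ℝ => exp (I * y * ξ) * n ξ) volume := fun hn y => by
    have h := hn.mul_left (f := fun ξ : ℝ => exp (I * y * ξ)) (Complex.contDiff_exp.comp (contDiff_const.mul Complex.ofRealCLM.contDiff))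
    exact memLp_one_iff_integrable.1 (h.memLp 1)
  have h := hasDerivAt_integral_of_dominated_loc_of_deriv_le (μ := volume) (s := univ) (F := fun y ξ => exp (I * (y : ℝ) * (ξ : ℝ)) * m ξ)
    (F' := fun y ξ => exp (I * (y : ℝ) * (ξ : ℝ)) * dsymbol m ξ)
    (bound := fun ξ => ‖dsymbol m ξ‖) (x₀ := x) univ_mem
    (.of_forall fun y => (hint hm y).1) (hint hm x) (hint hm.dsymbol x).1
    (.of_forall fun ξ y _ => by
      have e : (I * y * ξ : ℂ) = ((y * ξ : ℝ) : ℂ) * I := by push_cast; ring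
      rw [norm_mul, e, Complex.norm_exp_ofReal_mul_I, one_mul])
    (memLp_one_iff_integrable.1 (hm.dsymbol.memLp 1)).norm
    (.of_forall fun ξ y _ => by
      have h1 : HasDerivAt (fun y : ℝ => I * (y : ℂ) * (ξ : ℂ)) (I * ξ) y := by
        have := ((hasDerivAt_id y).ofReal_comp.const_mul I).mul_const (ξ : ℂ)
        refine this.congr_deriv ?_
        simp
      refine (h1.cexp.mul_const (m ξ)).congr_deriv ?_
      simp only [dsymbol]; ring)
  exact h.2.const_mul _

/-- If `α = -β'` weakly, then `m(D) α = -(iξ m)(D) β`. -/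
lemma mult_eq_neg_of_weak_deriv (hm : IsBump m) {α β : L2R} (h : ∀ b : ℝ → ℂ, IsBump b → ∫ x, b x * α x = ∫ x, deriv b x * β x) :
    mult m α = - mult (dsymbol m) β := by
  have key : ∀ x, conv m α x = - conv (dsymbol m) β x := by
    intro x
    set K : ℝ → ℂ := fun y => kernel m (x - y) with hK
    set K' : ℝ → ℂ := fun y => - kernel (dsymbol m) (x - y) with hK'
    have hKd : ∀ y, HasDerivAt K (K' y) y := fun y => by
      have := (hasDerivAt_kernel hm (x - y)).scomp y ((hasDerivAt_id y).const_sub x)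
      refine this.congr_deriv ?_
      simp [hK']
    have hKs : ContDiff ℝ ∞ K := by
      have e : kernel m = (FourierTransform.fourierInv hm.scaled.schwartz : SchwartzMap ℝ ℂ) :=
        funext (kernel_eq_schwartz hm)
      rw [hK, e]
      exact (SchwartzMap.smooth _ ⊤).comp (contDiff_const.sub contDiff_id)
    have hKα : Integrable (fun y => K y * α y) volume :=
      (memLp_kernel_sub hm x).integrable_mul (Lp.memLp α)
    have hKβ : Integrable (fun y => K y * β y) volume :=
      (memLp_kernel_sub hm x).integrable_mul (Lp.memLp β)
    have hKβ' : Integrable (fun y => K' y * β y) volume :=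
      (memLp_kernel_sub hm.dsymbol x).neg.integrable_mul (Lp.memLp β)
    have hcs : ∀ n, ContDiff ℝ ∞ (fun y => (cutoff n y : ℂ)) := fun n =>
      Complex.ofRealCLM.contDiff.comp (contDiff_cutoff n)
    have hb : ∀ n, IsBump (fun y => (cutoff n y : ℂ) * K y) := fun n =>
      ⟨(hcs n).mul hKs, ((hasCompactSupport_cutoff n).comp_left (g := fun x : ℝ => (x : ℂ))
        (by simp)).mul_right⟩
    have hbd : ∀ n y, deriv (fun y => (cutoff n y : ℂ) * K y) y = ((deriv bump (y / (n + 1)) / (n + 1) : ℝ) : ℂ) * K y + (cutoff n y : ℂ) * K' y := fun n y =>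
      ((hasDerivAt_cutoff n y).ofReal_comp.mul (hKd y)).deriv
    obtain ⟨C, hC0, hC, -⟩ := exists_bound_deriv_bump
    have hcn : ∀ n y, ‖(cutoff n y : ℂ)‖ ≤ 1 := fun n y => by
      rw [norm_real, norm_of_nonneg (cutoff_mem n y).1]; exact (cutoff_mem n y).2
    have hlim : ∀ y, Tendsto (fun n => (cutoff n y : ℂ)) atTop (nhds 1) := fun y => by
      have := (Complex.continuous_ofReal.tendsto 1).comp (tendsto_cutoff y)
      simpa [Function.comp_def] using this
    have t1 : Tendsto (fun n => ∫ y, (cutoff n y : ℂ) * K y * α y) atTop (nhds (∫ y, K y * α y)) := by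
      refine tendsto_integral_of_dominated_convergence (fun y => ‖K y * α y‖)
        (fun n => (((hb n).smooth.continuous.aestronglyMeasurable).mul (Lp.aestronglyMeasurable _)))
        hKα.norm (fun n => .of_forall fun y => ?_)
        (.of_forall fun y => ?_)
      · rw [mul_assoc, norm_mul]
        exact mul_le_of_le_one_left (norm_nonneg _) (hcn n y)
      · simpa using ((hlim y).mul_const (K y)).mul_const (α y)
    have t2 : Tendsto (fun n => ∫ y, deriv (fun y => (cutoff n y : ℂ) * K y) y * β y) atTop (nhds (∫ y, K' y * β y)) := by
      refine tendsto_integral_of_dominated_convergence (fun y => C * ‖K y * β y‖ + ‖K' y * β y‖)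
        (fun n => ((hb n).deriv.smooth.continuous.aestronglyMeasurable).mul (Lp.aestronglyMeasurable _))
        ((hKβ.norm.const_mul C).add hKβ'.norm) (fun n => .of_forall fun y => ?_)
        (.of_forall fun y => ?_)
      · rw [hbd, add_mul, mul_assoc, mul_assoc]
        refine (norm_add_le _ _).trans (add_le_add ?_ ?_)
        · rw [norm_mul]
          refine mul_le_mul_of_nonneg_right ?_ (norm_nonneg _)
          rw [norm_real, norm_eq_abs, abs_div]
          refine (div_le_self (abs_nonneg _) ?_).trans (hC _)
          rw [abs_of_pos (by positivity)]; linarith [(n.cast_nonneg : (0 : ℝ) ≤ n)]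
        · rw [norm_mul]
          exact mul_le_of_le_one_left (norm_nonneg _) (hcn n y)
      · simp only [hbd]
        have h0 : Tendsto (fun n : ℕ => ((deriv bump (y / (n + 1)) / (n + 1) : ℝ) : ℂ)) atTop (nhds 0) := by
          rw [← Complex.ofReal_zero]
          refine (Complex.continuous_ofReal.tendsto 0).comp ?_
          refine squeeze_zero_norm (a := fun n : ℕ => C * (1 / ((n : ℝ) + 1))) (fun n => ?_) ?_
          · rw [norm_eq_abs, abs_div, abs_of_pos (by positivity : (0 : ℝ) < (n : ℝ) + 1),
              div_eq_mul_one_div]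
            exact mul_le_mul_of_nonneg_right (hC _) (by positivity)
          · simpa using tendsto_one_div_add_atTop_nhds_zero_nat.const_mul C
        simpa using ((h0.mul_const (K y)).add ((hlim y).mul_const (K' y))).mul_const (β y)
    have := tendsto_nhds_unique t1 (t2.congr fun n => (h _ (hb n)).symm)
    calc conv m α x = ∫ y, K' y * β y := this
      _ = - conv (dsymbol m) β x := by
        rw [conv, ← integral_neg]
        exact integral_ext fun y => by simp [hK']
  rw [← toL2_coeFn (mult m α), ← toL2_coeFn (- mult (dsymbol m) β)]
  refine toL2_congr ?_
  filter_upwards [conv_ae_eq_mult hm α, conv_ae_eq_mult hm.dsymbol β, Lp.coeFn_neg (mult (dsymbol m) β)] with x h1 h2 h3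
  rw [h3, Pi.neg_apply, ← h1, ← h2, key]

/-! ## The dyadic partition of unity -/

/-- The complex valued symbol of a dyadic block. -/
def dyadic (χ φ : ℝ → ℝ) (j : ℕ) (ξ : ℝ) : ℂ := (blockSymbol χ φ j ξ : ℂ)

lemma blockSymbol_mem (h : IsLP χ φ) (j : ℕ) (ξ : ℝ) : blockSymbol χ φ j ξ ∈ Icc (0 : ℝ) 1 := by
  cases j with
  | zero => exact h.range_low ξ
  | succ q => exact h.range_shell _

lemma abs_le_of_blockSymbol (h : IsLP χ φ) {j : ℕ} {ξ : ℝ} (hξ : blockSymbol χ φ j ξ ≠ 0) : |ξ| ≤ 4 / 3 * 2 ^ j := by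
  cases j with
  | zero => simpa using h.supp_low ξ hξ
  | succ q =>
    have := (h.supp_shell _ hξ).2
    rw [abs_div, abs_of_pos (by positivity : (0 : ℝ) < 2 ^ q), div_le_iff₀ (by positivity)] at this
    rw [pow_succ]; linarith

lemma le_abs_of_blockSymbol (h : IsLP χ φ) {j : ℕ} (hj : j ≠ 0) {ξ : ℝ} (hξ : blockSymbol χ φ j ξ ≠ 0) : 3 / 8 * 2 ^ j ≤ |ξ| := by
  cases j with
  | zero => exact absurd rfl hj
  | succ q =>
    have := (h.supp_shell _ hξ).1
    rw [abs_div, abs_of_pos (by positivity : (0 : ℝ) < 2 ^ q), le_div_iff₀ (by positivity)] at this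
    rw [pow_succ]; linarith

lemma blockSymbol_ne_zero {j : ℕ} {ξ : ℝ} (hξ : dyadic χ φ j ξ ≠ 0) : blockSymbol χ φ j ξ ≠ 0 :=
  fun h0 => hξ (by simp [dyadic, h0])

lemma isBump_dyadic (h : IsLP χ φ) (j : ℕ) : IsBump (dyadic χ φ j) := by
  refine ⟨Complex.ofRealCLM.contDiff.comp ?_, HasCompactSupport.of_support_subset_isCompact
    (isCompact_Icc (a := -(4 / 3 * 2 ^ j)) (b := 4 / 3 * 2 ^ j)) fun ξ hξ => ?_⟩
  · cases j with
    | zero => exact h.smooth_low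
    | succ q => exact h.smooth_shell.comp (contDiff_id.div_const _)
  · exact abs_le.1 (abs_le_of_blockSymbol h (blockSymbol_ne_zero hξ))

lemma hasSum_blockSymbol (h : IsLP χ φ) (ξ : ℝ) : HasSum (fun j => blockSymbol χ φ j ξ) 1 := by
  have hf : (Function.support fun j => blockSymbol χ φ j ξ).Finite := by
    obtain ⟨N, hN⟩ := pow_unbounded_of_one_lt (8 / 3 * |ξ|) (one_lt_two (α := ℝ))
    refine (Set.finite_lt_nat (N + 1)).subset fun j hj => ?_
    by_contra hlt
    have hjN : N + 1 ≤ j := not_lt.1 hlt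
    have h1 := le_abs_of_blockSymbol h (by omega) hj
    have h2 : (2 : ℝ) ^ N ≤ 2 ^ j := pow_le_pow_right₀ one_le_two (by omega)
    linarith
  have hs : Summable fun j => blockSymbol χ φ j ξ := summable_of_hasFiniteSupport hf
  have := hs.hasSum
  rw [hs.tsum_eq_zero_add] at this
  have e := h.partition ξ
  simp only [blockSymbol] at this
  rw [e] at this
  exact this

/-- The dyadic block on `L²(ℝ)`. -/
def dblock (χ φ : ℝ → ℝ) (j : ℕ) : L2R →L[ℂ] L2R := mult (dyadic χ φ j)

lemma norm_dblock_le (h : IsLP χ φ) (j : ℕ) (a : L2R) : ‖dblock χ φ j a‖ ≤ ‖a‖ := by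
  have := norm_mult_le (isBump_dyadic h j) (C := 1) (fun ξ => by
    rw [dyadic, norm_real, norm_of_nonneg (blockSymbol_mem h j ξ).1]
    exact (blockSymbol_mem h j ξ).2) a
  rwa [one_mul] at this

lemma toL2_block (h : IsLP χ φ) (j : ℕ) {u : ℝ → ℂ} (hu : MemLp u 2 volume) : toL2 (block χ φ j u) = dblock χ φ j (toL2 u) :=
  toL2_conv (isBump_dyadic h j) hu

lemma memLp_block (h : IsLP χ φ) (j : ℕ) {u : ℝ → ℂ} (hu : MemLp u 2 volume) : MemLp (block χ φ j u) 2 volume := by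
  have := memLp_conv (isBump_dyadic h j) (toL2 u)
  rwa [conv_congr _ (coeFn_toL2 hu)] at this

/-- The low frequency cut-off `∑_{j < n} Δ_j`. -/
def lowPass (χ φ : ℝ → ℝ) (n : ℕ) : L2R →L[ℂ] L2R :=
  mult fun ξ => ∑ j ∈ Finset.range n, dyadic χ φ j ξ

lemma isBump_lowPass (h : IsLP χ φ) (n : ℕ) : IsBump fun ξ => ∑ j ∈ Finset.range n, dyadic χ φ j ξ := IsBump.sum _ (isBump_dyadic h)

lemma lowPass_eq (h : IsLP χ φ) (n : ℕ) (a : L2R) : lowPass χ φ n a = ∑ j ∈ Finset.range n, dblock χ φ j a :=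
  mult_sum_symbol _ (isBump_dyadic h) a

lemma lowPass_symbol_mem (h : IsLP χ φ) (n : ℕ) (ξ : ℝ) : ∑ j ∈ Finset.range n, blockSymbol χ φ j ξ ∈ Icc (0 : ℝ) 1 :=
  ⟨Finset.sum_nonneg fun j _ => (blockSymbol_mem h j ξ).1,
    sum_le_hasSum _ (fun j _ => (blockSymbol_mem h j ξ).1) (hasSum_blockSymbol h ξ)⟩

lemma tendsto_lowPass (h : IsLP χ φ) (a : L2R) : Tendsto (fun n => lowPass χ φ n a) atTop (nhds a) := by
  rw [tendsto_iff_norm_sub_tendsto_zero]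
  set c : ℕ → ℝ → ℂ := fun n ζ => scaled (fun ξ => ∑ j ∈ Finset.range n, dyadic χ φ j ξ) ζ with hc
  have hcc : ∀ n ζ, c n ζ = ((∑ j ∈ Finset.range n, blockSymbol χ φ j (2 * π * ζ) : ℝ) : ℂ) :=
    fun n ζ => by simp [hc, scaled, dyadic]
  have hmem : ∀ n, MemLp (fun ζ => c n ζ * ft a ζ) 2 volume := fun n =>
    (isBump_lowPass h n).scaled.memLp_mul (Lp.memLp _)
  have e : ∀ n, ‖lowPass χ φ n a - a‖ ^ 2 = ∫ ζ, ‖c n ζ * ft a ζ - ft a ζ‖ ^ 2 := fun n => by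
    have h1 : ‖lowPass χ φ n a - a‖ = ‖toL2 fun ζ => c n ζ * ft a ζ - ft a ζ‖ := by
      rw [← ft.norm_map, map_sub, lowPass, ft_mult (isBump_lowPass h n), toL2_sub (hmem n) (Lp.memLp _), toL2_coeFn]
    rw [h1, norm_toL2_sq (f := fun ζ => c n ζ * ft a ζ - ft a ζ) ((hmem n).sub (Lp.memLp _))]
  have hlim : Tendsto (fun n => ‖lowPass χ φ n a - a‖ ^ 2) atTop (nhds 0) := by
    simp only [e]; rw [← integral_zero ℝ ℝ (μ := volume)]
    refine tendsto_integral_of_dominated_convergence (fun ζ => ‖ft a ζ‖ ^ 2) (fun n => (((hmem n).1.sub (Lp.aestronglyMeasurable _)).norm.pow 2))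
      ((memLp_two_iff_integrable_sq_norm (Lp.aestronglyMeasurable _)).1 (Lp.memLp _))
      (fun n => .of_forall fun ζ => ?_) (.of_forall fun ζ => ?_)
    · rw [norm_of_nonneg (by positivity)]
      refine pow_le_pow_left₀ (norm_nonneg _) ?_ 2
      have hm := lowPass_symbol_mem h n (2 * π * ζ)
      have : c n ζ * ft a ζ - ft a ζ = ((∑ j ∈ Finset.range n, blockSymbol χ φ j (2 * π * ζ) - 1 : ℝ) : ℂ) * ft a ζ := by
        rw [hcc]; push_cast; ring
      rw [this, norm_mul, norm_real, norm_eq_abs]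
      refine mul_le_of_le_one_left (norm_nonneg _) ?_
      rw [abs_le]; constructor <;> linarith [hm.1, hm.2]
    · have h1 : Tendsto (fun n => c n ζ) atTop (nhds 1) := by
        simp only [hcc]
        have := (Complex.continuous_ofReal.tendsto 1).comp (hasSum_blockSymbol h (2 * π * ζ)).tendsto_sum_nat
        simpa [Function.comp_def] using this
      have h2 := ((h1.mul_const (ft a ζ)).sub_const (ft a ζ)).norm.pow 2
      simpa using h2
  have := hlim.sqrt
  simpa [sqrt_sq (norm_nonneg _)] using this

/-- Bernstein's inequality for the dyadic blocks. -/
lemma ae_norm_dblock_le (h : IsLP χ φ) (j : ℕ) (a : L2R) : ∀ᵐ x, ‖dblock χ φ j a x‖ ≤ √(4 / 3 * 2 ^ j) * ‖dblock χ φ j a‖ := by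
  filter_upwards [conv_ae_eq_mult (isBump_dyadic h j) a] with x hx
  rw [dblock, ← hx]
  refine norm_conv_le (isBump_dyadic h j) (by positivity) (fun ξ hξ => ?_) a x
  exact abs_le_of_blockSymbol h (blockSymbol_ne_zero hξ)

/-- A high frequency block of a product of low frequency functions vanishes. -/
lemma dblock_lowPass_mul (h : IsLP χ φ) (j : ℕ) (a b : L2R) : dblock χ φ j (toL2 fun x => lowPass χ φ (j - 2) a x * lowPass χ φ (j - 2) b x) = 0 := by
  rcases Nat.lt_or_ge j 3 with hj | hj
  · have : j - 2 = 0 := by omega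
    rw [this]
    have hz : ∀ a, lowPass χ φ 0 a = 0 := fun a => by rw [lowPass_eq h]; simp
    rw [hz, hz, toL2_congr (g := fun x => (0 : L2R) x), toL2_coeFn, map_zero]
    filter_upwards [Lp.coeFn_zero ℂ 2 vol] with x hx
    rw [hx]; simp
  have hs : ∀ ξ, ∑ l ∈ Finset.range (j - 2), dyadic χ φ l ξ ≠ 0 → |ξ| ≤ 4 / 3 * 2 ^ (j - 3) := by
    intro ξ hξ
    obtain ⟨l, hl, hne⟩ := Finset.exists_ne_zero_of_sum_ne_zero hξ
    refine (abs_le_of_blockSymbol h (blockSymbol_ne_zero hne)).trans ?_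
    have : l ≤ j - 3 := by have := Finset.mem_range.1 hl; omega
    gcongr; norm_num
  refine mult_mul_eq_zero (isBump_dyadic h j) (isBump_lowPass h _) (isBump_lowPass h _) hs hs (fun ξ hξ => ?_) a b
  refine lt_of_lt_of_le ?_ (le_abs_of_blockSymbol h (by omega) (blockSymbol_ne_zero hξ))
  have : (2 : ℝ) ^ j = 2 ^ (j - 3) * 8 := by
    rw [← (by omega : j - 3 + 3 = j), pow_add]; norm_num
  rw [this]
  have : (0 : ℝ) < 2 ^ (j - 3) := by positivity
  linarith
section

/-! ## Norms -/

lemma eLpNorm_two_sq {α E : Type*} [MeasurableSpace α] [TopologicalSpace E] [ContinuousENorm E]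
    (f : α → E) (ν : Measure α) : eLpNorm f 2 ν ^ 2 = ∫⁻ a, ‖f a‖ₑ ^ 2 ∂ν := by
  rw [eLpNorm_eq_lintegral_rpow_enorm_toReal (by norm_num) (by norm_num)]
  simp only [toReal_ofNat, ENNReal.rpow_ofNat]
  rw [← rpow_natCast, ← rpow_mul]
  norm_num

lemma sq_le_sq_ennreal {a b : ℝ≥0∞} : a ^ 2 ≤ b ^ 2 ↔ a ≤ b :=
  ⟨fun h => by
    by_contra hc
    exact absurd h (not_le.2 (ENNReal.pow_lt_pow_left two_ne_zero (not_le.1 hc))),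
  fun h => pow_le_pow_left₀ zero_le h 2⟩

lemma sq_injective_ennreal {a b : ℝ≥0∞} (h : a ^ 2 = b ^ 2) : a = b :=
  le_antisymm (sq_le_sq_ennreal.1 h.le) (sq_le_sq_ennreal.1 h.ge)

/-- The weighted `ℓ²` norm with weights `(k + 1/2)^σ`. -/
def wnorm (σ : ℝ) (x : ℕ → ℝ≥0∞) : ℝ≥0∞ :=
  eLpNorm x 2 ((Measure.count : Measure ℕ).withDensity (weight σ))

lemma wnorm_sq (σ : ℝ) (x : ℕ → ℝ≥0∞) : wnorm σ x ^ 2 = ∑' k, weight σ k * x k ^ 2 := by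
  rw [wnorm, eLpNorm_two_sq, lintegral_withDensity_eq_lintegral_mul _ (by fun_prop) (by fun_prop),
    lintegral_count]
  rfl

lemma wnorm_mono {σ : ℝ} {x y : ℕ → ℝ≥0∞} (h : ∀ k, x k ≤ y k) : wnorm σ x ≤ wnorm σ y :=
  eLpNorm_mono_enorm h

lemma wnorm_add_le (σ : ℝ) (x y : ℕ → ℝ≥0∞) : wnorm σ (fun k => x k + y k) ≤ wnorm σ x + wnorm σ y :=
  eLpNorm_add_le (Measurable.of_discrete).aestronglyMeasurable (Measurable.of_discrete).aestronglyMeasurable (by norm_num)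

lemma wnorm_const_mul (σ : ℝ) (c : ℝ≥0∞) (x : ℕ → ℝ≥0∞) : wnorm σ (fun k => c * x k) = c * wnorm σ x := by
  refine sq_injective_ennreal ?_
  rw [mul_pow, wnorm_sq, wnorm_sq, ← ENNReal.tsum_mul_left]
  exact tsum_congr fun k => by ring

lemma measurable_wnorm {α : Type*} [MeasurableSpace α] {ν : Measure α} (σ : ℝ) {x : ℕ → α → ℝ≥0∞}
    (hx : ∀ k, AEMeasurable (x k) ν) : AEMeasurable (fun a => wnorm σ fun k => x k a) ν := by
  have h : ∀ a, wnorm σ (fun k => x k a) = (∑' k, weight σ k * x k a ^ 2) ^ (1 / 2 : ℝ) := fun a => by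
    rw [← wnorm_sq, ← rpow_natCast, ← rpow_mul]; norm_num
  simp only [h]
  refine AEMeasurable.pow_const (AEMeasurable.tsum fun k => ?_) _
  exact ((hx k).pow_const 2).const_mul _

lemma eLpNorm_tsum_le {α : Type*} [MeasurableSpace α] {ν : Measure α} {F : ℕ → α → ℝ≥0∞} (hF : ∀ l, AEMeasurable (F l) ν) {p : ℝ≥0∞} (hp : p = 2 ∨ p = ⊤) :
    eLpNorm (fun a => ∑' l, F l a) p ν ≤ ∑' l, eLpNorm (F l) p ν := by
  rcases hp with rfl | rfl
  · have hfin : ∀ n, eLpNorm (fun a => ∑ l ∈ Finset.range n, F l a) 2 ν ≤ ∑' l, eLpNorm (F l) 2 ν := by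
      intro n
      refine le_trans ?_ (sum_le_tsum (Finset.range n))
      have := eLpNorm_sum_le (s := Finset.range n) (f := F) (p := 2) (μ := ν)
        (fun l _ => (hF l).aestronglyMeasurable) (by norm_num)
      have e : (fun a => ∑ l ∈ Finset.range n, F l a) = ∑ l ∈ Finset.range n, F l := by
        ext a; simp
      rw [e]; exact this
    rw [← sq_le_sq_ennreal, eLpNorm_two_sq]
    have hlim := lintegral_tendsto_of_tendsto_of_monotone (μ := ν) (f := fun n a => (∑ l ∈ Finset.range n, F l a) ^ 2) (F := fun a => (∑' l, F l a) ^ 2)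
      (fun n => (Finset.aemeasurable_fun_sum _ fun l _ => hF l).pow_const 2)
      (.of_forall fun a m n hmn => by
        dsimp only
        gcongr)
      (.of_forall fun a =>
        (ENNReal.continuous_pow 2).tendsto _ |>.comp (ENNReal.tendsto_nat_tsum fun l => F l a))
    refine le_of_tendsto' hlim fun n => ?_
    have := pow_le_pow_left₀ (zero_le) (hfin n) 2
    rwa [eLpNorm_two_sq] at this
  · simp only [eLpNorm_exponent_top]
    refine essSup_le_of_ae_le _ ?_
    have h : ∀ᵐ a ∂ν, ∀ l, F l a ≤ eLpNormEssSup (F l) ν :=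
      ae_all_iff.2 fun l => ae_le_eLpNormEssSup (f := F l)
    filter_upwards [h] with a ha
    exact tsum_le_tsum ha

lemma wnorm_tsum_le (σ : ℝ) (F : ℕ → ℕ → ℝ≥0∞) : wnorm σ (fun k => ∑' l, F l k) ≤ ∑' l, wnorm σ (F l) :=
  eLpNorm_tsum_le (fun _ => (Measurable.of_discrete).aemeasurable) (Or.inl rfl)

lemma weight_le {σ τ : ℝ} (h : σ ≤ τ) (h2 : τ ≤ σ + 2) (k : ℕ) : weight σ k ≤ 4 * weight τ k := by
  have hk : (0 : ℝ) < (k : ℝ) + 1 / 2 := by positivity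
  have h4 : (4 : ℝ≥0∞) = ofReal 4 := by norm_num
  rw [weight, weight, h4, ← ofReal_mul (by norm_num)]
  refine ofReal_le_ofReal ?_
  have e : ((k : ℝ) + 1 / 2) ^ τ = ((k : ℝ) + 1 / 2) ^ σ * ((k : ℝ) + 1 / 2) ^ (τ - σ) := by
    rw [← rpow_add hk]; ring_nf
  have h3 : (1 / 4 : ℝ) ≤ ((k : ℝ) + 1 / 2) ^ (τ - σ) := by
    calc (1 / 4 : ℝ) = (1 / 2) ^ (2 : ℝ) := by norm_num
      _ ≤ (1 / 2) ^ (τ - σ) :=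
        Real.rpow_le_rpow_of_exponent_ge (by norm_num) (by norm_num) (by linarith)
      _ ≤ _ := rpow_le_rpow (by norm_num) (by linarith [(k.cast_nonneg : (0 : ℝ) ≤ k)]) (by linarith)
  rw [e]
  nlinarith [rpow_pos_of_pos hk σ]

lemma hoelder_wnorm (σ : ℝ) (x y : ℕ → ℝ≥0∞) : ∑' k, x k * y k ≤ wnorm (-σ) x * wnorm σ y := by
  have h : ∀ t : Finset ℕ, ∑ k ∈ t, x k * y k ≤ wnorm (-σ) x * wnorm σ y := fun t => by
    rw [← sq_le_sq_ennreal, mul_pow, wnorm_sq, wnorm_sq]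
    have h1 := sum_mul_sq_le t (fun k => weight (-σ / 2) k * x k) (fun k => weight (σ / 2) k * y k)
    have e : ∀ k, weight (-σ / 2) k * x k * (weight (σ / 2) k * y k) = x k * y k := fun k => by
      have : weight (-σ / 2) k * weight (σ / 2) k = 1 := by
        rw [← weight_add, ← weight_zero k]; ring_nf
      calc _ = (weight (-σ / 2) k * weight (σ / 2) k) * (x k * y k) := by ring
        _ = _ := by rw [this, one_mul]
    have e2 : ∀ (τ : ℝ) (z : ℕ → ℝ≥0∞) k, (weight (τ / 2) k * z k) ^ 2 = weight τ k * z k ^ 2 :=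
      fun τ z k => by rw [mul_pow, sq (weight _ _), ← weight_add]; ring_nf
    simp only [e, e2] at h1
    exact h1.trans (mul_le_mul' (sum_le_tsum t) (sum_le_tsum t))
  exact ENNReal.summable.tsum_le_of_sum_le h

/-! ## Parseval's identity with parameters -/

lemma tsum_enorm_coef_sq (hf : MemLp f 2 volume) : ∑' k, ‖coef k f‖ₑ ^ 2 = eLpNorm f 2 volume ^ 2 := by
  have h := hasSum_norm_coef_sq hf
  have h1 : ∀ k, ‖coef k f‖ₑ ^ 2 = ofReal (‖coef k f‖ ^ 2) := fun k => by rw [ofReal_pow (norm_nonneg _), ofReal_norm]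
  simp only [h1]
  rw [← ofReal_tsum_of_nonneg (fun k => by positivity) h.summable, h.tsum_eq, eLpNorm_two_sq,
    ofReal_integral_eq_lintegral_ofReal ((memLp_two_iff_integrable_sq_norm hf.1).1 hf) (.of_forall fun v => by positivity)]
  refine lintegral_congr fun v => ?_
  rw [ofReal_pow (norm_nonneg _), ofReal_norm]

section Parseval

variable {α β : Type*} [MeasurableSpace α] [MeasurableSpace β] {ν : Measure α} {ρ : Measure β}

lemma eLpNorm_prod_sq [SFinite ρ] {F : α → β → ℂ} (hF : AEStronglyMeasurable (fun p : α × β => F p.1 p.2) (ν.prod ρ)) :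
    eLpNorm (fun p : α × β => F p.1 p.2) 2 (ν.prod ρ) ^ 2 = ∫⁻ a, eLpNorm (F a) 2 ρ ^ 2 ∂ν := by
  rw [eLpNorm_two_sq, lintegral_prod _ (hF.enorm.pow_const 2)]
  exact lintegral_congr fun a => (eLpNorm_two_sq _ _).symm

lemma aemeasurable_eLpNorm_slice [SFinite ρ] {F : α → β → ℂ} (hF : AEStronglyMeasurable (fun p : α × β => F p.1 p.2) (ν.prod ρ)) :
    AEMeasurable (fun a => eLpNorm (F a) 2 ρ) ν := by
  have h : ∀ a, eLpNorm (F a) 2 ρ = (∫⁻ b, ‖F a b‖ₑ ^ 2 ∂ρ) ^ (1 / 2 : ℝ) := fun a => by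
    rw [← eLpNorm_two_sq, ← rpow_natCast, ← rpow_mul]; norm_num
  simp only [h]
  exact (hF.enorm.pow_const 2).lintegral_prod_right'.pow_const _

lemma ae_memLp_slice [SFinite ρ] {F : α → β → ℂ} (hF : MemLp (fun p : α × β => F p.1 p.2) 2 (ν.prod ρ)) : ∀ᵐ a ∂ν, MemLp (F a) 2 ρ := by
  have h := eLpNorm_prod_sq hF.1
  have hfin : ∫⁻ a, eLpNorm (F a) 2 ρ ^ 2 ∂ν ≠ ⊤ := by
    rw [← h]; exact pow_ne_top hF.2.ne
  filter_upwards [ae_lt_top' ((aemeasurable_eLpNorm_slice hF.1).pow_const 2) hfin, hF.1.prodMk_left] with a h1 h2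
  refine ⟨h2, ?_⟩
  by_contra hc
  rw [not_lt, top_le_iff] at hc
  rw [hc] at h1
  exact absurd h1 (by simp)

variable {F G : α → ℝ → ℂ}

lemma summable_integral_norm_mul {ι : Type*} {f g : ι → α → ℂ} (hf : ∀ i, MemLp (f i) 2 ν) (hg : ∀ i, MemLp (g i) 2 ν) (hfs : ∑' i, eLpNorm (f i) 2 ν ^ 2 ≠ ⊤)
    (hgs : ∑' i, eLpNorm (g i) 2 ν ^ 2 ≠ ⊤) : Summable fun i => ∫ a, ‖f i a * g i a‖ ∂ν := by
  have h1 : ∀ {f : ι → α → ℂ}, (∀ i, MemLp (f i) 2 ν) → ∑' i, eLpNorm (f i) 2 ν ^ 2 ≠ ⊤ → Summable fun i => ∫ a, ‖f i a‖ ^ 2 ∂ν := fun {f} hf hs => by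
    refine (summable_toReal hs).congr fun i => ?_
    rw [eLpNorm_two_sq, integral_eq_lintegral_of_nonneg_ae (f := fun a => ‖f i a‖ ^ 2) (.of_forall fun a => by positivity) ((hf i).1.norm.pow 2)]
    congr 1
    refine lintegral_congr fun a => ?_
    rw [ofReal_pow (norm_nonneg _), ofReal_norm]
  refine Summable.of_nonneg_of_le (fun i => integral_nonneg fun a => norm_nonneg _) (fun i => ?_) ((h1 hf hfs).add (h1 hg hgs))
  have i1 := (memLp_two_iff_integrable_sq_norm (hf i).1).1 (hf i)
  have i2 := (memLp_two_iff_integrable_sq_norm (hg i).1).1 (hg i)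
  rw [← integral_add i1 i2]
  refine integral_mono ((hf i).integrable_mul (hg i)).norm (i1.add i2) fun a => ?_
  simp only [norm_mul]
  nlinarith [sq_nonneg (‖f i a‖ - ‖g i a‖), norm_nonneg (f i a), norm_nonneg (g i a)]

lemma memLp_conj_prod (hF : MemLp (fun p : α × ℝ => F p.1 p.2) 2 (ν.prod volume)) :
    MemLp (fun p : α × ℝ => conj (F p.1 p.2)) 2 (ν.prod volume) := memLp_conj hF

variable [SFinite ν]

lemma memLp_coef (hF : MemLp (fun p : α × ℝ => F p.1 p.2) 2 (ν.prod volume)) (k : ℕ) : MemLp (fun a => coef k (F a)) 2 ν := by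
  refine (memLp_congr_ae (.of_forall fun a => ?_)).1 (memLp_integral_mul hF (memLp_hermiteFun k))
  exact integral_ext fun v => mul_comm _ _

lemma tsum_eLpNorm_coef_sq (hF : MemLp (fun p : α × ℝ => F p.1 p.2) 2 (ν.prod volume)) : ∑' k, eLpNorm (fun a => coef k (F a)) 2 ν ^ 2
      = eLpNorm (fun p : α × ℝ => F p.1 p.2) 2 (ν.prod volume) ^ 2 := by
  rw [eLpNorm_prod_sq hF.1]
  simp only [eLpNorm_two_sq (fun a => coef _ (F a))]
  rw [← lintegral_tsum fun k => ((memLp_coef hF k).1.enorm.pow_const 2)]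
  refine lintegral_congr_ae ?_
  filter_upwards [ae_memLp_slice hF] with a ha
  exact tsum_enorm_coef_sq ha

/-- Parseval's identity for functions of a parameter and the velocity. -/
lemma hasSum_integral_coef_mul (hF : MemLp (fun p : α × ℝ => F p.1 p.2) 2 (ν.prod volume)) (hG : MemLp (fun p : α × ℝ => G p.1 p.2) 2 (ν.prod volume)) :
    HasSum (fun k => ∫ a, coef k (F a) * coef k (G a) ∂ν) (∫ a, (∫ v, F a v * G a v) ∂ν) := by
  have hs := summable_integral_norm_mul (memLp_coef hF) (memLp_coef hG)
    (by rw [tsum_eLpNorm_coef_sq hF]; exact pow_ne_top hF.2.ne)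
    (by rw [tsum_eLpNorm_coef_sq hG]; exact pow_ne_top hG.2.ne)
  have h := hasSum_integral_of_summable_integral_norm (fun k => (memLp_coef hF k).integrable_mul (memLp_coef hG k)) hs
  have e : ∫ a, (∫ v, F a v * G a v) ∂ν = ∫ a, ∑' k, coef k (F a) * coef k (G a) ∂ν := by
    refine integral_congr_ae ?_
    filter_upwards [ae_memLp_slice hF, ae_memLp_slice hG] with a h1 h2
    exact (hasSum_coef_mul h1 h2).tsum_eq.symm
  rw [e]; exact h

lemma aestronglyMeasurable_toL2 (hF : MemLp (fun p : α × ℝ => F p.1 p.2) 2 (ν.prod volume)) : AEStronglyMeasurable (fun a => toL2 (F a)) ν := by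
  refine aestronglyMeasurable_of_tendsto_ae atTop (f := fun n a => ∑ k ∈ Finset.range n, coef k (F a) • hermiteBasis k) (fun n => ?_) ?_
  · exact Finset.aestronglyMeasurable_fun_sum _ fun k _ => (memLp_coef hF k).1.smul_const _
  · filter_upwards [ae_memLp_slice hF] with a ha
    have := (hermiteBasis.hasSum_repr (toL2 (F a))).tendsto_sum_nat
    simpa only [HilbertBasis.repr_apply_apply, inner_hermiteBasis _ ha] using this

lemma eLpNorm_toL2 (hF : MemLp (fun p : α × ℝ => F p.1 p.2) 2 (ν.prod volume)) :
    eLpNorm (fun a => toL2 (F a)) 2 ν = eLpNorm (fun p : α × ℝ => F p.1 p.2) 2 (ν.prod volume) := by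
  refine sq_injective_ennreal ?_
  rw [eLpNorm_prod_sq hF.1, eLpNorm_two_sq]
  refine lintegral_congr_ae ?_
  filter_upwards [ae_memLp_slice hF] with a ha
  rw [enorm_toL2 ha]

lemma memLp_toL2 (hF : MemLp (fun p : α × ℝ => F p.1 p.2) 2 (ν.prod volume)) : MemLp (fun a => toL2 (F a)) 2 ν :=
  ⟨aestronglyMeasurable_toL2 hF, by rw [eLpNorm_toL2 hF]; exact hF.2⟩

lemma integral_inner_toL2 (hF : MemLp (fun p : α × ℝ => F p.1 p.2) 2 (ν.prod volume)) (hG : MemLp (fun p : α × ℝ => G p.1 p.2) 2 (ν.prod volume)) :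
    ∫ a, ⟪toL2 (F a), toL2 (G a)⟫_ℂ ∂ν = ∫ p, conj (F p.1 p.2) * G p.1 p.2 ∂(ν.prod volume) := by
  rw [integral_prod (fun p : α × ℝ => conj (F p.1 p.2) * G p.1 p.2) ((memLp_conj_prod hF).integrable_mul hG)]
  refine integral_congr_ae ?_
  filter_upwards [ae_memLp_slice hF, ae_memLp_slice hG] with a h1 h2
  rw [inner_toL2 h1 h2]

end Parseval

end

section

/-! ## Hermite coefficients in velocity as functions of position -/

/-- The Hermite coefficients in `v` of a function on the phase space. -/
def seq (F : ℝ → ℝ → ℂ) (k : ℕ) : L2R := toL2 fun x => coef k (F x)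

/-- Square integrability on the phase space. -/
def SqInt (F : ℝ → ℝ → ℂ) : Prop :=
  MemLp (fun p : ℝ × ℝ => F p.1 p.2) 2 vol₂

lemma SqInt.swap (hF : SqInt F) : SqInt (fun v x => F x v) :=
  hF.comp_measurePreserving Measure.measurePreserving_swap

lemma aestronglyMeasurable_swap (hF : AEStronglyMeasurable (fun p : ℝ × ℝ => F p.1 p.2) vol₂) : AEStronglyMeasurable (fun p : ℝ × ℝ => F p.2 p.1) vol₂ :=
  AEStronglyMeasurable.prod_swap hF

lemma eLpNorm_swap (hF : AEStronglyMeasurable (fun p : ℝ × ℝ => F p.1 p.2) vol₂) : eLpNorm (fun p : ℝ × ℝ => F p.2 p.1) 2 vol₂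
      = eLpNorm (fun p : ℝ × ℝ => F p.1 p.2) 2 vol₂ :=
  eLpNorm_comp_measurePreserving (f := Prod.swap) (g := fun p : ℝ × ℝ => F p.1 p.2) (ν := vol₂) hF Measure.measurePreserving_swap

lemma normVX_two (hF : AEStronglyMeasurable (fun p : ℝ × ℝ => F p.1 p.2) vol₂) : normVX 2 2 F = eLpNorm (fun p : ℝ × ℝ => F p.1 p.2) 2 vol₂ := by
  refine sq_injective_ennreal ?_
  rw [normVX, eLpNorm_two_sq, ← eLpNorm_swap hF]
  exact (eLpNorm_prod_sq (F := fun v x => F x v) (aestronglyMeasurable_swap hF)).symm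

lemma enorm_seq (hF : SqInt F) (k : ℕ) : ‖seq F k‖ₑ = eLpNorm (fun x => coef k (F x)) 2 volume := enorm_toL2 (memLp_coef hF k)

lemma wnorm_seq (hF : SqInt F) : wnorm 0 (fun k => ‖seq F k‖ₑ) = eLpNorm (fun p : ℝ × ℝ => F p.1 p.2) 2 vol₂ := by
  refine sq_injective_ennreal ?_
  rw [wnorm_sq, ← tsum_eLpNorm_coef_sq hF]
  exact tsum_congr fun k => by rw [weight_zero, one_mul, enorm_seq hF]

lemma SqInt.normVX_eq (hF : SqInt F) : normVX 2 2 F = wnorm 0 (fun k => ‖seq F k‖ₑ) := by rw [wnorm_seq hF, normVX_two hF.1]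

/-- A dyadic block in the position variable of a function on the phase space. -/
def xblock (χ φ : ℝ → ℝ) (j : ℕ) (F : ℝ → ℝ → ℂ) (x v : ℝ) : ℂ := block χ φ j (fun y => F y v) x

lemma continuous_kernel (hm : IsBump m) : Continuous (kernel m) :=
  continuous_iff_continuousAt.2 fun x => (hasDerivAt_kernel hm x).continuousAt

lemma aestronglyMeasurable_xblock (h : IsLP χ φ) (j : ℕ) (hF : SqInt F) : AEStronglyMeasurable (fun p : ℝ × ℝ => xblock χ φ j F p.1 p.2) vol₂ := by
  obtain ⟨F', hF', hae⟩ := hF.1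
  refine ⟨fun p => block χ φ j (fun y => F' (y, p.2)) p.1, ?_, ?_⟩
  · have h1 : StronglyMeasurable fun q : (ℝ × ℝ) × ℝ =>
        kernel (dyadic χ φ j) (q.1.1 - q.2) * F' (q.2, q.1.2) :=
      ((continuous_kernel (isBump_dyadic h j)).comp (by fun_prop)).stronglyMeasurable.mul
        (hF'.comp_measurable (by fun_prop))
    exact h1.integral_prod_right
  · have h1 : ∀ᵐ v : ℝ, (fun y => F y v) =ᵐ[volume] fun y => F' (y, v) := by
      have h2 := (Measure.measurePreserving_swap (μ := vol) (ν := vol)).quasiMeasurePreserving.ae hae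
      exact Measure.ae_ae_of_ae_prod h2
    filter_upwards [Measure.quasiMeasurePreserving_snd.ae h1] with p hp
    exact congrFun (conv_congr (dyadic χ φ j) hp) p.1

lemma sqInt_xblock (h : IsLP χ φ) (j : ℕ) (hF : SqInt F) : SqInt (xblock χ φ j F) := by
  have hm := aestronglyMeasurable_xblock h j hF
  refine ⟨hm, ?_⟩
  have h1 : eLpNorm (fun p : ℝ × ℝ => xblock χ φ j F p.1 p.2) 2 vol₂ ≤ eLpNorm (fun p : ℝ × ℝ => F p.1 p.2) 2 vol₂ := by
    rw [← sq_le_sq_ennreal, ← eLpNorm_swap hm, ← eLpNorm_swap hF.1, eLpNorm_prod_sq (F := fun v x => xblock χ φ j F x v) (aestronglyMeasurable_swap hm),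
      eLpNorm_prod_sq (F := fun v x => F x v) hF.swap.1]
    refine lintegral_mono_ae ?_
    filter_upwards [ae_memLp_slice (F := fun v x => F x v) hF.swap] with v hv
    have e : eLpNorm (fun x => xblock χ φ j F x v) 2 volume = ‖toL2 (block χ φ j fun y => F y v)‖ₑ :=
      (enorm_toL2 (memLp_block h j hv)).symm
    rw [e, toL2_block h j hv, ← enorm_toL2 hv]; gcongr
    exact enorm_le_iff_norm_le.2 (norm_dblock_le h j _)
  exact h1.trans_lt hF.2

lemma coef_xblock (h : IsLP χ φ) (j k : ℕ) (hF : SqInt F) (x : ℝ) : coef k (xblock χ φ j F x) = block χ φ j (fun y => coef k (F y)) x := by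
  have hK := memLp_kernel_sub (isBump_dyadic h j) x
  have hint : Integrable (fun p : ℝ × ℝ => (hermiteFun k p.1 : ℂ) * kernel (dyadic χ φ j) (x - p.2)
      * F p.2 p.1) vol₂ := (memLp_mul_prod (memLp_hermiteFun k) hK).integrable_mul hF.swap
  have e1 : coef k (xblock χ φ j F x) = ∫ v, ∫ y, (hermiteFun k v : ℂ) * kernel (dyadic χ φ j) (x - y) * F y v := by
    refine integral_ext fun v => ?_
    simp only [xblock, block, fourierMultiplier_eq_conv, conv]; rw [mul_comm, ← integral_const_mul]
    exact integral_ext fun y => by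
      change (hermiteFun k v : ℂ) * (kernel (dyadic χ φ j) (x - y) * F y v) = _
      ring
  rw [e1, integral_integral_swap hint]
  refine integral_ext fun y => ?_
  simp only [coef]
  rw [← integral_const_mul]
  exact integral_ext fun v => by
    simp only [dyadic, multiplierKernel, kernel]; ring

lemma seq_xblock (h : IsLP χ φ) (j k : ℕ) (hF : SqInt F) : seq (xblock χ φ j F) k = dblock χ φ j (seq F k) := by
  rw [seq, seq, ← toL2_block h j (memLp_coef hF k)]
  congr 1
  ext x
  exact coef_xblock h j k hF x

lemma normVX_xblock (h : IsLP χ φ) (j : ℕ) (hF : SqInt F) : normVX 2 2 (xblock χ φ j F) = wnorm 0 (fun k => ‖dblock χ φ j (seq F k)‖ₑ) := by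
  rw [(sqInt_xblock h j hF).normVX_eq]
  simp only [seq_xblock h j _ hF]

/-- The Besov norm of a sequence of Hermite coefficients. -/
def besov (χ φ : ℝ → ℝ) (a : ℕ → L2R) : ℝ≥0∞ :=
  ∑' j : ℕ, (2 : ℝ≥0∞) ^ (((j : ℝ) - 1) * (1 / 2)) * wnorm 0 (fun k => ‖dblock χ φ j (a k)‖ₑ)

lemma besovNorm_eq (h : IsLP χ φ) (hF : SqInt F) : besovNorm χ φ 2 2 (1 / 2) F = besov χ φ (seq F) := by
  unfold besovNorm besov
  refine tsum_congr fun j => ?_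
  rw [← normVX_xblock h j hF]; rfl

/-! ## Trajectories -/

/-- Lebesgue measure on `[0,T]`. -/
abbrev leb (T : ℝ) : Measure ℝ := volume.restrict (Icc 0 T)

/-- The Chemin-Lerner norm of a trajectory of sequences of Hermite coefficients, with the weights
`(k + 1/2)^σ`. -/
def cl (χ φ : ℝ → ℝ) (T : ℝ) (p : ℝ≥0∞) (σ : ℝ) (u : ℕ → ℝ → L2R) : ℝ≥0∞ :=
  ∑' j : ℕ, (2 : ℝ≥0∞) ^ (((j : ℝ) - 1) * (1 / 2)) * eLpNorm (fun t => wnorm σ (fun k => ‖dblock χ φ j (u k t)‖ₑ)) p (leb T)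

/-- Measurability in time of every component. -/
abbrev MeasSeq (T : ℝ) (u : ℕ → ℝ → L2R) : Prop := ∀ k, AEStronglyMeasurable (u k) (leb T)

/-- Square integrability on the slab. -/
def SqIntT (T : ℝ) (g : ℝ → ℝ → ℝ → ℂ) : Prop :=
  MemLp (fun p : ℝ × ℝ × ℝ => g p.1 p.2.1 p.2.2) 2 (slab T)

variable {g h : ℝ → ℝ → ℝ → ℂ}

lemma SqIntT.ae_sqInt (hg : SqIntT T g) : ∀ᵐ t ∂leb T, SqInt (g t) :=
  ae_memLp_slice (F := fun t (q : ℝ × ℝ) => g t q.1 q.2) hg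

lemma ae_normVX_eq (hg : AEStronglyMeasurable (fun p : ℝ × ℝ × ℝ => g p.1 p.2.1 p.2.2) (slab T)) : ∀ᵐ t ∂leb T, normVX 2 2 (g t)
      = eLpNorm (fun q : ℝ × ℝ => g t q.1 q.2) 2 vol₂ := by
  have h1 : ∀ᵐ t ∂leb T, AEStronglyMeasurable (fun q : ℝ × ℝ => g t q.1 q.2) vol₂ := hg.prodMk_left
  filter_upwards [h1] with t ht
  exact normVX_two ht

lemma MemTime.sqIntT {a : ℝ≥0∞} (ha : 2 ≤ a) (hg : MemTime T a g) : SqIntT T g := by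
  refine ⟨hg.1, ?_⟩
  have hm := aemeasurable_eLpNorm_slice (F := fun t (q : ℝ × ℝ) => g t q.1 q.2) hg.1
  have h1 : eLpNorm (fun t => eLpNorm (fun q : ℝ × ℝ => g t q.1 q.2) 2 vol₂) a (leb T) < ⊤ := by
    rw [← eLpNorm_congr_ae (ae_normVX_eq hg.1)]; exact hg.2
  have h2 := eLpNorm_le_eLpNorm_mul_rpow_measure_univ ha hm.aestronglyMeasurable
  have h3 : eLpNorm (fun t => eLpNorm (fun q : ℝ × ℝ => g t q.1 q.2) 2 vol₂) 2 (leb T) < ⊤ := by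
    refine h2.trans_lt (mul_lt_top h1 ?_)
    refine ENNReal.rpow_lt_top_of_nonneg ?_ (measure_ne_top _ _)
    have : (1 : ℝ) / a.toReal ≤ 1 / 2 := by
      rcases eq_or_ne a ⊤ with rfl | h
      · simp
      · have := ENNReal.toReal_mono h ha
        rw [toReal_ofNat] at this
        exact one_div_le_one_div_of_le (by norm_num) this
    simp only [toReal_ofNat]; linarith
  have h4 := eLpNorm_prod_sq (F := fun t (q : ℝ × ℝ) => g t q.1 q.2) hg.1
  rw [eLpNorm_two_sq] at h4
  have h5 : eLpNorm (fun p : ℝ × ℝ × ℝ => g p.1 p.2.1 p.2.2) 2 (slab T) ^ 2 < ⊤ := by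
    rw [eLpNorm_two_sq]
    change ∫⁻ a, ‖g a.1 a.2.1 a.2.2‖ₑ ^ 2 ∂(volume.restrict (Icc 0 T)).prod (volume : Measure (ℝ × ℝ)) < ⊤
    rw [h4]
    have := pow_lt_top h3 (n := 2)
    rwa [eLpNorm_two_sq] at this
  by_contra hc
  rw [not_lt, top_le_iff] at hc
  rw [hc] at h5
  exact absurd h5 (by simp)

lemma SqIntT.assoc (hg : SqIntT T g) : MemLp (fun p : (ℝ × ℝ) × ℝ => g p.1.1 p.1.2 p.2) 2 (((leb T).prod vol).prod vol) :=
  MemLp.comp_measurePreserving hg (measurePreserving_prodAssoc _ _ _)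

lemma SqIntT.memLp_coef (hg : SqIntT T g) (k : ℕ) : MemLp (fun p : ℝ × ℝ => coef k (g p.1 p.2)) 2 ((leb T).prod volume) :=
  Kac.memLp_coef (F := fun p : ℝ × ℝ => g p.1 p.2) hg.assoc k

lemma SqIntT.memLp_seq (hg : SqIntT T g) (k : ℕ) : MemLp (fun t => seq (g t) k) 2 (leb T) :=
  memLp_toL2 (F := fun t x => coef k (g t x)) (hg.memLp_coef k)

lemma tsum_eLpNorm_seq_sq (hg : SqIntT T g) : ∑' k, eLpNorm (fun t => seq (g t) k) 2 (leb T) ^ 2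
      = eLpNorm (fun p : ℝ × ℝ × ℝ => g p.1 p.2.1 p.2.2) 2 (slab T) ^ 2 := by
  have h1 := tsum_eLpNorm_coef_sq (F := fun p : ℝ × ℝ => g p.1 p.2) hg.assoc
  have e := eLpNorm_comp_measurePreserving (p := 2) (f := (MeasurableEquiv.prodAssoc : (ℝ × ℝ) × ℝ ≃ᵐ _)) (g := fun p : ℝ × ℝ × ℝ => g p.1 p.2.1 p.2.2)
    (μ := ((leb T).prod vol).prod vol) hg.1
    (measurePreserving_prodAssoc _ _ _)
  refine Eq.trans ?_ (h1.trans (congrArg (· ^ 2) e))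
  refine tsum_congr fun k => ?_
  exact congrArg (· ^ 2) (eLpNorm_toL2 (F := fun t x => coef k (g t x)) (hg.memLp_coef k))

/-- Parseval's identity on the slab. -/
lemma hasSum_integral_inner_seq (hg : SqIntT T g) (hh : SqIntT T h) : HasSum (fun k => ∫ t in Icc 0 T, ⟪seq (g t) k, seq (h t) k⟫_ℂ)
      (∫ t in Icc 0 T, ∫ x, ∫ v, conj (g t x v) * h t x v) := by
  have hgc : MemLp (fun p : (ℝ × ℝ) × ℝ => conj (g p.1.1 p.1.2 p.2)) 2 (((leb T).prod vol).prod vol) := memLp_conj hg.assoc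
  have h1 := hasSum_integral_coef_mul (F := fun p : ℝ × ℝ => fun v => conj (g p.1 p.2 v)) (G := fun p : ℝ × ℝ => h p.1 p.2) hgc hh.assoc
  have hint : Integrable (fun p : ℝ × ℝ => ∫ v, conj (g p.1 p.2 v) * h p.1 p.2 v) ((leb T).prod volume) := (hgc.integrable_mul hh.assoc).integral_prod_left
  rw [integral_prod _ hint] at h1
  refine h1.congr_fun fun k => ?_
  have h2 := integral_inner_toL2 (F := fun t x => coef k (g t x)) (G := fun t x => coef k (h t x)) (hg.memLp_coef k) (hh.memLp_coef k)
  rw [show (∫ t in Icc 0 T, ⟪seq (g t) k, seq (h t) k⟫_ℂ) = _ from h2]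
  refine integral_ext fun p => ?_
  simp only [coef_conj]

lemma hasSum_inner_seq {G : ℝ → ℝ → ℂ} (hF : SqInt F) (hG : SqInt G) : HasSum (fun k => ⟪seq F k, seq G k⟫_ℂ) (∫ x, ∫ v, conj (F x v) * G x v) := by
  have h1 := hasSum_integral_coef_mul (F := fun x v => conj (F x v)) (G := G) (memLp_conj hF) hG
  refine h1.congr_fun fun k => ?_
  rw [seq, seq, inner_toL2 (memLp_coef hF k) (memLp_coef hG k)]
  refine integral_ext fun p => ?_
  simp only [coef_conj]

lemma cheminLernerNorm_eq (hχφ : IsLP χ φ) (hg : SqIntT T g) (p : ℝ≥0∞) : cheminLernerNorm χ φ T p 2 2 (1 / 2) g = cl χ φ T p 0 (fun k t => seq (g t) k) := by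
  unfold cheminLernerNorm cl normTVX
  refine tsum_congr fun j => ?_
  refine congrArg₂ _ rfl (eLpNorm_congr_ae ?_)
  filter_upwards [hg.ae_sqInt] with t ht
  rw [← normVX_xblock hχφ j ht]; rfl

lemma seq_harmonicPower {r : ℝ} (hg : SqIntT T g) (hh : IsHarmonicPower T r g h) :
    ∀ᵐ t ∂leb T, ∀ k, seq (h t) k = ((((k : ℝ) + 1 / 2) ^ r : ℝ) : ℂ) • seq (g t) k := by
  rw [ae_all_iff]
  intro k
  have h1 : ∀ᵐ t ∂leb T, ∀ᵐ x, coef k (h t x) = ((((k : ℝ) + 1 / 2) ^ r : ℝ) : ℂ) * coef k (g t x) :=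
    Measure.ae_ae_of_ae_prod (hh.2 k)
  filter_upwards [h1, hg.ae_sqInt] with t ht hgt
  rw [seq, toL2_congr ht, toL2_const_mul _ (Kac.memLp_coef hgt k)]; rfl

lemma cheminLernerNorm_harmonicPower (hχφ : IsLP χ φ) (hg : SqIntT T g) (hh : IsHarmonicPower T (s / 2) g h) (p : ℝ≥0∞) :
    cheminLernerNorm χ φ T p 2 2 (1 / 2) h = cl χ φ T p s (fun k t => seq (g t) k) := by
  rw [cheminLernerNorm_eq hχφ (hh.1.sqIntT le_rfl)]
  unfold cl
  refine tsum_congr fun j => ?_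
  refine congrArg₂ _ rfl (eLpNorm_congr_ae ?_)
  filter_upwards [seq_harmonicPower hg hh] with t ht
  refine sq_injective_ennreal ?_
  rw [wnorm_sq, wnorm_sq]
  refine tsum_congr fun k => ?_
  have e : ‖((((k : ℝ) + 1 / 2) ^ (s / 2) : ℝ) : ℂ)‖ₑ = weight (s / 2) k := by
    rw [← ofReal_norm, norm_real, norm_of_nonneg (by positivity), weight]
  rw [ht, map_smul, enorm_smul, e, mul_pow, sq (weight _ _), ← weight_add, weight_zero, one_mul]
  ring_nf

end

section

/-! ## Test functions on the space-time -/

/-- Smooth compactly supported functions of `(t, x, v)`. -/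
structure IsBump₃ (F : ℝ × ℝ × ℝ → ℂ) : Prop where
  smooth : ContDiff ℝ ∞ F
  compact : HasCompactSupport F

lemma IsTest.isBump {F : ℝ × ℝ × ℝ → ℂ} (hF : IsTest T F) : IsBump₃ F := ⟨hF.smooth, hF.compact⟩

/-- The directional derivative in the direction `e`. -/
def dir (e : ℝ × ℝ × ℝ) (F : ℝ × ℝ × ℝ → ℂ) (p : ℝ × ℝ × ℝ) : ℂ := fderiv ℝ F p e

namespace IsBump₃

variable {F G : ℝ × ℝ × ℝ → ℂ}

lemma dir (hF : IsBump₃ F) (e : ℝ × ℝ × ℝ) : IsBump₃ (dir e F) :=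
  ⟨(hF.smooth.fderiv_right (m := ∞) (by simp)).clm_apply contDiff_const,
    hF.compact.fderiv_apply (𝕜 := ℝ) e⟩

lemma mul_left (hF : IsBump₃ F) {f : ℝ × ℝ × ℝ → ℂ} (hf : ContDiff ℝ ∞ f) : IsBump₃ (fun p => f p * F p) := ⟨hf.mul hF.smooth, hF.compact.mul_left⟩

lemma add (hF : IsBump₃ F) (hG : IsBump₃ G) : IsBump₃ (fun p => F p + G p) :=
  ⟨hF.smooth.add hG.smooth, hF.compact.add hG.compact⟩

lemma neg (hF : IsBump₃ F) : IsBump₃ (fun p => - F p) := ⟨hF.smooth.neg, hF.compact.neg⟩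

lemma star (hF : IsBump₃ F) : IsBump₃ (fun p => starRingEnd ℂ (F p)) :=
  ⟨Complex.conjCLE.contDiff.comp hF.smooth, hF.compact.comp_left (map_zero _)⟩

lemma hasDerivAt_fst (hF : IsBump₃ F) (t x v : ℝ) : HasDerivAt (fun τ => F (τ, x, v)) (Kac.dir (1, 0, 0) F (t, x, v)) t := by
  have h := ((hF.smooth.differentiable (by simp)) (t, x, v)).hasFDerivAt
  have h2 : HasDerivAt (fun τ : ℝ => ((τ, x, v) : ℝ × ℝ × ℝ)) (1, 0, 0) t :=
    (hasDerivAt_id t).prodMk ((hasDerivAt_const t x).prodMk (hasDerivAt_const t v))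
  exact h.comp_hasDerivAt t h2

lemma hasDerivAt_snd (hF : IsBump₃ F) (t x v : ℝ) : HasDerivAt (fun y => F (t, y, v)) (Kac.dir (0, 1, 0) F (t, x, v)) x := by
  have h := ((hF.smooth.differentiable (by simp)) (t, x, v)).hasFDerivAt
  have h2 : HasDerivAt (fun y : ℝ => ((t, y, v) : ℝ × ℝ × ℝ)) (0, 1, 0) x :=
    (hasDerivAt_const x t).prodMk ((hasDerivAt_id x).prodMk (hasDerivAt_const x v))
  exact h.comp_hasDerivAt x h2

lemma hasDerivAt_third (hF : IsBump₃ F) (t x v : ℝ) : HasDerivAt (fun w => F (t, x, w)) (Kac.dir (0, 0, 1) F (t, x, v)) v := by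
  have h := ((hF.smooth.differentiable (by simp)) (t, x, v)).hasFDerivAt
  have h2 : HasDerivAt (fun w : ℝ => ((t, x, w) : ℝ × ℝ × ℝ)) (0, 0, 1) v :=
    (hasDerivAt_const v t).prodMk ((hasDerivAt_const v x).prodMk (hasDerivAt_id v))
  exact h.comp_hasDerivAt v h2

lemma isBump_third (hF : IsBump₃ F) (t x : ℝ) : IsBump (fun v => F (t, x, v)) := by
  refine ⟨hF.smooth.comp (by fun_prop), hF.compact.comp_isClosedEmbedding ?_⟩
  exact (Isometry.of_dist_eq fun a b => by simp [Prod.dist_eq]).isClosedEmbedding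

lemma memLp_prod (hF : IsBump₃ F) (μ : Measure ℝ) [IsFiniteMeasureOnCompacts μ] [SFinite μ] (p : ℝ≥0∞) : MemLp F p (μ.prod (volume : Measure (ℝ × ℝ))) :=
  hF.smooth.continuous.memLp_of_hasCompactSupport hF.compact

lemma sqIntT (hF : IsBump₃ F) (T : ℝ) : SqIntT T (fun t x v => F (t, x, v)) :=
  hF.memLp_prod (leb T) 2

lemma memLp_slice (hF : IsBump₃ F) (t : ℝ) (p : ℝ≥0∞) : MemLp (fun q : ℝ × ℝ => F (t, q.1, q.2)) p vol₂ := by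
  refine (hF.smooth.continuous.comp (by fun_prop)).memLp_of_hasCompactSupport
    (hF.compact.comp_isClosedEmbedding (g := fun q : ℝ × ℝ => (t, q)) ?_)
  exact (Isometry.of_dist_eq fun a b => by simp [Prod.dist_eq]).isClosedEmbedding

lemma sqInt (hF : IsBump₃ F) (t : ℝ) : SqInt (fun x v => F (t, x, v)) := hF.memLp_slice t 2

end IsBump₃

/-- The Hermite coefficients of a function of `(t, x, v)`. -/
def tcoef (F : ℝ × ℝ × ℝ → ℂ) (k : ℕ) (t : ℝ) : L2R := seq (fun x v => F (t, x, v)) k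

/-- The transport operator `∂_t + v ∂_x`. -/
def transport (F : ℝ × ℝ × ℝ → ℂ) (p : ℝ × ℝ × ℝ) : ℂ :=
  dir (1, 0, 0) F p + (p.2.2 : ℂ) * dir (0, 1, 0) F p

/-- The oscillator in the variable `v`. -/
def oscillator₃ (F : ℝ × ℝ × ℝ → ℂ) (p : ℝ × ℝ × ℝ) : ℂ :=
  - dir (0, 0, 1) (dir (0, 0, 1) F) p + (p.2.2 : ℂ) ^ 2 / 4 * F p

variable {F G : ℝ × ℝ × ℝ → ℂ}

lemma contDiff_ofReal_third : ContDiff ℝ ∞ (fun p : ℝ × ℝ × ℝ => (p.2.2 : ℂ)) :=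
  Complex.ofRealCLM.contDiff.comp (contDiff_snd.comp contDiff_snd)

lemma contDiff_ofReal_first : ContDiff ℝ ∞ (fun p : ℝ × ℝ × ℝ => (p.1 : ℂ)) :=
  Complex.ofRealCLM.contDiff.comp contDiff_fst

lemma IsBump₃.transport (hF : IsBump₃ F) : IsBump₃ (transport F) :=
  (hF.dir _).add ((hF.dir _).mul_left contDiff_ofReal_third)

lemma IsBump₃.oscillator₃ (hF : IsBump₃ F) : IsBump₃ (oscillator₃ F) :=
  ((hF.dir _).dir _).neg.add (hF.mul_left ((contDiff_ofReal_third.pow 2).div_const 4))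

lemma transport_eq (hF : IsBump₃ F) (t x v : ℝ) : transport F (t, x, v) = deriv (fun τ => F (τ, x, v)) t + (v : ℂ) * deriv (fun y => F (t, y, v)) x := by
  rw [(hF.hasDerivAt_fst t x v).deriv, (hF.hasDerivAt_snd t x v).deriv]; rfl

lemma oscillator₃_eq (hF : IsBump₃ F) (t x v : ℝ) : oscillator₃ F (t, x, v) = oscillator (fun w => F (t, x, w)) v := by
  have h : deriv (fun w => F (t, x, w)) = fun w => dir (0, 0, 1) F (t, x, w) :=
    funext fun w => (hF.hasDerivAt_third t x w).deriv
  rw [oscillator, h, ((hF.dir _).hasDerivAt_third t x v).deriv]; rfl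

lemma tcoef_oscillator (hF : IsBump₃ F) (k : ℕ) (t : ℝ) : tcoef (oscillator₃ F) k t = ((k : ℂ) + 1 / 2) • tcoef F k t := by
  rw [tcoef, tcoef, seq, seq, ← toL2_const_mul _ (memLp_coef (F := fun x v => F (t, x, v)) (hF.sqInt t) k)]
  congr 1
  ext x
  rw [← coef_oscillator (hF.isBump_third t x)]
  congr 1
  ext v
  exact oscillator₃_eq hF t x v

lemma memLp_tcoef (hF : IsBump₃ F) (T : ℝ) (k : ℕ) : MemLp (tcoef F k) 2 (leb T) :=
  (hF.sqIntT T).memLp_seq k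

/-- The square of the norm of `L²([0,T]; ℓ²_σ(L²))`. -/
def energy (T σ : ℝ) (u : ℕ → ℝ → L2R) : ℝ≥0∞ :=
  ∑' k, weight σ k * eLpNorm (u k) 2 (leb T) ^ 2

lemma energy_eq {σ : ℝ} {u : ℕ → ℝ → L2R} (hu : MeasSeq T u) :
    energy T σ u = eLpNorm (fun t => wnorm σ fun k => ‖u k t‖ₑ) 2 (leb T) ^ 2 := by
  rw [eLpNorm_two_sq]
  simp only [enorm_eq_self, wnorm_sq]
  rw [lintegral_tsum fun k => ((hu k).enorm.pow_const 2).const_mul _]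
  refine tsum_congr fun k => ?_
  rw [lintegral_const_mul'' _ ((hu k).enorm.pow_const 2), eLpNorm_two_sq]

lemma energy_tcoef_zero_lt_top (hF : IsBump₃ F) (T : ℝ) : energy T 0 (tcoef F) < ⊤ := by
  have := tsum_eLpNorm_seq_sq (hF.sqIntT T)
  simp only [energy, weight_zero, one_mul]
  exact this.trans_lt (pow_lt_top (hF.sqIntT T).2)

lemma energy_mono_weight {σ τ : ℝ} (h : σ ≤ τ) (h2 : τ ≤ σ + 2) (u : ℕ → ℝ → L2R) :
    energy T σ u ≤ 4 * energy T τ u := by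
  rw [energy, energy, ← ENNReal.tsum_mul_left]
  refine tsum_le_tsum fun k => ?_
  rw [← mul_assoc]
  gcongr
  exact weight_le h h2 k

lemma energy_tcoef_lt_top (hF : IsBump₃ F) (T : ℝ) {σ : ℝ} (h0 : 0 ≤ σ) (h2 : σ ≤ 2) :
    energy T σ (tcoef F) < ⊤ := by
  refine (energy_mono_weight h2 (by linarith) _).trans_lt (mul_lt_top (by simp) ?_)
  refine lt_of_eq_of_lt ?_ (energy_tcoef_zero_lt_top hF.oscillator₃ T)
  rw [energy, energy]
  refine tsum_congr fun k => ?_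
  have e : tcoef (oscillator₃ F) k = ((k : ℂ) + 1 / 2) • tcoef F k :=
    funext fun t => tcoef_oscillator hF k t
  have e2 : ‖((k : ℂ) + 1 / 2)‖ₑ = weight 1 k := by
    have : ((k : ℂ) + 1 / 2) = (((k : ℝ) + 1 / 2 : ℝ) : ℂ) := by push_cast; ring
    rw [this, ← ofReal_norm, norm_real, norm_of_nonneg (by positivity), weight,
      rpow_one]
  rw [e, eLpNorm_const_smul, e2, mul_pow, weight_zero, one_mul, sq (weight 1 k), ← weight_add]
  norm_num

/-! ## Pairings of trajectories -/

lemma tsum_lintegral_mul_le {σ : ℝ} {a b : ℕ → ℝ → L2R} (ha : MeasSeq T a) (hb : MeasSeq T b) :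
    (∑' k, ∫⁻ t in Icc 0 T, ‖a k t‖ₑ * ‖b k t‖ₑ) ^ 2 ≤ energy T (-σ) a * energy T σ b := by
  rw [← lintegral_tsum (f := fun k t => ‖a k t‖ₑ * ‖b k t‖ₑ) fun k => ((ha k).enorm.mul (hb k).enorm), energy_eq ha, energy_eq hb, ← mul_pow,
    sq_le_sq_ennreal]
  have hm : ∀ (τ : ℝ) {c : ℕ → ℝ → L2R}, (MeasSeq T c) → AEMeasurable (fun t => wnorm τ fun k => ‖c k t‖ₑ) (leb T) := fun τ c hc =>
    measurable_wnorm τ fun k => (hc k).enorm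
  have h1 := ENNReal.lintegral_mul_le_Lp_mul_Lq (leb T) Real.HolderConjugate.two_two (hm (-σ) ha) (hm σ hb)
  refine (lintegral_mono fun t => hoelder_wnorm σ _ _).trans (h1.trans (le_of_eq ?_))
  rw [eLpNorm_eq_lintegral_rpow_enorm_toReal (by norm_num) (by norm_num),
    eLpNorm_eq_lintegral_rpow_enorm_toReal (by norm_num) (by norm_num)]
  simp

lemma integrable_inner_of_memLp {a b : ℝ → L2R} (ha : MemLp a 2 (leb T)) (hb : MemLp b 2 (leb T)) : Integrable (fun t => ⟪a t, b t⟫_ℂ) (leb T) := by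
  have h := L2.integrable_inner (𝕜 := ℂ) (ha.toLp a) (hb.toLp b)
  refine h.congr ?_
  filter_upwards [ha.coeFn_toLp, hb.coeFn_toLp] with t h1 h2
  rw [h1, h2]

lemma enorm_integral_inner_le (a b : ℝ → L2R) (t : Set ℝ) : ‖∫ τ in t, ⟪a τ, b τ⟫_ℂ‖ₑ ≤ ∫⁻ τ in t, ‖a τ‖ₑ * ‖b τ‖ₑ := by
  refine (enorm_integral_le_lintegral_enorm _).trans (lintegral_mono fun τ => ?_)
  rw [← ofReal_norm, ← ofReal_norm, ← ofReal_norm, ← ofReal_mul (norm_nonneg _)]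
  exact ofReal_le_ofReal (norm_inner_le_norm _ _)

lemma summable_of_tsum_enorm {ι : Type*} {z : ι → ℂ} (h : ∑' k, ‖z k‖ₑ ≠ ⊤) : Summable z := by
  refine Summable.of_norm ?_
  have := summable_toReal h
  simpa using this

lemma enorm_tsum_le {ι : Type*} (z : ι → ℂ) : ‖∑' k, z k‖ₑ ≤ ∑' k, ‖z k‖ₑ := by
  rcases eq_or_ne (∑' k, ‖z k‖ₑ) ⊤ with h | h
  · rw [h]; exact le_top
  · have hs : Summable fun k => ‖z k‖ := by
      have := summable_toReal h
      simpa using this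
    rw [← ofReal_norm]
    refine (ofReal_le_ofReal (norm_tsum_le_tsum_norm hs)).trans (le_of_eq ?_)
    rw [ofReal_tsum_of_nonneg (fun k => norm_nonneg _) hs]
    exact tsum_congr fun k => ofReal_norm _

lemma summable_integral_inner {σ : ℝ} {a b : ℕ → ℝ → L2R} (ha : MeasSeq T a) (hb : MeasSeq T b) (hae : energy T (-σ) a ≠ ⊤)
    (hbe : energy T σ b ≠ ⊤) : Summable fun k => ∫ t in Icc 0 T, ⟪a k t, b k t⟫_ℂ := by
  refine summable_of_tsum_enorm (ne_top_of_le_ne_top ?_ (tsum_le_tsum fun k => enorm_integral_inner_le (a k) (b k) (Icc 0 T)))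
  have := tsum_lintegral_mul_le (σ := σ) ha hb
  intro h
  rw [h] at this
  simp only [ne_eq, OfNat.ofNat_ne_zero, not_false_eq_true, ENNReal.top_pow, top_le_iff] at this
  exact mul_ne_top hae hbe this

lemma memLp_of_energy {σ : ℝ} {u : ℕ → ℝ → L2R} (hu : MeasSeq T u) (h : energy T σ u ≠ ⊤) (k : ℕ) : MemLp (u k) 2 (leb T) := by
  refine ⟨hu k, ?_⟩
  by_contra hc
  rw [not_lt, top_le_iff] at hc
  refine h (ENNReal.tsum_eq_top_of_eq_top ⟨k, ?_⟩)
  rw [hc]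
  simp [mul_top, weight_ne_zero]

/-! ## The weak formulation for Hermite coefficients -/

/-- The weak formulation of `∂_t u + v ∂_x u + 𝒦 u = f`, `u(0) = u₀` in terms of Hermite
coefficients. -/
def IsWeakSeq (s T : ℝ) (u₀ : ℕ → L2R) (u f : ℕ → ℝ → L2R) : Prop :=
  ∀ φ : ℝ × ℝ × ℝ → ℂ, IsTest T φ → ∑' k, ∫ t in Icc 0 T, ⟪tcoef φ k t, (rate s k : ℂ) • u k t - f k t⟫_ℂ
      = (∑' k, ∫ t in Icc 0 T, ⟪tcoef (transport φ) k t, u k t⟫_ℂ) + ∑' k, ⟪tcoef φ k 0, u₀ k⟫_ℂ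

end

section

/-! ## The energy identity for test functions -/

variable {F G φ : ℝ × ℝ × ℝ → ℂ}

lemma integral_dir_snd (hF : IsBump₃ F) (t v : ℝ) : ∫ x, dir (0, 1, 0) F (t, x, v) = 0 := by
  have hc : HasCompactSupport fun x => F (t, x, v) :=
    hF.compact.comp_isClosedEmbedding (g := fun x : ℝ => (t, x, v)) (Isometry.of_dist_eq fun a b => by simp [Prod.dist_eq]).isClosedEmbedding
  have hc' : HasCompactSupport fun x => dir (0, 1, 0) F (t, x, v) :=
    (hF.dir _).compact.comp_isClosedEmbedding (g := fun x : ℝ => (t, x, v)) (Isometry.of_dist_eq fun a b => by simp [Prod.dist_eq]).isClosedEmbedding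
  exact integral_eq_zero_of_hasDerivAt_of_integrable (fun x => hF.hasDerivAt_snd t x v)
    (((hF.dir _).smooth.continuous.comp (by fun_prop)).integrable_of_hasCompactSupport hc')
    ((hF.smooth.continuous.comp (by fun_prop)).integrable_of_hasCompactSupport hc)

lemma IsBump₃.integrable_prod (hF : IsBump₃ F) (T : ℝ) : Integrable F ((leb T).prod (volume : Measure (ℝ × ℝ))) :=
  memLp_one_iff_integrable.1 (hF.memLp_prod _ 1)

lemma IsBump₃.integrable_slice (hF : IsBump₃ F) (t : ℝ) : Integrable (fun q : ℝ × ℝ => F (t, q.1, q.2)) vol₂ :=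
  memLp_one_iff_integrable.1 (hF.memLp_slice t 1)

lemma IsBump₃.integral_slab (hF : IsBump₃ F) (T : ℝ) : ∫ t in Icc 0 T, ∫ x, ∫ v, F (t, x, v) = ∫ p, F p ∂((leb T).prod (volume : Measure (ℝ × ℝ))) := by
  rw [integral_prod _ (hF.integrable_prod T)]
  refine integral_ext fun t => ?_
  exact (integral_prod _ (hF.integrable_slice t)).symm

lemma integral_transport (hT : 0 ≤ T) (hF : IsBump₃ F) (h0 : ∀ x v, F (T, x, v) = 0) :
    ∫ t in Icc 0 T, ∫ x, ∫ v, transport F (t, x, v) = - ∫ x, ∫ v, F (0, x, v) := by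
  have h1 := hF.dir (1, 0, 0)
  have h2 := (hF.dir (0, 1, 0)).mul_left contDiff_ofReal_third
  rw [hF.transport.integral_slab T]
  have e : ∫ p, transport F p ∂((leb T).prod (volume : Measure (ℝ × ℝ))) = ∫ p, dir (1, 0, 0) F p ∂((leb T).prod (volume : Measure (ℝ × ℝ)))
      + ∫ p, (p.2.2 : ℂ) * dir (0, 1, 0) F p ∂((leb T).prod (volume : Measure (ℝ × ℝ))) :=
    integral_add (h1.integrable_prod T) (h2.integrable_prod T)
  have e2 : ∫ p, (p.2.2 : ℂ) * dir (0, 1, 0) F p ∂((leb T).prod (volume : Measure (ℝ × ℝ))) = 0 := by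
    rw [← h2.integral_slab T]
    refine integral_eq_zero_of_ae (.of_forall fun t => ?_)
    simp only [Pi.zero_apply]; rw [integral_integral_swap (h2.integrable_slice t)]
    refine integral_eq_zero_of_ae (.of_forall fun v => ?_)
    simp only [Pi.zero_apply]; rw [integral_const_mul, integral_dir_snd hF, mul_zero]
  have e1 : ∫ p, dir (1, 0, 0) F p ∂((leb T).prod (volume : Measure (ℝ × ℝ))) = - ∫ x, ∫ v, F (0, x, v) := by
    rw [integral_prod_symm _ (h1.integrable_prod T)]
    have : ∀ q : ℝ × ℝ, ∫ t in Icc 0 T, dir (1, 0, 0) F (t, q) = - F (0, q.1, q.2) := fun q => by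
      rw [integral_Icc_eq_integral_Ioc, ← intervalIntegral.integral_of_le hT, intervalIntegral.integral_eq_sub_of_hasDerivAt (f := fun t => F (t, q.1, q.2))
          (fun t _ => hF.hasDerivAt_fst t q.1 q.2)
          ((h1.smooth.continuous.comp (by fun_prop : Continuous fun t : ℝ => (t, q))).intervalIntegrable _ _)]
      rw [h0, zero_sub]
    simp only [this]; rw [integral_neg]
    exact congrArg _ (integral_prod _ (hF.integrable_slice 0))
  rw [e, e1, e2, add_zero]

lemma IsTest.apply_end (h : IsTest T φ) (x v : ℝ) : φ (T, x, v) = 0 := by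
  by_contra hne
  exact lt_irrefl T (h.before _ (subset_tsupport _ hne))

/-- The growing weight used for the coercivity of the adjoint problem. -/
def growing (φ : ℝ × ℝ × ℝ → ℂ) (p : ℝ × ℝ × ℝ) : ℂ := (1 + (p.1 : ℂ)) * φ p

lemma isBump_growing (hF : IsBump₃ F) : IsBump₃ (growing F) :=
  hF.mul_left (contDiff_const.add contDiff_ofReal_first)

lemma transport_energy_density (hF : IsBump₃ F) (t x v : ℝ) : transport (fun p => growing F p * conj (F p)) (t, x, v)
      = conj (F (t, x, v)) * F (t, x, v) + (conj (growing F (t, x, v)) * transport F (t, x, v)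
        + conj (conj (growing F (t, x, v)) * transport F (t, x, v))) := by
  have hQ : IsBump₃ (fun p => growing F p * conj (F p)) :=
    ⟨(isBump_growing hF).smooth.mul hF.star.smooth, (isBump_growing hF).compact.mul_right⟩
  have h1 : HasDerivAt (fun τ : ℝ => (1 + (τ : ℂ)) * F (τ, x, v) * conj (F (τ, x, v)))
      ((1 * F (t, x, v) + (1 + (t : ℂ)) * dir (1, 0, 0) F (t, x, v)) * conj (F (t, x, v))
        + ((1 + (t : ℂ)) * F (t, x, v)) * conj (dir (1, 0, 0) F (t, x, v))) t := by
    have ht : HasDerivAt (fun τ : ℝ => 1 + (τ : ℂ)) 1 t := by simpa using (hasDerivAt_id t).ofReal_comp.const_add (1 : ℂ)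
    exact (ht.mul (hF.hasDerivAt_fst t x v)).mul (hF.hasDerivAt_fst t x v).star
  have h2 : HasDerivAt (fun y : ℝ => (1 + (t : ℂ)) * F (t, y, v) * conj (F (t, y, v)))
      (((1 + (t : ℂ)) * dir (0, 1, 0) F (t, x, v)) * conj (F (t, x, v)) + ((1 + (t : ℂ)) * F (t, x, v)) * conj (dir (0, 1, 0) F (t, x, v))) x :=
    ((hF.hasDerivAt_snd t x v).const_mul _).mul (hF.hasDerivAt_snd t x v).star
  rw [transport_eq hQ]
  have e1 : deriv (fun τ => growing F (τ, x, v) * conj (F (τ, x, v))) t = _ := h1.deriv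
  have e2 : deriv (fun y => growing F (t, y, v) * conj (F (t, y, v))) x = _ := h2.deriv
  rw [e1, e2]
  simp only [growing, transport, map_mul, map_add, map_one, conj_conj, conj_ofReal]
  ring

lemma tcoef_growing (hF : IsBump₃ F) (k : ℕ) (t : ℝ) : tcoef (growing F) k t = (1 + (t : ℂ)) • tcoef F k t := by
  rw [tcoef, tcoef, seq, seq, ← toL2_const_mul _ (memLp_coef (F := fun x v => F (t, x, v)) (hF.sqInt t) k)]
  congr 1
  ext x
  simp only [growing, coef, mul_assoc]
  rw [integral_const_mul]

lemma hasSum_test_energy (hT : 0 ≤ T) (h : IsTest T φ) : ∃ I : ℂ, HasSum (fun k => ∫ t in Icc 0 T, ⟪tcoef (growing φ) k t, tcoef (transport φ) k t⟫_ℂ) I ∧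
      - 2 * I.re = (∑' k, ‖tcoef φ k 0‖ ^ 2) + ∑' k, ∫ t in Icc 0 T, ‖tcoef φ k t‖ ^ 2 := by
  have hF := h.isBump
  have hg := isBump_growing hF
  refine ⟨_, hasSum_integral_inner_seq (hg.sqIntT T) (hF.transport.sqIntT T), ?_⟩
  set J := ∫ t in Icc 0 T, ∫ x, ∫ v, conj (growing φ (t, x, v)) * transport φ (t, x, v) with hJ
  have hQ : IsBump₃ (fun p => growing φ p * conj (φ p)) :=
    ⟨hg.smooth.mul hF.star.smooth, hg.compact.mul_right⟩
  have hA : IsBump₃ (fun p => conj (φ p) * φ p) := ⟨hF.star.smooth.mul hF.smooth, hF.compact.mul_left⟩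
  have hB : IsBump₃ (fun p => conj (growing φ p) * transport φ p) :=
    ⟨hg.star.smooth.mul hF.transport.smooth, hF.transport.compact.mul_left⟩
  have h1 := integral_transport hT hQ fun x v => by rw [h.apply_end]; simp
  rw [hQ.transport.integral_slab T] at h1
  have e : ∫ p, transport (fun p => growing φ p * conj (φ p)) p ∂((leb T).prod (volume : Measure (ℝ × ℝ)))
      = ∫ p, conj (φ p) * φ p ∂((leb T).prod (volume : Measure (ℝ × ℝ))) + (∫ p, conj (growing φ p) * transport φ p ∂((leb T).prod (volume : Measure (ℝ × ℝ)))
        + ∫ p, conj (conj (growing φ p) * transport φ p) ∂((leb T).prod (volume : Measure (ℝ × ℝ)))) := by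
    rw [← integral_add (f := fun p => conj (growing φ p) * transport φ p) (g := fun p => conj (conj (growing φ p) * transport φ p))
        (hB.integrable_prod T) (hB.star.integrable_prod T),
      ← integral_add (f := fun p => conj (φ p) * φ p) (g := fun p => conj (growing φ p) * transport φ p + conj (conj (growing φ p) * transport φ p))
        (hA.integrable_prod T) ((hB.integrable_prod T).add (hB.star.integrable_prod T))]
    exact integral_ext fun p => transport_energy_density hF p.1 p.2.1 p.2.2
  rw [e, integral_conj, ← hB.integral_slab T, ← hJ, ← hA.integral_slab T] at h1
  have hs1 := hasSum_integral_inner_seq (hF.sqIntT T) (hF.sqIntT T)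
  have hs0 := hasSum_inner_seq (hF.sqInt 0) (hF.sqInt 0)
  have hx : (∫ x, ∫ v, growing φ (0, x, v) * conj (φ (0, x, v))) = ∫ x, ∫ v, conj (φ (0, x, v)) * φ (0, x, v) := by simp [growing, mul_comm]
  rw [hx] at h1
  have n1 : ∀ a : L2R, ⟪a, a⟫_ℂ = ((‖a‖ ^ 2 : ℝ) : ℂ) := fun a => by
    rw [inner_self_eq_norm_sq_to_K]; push_cast; rfl
  simp only [n1, integral_complex_ofReal] at hs1 hs0
  have r1 := Complex.hasSum_re hs1
  have r0 := Complex.hasSum_re hs0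
  simp only [ofReal_re] at r1 r0
  have h2 := congrArg Complex.re h1
  simp only [add_re, conj_re, Complex.neg_re] at h2
  have t1 : ∑' k, ∫ t in Icc 0 T, ‖tcoef φ k t‖ ^ 2 = _ := r1.tsum_eq
  have t0 : ∑' k, ‖tcoef φ k 0‖ ^ 2 = _ := r0.tsum_eq
  rw [t1, t0]
  linarith

/-! ## Coercivity of the adjoint problem -/

lemma energy_const_mul_le {σ τ : ℝ} {c : ℕ → ℂ} {C : ℝ≥0∞} (u : ℕ → ℝ → L2R) (h : ∀ k, weight σ k * ‖c k‖ₑ ^ 2 ≤ C * weight τ k) :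
    energy T σ (fun k t => c k • u k t) ≤ C * energy T τ u := by
  rw [energy, energy, ← ENNReal.tsum_mul_left]
  refine tsum_le_tsum fun k => ?_
  have e : (fun t => c k • u k t) = c k • u k := rfl
  rw [e, eLpNorm_const_smul, mul_pow, ← mul_assoc, ← mul_assoc]
  exact mul_le_mul' (h k) le_rfl

lemma energy_sub_le {σ : ℝ} {a b : ℕ → ℝ → L2R} (ha : MeasSeq T a) (hb : MeasSeq T b) :
    energy T σ (fun k t => a k t - b k t) ≤ 2 * (energy T σ a + energy T σ b) := by
  rw [energy, energy, energy, ← tsum_add, ← ENNReal.tsum_mul_left]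
  refine tsum_le_tsum fun k => ?_
  have h1 := eLpNorm_sub_le (ha k) (hb k) (p := 2) (by norm_num)
  have h2 := sum_mul_sq_le (Finset.univ : Finset (Fin 2)) (fun _ => 1) ![eLpNorm (a k) 2 (leb T), eLpNorm (b k) 2 (leb T)]
  simp only [one_mul, Fin.sum_univ_two, one_pow, Matrix.cons_val_zero, Matrix.cons_val_one] at h2
  calc weight σ k * eLpNorm (fun t => a k t - b k t) 2 (leb T) ^ 2
      ≤ weight σ k * (eLpNorm (a k) 2 (leb T) + eLpNorm (b k) 2 (leb T)) ^ 2 := by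
        gcongr; exact h1
    _ ≤ weight σ k * ((1 + 1) * (eLpNorm (a k) 2 (leb T) ^ 2 + eLpNorm (b k) 2 (leb T) ^ 2)) := by
        gcongr
    _ = _ := by rw [one_add_one_eq_two]; ring

lemma exists_energy_relax_le (hs : s ∈ Ioo 0 1) : ∃ C : ℝ≥0∞, C ≠ ⊤ ∧
    ∀ (T : ℝ) (u : ℕ → ℝ → L2R), energy T (-s) (fun k t => (rate s k : ℂ) • u k t) ≤ C * energy T s u := by
  obtain ⟨C, hC, h⟩ := exists_rate_le hs
  refine ⟨ofReal (C ^ 2), ofReal_ne_top, fun T u => energy_const_mul_le u fun k => ?_⟩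
  have hk : (0 : ℝ) < (k : ℝ) + 1 / 2 := by positivity
  have h0 := rate_nonneg hs k
  rw [← ofReal_norm, norm_real, norm_of_nonneg h0, weight, weight, ← ofReal_pow h0, ← ofReal_mul (by positivity), ← ofReal_mul (by positivity)]
  refine ofReal_le_ofReal ?_
  have h1 := pow_le_pow_left₀ h0 (h k) 2
  calc ((k : ℝ) + 1 / 2) ^ (-s) * rate s k ^ 2
      ≤ ((k : ℝ) + 1 / 2) ^ (-s) * (C * ((k : ℝ) + 1 / 2) ^ s) ^ 2 := by gcongr
    _ = C ^ 2 * ((k : ℝ) + 1 / 2) ^ s * (((k : ℝ) + 1 / 2) ^ (-s) * ((k : ℝ) + 1 / 2) ^ s) := by ring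
    _ = _ := by rw [← rpow_add hk]; simp

lemma memLp_smul {u : ℝ → L2R} {μ : Measure ℝ} (hu : MemLp u 2 μ) (c : ℂ) : MemLp (fun t => c • u t) 2 μ := hu.const_smul c

lemma memLp_sub {u w : ℝ → L2R} {μ : Measure ℝ} (hu : MemLp u 2 μ) (hw : MemLp w 2 μ) : MemLp (fun t => u t - w t) 2 μ := hu.sub hw

/-- The adjoint operator applied to a test function. -/
def adjoint (s : ℝ) (φ : ℝ × ℝ × ℝ → ℂ) (k : ℕ) (t : ℝ) : L2R :=
  (rate s k : ℂ) • tcoef φ k t - tcoef (transport φ) k t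

lemma memLp_adjoint (s : ℝ) (hF : IsBump₃ F) (T : ℝ) (k : ℕ) : MemLp (adjoint s F k) 2 (leb T) :=
  memLp_sub (memLp_smul (memLp_tcoef hF T k) _) (memLp_tcoef hF.transport T k)

lemma energy_adjoint_lt_top (hs : s ∈ Ioo 0 1) (hF : IsBump₃ F) (T : ℝ) :
    energy T (-s) (adjoint s F) < ⊤ := by
  obtain ⟨C, hC, h⟩ := exists_energy_relax_le hs
  refine (energy_sub_le (a := fun k t => (rate s k : ℂ) • tcoef F k t) (b := tcoef (transport F)) (fun k => (memLp_smul (memLp_tcoef hF T k) _).1)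
    (fun k => (memLp_tcoef hF.transport T k).1)).trans_lt (mul_lt_top (by simp)
      (ENNReal.add_lt_top.2 ⟨(h T _).trans_lt (mul_lt_top hC.lt_top (energy_tcoef_lt_top hF T hs.1.le (by linarith [hs.2]))), ?_⟩))
  exact (energy_mono_weight (by linarith [hs.1, hs.2]) (by linarith [hs.1, hs.2]) _).trans_lt
    (mul_lt_top (by simp) (energy_tcoef_zero_lt_top hF.transport T))

lemma ofReal_integral_norm_sq {u : ℝ → L2R} (hu : MemLp u 2 (leb T)) : ofReal (∫ t in Icc 0 T, ‖u t‖ ^ 2) = eLpNorm u 2 (leb T) ^ 2 := by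
  rw [eLpNorm_two_sq, ofReal_integral_eq_lintegral_ofReal ((memLp_two_iff_integrable_sq_norm hu.1).1 hu) (.of_forall fun v => by positivity)]
  refine lintegral_congr fun v => ?_
  rw [ofReal_pow (norm_nonneg _), ofReal_norm]

/-- The a priori estimate for the adjoint problem. -/
lemma adjoint_estimate (hs : s ∈ Ioo 0 1) (hT : 0 ≤ T) (h : IsTest T φ) : ofReal (∑' k, ‖tcoef φ k 0‖ ^ 2) + energy T s (tcoef φ)
      ≤ ofReal (1280 * (1 + T)) * ∑' k, ∫⁻ t in Icc 0 T, ‖tcoef φ k t‖ₑ * ‖adjoint s φ k t‖ₑ := by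
  have hF := h.isBump
  have hg := isBump_growing hF
  obtain ⟨I, hI, hIe⟩ := hasSum_test_energy hT h
  obtain ⟨C, hC, hrel⟩ := exists_energy_relax_le hs
  set N0 := ∑' k, ‖tcoef φ k 0‖ ^ 2 with hN0
  have hN0n : 0 ≤ N0 := tsum_nonneg fun k => by positivity
  have hm := fun k => memLp_tcoef hF T k
  -- the dissipation
  have hsd : Summable fun k => ∫ t in Icc 0 T, ⟪tcoef (growing φ) k t, (rate s k : ℂ) • tcoef φ k t⟫_ℂ := by
    refine summable_integral_inner (σ := -s) (a := tcoef (growing φ)) (fun k => (memLp_tcoef hg T k).1) (b := fun k t => (rate s k : ℂ) • tcoef φ k t)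
      (fun k => (memLp_smul (hm k) _).1) ?_ ?_
    · rw [neg_neg]; exact (energy_tcoef_lt_top hg T hs.1.le (by linarith [hs.2])).ne
    · exact ((hrel T _).trans_lt (mul_lt_top hC.lt_top
        (energy_tcoef_lt_top hF T hs.1.le (by linarith [hs.2])))).ne
  have hdiff := hsd.hasSum.sub hI
  have hdiff' : HasSum (fun k => ∫ t in Icc 0 T, ⟪tcoef (growing φ) k t, adjoint s φ k t⟫_ℂ) _ :=
    hdiff.congr_fun fun k => by
      rw [← integral_sub (f := fun t => ⟪tcoef (growing φ) k t, (rate s k : ℂ) • tcoef φ k t⟫_ℂ)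
        (g := fun t => ⟪tcoef (growing φ) k t, tcoef (transport φ) k t⟫_ℂ)
        (integrable_inner_of_memLp (memLp_tcoef hg T k) (memLp_smul (hm k) _))
        (integrable_inner_of_memLp (memLp_tcoef hg T k) (memLp_tcoef hF.transport T k))]
      exact integral_ext fun t => by simp only [adjoint, inner_sub_right]
  set P := (∑' k, ∫ t in Icc 0 T, ⟪tcoef (growing φ) k t, (rate s k : ℂ) • tcoef φ k t⟫_ℂ) - I with hP
  have hre : ∀ k, (∫ t in Icc 0 T, ⟪tcoef (growing φ) k t, (rate s k : ℂ) • tcoef φ k t⟫_ℂ)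
      = ((∫ t in Icc 0 T, (1 + t) * (rate s k * ‖tcoef φ k t‖ ^ 2) : ℝ) : ℂ) := fun k => by
    rw [← integral_complex_ofReal]
    refine integral_ext fun t => ?_
    simp only [tcoef_growing hF, inner_smul_left, inner_smul_right, inner_self_eq_norm_sq_to_K]; simp; ring
  have hD : Summable fun k => ∫ t in Icc 0 T, (1 + t) * (rate s k * ‖tcoef φ k t‖ ^ 2) :=
    Complex.summable_ofReal.1 (hsd.congr hre)
  have hDe : (∑' k, ∫ t in Icc 0 T, ⟪tcoef (growing φ) k t, (rate s k : ℂ) • tcoef φ k t⟫_ℂ)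
      = ((∑' k, ∫ t in Icc 0 T, (1 + t) * (rate s k * ‖tcoef φ k t‖ ^ 2) : ℝ) : ℂ) := by
    rw [Complex.ofReal_tsum]; exact tsum_congr hre
  have hn : ∑' k, eLpNorm (tcoef φ k) 2 (leb T) ^ 2 ≠ ⊤ := by
    have := (energy_tcoef_zero_lt_top hF T).ne
    simpa only [energy, weight_zero, one_mul] using this
  have hN : Summable fun k => ∫ t in Icc 0 T, ‖tcoef φ k t‖ ^ 2 := by
    refine (summable_toReal hn).congr fun k => ?_
    rw [← ofReal_integral_norm_sq (hm k), toReal_ofReal (integral_nonneg fun t => by positivity)]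
  set D := ∑' k, ∫ t in Icc 0 T, (1 + t) * (rate s k * ‖tcoef φ k t‖ ^ 2) with hDdef
  set N := ∑' k, ∫ t in Icc 0 T, ‖tcoef φ k t‖ ^ 2 with hNdef
  have hPre : 2 * P.re = 2 * D + (N0 + N) := by
    rw [hP, hDe, sub_re, ofReal_re, ← hIe]; ring
  -- lower bound by the energy
  have hlow : energy T s (tcoef φ) ≤ ofReal (320 * (D + N)) := by
    rw [← hD.tsum_add hN, ← tsum_mul_left, ofReal_tsum_of_nonneg]
    · refine tsum_le_tsum fun k => ?_
      rw [← ofReal_integral_norm_sq (hm k), weight, ← ofReal_mul (by positivity)]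
      refine ofReal_le_ofReal ?_
      have h1 := weight_le_rate hs k
      have h2 : rate s k * ∫ t in Icc 0 T, ‖tcoef φ k t‖ ^ 2 ≤ ∫ t in Icc 0 T, (1 + t) * (rate s k * ‖tcoef φ k t‖ ^ 2) := by
        rw [← integral_const_mul]
        have i1 := (memLp_two_iff_integrable_sq_norm (hm k).1).1 (hm k)
        have i2 := (memLp_two_iff_integrable_sq_norm (memLp_tcoef hg T k).1).1 (memLp_tcoef hg T k)
        refine integral_mono_ae (i1.const_mul _) ?_ ?_
        · refine ((i1.const_mul (rate s k)).bdd_mul (c := 1 + T) (f := fun t => 1 + t)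
            (by fun_prop : Continuous fun t : ℝ => 1 + t).aestronglyMeasurable ?_)
          filter_upwards [ae_restrict_mem measurableSet_Icc] with t ht
          rw [norm_of_nonneg (by linarith [ht.1])]; linarith [ht.2]
        · filter_upwards [ae_restrict_mem measurableSet_Icc] with t ht
          have := mul_nonneg (rate_nonneg hs k) (sq_nonneg ‖tcoef φ k t‖)
          nlinarith [ht.1]
      have h3 : 0 ≤ ∫ t in Icc 0 T, ‖tcoef φ k t‖ ^ 2 := integral_nonneg fun t => by positivity
      nlinarith [mul_le_mul_of_nonneg_right h1 h3]
    · intro k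
      refine mul_nonneg (by norm_num) (add_nonneg (setIntegral_nonneg measurableSet_Icc fun t ht => ?_)
        (integral_nonneg fun t => by positivity))
      exact mul_nonneg (by linarith [ht.1]) (mul_nonneg (rate_nonneg hs k) (by positivity))
    · exact (hD.add hN).mul_left _
  have hDn : 0 ≤ D := tsum_nonneg fun k => setIntegral_nonneg measurableSet_Icc fun t ht =>
    mul_nonneg (by linarith [ht.1]) (mul_nonneg (rate_nonneg hs k) (by positivity))
  have hNn : 0 ≤ N := tsum_nonneg fun k => integral_nonneg fun t => by positivity
  -- upper bound of the pairing
  have hup : ‖P‖ₑ ≤ ofReal (1 + T) * ∑' k, ∫⁻ t in Icc 0 T, ‖tcoef φ k t‖ₑ * ‖adjoint s φ k t‖ₑ := by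
    rw [← hdiff'.tsum_eq, ← ENNReal.tsum_mul_left]
    refine (enorm_tsum_le _).trans (tsum_le_tsum fun k => ?_)
    refine (enorm_integral_inner_le _ _ _).trans ?_
    rw [← lintegral_const_mul' _ _ ofReal_ne_top]
    refine lintegral_mono_ae ?_
    filter_upwards [ae_restrict_mem measurableSet_Icc] with t ht
    rw [tcoef_growing hF, enorm_smul, mul_assoc]; gcongr
    have : (1 + (t : ℂ)) = ((1 + t : ℝ) : ℂ) := by push_cast; rfl
    rw [this, ← ofReal_norm, norm_real, norm_of_nonneg (by linarith [ht.1])]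
    exact ofReal_le_ofReal (by linarith [ht.2])
  have hPle : P.re ≤ ‖P‖ := Complex.re_le_norm P
  calc ofReal N0 + energy T s (tcoef φ)
      ≤ ofReal N0 + ofReal (320 * (D + N)) := by gcongr
    _ = ofReal (N0 + 320 * (D + N)) := (ofReal_add hN0n (by positivity)).symm
    _ ≤ ofReal (1280 * ‖P‖) := ofReal_le_ofReal (by nlinarith)
    _ = ofReal 1280 * ‖P‖ₑ := by rw [ofReal_mul (by norm_num), ofReal_norm]
    _ ≤ ofReal 1280 * (ofReal (1 + T) * _) := by gcongr
    _ = _ := by rw [← mul_assoc, ← ofReal_mul (by norm_num)]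

end

section

/-! ## Existence of weak solutions of the linear problem -/

/-- The Lions-Lax-Milgram representation of a functional bounded by a linear image. -/
lemma exists_inner_eq_of_bound {E H : Type*} [AddCommGroup E] [Module ℂ E] [NormedAddCommGroup H]
    [InnerProductSpace ℂ H] [CompleteSpace H] (y : E →ₗ[ℂ] H) (l : E →ₗ[ℂ] ℂ) {C : ℝ}
    (h : ∀ e, ‖l e‖ ≤ C * ‖y e‖) : ∃ w : H, ∀ e, ⟪w, y e⟫_ℂ = l e := by
  have hker : LinearMap.ker y ≤ LinearMap.ker l := fun e he => by
    have := h e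
    rw [LinearMap.mem_ker.1 he, norm_zero, mul_zero] at this; exact norm_le_zero_iff.1 this
  let l' : LinearMap.range y →ₗ[ℂ] ℂ :=
    ((LinearMap.ker y).liftQ l hker).comp y.quotKerEquivRange.symm.toLinearMap
  have hl : ∀ e, l' ⟨y e, LinearMap.mem_range_self y e⟩ = l e := fun e => by
    have : y.quotKerEquivRange.symm ⟨y e, LinearMap.mem_range_self y e⟩ = (LinearMap.ker y).mkQ e :=
      y.quotKerEquivRange_symm_apply_image e _
    simp only [l', LinearMap.comp_apply, LinearEquiv.coe_coe]
    rw [this]; simp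
  let L : LinearMap.range y →L[ℂ] ℂ := l'.mkContinuous C (by
    rintro ⟨_, e, rfl⟩
    rw [hl]; exact h e)
  obtain ⟨g, hg, -⟩ := exists_extension_norm_eq (LinearMap.range y) L
  refine ⟨(InnerProductSpace.toDual ℂ H).symm g, fun e => ?_⟩
  rw [InnerProductSpace.toDual_symm_apply]
  exact (hg ⟨y e, LinearMap.mem_range_self y e⟩).trans (hl e)

lemma weight_half_sq (σ : ℝ) (k : ℕ) : ‖((((k : ℝ) + 1 / 2) ^ (σ / 2) : ℝ) : ℂ)‖ₑ ^ 2 = weight σ k := by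
  rw [← ofReal_norm, norm_real, norm_of_nonneg (by positivity), ← ofReal_pow (by positivity),
    weight, ← Real.rpow_natCast, ← Real.rpow_mul (by positivity)]
  congr 2
  push_cast
  ring

lemma exists_seq_inner_eq {E : Type*} [AddCommGroup E] [Module ℂ E] (y : E →ₗ[ℂ] (ℕ → ℝ → L2R)) (l : E →ₗ[ℂ] ℂ) (σ : ℝ) (hy : ∀ e k, MemLp (y e k) 2 (leb T))
    (hye : ∀ e, energy T (-σ) (y e) ≠ ⊤) {K : ℝ≥0∞} (hK : K ≠ ⊤)
    (h : ∀ e, ‖l e‖ₑ ^ 2 ≤ K * energy T (-σ) (y e)) :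
    ∃ u : ℕ → ℝ → L2R, MeasSeq T u ∧ energy T σ u ≠ ⊤ ∧ ∀ e, ∑' k, ∫ t in Icc 0 T, ⟪u k t, y e k t⟫_ℂ = l e := by
  set c : ℕ → ℂ := fun k => ((((k : ℝ) + 1 / 2) ^ (-σ / 2) : ℝ) : ℂ) with hc
  have hcw : ∀ k, ‖c k‖ₑ ^ 2 = weight (-σ) k := fun k => weight_half_sq (-σ) k
  have hz : ∀ e k, MemLp (fun t => c k • y e k t) 2 (leb T) := fun e k => memLp_smul (hy e k) _
  have hn : ∀ e k, ‖(hz e k).toLp‖ₑ ^ 2 = weight (-σ) k * eLpNorm (y e k) 2 (leb T) ^ 2 := fun e k => by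
    rw [Lp.enorm_toLp, ← hcw, ← mul_pow]
    exact congrArg (· ^ 2) (eLpNorm_const_smul (c k) (y e k) 2 _)
  have hsum : ∀ e, ∑' k, ‖(hz e k).toLp‖ₑ ^ 2 = energy T (-σ) (y e) := fun e => tsum_congr (hn e)
  have hmem : ∀ e, Memℓp (fun k => (hz e k).toLp) 2 := fun e => by
    refine memℓp_gen ?_
    have := summable_toReal ((hsum e).trans_ne (hye e))
    simpa using this
  let Z : E →ₗ[ℂ] lp (fun _ : ℕ => Lp L2R 2 (leb T)) 2 :=
    { toFun := fun e => ⟨fun k => (hz e k).toLp, hmem e⟩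
      map_add' := fun a b => by
        ext1
        funext k
        refine Eq.trans ?_ (MemLp.toLp_add (hz a k) (hz b k))
        refine MemLp.toLp_congr (hz (a + b) k) _ (.of_forall fun t => ?_)
        simp [smul_add]
      map_smul' := fun r a => by
        ext1
        funext k
        refine Eq.trans ?_ (MemLp.toLp_const_smul r (hz a k))
        refine MemLp.toLp_congr (hz (r • a) k) _ (.of_forall fun t => ?_)
        simp [smul_comm r] }
  have hZ : ∀ e, ‖Z e‖ₑ ^ 2 = energy T (-σ) (y e) := fun e => by
    have h1 := lp.norm_rpow_eq_tsum (p := 2) (by norm_num) (Z e)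
    simp only [toReal_ofNat, Real.rpow_ofNat] at h1
    rw [← hsum e, ← ofReal_norm, ← ofReal_pow (norm_nonneg _), h1, ofReal_tsum_of_nonneg]
    · refine tsum_congr fun k => ?_
      rw [ofReal_pow (norm_nonneg _), ofReal_norm]; rfl
    · intro k; positivity
    · have := (lp.memℓp (Z e)).summable (by norm_num)
      simpa using this
  have hbound : ∀ e, ‖l e‖ ≤ √K.toReal * ‖Z e‖ := fun e => by
    have h1 := h e
    rw [← hZ e, ← ofReal_norm, ← ofReal_norm, ← ENNReal.ofReal_toReal hK, ← ofReal_pow (norm_nonneg _),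
      ← ofReal_pow (norm_nonneg _), ← ofReal_mul (by positivity),
      ENNReal.ofReal_le_ofReal_iff (by positivity)] at h1
    rw [← sqrt_sq (norm_nonneg (Z e)), ← sqrt_mul (by positivity)]; exact Real.le_sqrt_of_sq_le h1
  obtain ⟨w, hw⟩ := exists_inner_eq_of_bound Z l hbound
  have hwm : ∀ k, MemLp (fun t => (w k : ℝ → L2R) t) 2 (leb T) := fun k => Lp.memLp (w k)
  refine ⟨fun k t => c k • (w k : ℝ → L2R) t, fun k => (memLp_smul (hwm k) _).1, ?_, fun e => ?_⟩
  · have h1 := (lp.memℓp w).summable (by norm_num)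
    simp only [toReal_ofNat, Real.rpow_ofNat] at h1
    have h2 : energy T σ (fun k t => c k • (w k : ℝ → L2R) t) ≤ 1 * energy T 0 (fun k => (w k : ℝ → L2R)) :=
      energy_const_mul_le _ fun k => by rw [hcw, mul_comm, weight_neg_mul]; simp
    refine ne_top_of_le_ne_top ?_ h2
    rw [one_mul, energy]
    have h3 : ∀ k, weight 0 k * eLpNorm (w k : ℝ → L2R) 2 (leb T) ^ 2 = ofReal (‖w k‖ ^ 2) := fun k => by
      rw [weight_zero, one_mul, ofReal_pow (norm_nonneg _), ofReal_norm, Lp.enorm_def]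
    simp only [h3]; exact h1.tsum_ofReal_ne_top
  · rw [← hw e, lp.inner_eq_tsum]
    refine tsum_congr fun k => ?_
    rw [L2.inner_def]
    refine integral_congr_ae ?_
    filter_upwards [(hz e k).coeFn_toLp] with t ht
    have : ((Z e : ∀ k, Lp L2R 2 (leb T)) k : ℝ → L2R) t = c k • y e k t := ht
    rw [this, inner_smul_left, inner_smul_right, hc]; simp

/-- The space of test functions. -/
def testSpace (T : ℝ) : Submodule ℂ (ℝ × ℝ × ℝ → ℂ) where
  carrier := {φ | IsTest T φ}
  add_mem' := fun {a b} ha hb => ⟨ha.smooth.add hb.smooth, ha.compact.add hb.compact, fun p hp => by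
    rcases tsupport_add a b hp with h | h
    · exact ha.before p h
    · exact hb.before p h⟩
  zero_mem' := ⟨contDiff_const, HasCompactSupport.zero, fun p hp => by
    rw [tsupport_eq_empty_iff.2 rfl] at hp; exact hp.elim⟩
  smul_mem' := fun c a ha => ⟨contDiff_const.smul ha.smooth, ha.compact.smul_left (f := fun _ => c),
    fun p hp => ha.before p (tsupport_smul_subset_right (fun _ => c) a hp)⟩

section linear

variable {F G : ℝ × ℝ × ℝ → ℂ}

lemma integrable_mul_hermiteFun (hf : MemLp f 2 volume) (k : ℕ) :
    Integrable (fun v => f v * (hermiteFun k v : ℂ)) volume := hf.integrable_mul (memLp_hermiteFun k)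

lemma tcoef_add (hF : IsBump₃ F) (hG : IsBump₃ G) (k : ℕ) (t : ℝ) : tcoef (F + G) k t = tcoef F k t + tcoef G k t := by
  rw [tcoef, tcoef, tcoef, seq, seq, seq, ← toL2_add (memLp_coef (F := fun x v => F (t, x, v)) (hF.sqInt t) k)
    (memLp_coef (F := fun x v => G (t, x, v)) (hG.sqInt t) k)]
  congr 1
  ext x
  simp only [coef, Pi.add_apply, add_mul]
  exact integral_add (integrable_mul_hermiteFun ((hF.isBump_third t x).memLp 2) k) (integrable_mul_hermiteFun ((hG.isBump_third t x).memLp 2) k)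

lemma tcoef_smul (c : ℂ) (hF : IsBump₃ F) (k : ℕ) (t : ℝ) : tcoef (c • F) k t = c • tcoef F k t := by
  rw [tcoef, tcoef, seq, seq, ← toL2_const_mul _ (memLp_coef (F := fun x v => F (t, x, v)) (hF.sqInt t) k)]
  congr 1
  ext x
  simp only [coef, Pi.smul_apply, smul_eq_mul, mul_assoc]
  rw [integral_const_mul]

lemma transport_add (hF : IsBump₃ F) (hG : IsBump₃ G) : transport (F + G) = transport F + transport G := by
  ext p
  have h1 : ∀ e, dir e (F + G) p = dir e F p + dir e G p := fun e => by
    rw [dir, fderiv_add ((hF.smooth.differentiable (by simp)) p) ((hG.smooth.differentiable (by simp)) p)]; rfl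
  simp only [transport, Pi.add_apply, h1]
  ring

lemma transport_smul (c : ℂ) (hF : IsBump₃ F) : transport (c • F) = c • transport F := by
  ext p
  have h1 : ∀ e, dir e (c • F) p = c * dir e F p := fun e => by
    rw [dir, fderiv_const_smul ((hF.smooth.differentiable (by simp)) p)]; rfl
  simp only [transport, Pi.smul_apply, h1, smul_eq_mul]
  ring

end linear

lemma hasSum_tcoef_sq {F : ℝ × ℝ × ℝ → ℂ} (hF : IsBump₃ F) (t : ℝ) : Summable fun k => ‖tcoef F k t‖ ^ 2 := by
  have hs := hasSum_inner_seq (hF.sqInt t) (hF.sqInt t)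
  have n1 : ∀ a : L2R, ⟪a, a⟫_ℂ = ((‖a‖ ^ 2 : ℝ) : ℂ) := fun a => by
    rw [inner_self_eq_norm_sq_to_K]; push_cast; rfl
  simp only [n1] at hs
  exact Complex.summable_ofReal.1 hs.summable

lemma enorm_inner_le (a b : L2R) : ‖⟪a, b⟫_ℂ‖ₑ ≤ ‖a‖ₑ * ‖b‖ₑ := by
  rw [← ofReal_norm, ← ofReal_norm, ← ofReal_norm, ← ofReal_mul (norm_nonneg _)]
  exact ofReal_le_ofReal (norm_inner_le_norm _ _)

lemma tsum_mul_sq_le (a b : ℕ → ℝ≥0∞) : (∑' k, a k * b k) ^ 2 ≤ (∑' k, a k ^ 2) * ∑' k, b k ^ 2 := by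
  have h := hoelder_wnorm 0 a b
  have h2 : (∑' k, a k * b k) ^ 2 ≤ (wnorm (-0) a * wnorm 0 b) ^ 2 := by gcongr
  rw [mul_pow, wnorm_sq, wnorm_sq] at h2
  simpa using h2

lemma tsum_enorm_sq_tcoef {F : ℝ × ℝ × ℝ → ℂ} (hF : IsBump₃ F) (t : ℝ) : ∑' k, ‖tcoef F k t‖ₑ ^ 2 = ofReal (∑' k, ‖tcoef F k t‖ ^ 2) := by
  rw [ofReal_tsum_of_nonneg (fun k => by positivity) (hasSum_tcoef_sq hF t)]
  refine tsum_congr fun k => ?_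
  rw [ofReal_pow (norm_nonneg _), ofReal_norm]

lemma two_term_sq_le (a b : ℝ≥0∞) : (a + b) ^ 2 ≤ 2 * (a ^ 2 + b ^ 2) := by
  have h2 := sum_mul_sq_le (Finset.univ : Finset (Fin 2)) (fun _ => 1) ![a, b]
  simp only [one_mul, Fin.sum_univ_two, one_pow, Matrix.cons_val_zero, Matrix.cons_val_one] at h2
  rwa [one_add_one_eq_two] at h2

lemma sq_mul_le_cancel {x y : ℝ≥0∞} (hx : x ≠ ⊤) (h : x ^ 2 ≤ y * x) : x ≤ y := by
  rcases eq_or_ne x 0 with h0 | h0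
  · simp [h0]
  · rw [sq] at h
    exact (ENNReal.mul_le_mul_iff_left h0 hx).1 h

/-- Existence for the linear problem. -/
lemma exists_isWeakSeq (hs : s ∈ Ioo 0 1) (hT : 0 ≤ T) {u₀ : ℕ → L2R} {f : ℕ → ℝ → L2R} (hu₀ : ∑' k, ‖u₀ k‖ₑ ^ 2 ≠ ⊤) (hf : MeasSeq T f)
    (hfe : energy T (-s) f ≠ ⊤) :
    ∃ u : ℕ → ℝ → L2R, MeasSeq T u ∧ energy T s u ≠ ⊤ ∧ IsWeakSeq s T u₀ u f := by
  have hfm := memLp_of_energy hf hfe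
  have hB : ∀ e : testSpace T, IsBump₃ e.1 := fun e => IsTest.isBump e.2
  let y : testSpace T →ₗ[ℂ] (ℕ → ℝ → L2R) :=
    { toFun := fun e => adjoint s e.1
      map_add' := fun a b => by
        funext k t
        simp only [adjoint, Pi.add_apply, Submodule.coe_add]
        rw [transport_add (hB a) (hB b), tcoef_add (hB a) (hB b), tcoef_add (hB a).transport (hB b).transport]
        module
      map_smul' := fun c a => by
        funext k t
        simp only [adjoint, Pi.smul_apply, Submodule.coe_smul, RingHom.id_apply]
        rw [transport_smul c (hB a), tcoef_smul c (hB a), tcoef_smul c (hB a).transport]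
        module }
  have hs1 : ∀ e : testSpace T, Summable fun k => ∫ t in Icc 0 T, ⟪f k t, tcoef e.1 k t⟫_ℂ := fun e =>
    summable_integral_inner hf (fun k => (memLp_tcoef (hB e) T k).1) hfe (energy_tcoef_lt_top (hB e) T hs.1.le (by linarith [hs.2])).ne
  have hb0 : ∀ e : testSpace T, (∑' k, ‖u₀ k‖ₑ * ‖tcoef e.1 k 0‖ₑ) ^ 2 ≤ (∑' k, ‖u₀ k‖ₑ ^ 2) * ofReal (∑' k, ‖tcoef e.1 k 0‖ ^ 2) := fun e => by
    rw [← tsum_enorm_sq_tcoef (hB e)]; exact tsum_mul_sq_le _ _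
  have hs2 : ∀ e : testSpace T, Summable fun k => ⟪u₀ k, tcoef e.1 k 0⟫_ℂ := fun e => by
    refine summable_of_tsum_enorm (ne_top_of_le_ne_top ?_ (tsum_le_tsum fun k => enorm_inner_le _ _))
    intro h
    have := hb0 e
    rw [h] at this
    simp only [ne_eq, OfNat.ofNat_ne_zero, not_false_eq_true, ENNReal.top_pow, top_le_iff] at this
    exact mul_ne_top hu₀ ofReal_ne_top this
  let l : testSpace T →ₗ[ℂ] ℂ :=
    { toFun := fun e => (∑' k, ∫ t in Icc 0 T, ⟪f k t, tcoef e.1 k t⟫_ℂ) + ∑' k, ⟪u₀ k, tcoef e.1 k 0⟫_ℂ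
      map_add' := fun a b => by
        have e1 : ∀ k, ∫ t in Icc 0 T, ⟪f k t, tcoef (a + b).1 k t⟫_ℂ
            = (∫ t in Icc 0 T, ⟪f k t, tcoef a.1 k t⟫_ℂ) + ∫ t in Icc 0 T, ⟪f k t, tcoef b.1 k t⟫_ℂ := fun k => by
          rw [← integral_add (integrable_inner_of_memLp (hfm k) (memLp_tcoef (hB a) T k)) (integrable_inner_of_memLp (hfm k) (memLp_tcoef (hB b) T k))]
          refine integral_ext fun t => ?_
          simp only [Submodule.coe_add, tcoef_add (hB a) (hB b), inner_add_right]
        simp only [e1]; simp only [Submodule.coe_add, tcoef_add (hB a) (hB b), inner_add_right]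
        rw [(hs1 a).tsum_add (hs1 b), (hs2 a).tsum_add (hs2 b)]; ring
      map_smul' := fun c a => by
        simp only [Submodule.coe_smul, tcoef_smul c (hB a), inner_smul_right, integral_const_mul, tsum_mul_left, RingHom.id_apply, smul_eq_mul]
        ring }
  set F₀ := energy T (-s) f with hF₀
  set U₀ := ∑' k, ‖u₀ k‖ₑ ^ 2 with hU₀
  set K := ofReal (1280 * (1 + T)) with hK
  obtain ⟨u, hum, hue, hu⟩ := exists_seq_inner_eq y l s (fun e k => memLp_adjoint s (hB e) T k)
    (fun e => (energy_adjoint_lt_top hs (hB e) T).ne) (K := 2 * (F₀ + U₀) * K ^ 2)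
    (mul_ne_top (mul_ne_top (by simp) (ENNReal.add_ne_top.2 ⟨hfe, hu₀⟩)) (pow_ne_top ofReal_ne_top)) fun e => by
      set X := ofReal (∑' k, ‖tcoef e.1 k 0‖ ^ 2) + energy T s (tcoef e.1) with hX
      have hXtop : X ≠ ⊤ := ENNReal.add_ne_top.2 ⟨ofReal_ne_top, (energy_tcoef_lt_top (hB e) T hs.1.le (by linarith [hs.2])).ne⟩
      have hXle : X ≤ K ^ 2 * energy T (-s) (adjoint s e.1) := by
        refine sq_mul_le_cancel hXtop ?_
        have h1 := adjoint_estimate hs hT e.2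
        have h2 := tsum_lintegral_mul_le (T := T) (σ := s) (fun k => (memLp_adjoint s (hB e) T k).1) (fun k => (memLp_tcoef (hB e) T k).1)
        simp only [mul_comm ‖adjoint s _ _ _‖ₑ] at h2
        calc X ^ 2 ≤ (K * ∑' k, ∫⁻ t in Icc 0 T, ‖tcoef e.1 k t‖ₑ * ‖adjoint s e.1 k t‖ₑ) ^ 2 := by gcongr
          _ ≤ K ^ 2 * (energy T (-s) (adjoint s e.1) * energy T s (tcoef e.1)) := by rw [mul_pow]; gcongr
          _ ≤ K ^ 2 * (energy T (-s) (adjoint s e.1) * X) := by gcongr; exact le_add_self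
          _ = _ := by ring
      have hA : (∑' k, ∫⁻ t in Icc 0 T, ‖f k t‖ₑ * ‖tcoef e.1 k t‖ₑ) ^ 2 ≤ F₀ * energy T s (tcoef e.1) :=
        tsum_lintegral_mul_le hf fun k => (memLp_tcoef (hB e) T k).1
      have hl : ‖l e‖ₑ ≤ (∑' k, ∫⁻ t in Icc 0 T, ‖f k t‖ₑ * ‖tcoef e.1 k t‖ₑ) + ∑' k, ‖u₀ k‖ₑ * ‖tcoef e.1 k 0‖ₑ := by
        refine (enorm_add_le _ _).trans (add_le_add ?_ ?_)
        · exact (enorm_tsum_le _).trans (tsum_le_tsum fun k => enorm_integral_inner_le _ _ _)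
        · exact (enorm_tsum_le _).trans (tsum_le_tsum fun k => enorm_inner_le _ _)
      calc ‖l e‖ₑ ^ 2 ≤ (_ + _) ^ 2 := by gcongr
        _ ≤ 2 * (_ ^ 2 + _ ^ 2) := two_term_sq_le _ _
        _ ≤ 2 * (F₀ * X + U₀ * X) := by
          gcongr
          · exact hA.trans (by gcongr; exact le_add_self)
          · exact (hb0 e).trans (by gcongr; exact le_self_add)
        _ = 2 * (F₀ + U₀) * X := by ring
        _ ≤ 2 * (F₀ + U₀) * (K ^ 2 * energy T (-s) (adjoint s e.1)) := by gcongr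
        _ = _ := by rw [mul_assoc _ (K ^ 2)]; rfl
  refine ⟨u, hum, hue, fun φ hφ => ?_⟩
  have hum2 := memLp_of_energy hum hue
  have hφB := hφ.isBump
  have key := congrArg conj (hu ⟨φ, hφ⟩)
  simp only [l, LinearMap.coe_mk, AddHom.coe_mk, y, map_add, Complex.conj_tsum, ← integral_conj, inner_conj_symm] at key
  obtain ⟨C, hC, hrel⟩ := exists_energy_relax_le hs
  have S1 : Summable fun k => ∫ t in Icc 0 T, ⟪tcoef φ k t, (rate s k : ℂ) • u k t⟫_ℂ := by
    refine summable_integral_inner (σ := -s) (fun k => (memLp_tcoef hφB T k).1)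
      (b := fun k t => (rate s k : ℂ) • u k t) (fun k => (memLp_smul (hum2 k) _).1) ?_ ?_
    · rw [neg_neg]; exact (energy_tcoef_lt_top hφB T hs.1.le (by linarith [hs.2])).ne
    · exact ne_top_of_le_mul hC hue (hrel T u)
  have S2 : Summable fun k => ∫ t in Icc 0 T, ⟪tcoef φ k t, f k t⟫_ℂ := by
    refine summable_integral_inner (σ := -s) (fun k => (memLp_tcoef hφB T k).1) hf ?_ hfe
    rw [neg_neg]; exact (energy_tcoef_lt_top hφB T hs.1.le (by linarith [hs.2])).ne
  have S3 : Summable fun k => ∫ t in Icc 0 T, ⟪tcoef (transport φ) k t, u k t⟫_ℂ := by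
    refine summable_integral_inner (σ := s) (fun k => (memLp_tcoef hφB.transport T k).1) hum ?_ hue
    exact ne_top_of_le_mul (by simp) (energy_tcoef_zero_lt_top hφB.transport T).ne
      (energy_mono_weight (by linarith [hs.1, hs.2]) (by linarith [hs.1, hs.2]) _)
  have i1 := fun k => integrable_inner_of_memLp (memLp_tcoef hφB T k) (memLp_smul (hum2 k) (rate s k : ℂ))
  have i2 := fun k => integrable_inner_of_memLp (memLp_tcoef hφB T k) (hfm k)
  have i3 := fun k => integrable_inner_of_memLp (memLp_tcoef hφB.transport T k) (hum2 k)
  have e1 : ∀ k, ∫ t in Icc 0 T, ⟪tcoef φ k t, (rate s k : ℂ) • u k t - f k t⟫_ℂ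
      = (∫ t in Icc 0 T, ⟪tcoef φ k t, (rate s k : ℂ) • u k t⟫_ℂ) - ∫ t in Icc 0 T, ⟪tcoef φ k t, f k t⟫_ℂ := fun k => by
    rw [← integral_sub (i1 k) (i2 k)]; simp only [inner_sub_right]
  have e2 : ∀ k, ∫ t in Icc 0 T, ⟪adjoint s φ k t, u k t⟫_ℂ
      = (∫ t in Icc 0 T, ⟪tcoef φ k t, (rate s k : ℂ) • u k t⟫_ℂ) - ∫ t in Icc 0 T, ⟪tcoef (transport φ) k t, u k t⟫_ℂ := fun k => by
    rw [← integral_sub (i1 k) (i3 k)]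
    simp only [adjoint, inner_sub_left, inner_smul_left, inner_smul_right, conj_ofReal]
  simp only [e2] at key
  rw [S1.tsum_sub S3] at key
  simp only [e1]
  rw [S1.tsum_sub S2, sub_eq_iff_eq_add]
  rw [sub_eq_iff_eq_add] at key
  rw [key]
  ring

end

section

open Polynomial (X C hermite derivative eval eval_mul eval_map aeval_def eval_X derivative_mul aeval eval_C eval_add hermite_succ)

/-! ## The equation of a single Hermite mode -/

lemma eLpNorm_sq_eq_ofReal (hf : MemLp f 2 volume) : eLpNorm f 2 volume ^ 2 = ofReal (∫ v, ‖f v‖ ^ 2) := by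
  rw [eLpNorm_two_sq, ofReal_integral_eq_lintegral_ofReal ((memLp_two_iff_integrable_sq_norm hf.1).1 hf) (.of_forall fun v => by positivity)]
  refine lintegral_congr fun v => ?_
  rw [ofReal_pow (norm_nonneg _), ofReal_norm]

lemma coef_sub (k : ℕ) (hf : MemLp f 2 volume) (hg : MemLp g 2 volume) : coef k (fun v => f v - g v) = coef k f - coef k g := by
  simp only [coef, sub_mul]
  exact integral_sub (integrable_mul_hermiteFun hf k) (integrable_mul_hermiteFun hg k)

lemma tendsto_tsum_enorm_coef_sq {f : ℕ → ℝ → ℂ} (hf : ∀ n, MemLp (f n) 2 volume) (hg : MemLp g 2 volume)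
    (h : Tendsto (fun n => ∫ v, ‖f n v - g v‖ ^ 2) atTop (nhds 0)) :
    Tendsto (fun n => ∑' k, ‖coef k (f n) - coef k g‖ₑ ^ 2) atTop (nhds 0) := by
  have e : ∀ n, ∑' k, ‖coef k (f n) - coef k g‖ₑ ^ 2 = ofReal (∫ v, ‖f n v - g v‖ ^ 2) := fun n => by
    have hm : MemLp (fun v => f n v - g v) 2 volume := (hf n).sub hg
    rw [← eLpNorm_sq_eq_ofReal hm, ← tsum_enorm_coef_sq hm]
    exact tsum_congr fun k => by rw [coef_sub k (hf n) hg]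
  simp only [e]
  simpa using ENNReal.tendsto_ofReal h

lemma tendsto_coef {f : ℕ → ℝ → ℂ} (hf : ∀ n, MemLp (f n) 2 volume) (hg : MemLp g 2 volume)
    (h : Tendsto (fun n => ∫ v, ‖f n v - g v‖ ^ 2) atTop (nhds 0)) (k : ℕ) :
    Tendsto (fun n => coef k (f n)) atTop (nhds (coef k g)) := by
  have h1 := tendsto_of_tendsto_of_tendsto_of_le_of_le tendsto_const_nhds (tendsto_tsum_enorm_coef_sq hf hg h) (fun n => zero_le)
    (fun n => le_tsum (f := fun k => ‖coef k (f n) - coef k g‖ₑ ^ 2) k)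
  rw [tendsto_iff_edist_tendsto_0]
  have h2 := h1.ennrpow_const (1 / 2)
  rw [ENNReal.zero_rpow_of_pos (by norm_num)] at h2
  refine h2.congr fun n => ?_
  rw [← rpow_natCast, ← rpow_mul, edist_eq_enorm_sub]
  norm_num

lemma memLp_cutg (n : ℕ) (p : ℝ[X]) : MemLp (cutg n p) 2 volume := (isBump_cutg n p).memLp 2

/-- The image of `gpoly p` under the oscillator. -/
def oscPoly (p : ℝ[X]) : ℝ[X] :=
  -gderiv (gderiv p) + C (1 / 4) * X ^ 2 * p

lemma tendsto_oscillator_cutg (p : ℝ[X]) : Tendsto (fun n => ∫ v, ‖oscillator (cutg n p) v - (gpoly (oscPoly p) v : ℂ)‖ ^ 2) atTop (nhds 0) := by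
  refine (tendsto_integral_oscillator_cutoff p).congr fun n => ?_
  refine integral_ext fun v => ?_
  simp only [gpoly, oscPoly, eval_add, Polynomial.eval_neg, eval_mul, eval_C, Polynomial.eval_pow, eval_X]
  congr 3
  push_cast
  ring

lemma coef_oscPoly (p : ℝ[X]) (k : ℕ) : coef k (fun v => (gpoly (oscPoly p) v : ℂ)) = ((k : ℂ) + 1 / 2) * coef k (fun v => (gpoly p v : ℂ)) := by
  have h1 := tendsto_coef (fun n => (isBump_cutg n p).oscillator.memLp 2) (memLp_gpoly (oscPoly p)) (tendsto_oscillator_cutg p) k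
  have h2 := (tendsto_coef (fun n => memLp_cutg n p) (memLp_gpoly p) (tendsto_integral_cutoff p) k).const_mul ((k : ℂ) + 1 / 2)
  simp only [coef_oscillator (isBump_cutg _ p)] at h1
  exact tendsto_nhds_unique h1 h2

lemma enorm_natCast_add_half_sq (k : ℕ) : ‖((k : ℂ) + 1 / 2)‖ₑ ^ 2 = weight 2 k := by
  have : ((k : ℂ) + 1 / 2) = (((k : ℝ) + 1 / 2 : ℝ) : ℂ) := by push_cast; ring
  rw [this, ← ofReal_norm, norm_real, norm_of_nonneg (by positivity), weight,
    ← ofReal_pow (by positivity)]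
  norm_num

lemma tsum_mul_sq_le_weight (c X : ℕ → ℂ) : (∑' j, ‖c j‖ₑ * ‖X j‖ₑ) ^ 2 ≤ (∑' j, weight 2 j * ‖c j‖ₑ ^ 2) * ∑' j, weight (-2) j * ‖X j‖ₑ ^ 2 := by
  have h := hoelder_wnorm (-2) (fun j => ‖c j‖ₑ) fun j => ‖X j‖ₑ
  have h2 : (∑' j, ‖c j‖ₑ * ‖X j‖ₑ) ^ 2 ≤ (wnorm (- -2) (fun j => ‖c j‖ₑ) * wnorm (-2) fun j => ‖X j‖ₑ) ^ 2 := by gcongr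
  rwa [mul_pow, wnorm_sq, wnorm_sq, neg_neg] at h2

lemma summable_conj_coef_mul {X : ℕ → ℂ} (hX : ∑' j, weight (-2) j * ‖X j‖ₑ ^ 2 ≠ ⊤) {q : ℝ → ℂ}
    (hq : MemLp q 2 volume) (hf : ∀ k, coef k q = ((k : ℂ) + 1 / 2) * coef k f) :
    Summable fun j => conj (coef j f) * X j := by
  refine summable_of_tsum_enorm ?_
  simp only [enorm_mul, RCLike.enorm_conj]
  intro hc
  have h1 := tsum_mul_sq_le_weight (fun j => coef j f) X
  rw [hc] at h1
  simp only [ne_eq, OfNat.ofNat_ne_zero, not_false_eq_true, ENNReal.top_pow, top_le_iff] at h1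
  refine mul_ne_top ?_ hX h1
  have : ∀ j, weight 2 j * ‖coef j f‖ₑ ^ 2 = ‖coef j q‖ₑ ^ 2 := fun j => by rw [hf, enorm_mul, mul_pow, enorm_natCast_add_half_sq]
  simp only [this, tsum_enorm_coef_sq hq]
  exact (pow_lt_top hq.2).ne

lemma summable_conj_coef_cutg {X : ℕ → ℂ} (hX : ∑' j, weight (-2) j * ‖X j‖ₑ ^ 2 ≠ ⊤) (n : ℕ) (p : ℝ[X]) : Summable fun j => conj (coef j (cutg n p)) * X j :=
  summable_conj_coef_mul hX ((isBump_cutg n p).oscillator.memLp 2) fun k => coef_oscillator (isBump_cutg n p) k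

lemma tendsto_tsum_coef (p : ℝ[X]) {X : ℕ → ℂ} (hX : ∑' j, weight (-2) j * ‖X j‖ₑ ^ 2 ≠ ⊤) :
    Tendsto (fun n => ∑' j, conj (coef j (cutg n p)) * X j) atTop (nhds (∑' j, conj (coef j fun v => (gpoly p v : ℂ)) * X j)) := by
  have hs1 := fun n => summable_conj_coef_cutg hX n p
  have hs2 := summable_conj_coef_mul hX (memLp_gpoly (oscPoly p)) (coef_oscPoly p)
  have hz := tendsto_tsum_enorm_coef_sq (fun n => (isBump_cutg n p).oscillator.memLp 2) (memLp_gpoly (oscPoly p)) (tendsto_oscillator_cutg p)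
  have hz2 := (ENNReal.Tendsto.mul_const hz (Or.inr hX)).ennrpow_const (1 / 2)
  rw [zero_mul, ENNReal.zero_rpow_of_pos (by norm_num)] at hz2
  rw [tendsto_iff_edist_tendsto_0]
  refine tendsto_of_tendsto_of_tendsto_of_le_of_le tendsto_const_nhds hz2 (fun n => zero_le) fun n => ?_
  have h1 := tsum_mul_sq_le_weight (fun j => coef j (cutg n p) - coef j fun v => (gpoly p v : ℂ)) X
  have h2 : ∀ j, weight 2 j * ‖coef j (cutg n p) - coef j fun v => (gpoly p v : ℂ)‖ₑ ^ 2
      = ‖coef j (oscillator (cutg n p)) - coef j fun v => (gpoly (oscPoly p) v : ℂ)‖ₑ ^ 2 := fun j => by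
    rw [coef_oscillator (isBump_cutg n p), coef_oscPoly, ← mul_sub, enorm_mul, mul_pow, enorm_natCast_add_half_sq]
  simp only [h2] at h1
  rw [edist_eq_enorm_sub, ← (hs1 n).tsum_sub hs2]
  calc _ ≤ ∑' j, ‖coef j (cutg n p) - coef j fun v => (gpoly p v : ℂ)‖ₑ * ‖X j‖ₑ := by
        refine (enorm_tsum_le _).trans (le_of_eq (tsum_congr fun j => ?_))
        rw [← sub_mul, ← map_sub, enorm_mul, RCLike.enorm_conj]
    _ = ((∑' j, ‖coef j (cutg n p) - coef j fun v => (gpoly p v : ℂ)‖ₑ * ‖X j‖ₑ) ^ 2) ^ (1 / 2 : ℝ) := by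
        rw [← rpow_natCast, ← rpow_mul]; norm_num
    _ ≤ _ := ENNReal.rpow_le_rpow h1 (by norm_num)

/-- A tensor product function. -/
def tensor (a b c : ℝ → ℂ) (p : ℝ × ℝ × ℝ) : ℂ := a p.1 * (b p.2.1 * c p.2.2)

variable {a b c : ℝ → ℂ}

lemma isTest_tensor (ha : IsBump a) (hT : tsupport a ⊆ Iio T) (hb : IsBump b) (hc : IsBump c) : IsTest T (tensor a b c) where
  smooth := (ha.smooth.comp contDiff_fst).mul ((hb.smooth.comp (contDiff_fst.comp contDiff_snd)).mul (hc.smooth.comp (contDiff_snd.comp contDiff_snd)))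
  compact := by
    refine HasCompactSupport.intro (ha.compact.isCompact.prod (hb.compact.isCompact.prod hc.compact.isCompact)) ?_
    rintro ⟨t, x, v⟩ hp
    simp only [mem_prod, not_and_or] at hp
    rcases hp with h | h | h <;> simp [tensor, image_eq_zero_of_notMem_tsupport h]
  before := fun p hp => by
    have : tsupport (tensor a b c) ⊆ Prod.fst ⁻¹' tsupport a := by
      refine closure_minimal (fun q hq => ?_) ((isClosed_tsupport a).preimage continuous_fst)
      exact subset_tsupport _ fun h0 => hq (by simp [tensor, h0])
    exact hT (this hp)

lemma tcoef_tensor (hb : IsBump b) (k : ℕ) (t : ℝ) : tcoef (tensor a b c) k t = (a t * coef k c) • toL2 b := by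
  rw [tcoef, seq, ← toL2_const_mul _ (hb.memLp 2)]
  congr 1
  ext x
  simp only [coef, tensor, mul_assoc]
  rw [integral_const_mul, integral_const_mul]
  ring

lemma transport_tensor (ha : IsBump a) (hT : tsupport a ⊆ Iio T) (hb : IsBump b) (hc : IsBump c) :
    transport (tensor a b c) = tensor (deriv a) b c + tensor a (deriv b) fun v => v * c v := by
  ext ⟨t, x, v⟩
  rw [transport_eq (isTest_tensor ha hT hb hc).isBump]
  have h1 : deriv (fun τ => tensor a b c (τ, x, v)) t = deriv a t * (b x * c v) :=
    ((ha.hasDerivAt t).mul_const (b x * c v)).deriv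
  have h2 : deriv (fun y => tensor a b c (t, y, v)) x = a t * (deriv b x * c v) :=
    (((hb.hasDerivAt x).mul_const (c v)).const_mul (a t)).deriv
  rw [h1, h2, Pi.add_apply, tensor, tensor]
  ring

lemma mul_cutg (n : ℕ) (p : ℝ[X]) : (fun v : ℝ => (v : ℂ) * cutg n p v) = cutg n (X * p) := by
  ext v
  simp only [cutg, gpoly, eval_mul, eval_X]
  push_cast
  ring

lemma tsum_conj_coef_hermitePoly (k : ℕ) (Z : ℕ → ℂ) : ∑' j, conj (coef j fun v => (gpoly (hermitePoly k) v : ℂ)) * Z j = Z k := by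
  simp only [← hermiteFun_eq_gpoly, coef_hermiteFun]
  rw [tsum_eq_single k fun j hj => by simp [hj]]
  simp

lemma tsum_conj_coef_mul_hermitePoly (k : ℕ) (Z : ℕ → ℂ) : ∑' j, conj (coef j fun v => (gpoly (X * hermitePoly k) v : ℂ)) * Z j
      = √(k + 1) * Z (k + 1) + √k * Z (k - 1) := by
  have e : (fun v => (gpoly (X * hermitePoly k) v : ℂ)) = fun v => (√(k + 1) : ℂ) * (hermiteFun (k + 1) v : ℂ) + (√k : ℂ) * (hermiteFun (k - 1) v : ℂ) := by
    ext v
    have : gpoly (X * hermitePoly k) v = v * hermiteFun k v := by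
      rw [hermiteFun_eq_gpoly]; simp only [gpoly, eval_mul, eval_X]; ring
    rw [this, mul_hermiteFun]; push_cast; ring
  have h : ∀ j, coef j (fun v => (gpoly (X * hermitePoly k) v : ℂ))
      = (√(k + 1) : ℂ) * (if j = k + 1 then 1 else 0) + (√k : ℂ) * (if j = k - 1 then 1 else 0) := fun j => by
    rw [e, ← coef_hermiteFun, ← coef_hermiteFun, coef, coef, coef, ← integral_const_mul, ← integral_const_mul,
      ← integral_add ((integrable_mul_hermiteFun (memLp_hermiteFun _) j).const_mul _) ((integrable_mul_hermiteFun (memLp_hermiteFun _) j).const_mul _)]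
    refine integral_ext fun v => ?_
    ring
  simp only [h]
  rw [tsum_eq_sum (s := {k + 1, k - 1}) fun j hj => by
    simp only [Finset.mem_insert, Finset.mem_singleton, not_or] at hj
    simp [hj.1, hj.2]]
  have hne : k + 1 ≠ k - 1 := by omega
  rw [Finset.sum_pair hne]
  simp [hne, hne.symm, conj_ofReal]

lemma lintegral_mul_sq_le {a b : ℝ → L2R} (ha : AEStronglyMeasurable a (leb T)) (hb : AEStronglyMeasurable b (leb T)) :
    (∫⁻ t in Icc 0 T, ‖a t‖ₑ * ‖b t‖ₑ) ^ 2 ≤ eLpNorm a 2 (leb T) ^ 2 * eLpNorm b 2 (leb T) ^ 2 := by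
  rw [← mul_pow, sq_le_sq_ennreal]
  have h1 := ENNReal.lintegral_mul_le_Lp_mul_Lq (leb T) Real.HolderConjugate.two_two ha.enorm hb.enorm
  refine h1.trans (le_of_eq ?_)
  rw [eLpNorm_eq_lintegral_rpow_enorm_toReal (by norm_num) (by norm_num),
    eLpNorm_eq_lintegral_rpow_enorm_toReal (by norm_num) (by norm_num)]
  simp

lemma tsum_weight_inner_ne_top {z : ℝ → L2R} (hz : MemLp z 2 (leb T)) {σ : ℝ} {w : ℕ → ℝ → L2R} (hw : MeasSeq T w) (hwe : energy T σ w ≠ ⊤) :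
    ∑' j, weight σ j * ‖∫ t in Icc 0 T, ⟪z t, w j t⟫_ℂ‖ₑ ^ 2 ≠ ⊤ := by
  refine ne_top_of_le_mul (pow_ne_top hz.2.ne (n := 2)) hwe ?_
  rw [energy, ← ENNReal.tsum_mul_left]
  refine tsum_le_tsum fun j => ?_
  calc weight σ j * ‖∫ t in Icc 0 T, ⟪z t, w j t⟫_ℂ‖ₑ ^ 2
      ≤ weight σ j * (eLpNorm z 2 (leb T) ^ 2 * eLpNorm (w j) 2 (leb T) ^ 2) := by
        gcongr
        exact (pow_le_pow_left₀ zero_le (enorm_integral_inner_le _ _ _) 2).trans (lintegral_mul_sq_le hz.1 (hw j))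
    _ = _ := by ring

lemma memLp_smul_const (ha : IsBump a) (B : L2R) : MemLp (fun t => a t • B) 2 (leb T) :=
  (ha.smooth.continuous.smul continuous_const).memLp_of_hasCompactSupport ha.compact.smul_right

/-- The data of the linear problem. -/
structure IsSolution (s T : ℝ) (u₀ : ℕ → L2R) (u f : ℕ → ℝ → L2R) : Prop where
  weak : IsWeakSeq s T u₀ u f
  initial : ∑' k, ‖u₀ k‖ₑ ^ 2 ≠ ⊤
  meas : MeasSeq T u
  energy : energy T s u ≠ ⊤
  meas_source : MeasSeq T f
  energy_source : Kac.energy T (-s) f ≠ ⊤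

namespace IsSolution

variable {u₀ : ℕ → L2R} {u f : ℕ → ℝ → L2R}

lemma memLp (h : IsSolution s T u₀ u f) (k : ℕ) : MemLp (u k) 2 (leb T) := memLp_of_energy h.meas h.energy k

lemma memLp_source (h : IsSolution s T u₀ u f) (k : ℕ) : MemLp (f k) 2 (leb T) :=
  memLp_of_energy h.meas_source h.energy_source k

lemma memLp_residual (h : IsSolution s T u₀ u f) (k : ℕ) : MemLp (fun t => (rate s k : ℂ) • u k t - f k t) 2 (leb T) :=
  memLp_sub (memLp_smul (h.memLp k) _) (h.memLp_source k)

lemma energy_residual (h : IsSolution s T u₀ u f) (hs : s ∈ Ioo 0 1) : Kac.energy T (-s) (fun k t => (rate s k : ℂ) • u k t - f k t) ≠ ⊤ := by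
  obtain ⟨C, hC, hrel⟩ := exists_energy_relax_le hs
  exact ne_top_of_le_mul (by simp) (ENNReal.add_ne_top.2 ⟨ne_top_of_le_mul hC h.energy (hrel T u), h.energy_source⟩)
    (energy_sub_le (a := fun k t => (rate s k : ℂ) • u k t) (fun k => (memLp_smul (h.memLp k) _).1) h.meas_source)

lemma energy_zero (h : IsSolution s T u₀ u f) (hs : s ∈ Ioo 0 1) : Kac.energy T 0 u ≠ ⊤ :=
  ne_top_of_le_mul (by simp) h.energy (energy_mono_weight hs.1.le (by linarith [hs.2]) u)

lemma mode_inner (h : IsSolution s T u₀ u f) (hs : s ∈ Ioo 0 1) (ha : IsBump a) (hT : tsupport a ⊆ Iio T) (hb : IsBump b) (k : ℕ) :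
    ∫ t in Icc 0 T, ⟪a t • toL2 b, (rate s k : ℂ) • u k t - f k t⟫_ℂ = (∫ t in Icc 0 T, ⟪deriv a t • toL2 b, u k t⟫_ℂ)
        + (√(k + 1) * (∫ t in Icc 0 T, ⟪a t • toL2 (deriv b), u (k + 1) t⟫_ℂ) + √k * (∫ t in Icc 0 T, ⟪a t • toL2 (deriv b), u (k - 1) t⟫_ℂ))
        + ⟪a 0 • toL2 b, u₀ k⟫_ℂ := by
  set w : ℕ → ℝ → L2R := fun k t => (rate s k : ℂ) • u k t - f k t with hw
  have hlow : ∀ {σ : ℝ} {z : ℕ → ℂ}, -2 ≤ σ → σ ≤ 0 → ∑' j, weight σ j * ‖z j‖ₑ ^ 2 ≠ ⊤ → ∑' j, weight (-2) j * ‖z j‖ₑ ^ 2 ≠ ⊤ := fun {σ z} h1 h2 hz => by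
    refine ne_top_of_le_mul (by simp : (4 : ℝ≥0∞) ≠ ⊤) hz ?_
    rw [← ENNReal.tsum_mul_left]
    refine tsum_le_tsum fun j => ?_
    rw [← mul_assoc]
    exact mul_le_mul' (weight_le h1 (by linarith) j) le_rfl
  have hue := h.energy_zero hs
  have hA := hlow (by linarith [hs.1, hs.2]) (by linarith [hs.1, hs.2]) (tsum_weight_inner_ne_top (memLp_smul_const (T := T) ha (toL2 b)) (fun k => (h.memLp_residual k).1) (h.energy_residual hs))
  have hB := hlow (by norm_num) le_rfl (tsum_weight_inner_ne_top (memLp_smul_const (T := T) ha.deriv (toL2 b)) h.meas hue)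
  have hD := hlow (by norm_num) le_rfl (tsum_weight_inner_ne_top (memLp_smul_const (T := T) ha (toL2 (deriv b))) h.meas hue)
  have hE : ∑' j, weight (-2) j * ‖⟪a 0 • toL2 b, u₀ j⟫_ℂ‖ₑ ^ 2 ≠ ⊤ := by
    refine hlow (σ := 0) (by norm_num) le_rfl ?_
    refine ne_top_of_le_mul (pow_ne_top (enorm_ne_top (x := a 0 • toL2 b)) (n := 2)) h.initial ?_
    rw [← ENNReal.tsum_mul_left]
    refine tsum_le_tsum fun j => ?_
    rw [weight_zero, one_mul, ← mul_pow]
    exact pow_le_pow_left₀ zero_le (enorm_inner_le _ _) 2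
  have key : ∀ n, ∑' j, conj (coef j (cutg n (hermitePoly k))) * (∫ t in Icc 0 T, ⟪a t • toL2 b, w j t⟫_ℂ)
      = (∑' j, conj (coef j (cutg n (hermitePoly k))) * (∫ t in Icc 0 T, ⟪deriv a t • toL2 b, u j t⟫_ℂ))
        + (∑' j, conj (coef j (cutg n (X * hermitePoly k))) * (∫ t in Icc 0 T, ⟪a t • toL2 (deriv b), u j t⟫_ℂ))
        + ∑' j, conj (coef j (cutg n (hermitePoly k))) * ⟪a 0 • toL2 b, u₀ j⟫_ℂ := fun n => by
    rw [← (summable_conj_coef_cutg hB n _).tsum_add (summable_conj_coef_cutg hD n _)]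
    have hc := isBump_cutg n (hermitePoly k)
    have hvc := isBump_cutg n (X * hermitePoly k)
    have hw := h.weak _ (isTest_tensor ha hT hb hc)
    have h1 := transport_tensor ha hT hb hc
    rw [mul_cutg] at h1
    have hT' : tsupport (deriv a) ⊆ Iio T := (tsupport_deriv_subset (𝕜 := ℝ)).trans hT
    have i1 := (isTest_tensor ha.deriv hT' hb hc).isBump
    have i2 := (isTest_tensor ha hT hb.deriv hvc).isBump
    rw [h1] at hw; simp only [tcoef_add i1 i2, tcoef_tensor hb, tcoef_tensor hb.deriv] at hw
    refine Eq.trans (tsum_congr fun j => ?_) (hw.trans (congrArg₂ _ (tsum_congr fun j => ?_) (tsum_congr fun j => ?_)))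
    · rw [← integral_const_mul]
      simp only [inner_smul_left, map_mul, mul_left_comm (conj (coef _ _)), mul_assoc]; rfl
    · rw [← integral_const_mul, ← integral_const_mul, ← integral_add
        (f := fun t => conj (coef j (cutg n (hermitePoly k))) * ⟪deriv a t • toL2 b, u j t⟫_ℂ)
        (g := fun t => conj (coef j (cutg n (X * hermitePoly k))) * ⟪a t • toL2 (deriv b), u j t⟫_ℂ)
        ((integrable_inner_of_memLp (memLp_smul_const ha.deriv _) (h.memLp j)).const_mul _)
        ((integrable_inner_of_memLp (memLp_smul_const ha _) (h.memLp j)).const_mul _)]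
      simp only [inner_add_left, inner_smul_left, map_mul, mul_left_comm (conj (coef _ _)), mul_assoc]
    · simp only [inner_smul_left, map_mul, mul_left_comm (conj (coef _ _)), mul_assoc]
  have lim := tendsto_nhds_unique (tendsto_tsum_coef (hermitePoly k) hA) ((((tendsto_tsum_coef (hermitePoly k) hB).add
    (tendsto_tsum_coef (X * hermitePoly k) hD)).add (tendsto_tsum_coef (hermitePoly k) hE)).congr fun n => (key n).symm)
  rwa [tsum_conj_coef_hermitePoly, tsum_conj_coef_hermitePoly, tsum_conj_coef_hermitePoly, tsum_conj_coef_mul_hermitePoly] at lim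

end IsSolution

/-! ## Duhamel's formula for frequency-localized modes -/

/-- The neighbouring modes produced by multiplication by `v`. -/
def shift (u : ℕ → ℝ → L2R) (k : ℕ) (t : ℝ) : L2R := (√(k + 1) : ℂ) • u (k + 1) t + (√k : ℂ) • u (k - 1) t

/-- Minus the time derivative of the mode `mult m (u k)`. -/
def slope (s : ℝ) (m : ℝ → ℂ) (u f : ℕ → ℝ → L2R) (k : ℕ) (t : ℝ) : L2R :=
  (rate s k : ℂ) • mult m (u k t) - mult m (f k t) + mult (dsymbol m) (shift u k t)

namespace IsSolution

variable {u₀ : ℕ → L2R} {u f : ℕ → ℝ → L2R}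

lemma memLp_shift (h : IsSolution s T u₀ u f) (k : ℕ) : MemLp (shift u k) 2 (leb T) :=
  (memLp_smul (h.memLp (k + 1)) _).add (memLp_smul (h.memLp (k - 1)) _)

lemma _root_.Kac.memLp_clm (L : L2R →L[ℂ] L2R) {w : ℝ → L2R} {μ : Measure ℝ} (hw : MemLp w 2 μ) : MemLp (fun t => L (w t)) 2 μ := L.comp_memLp' hw

lemma memLp_slope (h : IsSolution s T u₀ u f) (m : ℝ → ℂ) (k : ℕ) : MemLp (slope s m u f k) 2 (leb T) :=
  (memLp_sub (memLp_smul (memLp_clm _ (h.memLp k)) _) (memLp_clm _ (h.memLp_source k))).add (memLp_clm _ (h.memLp_shift k))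

lemma _root_.Kac.integrable_bump_smul (ha : IsBump a) {w : ℝ → L2R} (hw : MemLp w 2 (leb T)) : Integrable (fun t => a t • w t) (leb T) :=
  (hw.integrable (by norm_num)).smul_of_top_right ((ha.memLp ⊤).restrict _)

lemma mode_vector (h : IsSolution s T u₀ u f) (hs : s ∈ Ioo 0 1) (hm : IsBump m)
    (ha : IsBump a) (har : ∀ t, conj (a t) = a t) (hT : tsupport a ⊆ Iio T) (k : ℕ) :
    (∫ t in Icc 0 T, deriv a t • mult m (u k t)) + a 0 • mult m (u₀ k) = ∫ t in Icc 0 T, a t • slope s m u f k t := by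
  have hwm := h.memLp_residual k
  have har' : ∀ t, conj (deriv a t) = deriv a t := fun t => by
    have h1 : deriv (fun t => conj (a t)) t = conj (deriv a t) := (ha.hasDerivAt t).star.deriv
    rw [← h1]; simp only [har]
  have i1 := integrable_bump_smul ha hwm
  have i2 := integrable_bump_smul ha.deriv (h.memLp k)
  have i3 := integrable_bump_smul ha (h.memLp_shift k)
  have key := mult_eq_neg_of_weak_deriv hm (α := (∫ t in Icc 0 T, a t • ((rate s k : ℂ) • u k t - f k t)) - (∫ t in Icc 0 T, deriv a t • u k t) - a 0 • u₀ k)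
    (β := ∫ t in Icc 0 T, a t • shift u k t) fun b hb => by
      have e : ∀ {c : ℝ → ℂ}, IsBump c → ∀ α : L2R, ∫ x, c x * α x = ⟪toL2 (fun x => conj (c x)), α⟫_ℂ := fun hc α => by
        conv_rhs => rw [← toL2_coeFn α]
        rw [inner_toL2 (hc.conj.memLp 2) (Lp.memLp α)]; simp
      have hdb : (fun x => conj (deriv b x)) = deriv fun x => conj (b x) :=
        funext fun x => ((hb.hasDerivAt x).star.deriv).symm
      have hsw : ∀ (r : ℂ) (B w : L2R), conj r = r → ⟪B, r • w⟫_ℂ = ⟪r • B, w⟫_ℂ := fun r B w hr => by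
        rw [inner_smul_left, inner_smul_right, hr]
      rw [e hb, e hb.deriv, hdb, inner_sub_right, inner_sub_right, ← integral_inner i1, ← integral_inner i2, ← integral_inner i3]
      simp only [hsw _ _ _ (har _), hsw _ _ _ (har' _)]
      rw [h.mode_inner hs ha hT hb.conj k, ← integral_const_mul, ← integral_const_mul, ← integral_add
        (f := fun t => (√(k + 1) : ℂ) * ⟪a t • toL2 (deriv fun x => conj (b x)), u (k + 1) t⟫_ℂ)
        (g := fun t => (√k : ℂ) * ⟪a t • toL2 (deriv fun x => conj (b x)), u (k - 1) t⟫_ℂ)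
        ((integrable_inner_of_memLp (memLp_smul_const ha _) (h.memLp (k + 1))).const_mul _)
        ((integrable_inner_of_memLp (memLp_smul_const ha _) (h.memLp (k - 1))).const_mul _)]
      simp only [shift, inner_add_right, inner_smul_right]; ring
  rw [map_sub, map_sub, map_smul, ← ContinuousLinearMap.integral_comp_comm _ i1,
    ← ContinuousLinearMap.integral_comp_comm _ i2, ← ContinuousLinearMap.integral_comp_comm _ i3, sub_sub,
    sub_eq_iff_eq_add, ← sub_eq_neg_add, eq_sub_iff_add_eq] at key
  simp only [map_smul, map_sub] at key
  rw [← key, ← integral_add]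
  · refine integral_ext fun t => ?_
    simp only [slope, smul_add]
  · refine (integrable_bump_smul ha (memLp_clm (mult m) hwm)).congr (.of_forall fun t => ?_)
    simp only [map_sub, map_smul]
  · exact integrable_bump_smul ha (memLp_clm (mult (dsymbol m)) (h.memLp_shift k))

end IsSolution

/-! ## Weak derivatives in time -/

lemma exists_primitive {g : ℝ → ℝ} (hg : ContDiff ℝ ∞ g) (hc : HasCompactSupport g) (hT : tsupport g ⊆ Iio T) :
    ∃ a : ℝ → ℝ, ContDiff ℝ ∞ a ∧ HasCompactSupport a ∧ tsupport a ⊆ Iio T ∧ ∀ t, 0 ≤ t → deriv a t = g t ∧ a t = ∫ r in T..t, g r := by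
  set A : ℝ → ℝ := fun t => ∫ r in T..t, g r with hA
  have hAd : ∀ t, HasDerivAt A (g t) t := fun t => hg.continuous.integral_hasStrictDerivAt T t |>.hasDerivAt
  have hAs : ContDiff ℝ ∞ A := by
    refine contDiff_infty_iff_deriv.2 ⟨fun t => (hAd t).differentiableAt, ?_⟩
    rwa [show deriv A = g from funext fun t => (hAd t).deriv]
  obtain ⟨R, hRT, hR⟩ : ∃ R < T, tsupport g ⊆ Iic R := by
    rcases (tsupport g).eq_empty_or_nonempty with h0 | h0
    · exact ⟨T - 1, by linarith, by simp [h0]⟩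
    · obtain ⟨R, hR, hm⟩ := hc.isCompact.exists_isMaxOn h0 continuous_id.continuousOn
      exact ⟨R, hT hR, fun x hx => hm hx⟩
  have hA0 : ∀ t, R < t → A t = 0 := fun t ht => by
    refine (intervalIntegral.integral_congr (g := fun _ => (0 : ℝ)) fun r hr => ?_).trans (by simp)
    refine image_eq_zero_of_notMem_tsupport fun hr' => ?_
    have h1 := hR hr'
    have h2 := hr.1
    simp only [mem_Iic] at h1
    rcases le_total T t with h | h
    · rw [min_eq_left h] at h2; linarith
    · rw [min_eq_right h] at h2; linarith
  have hsupp : tsupport (fun t => Real.smoothTransition (t + 2) * A t) ⊆ Icc (-2) R := by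
    refine closure_minimal (fun t ht => ?_) isClosed_Icc
    by_contra hn
    rw [mem_Icc, not_and_or, not_le, not_le] at hn
    rcases hn with h | h
    · exact ht (by simp [Real.smoothTransition.zero_of_nonpos (by linarith : t + 2 ≤ 0)])
    · exact ht (by simp [hA0 t h])
  refine ⟨fun t => Real.smoothTransition (t + 2) * A t, (Real.smoothTransition.contDiff.comp (contDiff_id.add contDiff_const)).mul hAs,
    isCompact_Icc.of_isClosed_subset (isClosed_tsupport _) hsupp, fun t ht => (hsupp ht).2.trans_lt hRT,
    fun t ht => ⟨?_, ?_⟩⟩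
  · refine HasDerivAt.deriv ((hAd t).congr_of_eventuallyEq ?_)
    filter_upwards [lt_mem_nhds (by linarith : (-1 : ℝ) < t)] with r hr
    rw [Real.smoothTransition.one_of_one_le (by linarith), one_mul]
  · simp only [Real.smoothTransition.one_of_one_le (by linarith : 1 ≤ t + 2), one_mul]; rfl

lemma integral_triangle {E : Type*} [NormedAddCommGroup E] [NormedSpace ℝ E] {Φ : ℝ → ℝ → E} (h : Integrable (Function.uncurry Φ) ((leb T).prod (leb T))) :
    ∫ t in Icc 0 T, ∫ r in (0 : ℝ)..t, Φ t r = ∫ r in Icc 0 T, ∫ t in r..T, Φ t r := by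
  have hD : MeasurableSet {p : ℝ × ℝ | p.2 ≤ p.1} := measurableSet_le measurable_snd measurable_fst
  have key := integral_integral_swap (f := fun t r => {p : ℝ × ℝ | p.2 ≤ p.1}.indicator (Function.uncurry Φ) (t, r)) (h.indicator hD)
  have e1 : ∫ t in Icc 0 T, ∫ r in (0 : ℝ)..t, Φ t r = ∫ t in Icc 0 T, ∫ r in Icc 0 T, {p : ℝ × ℝ | p.2 ≤ p.1}.indicator (Function.uncurry Φ) (t, r) := by
    refine setIntegral_congr_fun measurableSet_Icc fun t ht => ?_
    have : ∀ r, {p : ℝ × ℝ | p.2 ≤ p.1}.indicator (Function.uncurry Φ) (t, r) = (Iic t).indicator (Φ t) r := fun r => by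
      by_cases hr : r ≤ t <;> simp [indicator, hr]
    simp only [this]
    rw [setIntegral_indicator measurableSet_Iic, intervalIntegral.integral_of_le ht.1, ← integral_Icc_eq_integral_Ioc]
    congr 2
    ext r; simp only [mem_inter_iff, mem_Icc, mem_Iic]; constructor
    · exact fun hr => ⟨⟨hr.1, hr.2.trans ht.2⟩, hr.2⟩
    · exact fun hr => ⟨hr.1.1, hr.2⟩
  have e2 : ∫ r in Icc 0 T, ∫ t in r..T, Φ t r = ∫ r in Icc 0 T, ∫ t in Icc 0 T, {p : ℝ × ℝ | p.2 ≤ p.1}.indicator (Function.uncurry Φ) (t, r) := by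
    refine setIntegral_congr_fun measurableSet_Icc fun r hr => ?_
    have : ∀ t, {p : ℝ × ℝ | p.2 ≤ p.1}.indicator (Function.uncurry Φ) (t, r) = (Ici r).indicator (fun t => Φ t r) t := fun t => by
      by_cases ht : r ≤ t <;> simp [indicator, ht]
    simp only [this]
    rw [setIntegral_indicator measurableSet_Ici, intervalIntegral.integral_of_le hr.2, ← integral_Icc_eq_integral_Ioc]
    congr 2
    ext t; simp only [mem_inter_iff, mem_Icc, mem_Ici]; constructor
    · exact fun ht => ⟨⟨hr.1.trans ht.1, ht.2⟩, ht.1⟩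
    · exact fun ht => ⟨ht.2, ht.1.2⟩
  rw [e1, e2, key]

variable {U G : ℝ → L2R} {U₀ : L2R}

lemma intervalIntegrable_of_leb {E : Type*} [NormedAddCommGroup E] {G : ℝ → E} (hG : Integrable G (leb T)) {a b : ℝ}
    (ha : a ∈ Icc 0 T) (hb : b ∈ Icc 0 T) : IntervalIntegrable G volume a b := by
  refine IntegrableOn.intervalIntegrable (hG.mono_measure (Measure.restrict_mono ?_ le_rfl))
  exact uIcc_subset_Icc ha hb

/-- The continuous representative. -/
def primitive (U₀ : L2R) (G : ℝ → L2R) (t : ℝ) : L2R := U₀ - ∫ r in (0 : ℝ)..t, G r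

lemma continuousOn_primitive (hT : 0 ≤ T) (hG : Integrable G (leb T)) : ContinuousOn (primitive U₀ G) (Icc 0 T) := by
  have := intervalIntegral.continuousOn_primitive_interval (a := 0) (b := T) (f := G) (μ := volume)
    (by rw [uIcc_of_le hT]; exact hG)
  rw [uIcc_of_le hT] at this
  exact continuousOn_const.sub this

lemma integrable_primitive (hT : 0 ≤ T) (hG : Integrable G (leb T)) : Integrable (primitive U₀ G) (leb T) :=
  (continuousOn_primitive hT hG).integrableOn_compact isCompact_Icc

lemma ae_eq_primitive (hT : 0 ≤ T) (hU : Integrable U (leb T)) (hG : Integrable G (leb T))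
    (h : ∀ a : ℝ → ℝ, ContDiff ℝ ∞ a → HasCompactSupport a → tsupport a ⊆ Iio T → (∫ t in Icc 0 T, deriv a t • U t) + a 0 • U₀ = ∫ t in Icc 0 T, a t • G t) :
    U =ᵐ[leb T] primitive U₀ G := by
  have hV := integrable_primitive (U₀ := U₀) hT hG
  have key := isOpen_Iio.ae_eq_zero_of_integral_contDiff_smul_eq_zero (U := Iio T) (μ := leb T)
    (f := fun t => U t - primitive U₀ G t) ((hU.sub hV).locallyIntegrable.locallyIntegrableOn _) fun g hg hc hgT => by
      obtain ⟨a, has, hac, haT, ha⟩ := exists_primitive hg hc hgT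
      have h1 := h a has hac haT
      have hgm : MemLp g ⊤ (leb T) := (hg.continuous.memLp_of_hasCompactSupport hc)
      have i1 : Integrable (fun t => g t • U t) (leb T) := hU.smul_of_top_right hgm
      have i2 : Integrable (fun t => g t • primitive U₀ G t) (leb T) := hV.smul_of_top_right hgm
      have hgi : Integrable g (leb T) := (hg.continuous.integrable_of_hasCompactSupport hc)
      have i3 : Integrable (fun t => g t • ∫ r in (0 : ℝ)..t, G r) (leb T) := by
        refine ((hgi.smul_const U₀).sub i2).congr (.of_forall fun t => ?_)
        simp only [Pi.sub_apply, primitive, smul_sub, sub_sub_cancel]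
      have e1 : ∫ t in Icc 0 T, deriv a t • U t = ∫ t in Icc 0 T, g t • U t :=
        setIntegral_congr_fun measurableSet_Icc fun t ht => by simp only [(ha t ht.1).1]
      have hprod : Integrable (Function.uncurry fun t r => g t • G r) ((leb T).prod (leb T)) := by
        refine (hgi.norm.mul_prod hG.norm).mono' (hgi.1.comp_fst.smul hG.1.comp_snd) (.of_forall fun p => ?_)
        simp [Function.uncurry, norm_smul]
      have tri := integral_triangle hprod
      simp only [intervalIntegral.integral_smul, intervalIntegral.integral_smul_const] at tri
      have e2 : ∫ t in Icc 0 T, a t • G t = - ∫ r in Icc 0 T, (∫ t in r..T, g t) • G r := by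
        rw [← integral_neg]
        refine setIntegral_congr_fun measurableSet_Icc fun t ht => ?_
        simp only [(ha t ht.1).2]; rw [intervalIntegral.integral_symm, neg_smul]
      have e3 : a 0 = - ∫ t in Icc 0 T, g t := by
        rw [(ha 0 le_rfl).2, intervalIntegral.integral_symm, intervalIntegral.integral_of_le hT, integral_Icc_eq_integral_Ioc]
      have e4 : ∫ t in Icc 0 T, g t • primitive U₀ G t = (∫ t in Icc 0 T, g t) • U₀ - ∫ t in Icc 0 T, g t • ∫ r in (0 : ℝ)..t, G r := by
        rw [← integral_smul_const, ← integral_sub (hgi.smul_const U₀) i3]; simp only [primitive, smul_sub]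
      simp only [smul_sub]; rw [integral_sub i1 i2, e4, tri]; rw [e1, e2, e3, neg_smul] at h1
      rw [eq_neg_iff_add_eq_zero] at h1; rw [← h1]; abel
  have hne : ∀ᵐ t ∂leb T, t ≠ T := by
    rw [ae_iff]
    refine measure_mono_null (t := {T}) (fun t ht => by simpa using ht) ?_
    exact nonpos_iff_eq_zero.1 ((Measure.restrict_apply_le _ _).trans (by simp))
  filter_upwards [key, ae_restrict_mem measurableSet_Icc, hne] with t h1 h2 h3
  exact sub_eq_zero.1 (h1 (lt_of_le_of_ne h2.2 h3))

lemma integrable_inner_primitive (hT : 0 ≤ T) (hG : Integrable G (leb T)) : Integrable (fun t => ⟪primitive U₀ G t, G t⟫_ℂ) (leb T) := by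
  obtain ⟨C, hC⟩ := isCompact_Icc.exists_bound_of_continuousOn (continuousOn_primitive (U₀ := U₀) hT hG)
  refine (hG.norm.const_mul C).mono' ((integrable_primitive hT hG).1.inner hG.1) ?_
  filter_upwards [ae_restrict_mem measurableSet_Icc] with t ht
  exact (norm_inner_le_norm _ _).trans (mul_le_mul_of_nonneg_right (hC t ht) (norm_nonneg _))

lemma inner_intervalIntegral {a b : ℝ} (hG : IntervalIntegrable G volume a b) (B : L2R) : ⟪B, ∫ ρ in a..b, G ρ⟫_ℂ = ∫ ρ in a..b, ⟪B, G ρ⟫_ℂ :=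
  ((innerSL ℂ B).intervalIntegral_comp_comm hG).symm

lemma intervalIntegral_inner {a b : ℝ} (hG : IntervalIntegrable G volume a b) (B : L2R) : ⟪∫ ρ in a..b, G ρ, B⟫_ℂ = ∫ ρ in a..b, ⟪G ρ, B⟫_ℂ := by
  rw [← inner_conj_symm, inner_intervalIntegral hG]
  simp only [intervalIntegral, map_sub, ← integral_conj, inner_conj_symm]

lemma inner_integral_self (hG : Integrable G (leb T)) (hT : 0 ≤ T) :
    ‖∫ r in (0 : ℝ)..T, G r‖ ^ 2 = 2 * (∫ r in Icc 0 T, ⟪∫ ρ in (0 : ℝ)..r, G ρ, G r⟫_ℂ).re := by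
  have hprod : Integrable (Function.uncurry fun ρ r => ⟪G ρ, G r⟫_ℂ) ((leb T).prod (leb T)) := by
    refine (hG.norm.mul_prod hG.norm).mono' (hG.1.comp_fst.inner hG.1.comp_snd) (.of_forall fun p => ?_)
    exact norm_inner_le_norm _ _
  have h0 : (0 : ℝ) ∈ Icc 0 T := ⟨le_rfl, hT⟩
  have hT' : T ∈ Icc 0 T := ⟨hT, le_rfl⟩
  set X := ∫ r in Icc 0 T, ⟪∫ ρ in (0 : ℝ)..r, G ρ, G r⟫_ℂ with hX
  have h1 : ∫ r in Icc 0 T, ⟪∫ ρ in r..T, G ρ, G r⟫_ℂ = conj X := by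
    have : ∫ r in Icc 0 T, ⟪∫ ρ in r..T, G ρ, G r⟫_ℂ = ∫ r in Icc 0 T, ∫ ρ in r..T, ⟪G ρ, G r⟫_ℂ :=
      setIntegral_congr_fun measurableSet_Icc fun r hr =>
        intervalIntegral_inner (intervalIntegrable_of_leb hG hr hT') (G r)
    rw [this, ← integral_triangle hprod, hX, ← integral_conj]
    refine setIntegral_congr_fun measurableSet_Icc fun r hr => ?_
    exact (inner_intervalIntegral (intervalIntegrable_of_leb hG h0 hr) (G r)).symm.trans (inner_conj_symm _ _).symm
  have i1 : Integrable (fun r => ⟪∫ ρ in (0 : ℝ)..r, G ρ, G r⟫_ℂ) (leb T) := by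
    refine (integrable_inner_primitive (U₀ := 0) hT hG).neg.congr (.of_forall fun r => ?_)
    simp [primitive, inner_neg_left]
  have h2 : ∫ r in Icc 0 T, ⟪∫ ρ in r..T, G ρ, G r⟫_ℂ = ⟪∫ ρ in (0 : ℝ)..T, G ρ, ∫ ρ in (0 : ℝ)..T, G ρ⟫_ℂ - X := by
    have e : ⟪∫ ρ in (0 : ℝ)..T, G ρ, ∫ ρ in (0 : ℝ)..T, G ρ⟫_ℂ = ∫ r in Icc 0 T, ⟪∫ ρ in (0 : ℝ)..T, G ρ, G r⟫_ℂ := by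
      rw [inner_intervalIntegral (intervalIntegrable_of_leb hG h0 hT'), intervalIntegral.integral_of_le hT, integral_Icc_eq_integral_Ioc]
    rw [e, hX, ← integral_sub (hG.const_inner _) i1]
    refine setIntegral_congr_fun measurableSet_Icc fun r hr => ?_
    rw [← intervalIntegral.integral_add_adjacent_intervals (intervalIntegrable_of_leb hG h0 hr)
      (intervalIntegrable_of_leb hG hr hT'), inner_add_left, add_sub_cancel_left]
  rw [h1, inner_self_eq_norm_sq_to_K] at h2
  have h3 := congrArg Complex.re h2
  simp only [conj_re, sub_re, Complex.coe_algebraMap, ← Complex.ofReal_pow, ofReal_re] at h3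
  linarith

lemma norm_primitive_sq (hG : Integrable G (leb T)) {t : ℝ} (ht : t ∈ Icc 0 T) :
    ‖primitive U₀ G t‖ ^ 2 = ‖U₀‖ ^ 2 - 2 * (∫ r in Icc 0 t, ⟪primitive U₀ G r, G r⟫_ℂ).re := by
  have hG' : Integrable G (leb t) := hG.mono_measure (Measure.restrict_mono (Icc_subset_Icc_right ht.2) le_rfl)
  have i1 : Integrable (fun r => ⟪∫ ρ in (0 : ℝ)..r, G ρ, G r⟫_ℂ) (leb t) := by
    refine (integrable_inner_primitive (U₀ := 0) ht.1 hG').neg.congr (.of_forall fun r => ?_)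
    simp [primitive, inner_neg_left]
  have e : ∫ r in Icc 0 t, ⟪primitive U₀ G r, G r⟫_ℂ = ⟪U₀, ∫ r in (0 : ℝ)..t, G r⟫_ℂ - ∫ r in Icc 0 t, ⟪∫ ρ in (0 : ℝ)..r, G ρ, G r⟫_ℂ := by
    rw [inner_intervalIntegral (intervalIntegrable_of_leb hG ⟨le_rfl, ht.1.trans ht.2⟩ ht),
      intervalIntegral.integral_of_le ht.1, ← integral_Icc_eq_integral_Ioc, ← integral_sub (hG'.const_inner _) i1]
    simp only [primitive, inner_sub_left]
  have h1 := inner_integral_self hG' ht.1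
  have h2 := norm_sub_sq (𝕜 := ℂ) U₀ (∫ r in (0 : ℝ)..t, G r)
  rw [primitive, h2, e, sub_re, h1]
  simp only [RCLike.re_to_complex]
  ring

end

section

/-! ## The energy inequality -/

lemma inner_mult_dsymbol (hm : IsBump m) (a b : L2R) : ⟪mult m a, mult (dsymbol m) b⟫_ℂ = - conj ⟪mult m b, mult (dsymbol m) a⟫_ℂ := by
  have hn : IsBump fun ξ => -dsymbol m ξ := hm.dsymbol.neg
  have h1 := inner_mult_mult hm hm.dsymbol hn hm (fun ξ => by
    simp only [dsymbol, map_neg, map_mul, Complex.conj_I, conj_ofReal]; ring) a b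
  have h2 : mult (fun ξ => -dsymbol m ξ) a = - mult (dsymbol m) a := by
    refine mult_eq_of_ft hn ?_
    rw [map_neg]
    filter_upwards [ft_mult_ae hm.dsymbol a, Lp.coeFn_neg (ft (mult (dsymbol m) a))] with ζ h1 h2
    rw [h2, Pi.neg_apply, h1]; simp [scaled]
  rw [h1, h2, inner_neg_left, inner_conj_symm]

lemma frequently_sqrt_mul_le {p : ℕ → ℝ≥0∞} (hp : ∑' n, p n ≠ ⊤) {ε : ℝ} (hε : 0 < ε) : ∃ᶠ n : ℕ in atTop, ofReal √n * p n ≤ ofReal ε := by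
  intro h
  have hfin : ∀ n, p n ≠ ⊤ := ENNReal.ne_top_of_tsum_ne_top hp
  have hs := summable_toReal hp
  refine Real.not_summable_one_div_natCast (Summable.of_norm_bounded_eventually_nat (hs.mul_left ε⁻¹) ?_)
  filter_upwards [h, eventually_ge_atTop 1] with n hn h1
  have h1' : (1 : ℝ) ≤ n := by exact_mod_cast h1
  rw [not_le, ← ENNReal.ofReal_toReal (hfin n), ← ofReal_mul (by positivity),
    ENNReal.ofReal_lt_ofReal_iff_of_nonneg hε.le] at hn
  have h2 : √(n : ℝ) ≤ n := Real.sqrt_le_left (by positivity) |>.2 (by nlinarith)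
  rw [norm_of_nonneg (by positivity), div_le_iff₀ (by positivity), inv_mul_eq_div, div_mul_eq_mul_div, le_div_iff₀ hε]
  have h3 : 0 ≤ (p n).toReal := ENNReal.toReal_nonneg
  nlinarith

lemma energy_clm_le {σ : ℝ} (L : L2R →L[ℂ] L2R) (u : ℕ → ℝ → L2R) :
    energy T σ (fun k t => L (u k t)) ≤ ‖L‖ₑ ^ 2 * energy T σ u := by
  rw [energy, energy, ← ENNReal.tsum_mul_left]
  refine tsum_le_tsum fun k => ?_
  rw [mul_left_comm, ← mul_pow]
  refine mul_le_mul' le_rfl (pow_le_pow_left₀ zero_le ?_ 2)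
  exact (eLpNorm_le_nnreal_smul_eLpNorm_of_ae_le_mul (c := ‖L‖₊) (.of_forall fun t => L.le_opNNNorm _) 2).trans (le_of_eq rfl)

namespace IsSolution

variable {u₀ : ℕ → L2R} {u f : ℕ → ℝ → L2R}

/-- The flux between neighbouring modes. -/
def flux (m : ℝ → ℂ) (u : ℕ → ℝ → L2R) (n : ℕ) (t : ℝ) : ℝ :=
  √n * (⟪mult m (u (n - 1) t), mult (dsymbol m) (u n t)⟫_ℂ).re

lemma re_inner_slope (hm : IsBump m) (u f : ℕ → ℝ → L2R) (k : ℕ) (t : ℝ) : (⟪mult m (u k t), slope s m u f k t⟫_ℂ).re = rate s k * ‖mult m (u k t)‖ ^ 2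
      - (⟪mult m (u k t), mult m (f k t)⟫_ℂ).re + (flux m u (k + 1) t - flux m u k t) := by
  have h1 : (⟪mult m (u k t), mult (dsymbol m) (shift u k t)⟫_ℂ).re = flux m u (k + 1) t - flux m u k t := by
    rw [shift, map_add, map_smul, map_smul, inner_add_right, inner_smul_right, inner_smul_right, inner_mult_dsymbol hm (u k t) (u (k - 1) t)]
    simp only [flux, add_re, Complex.re_ofReal_mul, Complex.neg_re, conj_re, Nat.add_sub_cancel]; push_cast
    ring
  rw [slope, inner_add_right, inner_sub_right, inner_smul_right, add_re, h1, sub_re, inner_self_eq_norm_sq_to_K, Complex.re_ofReal_mul]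
  simp only [Complex.coe_algebraMap, ← Complex.ofReal_pow, ofReal_re]

lemma exists_primitive_eq (h : IsSolution s T u₀ u f) (hs : s ∈ Ioo 0 1) (hT : 0 ≤ T) (hm : IsBump m) (k : ℕ) :
    (fun t => mult m (u k t)) =ᵐ[leb T] primitive (mult m (u₀ k)) (slope s m u f k) := by
  refine ae_eq_primitive hT ((memLp_clm _ (h.memLp k)).integrable (by norm_num))
    ((h.memLp_slope m k).integrable (by norm_num)) fun a ha hc haT => ?_
  have hab : IsBump fun t => (a t : ℂ) := ⟨Complex.ofRealCLM.contDiff.comp ha, hc.comp_left Complex.ofReal_zero⟩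
  have hsupp : tsupport (fun t => (a t : ℂ)) ⊆ Iio T := by
    refine (closure_mono fun t ht => ?_).trans haT
    exact fun h0 => ht (by simp [h0])
  have hd : ∀ t, deriv (fun t => (a t : ℂ)) t = ((deriv a t : ℝ) : ℂ) := fun t =>
    ((ha.differentiable (by simp) t).hasDerivAt.ofReal_comp).deriv
  have := h.mode_vector hs hm hab (fun t => conj_ofReal _) hsupp k
  simp only [hd, Complex.coe_smul] at this
  exact this

lemma mode_energy (h : IsSolution s T u₀ u f) (hs : s ∈ Ioo 0 1) (hm : IsBump m) {t : ℝ} (ht : t ∈ Icc 0 T) (k : ℕ) :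
    ‖primitive (mult m (u₀ k)) (slope s m u f k) t‖ ^ 2 + 2 * (rate s k * ∫ r in Icc 0 t, ‖mult m (u k r)‖ ^ 2)
      = ‖mult m (u₀ k)‖ ^ 2 + 2 * (∫ r in Icc 0 t, (⟪mult m (u k r), mult m (f k r)⟫_ℂ).re)
        - 2 * ((∫ r in Icc 0 t, flux m u (k + 1) r) - ∫ r in Icc 0 t, flux m u k r) := by
  have hT := ht.1.trans ht.2
  have hle : leb t ≤ leb T := Measure.restrict_mono (Icc_subset_Icc_right ht.2) le_rfl
  have hmu := fun k => memLp_clm (mult m) ((h.memLp k).mono_measure hle)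
  have hdu := fun k => memLp_clm (mult (dsymbol m)) ((h.memLp k).mono_measure hle)
  have hmf := memLp_clm (mult m) ((h.memLp_source k).mono_measure hle)
  have hsl := (h.memLp_slope m k).mono_measure hle
  have i1 : Integrable (fun r => rate s k * ‖mult m (u k r)‖ ^ 2) (leb t) :=
    ((memLp_two_iff_integrable_sq_norm (hmu k).1).1 (hmu k)).const_mul _
  have i2 : Integrable (fun r => (⟪mult m (u k r), mult m (f k r)⟫_ℂ).re) (leb t) :=
    (integrable_inner_of_memLp (hmu k) hmf).re
  have i3 : ∀ n, Integrable (flux m u n) (leb t) := fun n =>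
    ((integrable_inner_of_memLp (hmu (n - 1)) (hdu n)).re).const_mul _
  rw [norm_primitive_sq ((h.memLp_slope m k).integrable (by norm_num)) ht]
  have e1 : ∫ r in Icc 0 t, ⟪primitive (mult m (u₀ k)) (slope s m u f k) r, slope s m u f k r⟫_ℂ = ∫ r in Icc 0 t, ⟪mult m (u k r), slope s m u f k r⟫_ℂ := by
    refine integral_congr_ae ?_
    filter_upwards [ae_mono hle (h.exists_primitive_eq hs hT hm k)] with r hr
    rw [← hr]
  have e2 : (∫ r in Icc 0 t, ⟪mult m (u k r), slope s m u f k r⟫_ℂ).re = ∫ r in Icc 0 t, (⟪mult m (u k r), slope s m u f k r⟫_ℂ).re :=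
    (integral_re (integrable_inner_of_memLp (hmu k) hsl)).symm
  have e3 : ∫ r in Icc 0 t, (⟪mult m (u k r), slope s m u f k r⟫_ℂ).re = (rate s k * ∫ r in Icc 0 t, ‖mult m (u k r)‖ ^ 2)
        - (∫ r in Icc 0 t, (⟪mult m (u k r), mult m (f k r)⟫_ℂ).re)
        + ((∫ r in Icc 0 t, flux m u (k + 1) r) - ∫ r in Icc 0 t, flux m u k r) := by
    simp only [re_inner_slope hm]
    rw [← integral_const_mul, ← integral_sub i1 i2, ← integral_sub (i3 _) (i3 _), ← integral_add
      (f := fun r => rate s k * ‖mult m (u k r)‖ ^ 2 - (⟪mult m (u k r), mult m (f k r)⟫_ℂ).re)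
      (g := fun r => flux m u (k + 1) r - flux m u k r) (i1.sub i2) ((i3 _).sub (i3 _))]
  rw [e1, e2, e3]
  ring

lemma sum_mode_energy (h : IsSolution s T u₀ u f) (hs : s ∈ Ioo 0 1) (hm : IsBump m) {t : ℝ} (ht : t ∈ Icc 0 T) (n : ℕ) :
    ∑ k ∈ Finset.range n, (‖primitive (mult m (u₀ k)) (slope s m u f k) t‖ ^ 2 + 2 * (rate s k * ∫ r in Icc 0 t, ‖mult m (u k r)‖ ^ 2))
      = ∑ k ∈ Finset.range n, (‖mult m (u₀ k)‖ ^ 2 + 2 * (∫ r in Icc 0 t, (⟪mult m (u k r), mult m (f k r)⟫_ℂ).re))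
        - 2 * ∫ r in Icc 0 t, flux m u n r := by
  have h1 := Finset.sum_range_sub (fun k => ∫ r in Icc 0 t, flux m u k r) n
  have h0 : ∫ r in Icc 0 t, flux m u 0 r = 0 := by simp [flux]
  rw [h0, sub_zero] at h1
  rw [← h1, mul_sum, ← Finset.sum_sub_distrib]
  exact sum_congr rfl fun k _ => h.mode_energy hs hm ht k

lemma summable_flux (h : IsSolution s T u₀ u f) (hs₀ : 0 < s) (m : ℝ → ℂ) (hs₁ : s < 1) :
    ∑' n, ∫⁻ r in Icc 0 T, ‖mult m (u (n - 1) r)‖ₑ * ‖mult (dsymbol m) (u n r)‖ₑ ≠ ⊤ := by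
  have hue : Kac.energy T 0 u ≠ ⊤ := ne_top_of_le_mul (by simp) h.energy
    (energy_mono_weight hs₀.le (by linarith) u)
  have hclm : ∀ L : L2R →L[ℂ] L2R, ∑' k, eLpNorm (fun t => L (u k t)) 2 (leb T) ^ 2 ≠ ⊤ := fun L => by
    have := ne_top_of_le_mul (pow_ne_top (enorm_ne_top (x := L)) (n := 2)) hue (energy_clm_le L u)
    simpa only [Kac.energy, weight_zero, one_mul] using this
  rw [tsum_eq_zero_add' ENNReal.summable]
  have key : ∀ i j, ∫⁻ r in Icc 0 T, ‖mult m (u i r)‖ₑ * ‖mult (dsymbol m) (u j r)‖ₑ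
      ≤ eLpNorm (fun t => mult m (u i t)) 2 (leb T) ^ 2 + eLpNorm (fun t => mult (dsymbol m) (u j t)) 2 (leb T) ^ 2 := fun i j => by
    rw [eLpNorm_two_sq, eLpNorm_two_sq, ← lintegral_add_left' ((memLp_clm _ (h.memLp i)).1.enorm.pow_const 2)]
    refine lintegral_mono fun r => ?_
    rcases le_total ‖mult m (u i r)‖ₑ ‖mult (dsymbol m) (u j r)‖ₑ with hl | hl
    · exact (mul_le_mul' hl le_rfl).trans ((sq _).symm.le.trans le_add_self)
    · exact (mul_le_mul' le_rfl hl).trans ((sq _).symm.le.trans le_self_add)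
  have h1 := hclm (mult m)
  have h2 := hclm (mult (dsymbol m))
  refine ENNReal.add_ne_top.2 ⟨ne_top_of_le_ne_top (ENNReal.add_ne_top.2
    ⟨ENNReal.ne_top_of_tsum_ne_top h1 0, ENNReal.ne_top_of_tsum_ne_top h2 0⟩) (key _ 0), ?_⟩
  refine ne_top_of_le_ne_top (ENNReal.add_ne_top.2 ⟨h1, h2⟩) ((tsum_le_tsum fun k => key k (k + 1)).trans ?_)
  rw [tsum_add]
  refine add_le_add le_rfl ?_
  exact ENNReal.tsum_comp_le_tsum_of_injective (add_left_injective 1) fun k => eLpNorm (fun t => mult (dsymbol m) (u k t)) 2 (leb T) ^ 2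

/-- The energy inequality. -/
lemma energy_inequality (h : IsSolution s T u₀ u f) (hs : s ∈ Ioo 0 1) (hm : IsBump m) {t : ℝ} (ht : t ∈ Icc 0 T) :
    ∑' k, (‖primitive (mult m (u₀ k)) (slope s m u f k) t‖ₑ ^ 2 + 2 * (ofReal (rate s k) * ∫⁻ r in Icc 0 t, ‖mult m (u k r)‖ₑ ^ 2))
      ≤ ∑' k, ‖mult m (u₀ k)‖ₑ ^ 2 + 2 * ∑' k, ∫⁻ r in Icc 0 T, ‖mult m (f k r)‖ₑ * ‖mult m (u k r)‖ₑ := by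
  have hle : leb t ≤ leb T := Measure.restrict_mono (Icc_subset_Icc_right ht.2) le_rfl
  have hmu := fun k => memLp_clm (mult m) ((h.memLp k).mono_measure hle)
  set Q := ∑' k, ∫⁻ r in Icc 0 T, ‖mult m (f k r)‖ₑ * ‖mult m (u k r)‖ₑ with hQ
  set a : ℕ → ℝ≥0∞ := fun k => ‖primitive (mult m (u₀ k)) (slope s m u f k) t‖ₑ ^ 2 + 2 * (ofReal (rate s k) * ∫⁻ r in Icc 0 t, ‖mult m (u k r)‖ₑ ^ 2) with ha
  have hofR : ∀ k, a k = ofReal (‖primitive (mult m (u₀ k)) (slope s m u f k) t‖ ^ 2 + 2 * (rate s k * ∫ r in Icc 0 t, ‖mult m (u k r)‖ ^ 2)) := fun k => by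
    have h0 := rate_nonneg hs k
    have h1 : 0 ≤ ∫ r in Icc 0 t, ‖mult m (u k r)‖ ^ 2 := integral_nonneg fun r => by positivity
    rw [ofReal_add (by positivity) (by positivity), ofReal_mul (by norm_num), ofReal_mul h0,
      ofReal_integral_norm_sq (hmu k), eLpNorm_two_sq, ofReal_pow (norm_nonneg _), ofReal_norm]
    simp [ha]
  have hpart : ∀ n, ∑ k ∈ Finset.range n, a k ≤ ∑' k, ‖mult m (u₀ k)‖ₑ ^ 2 + 2 * Q
      + 2 * (ofReal √n * ∫⁻ r in Icc 0 T, ‖mult m (u (n - 1) r)‖ₑ * ‖mult (dsymbol m) (u n r)‖ₑ) := fun n => by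
    simp only [hofR]; rw [← ENNReal.ofReal_sum_of_nonneg, h.sum_mode_energy hs hm ht n]
    · have b1 : ∀ k, ofReal |∫ r in Icc 0 t, (⟪mult m (u k r), mult m (f k r)⟫_ℂ).re|
          ≤ ∫⁻ r in Icc 0 T, ‖mult m (f k r)‖ₑ * ‖mult m (u k r)‖ₑ := fun k => by
        rw [← norm_eq_abs, ofReal_norm]
        refine (enorm_integral_le_lintegral_enorm _).trans ((lintegral_mono fun r => ?_).trans (lintegral_mono' hle le_rfl))
        rw [mul_comm]
        refine le_trans ?_ (enorm_inner_le _ _)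
        rw [← ofReal_norm, ← ofReal_norm]
        exact ofReal_le_ofReal (Complex.abs_re_le_norm _)
      have b2 : ofReal |∫ r in Icc 0 t, flux m u n r| ≤ ofReal √n * ∫⁻ r in Icc 0 T, ‖mult m (u (n - 1) r)‖ₑ * ‖mult (dsymbol m) (u n r)‖ₑ := by
        rw [← norm_eq_abs, ofReal_norm, ← lintegral_const_mul' _ _ ofReal_ne_top]
        refine (enorm_integral_le_lintegral_enorm _).trans ((lintegral_mono fun r => ?_).trans (lintegral_mono' hle le_rfl))
        rw [flux, enorm_mul, ← ofReal_norm (√(n : ℝ)), norm_of_nonneg (by positivity)]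
        refine mul_le_mul' le_rfl (le_trans ?_ (enorm_inner_le _ _))
        rw [← ofReal_norm, ← ofReal_norm]
        exact ofReal_le_ofReal (Complex.abs_re_le_norm _)
      calc _ ≤ ofReal (∑ k ∈ Finset.range n, ‖mult m (u₀ k)‖ ^ 2
            + 2 * ∑ k ∈ Finset.range n, |∫ r in Icc 0 t, (⟪mult m (u k r), mult m (f k r)⟫_ℂ).re|
            + 2 * |∫ r in Icc 0 t, flux m u n r|) := by
            refine ofReal_le_ofReal ?_
            rw [Finset.sum_add_distrib, ← mul_sum]
            have := Finset.sum_le_sum fun k (_ : k ∈ Finset.range n) =>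
              le_abs_self (∫ r in Icc 0 t, (⟪mult m (u k r), mult m (f k r)⟫_ℂ).re)
            have := neg_abs_le (∫ r in Icc 0 t, flux m u n r)
            linarith
        _ = ∑ k ∈ Finset.range n, ‖mult m (u₀ k)‖ₑ ^ 2
            + 2 * ∑ k ∈ Finset.range n, ofReal |∫ r in Icc 0 t, (⟪mult m (u k r), mult m (f k r)⟫_ℂ).re|
            + 2 * ofReal |∫ r in Icc 0 t, flux m u n r| := by
            rw [ofReal_add (by positivity) (by positivity), ofReal_add (by positivity) (by positivity),
              ofReal_mul (by norm_num), ofReal_mul (by norm_num),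
              ENNReal.ofReal_sum_of_nonneg (fun _ _ => by positivity), ENNReal.ofReal_sum_of_nonneg (fun _ _ => by positivity)]
            simp [ofReal_pow]
        _ ≤ _ := by
            gcongr
            · exact sum_le_tsum _
            · exact (Finset.sum_le_sum fun k _ => b1 k).trans (sum_le_tsum _)
    · intro k _
      have h0 := rate_nonneg hs k
      have h1 : 0 ≤ ∫ r in Icc 0 t, ‖mult m (u k r)‖ ^ 2 := integral_nonneg fun r => by positivity
      positivity
  rw [ENNReal.tsum_eq_iSup_nat]
  refine iSup_le fun N => ENNReal.le_of_forall_pos_le_add fun ε hε _ => ?_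
  have hε' : (0 : ℝ) < ε / 2 := by positivity
  obtain ⟨n, hn, hNn⟩ := ((frequently_sqrt_mul_le (h.summable_flux hs.1 m hs.2) hε').and_eventually (eventually_ge_atTop N)).exists
  calc ∑ k ∈ Finset.range N, a k ≤ ∑ k ∈ Finset.range n, a k :=
        Finset.sum_le_sum_of_subset (Finset.range_mono hNn)
    _ ≤ _ := hpart n
    _ ≤ _ + 2 * ofReal (ε / 2) := by gcongr
    _ = _ := by
      congr 1
      rw [← ofReal_ofNat 2, ← ofReal_mul (by norm_num), mul_div_cancel₀ _ (by norm_num), ENNReal.ofReal_coe_nnreal]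

end IsSolution

/-! ## The linear estimate in Chemin-Lerner spaces -/

lemma le_add_of_sq_le {x a b : ℝ≥0∞} (hx : x ≠ ⊤) (h : x ^ 2 ≤ a ^ 2 + b * x) : x ≤ a + b := by
  by_contra hc
  rw [not_le] at hc
  have hab : a + b ≠ ⊤ := hc.ne_top
  have h0 : x ≠ 0 := (zero_le.trans_lt hc).ne'
  have h1 : (a + b) * x < x ^ 2 := by rw [sq]; exact ENNReal.mul_lt_mul_left h0 hx hc
  have h2 : a ^ 2 + b * x ≤ (a + b) * x := by
    rw [add_mul, sq]; gcongr; exact le_self_add.trans hc.le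
  exact absurd (h.trans h2) (not_le.2 h1)

namespace IsSolution

variable {u₀ : ℕ → L2R} {u f : ℕ → ℝ → L2R}

/-- The constant `√(1 + T)`. -/
def _root_.Kac.growth (T : ℝ) : ℝ≥0∞ := ofReal √(1 + T)

lemma _root_.Kac.growth_sq (hT : 0 ≤ T) : growth T ^ 2 = ofReal (1 + T) := by
  rw [growth, ← ofReal_pow (by positivity), sq_sqrt (by positivity)]

lemma _root_.Kac.one_le_growth (hT : 0 ≤ T) : 1 ≤ growth T := by
  rw [growth, ← ofReal_one]
  exact ofReal_le_ofReal (Real.one_le_sqrt.2 (by linarith))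

lemma mult_estimate (h : IsSolution s T u₀ u f) (hs : s ∈ Ioo 0 1) (hT : 0 ≤ T) (hm : IsBump m) :
    eLpNorm (fun t => wnorm 0 fun k => ‖mult m (u k t)‖ₑ) ⊤ (leb T) + eLpNorm (fun t => wnorm s fun k => ‖mult m (u k t)‖ₑ) 2 (leb T)
      ≤ 37 * growth T * wnorm 0 (fun k => ‖mult m (u₀ k)‖ₑ) + 1281 * growth T ^ 2 * eLpNorm (fun t => wnorm (-s) fun k => ‖mult m (f k t)‖ₑ) 2 (leb T) := by
  have hmu := fun k => memLp_clm (mult m) (h.memLp k)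
  have hmf := fun k => memLp_clm (mult m) (h.memLp_source k)
  set B := growth T with hB
  set G := wnorm 0 (fun k => ‖mult m (u₀ k)‖ₑ) with hG
  set E := eLpNorm (fun t => wnorm 0 fun k => ‖mult m (u k t)‖ₑ) ⊤ (leb T) with hE
  set D := eLpNorm (fun t => wnorm s fun k => ‖mult m (u k t)‖ₑ) 2 (leb T) with hD
  set F := eLpNorm (fun t => wnorm (-s) fun k => ‖mult m (f k t)‖ₑ) 2 (leb T) with hF
  have hB1 : 1 ≤ B := one_le_growth hT
  have hB2 : B ^ 2 = ofReal (1 + T) := growth_sq hT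
  have hD2 : D ^ 2 = Kac.energy T s (fun k t => mult m (u k t)) := (energy_eq fun k => (hmu k).1).symm
  have hF2 : F ^ 2 = Kac.energy T (-s) (fun k t => mult m (f k t)) := (energy_eq fun k => (hmf k).1).symm
  have hDfin : D ≠ ⊤ := fun hc => by
    rw [hc] at hD2
    refine ne_top_of_le_mul (pow_ne_top (enorm_ne_top (x := mult m)) (n := 2)) h.energy (energy_clm_le (mult m) u) ?_
    rw [← hD2]; simp
  have hQ : ∑' k, ∫⁻ r in Icc 0 T, ‖mult m (f k r)‖ₑ * ‖mult m (u k r)‖ₑ ≤ F * D := by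
    have := tsum_lintegral_mul_le (σ := s) (fun k => (hmf k).1) fun k => (hmu k).1
    rwa [← hF2, ← hD2, ← mul_pow, sq_le_sq_ennreal] at this
  set R := G ^ 2 + 2 * (F * D) with hR
  have hen : ∀ t ∈ Icc 0 T, ∑' k, (‖primitive (mult m (u₀ k)) (slope s m u f k) t‖ₑ ^ 2
      + 2 * (ofReal (rate s k) * ∫⁻ r in Icc 0 t, ‖mult m (u k r)‖ₑ ^ 2)) ≤ R := fun t ht => by
    refine (h.energy_inequality hs hm ht).trans ?_
    have hG2 : G ^ 2 = ∑' k, ‖mult m (u₀ k)‖ₑ ^ 2 := by rw [hG, wnorm_sq]; simp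
    rw [hR, hG2]; gcongr
  have hpt : ∀ᵐ t ∂leb T, ∑' k, ‖mult m (u k t)‖ₑ ^ 2 ≤ R := by
    filter_upwards [ae_all_iff.2 fun k => h.exists_primitive_eq hs hT hm k, ae_restrict_mem measurableSet_Icc] with t h1 h2
    simp only [h1]
    exact (tsum_le_tsum fun k => le_self_add).trans (hen t h2)
  have hED : E ≤ G + F + D := by
    rw [hE, eLpNorm_exponent_top]
    refine essSup_le_of_ae_le _ ?_
    filter_upwards [hpt] with t ht
    rw [enorm_eq_self, ← sq_le_sq_ennreal, wnorm_sq]; simp only [weight_zero, one_mul]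
    refine ht.trans ?_
    calc G ^ 2 + 2 * (F * D) ≤ G ^ 2 + 2 * (F * D) + (F ^ 2 + D ^ 2 + 2 * (G * F) + 2 * (G * D)) := le_self_add
      _ = _ := by ring
  have hmean : ∑' k, ∫⁻ r in Icc 0 T, ‖mult m (u k r)‖ₑ ^ 2 ≤ ofReal T * R := by
    rw [← lintegral_tsum fun k => (hmu k).1.enorm.pow_const 2]
    refine (lintegral_mono_ae hpt).trans (le_of_eq ?_)
    rw [lintegral_const, mul_comm]; simp
  have hdis : ∑' k, ofReal (rate s k) * ∫⁻ r in Icc 0 T, ‖mult m (u k r)‖ₑ ^ 2 ≤ R := by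
    refine (tsum_le_tsum fun k => ?_).trans (hen T ⟨hT, le_rfl⟩)
    refine le_trans ?_ le_add_self
    rw [two_mul]; exact le_self_add
  have hDle : D ^ 2 ≤ (18 * B * G) ^ 2 + (640 * B ^ 2 * F) * D := by
    calc D ^ 2 = ∑' k, weight s k * ∫⁻ r in Icc 0 T, ‖mult m (u k r)‖ₑ ^ 2 := by
          rw [hD2, Kac.energy]; exact tsum_congr fun k => by rw [eLpNorm_two_sq]
      _ ≤ ∑' k, 320 * (ofReal (rate s k) * (∫⁻ r in Icc 0 T, ‖mult m (u k r)‖ₑ ^ 2)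
          + ∫⁻ r in Icc 0 T, ‖mult m (u k r)‖ₑ ^ 2) := by
          refine tsum_le_tsum fun k => ?_
          have h1 : weight s k ≤ 320 * (ofReal (rate s k) + 1) := by
            rw [← ofReal_one, ← ofReal_add (rate_nonneg hs k) zero_le_one, ← ofReal_ofNat 320, ← ofReal_mul (by norm_num)]
            exact ofReal_le_ofReal (weight_le_rate hs k)
          refine (mul_le_mul' h1 le_rfl).trans (le_of_eq ?_)
          ring
      _ ≤ 320 * (R + ofReal T * R) := by
          rw [ENNReal.tsum_mul_left, tsum_add]; gcongr
      _ = 320 * B ^ 2 * R := by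
          rw [hB2, ofReal_add zero_le_one hT, ofReal_one]; ring
      _ = 320 * B ^ 2 * G ^ 2 + (640 * B ^ 2 * F) * D := by rw [hR]; ring
      _ ≤ 324 * B ^ 2 * G ^ 2 + (640 * B ^ 2 * F) * D := by gcongr; norm_num
      _ = _ := by ring
  have hDfinal := le_add_of_sq_le hDfin hDle
  calc E + D ≤ (G + F + D) + D := by gcongr
    _ = G + F + 2 * D := by ring
    _ ≤ B * G + B ^ 2 * F + 2 * (18 * B * G + 640 * B ^ 2 * F) := by
        gcongr
        · exact le_mul_of_one_le_left' hB1
        · exact le_mul_of_one_le_left' (one_le_pow₀ hB1)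
    _ = _ := by ring

/-- The estimate for the linear problem. -/
lemma linear_estimate (h : IsSolution s T u₀ u f) (hχφ : IsLP χ φ) (hs : s ∈ Ioo 0 1) (hT : 0 ≤ T) :
    cl χ φ T ⊤ 0 u + cl χ φ T 2 s u ≤ 37 * growth T * besov χ φ u₀ + 1281 * growth T ^ 2 * cl χ φ T 2 (-s) f := by
  rw [cl, cl, cl, besov, ← tsum_add, ← ENNReal.tsum_mul_left, ← ENNReal.tsum_mul_left, ← tsum_add]
  refine tsum_le_tsum fun j => ?_
  have := h.mult_estimate hs hT (isBump_dyadic hχφ j)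
  rw [← mul_add, mul_left_comm, mul_left_comm (1281 * growth T ^ 2), ← mul_add]
  exact mul_le_mul' le_rfl this

end IsSolution

/-! ## The bilinear term -/

variable {σ : ℝ} {a b : ℕ → L2R}

/-- The dyadic blocks of a sequence of Hermite coefficients, measured in `ℓ²_σ(L²)`. -/
def blk (χ φ : ℝ → ℝ) (σ : ℝ) (a : ℕ → L2R) (q : ℕ) : ℝ≥0∞ := wnorm σ fun k => ‖dblock χ φ q (a k)‖ₑ

/-- The dyadic weight `2^{(q-1)/2}`. -/
def dw (q : ℕ) : ℝ≥0∞ := (2 : ℝ≥0∞) ^ (((q : ℝ) - 1) * (1 / 2))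

/-- The Besov norm of a sequence of Hermite coefficients with weights in the index. -/
def bes (χ φ : ℝ → ℝ) (σ : ℝ) (a : ℕ → L2R) : ℝ≥0∞ := ∑' q, dw q * blk χ φ σ a q

lemma cl_eq {p : ℝ≥0∞} {u : ℕ → ℝ → L2R} : cl χ φ T p σ u = ∑' q, dw q * eLpNorm (fun t => blk χ φ σ (fun k => u k t) q) p (leb T) := rfl

lemma tendsto_sum_dblock (h : IsLP χ φ) (n : ℕ) (a : L2R) :
    Tendsto (fun m => ∑ q ∈ Finset.range m, dblock χ φ (n + q) a) atTop (𝓝 (a - lowPass χ φ n a)) := by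
  refine (((tendsto_lowPass h a).comp (tendsto_add_atTop_nat n)).sub_const (lowPass χ φ n a)).congr fun m => ?_
  rw [Function.comp_apply, lowPass_eq h, lowPass_eq h, add_comm m n, Finset.sum_range_add, add_sub_cancel_left]

lemma enorm_sub_lowPass_le (h : IsLP χ φ) (n : ℕ) (a : L2R) : ‖a - lowPass χ φ n a‖ₑ ≤ ∑' q, ‖dblock χ φ (n + q) a‖ₑ :=
  le_of_tendsto' (tendsto_sum_dblock h n a).enorm fun _ =>
    (enorm_sum_le _ _).trans (sum_le_tsum _)

lemma ae_enorm_sub_lowPass_le (h : IsLP χ φ) (n : ℕ) (a : L2R) : ∀ᵐ x, ‖(a - lowPass χ φ n a : L2R) x‖ₑ ≤ ∑' q, ‖dblock χ φ (n + q) a x‖ₑ := by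
  obtain ⟨ns, -, hns⟩ := (tendstoInMeasure_of_tendsto_Lp (tendsto_sum_dblock h n a)).exists_seq_tendsto_ae
  filter_upwards [hns, ae_all_iff.2 fun m => Lp.coeFn_finsetSum (Finset.range m) fun q => dblock χ φ (n + q) a] with x h1 h2
  refine le_of_tendsto' h1.enorm fun m => ?_
  rw [h2, Finset.sum_apply]
  exact (enorm_sum_le _ _).trans (sum_le_tsum _)

lemma lowPass_zero (h : IsLP χ φ) (a : L2R) : lowPass χ φ 0 a = 0 := by simp [lowPass_eq h]

lemma ae_enorm_lowPass_le (h : IsLP χ φ) (n : ℕ) (a : L2R) : ∀ᵐ x, ‖lowPass χ φ n a x‖ₑ ≤ ∑' q, ‖dblock χ φ q a x‖ₑ := by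
  rw [lowPass_eq h]
  filter_upwards [Lp.coeFn_finsetSum (Finset.range n) fun q => dblock χ φ q a] with x h2
  rw [h2, Finset.sum_apply]
  exact (enorm_sum_le _ _).trans (sum_le_tsum _)

lemma wnorm_sub_lowPass_le (h : IsLP χ φ) (σ : ℝ) (n : ℕ) (a : ℕ → L2R) : wnorm σ (fun k => ‖a k - lowPass χ φ n (a k)‖ₑ) ≤ ∑' q, blk χ φ σ a (n + q) :=
  (wnorm_mono fun k => enorm_sub_lowPass_le h n (a k)).trans (wnorm_tsum_le σ fun q k => ‖dblock χ φ (n + q) (a k)‖ₑ)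

lemma ofReal_sqrt_le_dw (q : ℕ) : ofReal √(4 / 3 * 2 ^ q) ≤ 2 * dw q := by
  have h2 : (2 : ℝ≥0∞) = ofReal 2 := by simp
  rw [dw, h2, ENNReal.ofReal_rpow_of_pos two_pos, ← ofReal_mul two_pos.le]
  refine ofReal_le_ofReal (Real.sqrt_le_left (by positivity) |>.2 ?_)
  have e : ((2 : ℝ) ^ (((q : ℝ) - 1) * (1 / 2))) ^ 2 = 2 ^ q / 2 := by
    rw [← Real.rpow_mul_natCast two_pos.le, mul_assoc]; norm_num [Real.rpow_sub]
  have : (0 : ℝ) < 2 ^ q := by positivity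
  rw [mul_pow, e]
  linarith

lemma ae_wnorm_le (h : IsLP χ φ) (σ : ℝ) (a : ℕ → L2R) : ∀ᵐ x, wnorm σ (fun k => ∑' q, ‖dblock χ φ q (a k) x‖ₑ) ≤ 2 * bes χ φ σ a := by
  filter_upwards [ae_all_iff.2 fun k => ae_all_iff.2 fun q => ae_norm_dblock_le h q (a k)] with x hx
  refine (wnorm_tsum_le σ fun q k => ‖dblock χ φ q (a k) x‖ₑ).trans ?_
  rw [bes, ← ENNReal.tsum_mul_left]
  refine tsum_le_tsum fun q => ?_
  calc wnorm σ (fun k => ‖dblock χ φ q (a k) x‖ₑ)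
      ≤ wnorm σ (fun k => ofReal √(4 / 3 * 2 ^ q) * ‖dblock χ φ q (a k)‖ₑ) := wnorm_mono fun k => by
        rw [← ofReal_norm, ← ofReal_norm, ← ofReal_mul (by positivity)]; exact ofReal_le_ofReal (hx k q)
    _ ≤ (2 * dw q) * blk χ φ σ a q := by
        rw [wnorm_const_mul]; exact mul_le_mul' (ofReal_sqrt_le_dw q) le_rfl
    _ = _ := by ring

lemma one_le_two_mul_dw (q : ℕ) : 1 ≤ 2 * dw q := by
  refine le_trans ?_ (ofReal_sqrt_le_dw q)
  rw [← ofReal_one]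
  refine ofReal_le_ofReal (Real.one_le_sqrt.2 ?_)
  have : (1 : ℝ) ≤ 2 ^ q := one_le_pow₀ one_le_two
  linarith

lemma wnorm_le_bes (h : IsLP χ φ) (σ : ℝ) (a : ℕ → L2R) : wnorm σ (fun k => ‖a k‖ₑ) ≤ 2 * bes χ φ σ a := by
  have h1 := wnorm_sub_lowPass_le h σ 0 a
  simp only [lowPass_zero h, sub_zero, zero_add] at h1
  refine h1.trans ?_
  rw [bes, ← ENNReal.tsum_mul_left]
  refine tsum_le_tsum fun q => ?_
  rw [← mul_assoc]
  exact le_mul_of_one_le_left' (one_le_two_mul_dw q)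

lemma ae_wnorm_apply_le (h : IsLP χ φ) (σ : ℝ) (a : ℕ → L2R) : ∀ᵐ x, wnorm σ (fun k => ‖a k x‖ₑ) ≤ 2 * bes χ φ σ a := by
  filter_upwards [ae_wnorm_le h σ a, ae_all_iff.2 fun k => ae_enorm_sub_lowPass_le h 0 (a k)] with x h1 h2
  simp only [lowPass_zero h, sub_zero, zero_add] at h2
  exact (wnorm_mono h2).trans h1

/-- The Hermite coefficients of `Γ(f, g)` in terms of those of `f` and `g`. -/
def prodSeq (s : ℝ) (a b : ℕ → L2R) (k : ℕ) : L2R :=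
  ∑ p ∈ antidiagonal k, (collCoef s p.1 p.2 : ℂ) • toL2 fun x => a p.1 x * b p.2 x

lemma coeFn_prodSeq (h : ∀ i j, MemLp (fun x => a i x * b j x) 2 volume) (k : ℕ) : ∀ᵐ x, prodSeq s a b k x
    = ∑ p ∈ antidiagonal k, (collCoef s p.1 p.2 : ℂ) * (a p.1 x * b p.2 x) := by
  have h1 : ∀ p : ℕ × ℕ, ∀ᵐ x, ((collCoef s p.1 p.2 : ℂ) • toL2 fun x => a p.1 x * b p.2 x : L2R) x
      = (collCoef s p.1 p.2 : ℂ) * (a p.1 x * b p.2 x) := fun p => by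
    filter_upwards [Lp.coeFn_smul (collCoef s p.1 p.2 : ℂ) (toL2 fun x => a p.1 x * b p.2 x), coeFn_toL2 (h p.1 p.2)] with x e1 e2
    rw [e1, Pi.smul_apply, e2, smul_eq_mul]
  filter_upwards [Lp.coeFn_finsetSum (antidiagonal k)
    fun p : ℕ × ℕ => (collCoef s p.1 p.2 : ℂ) • toL2 fun x => a p.1 x * b p.2 x, ae_all_iff.2 h1] with x e1 e2
  rw [prodSeq, e1, Finset.sum_apply]
  exact sum_congr rfl fun p _ => e2 p

lemma lintegral_wnorm_sq (σ : ℝ) (a : ℕ → L2R) : ∫⁻ x, wnorm σ (fun k => ‖a k x‖ₑ) ^ 2 = wnorm σ (fun k => ‖a k‖ₑ) ^ 2 := by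
  simp only [wnorm_sq]
  rw [lintegral_tsum fun k => ((Lp.aestronglyMeasurable (a k)).enorm.pow_const 2).const_mul _]
  refine tsum_congr fun k => ?_
  rw [lintegral_const_mul' _ _ (weight_ne_top σ k), Lp.enorm_def, eLpNorm_two_sq]

lemma exists_prodSeq_bound (hs : s ∈ Ioo 0 1) : ∃ C : ℝ≥0∞, C ≠ ⊤ ∧ ∀ (a b : ℕ → L2R) (Z : ℝ≥0∞), Z ≠ ⊤ →
    ∫⁻ x, (wnorm 0 (fun k => ‖a k x‖ₑ) * wnorm s (fun k => ‖b k x‖ₑ)) ^ 2 ≤ Z ^ 2 →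
    (∀ i j, MemLp (fun x => a i x * b j x) 2 volume) ∧ wnorm (-s) (fun k => ‖prodSeq s a b k‖ₑ) ≤ C * Z := by
  obtain ⟨C, hC, hb⟩ := exists_bilinear_bound hs
  refine ⟨ofReal √C, ofReal_ne_top, fun a b Z hZ hH => ?_⟩
  have hm : ∀ i j, AEStronglyMeasurable (fun x => a i x * b j x) volume := fun i j =>
    (Lp.aestronglyMeasurable _).mul (Lp.aestronglyMeasurable _)
  have hmem : ∀ i j, MemLp (fun x => a i x * b j x) 2 volume := fun i j => by
    refine ⟨hm i j, lt_top_iff_ne_top.2 fun hc => ?_⟩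
    have h1 : weight s j * eLpNorm (fun x => a i x * b j x) 2 volume ^ 2 ≤ Z ^ 2 := by
      refine le_trans ?_ hH
      rw [eLpNorm_two_sq, ← lintegral_const_mul' _ _ (weight_ne_top s j)]
      refine lintegral_mono fun x => ?_
      rw [mul_pow, wnorm_sq, wnorm_sq, enorm_mul, mul_pow, mul_left_comm]
      refine mul_le_mul' ?_ (le_tsum (f := fun j => weight s j * ‖b j x‖ₑ ^ 2) j)
      exact le_trans (by simp) (le_tsum (f := fun i => weight 0 i * ‖a i x‖ₑ ^ 2) i)
    rw [hc] at h1
    simp only [ne_eq, OfNat.ofNat_ne_zero, not_false_eq_true, ENNReal.top_pow, mul_top (weight_ne_zero s j), top_le_iff] at h1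
    exact pow_ne_top hZ h1
  refine ⟨hmem, ?_⟩
  rw [← sq_le_sq_ennreal, mul_pow, ← ofReal_pow (by positivity), sq_sqrt hC.le, ← lintegral_wnorm_sq]
  refine le_trans (lintegral_mono_ae ?_) ((lintegral_const_mul' (ofReal C) _ ofReal_ne_top).trans_le (mul_le_mul' le_rfl hH))
  filter_upwards [ae_all_iff.2 fun k => coeFn_prodSeq (s := s) hmem k] with x hx
  have h1 := hb (fun k => ‖a k x‖ₑ) fun k => ‖b k x‖ₑ
  rw [mul_pow, wnorm_sq, wnorm_sq, wnorm_sq]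
  simp only [weight_zero, one_mul]
  refine le_trans (tsum_le_tsum fun k => mul_le_mul' le_rfl (pow_le_pow_left₀ zero_le ?_ 2)) h1
  rw [hx]
  refine (enorm_sum_le _ _).trans (le_of_eq (sum_congr rfl fun p _ => ?_))
  rw [enorm_mul, enorm_mul, ← ofReal_norm (_ : ℂ), norm_real, ofReal_norm]

lemma lintegral_mul_le_left {M : ℝ≥0∞} (h : ∀ᵐ x, wnorm 0 (fun k => ‖a k x‖ₑ) ≤ M) :
    ∫⁻ x, (wnorm 0 (fun k => ‖a k x‖ₑ) * wnorm σ (fun k => ‖b k x‖ₑ)) ^ 2 ≤ (M * wnorm σ fun k => ‖b k‖ₑ) ^ 2 := by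
  rw [mul_pow, ← lintegral_wnorm_sq, ← lintegral_const_mul'' _ ((measurable_wnorm σ fun k => (Lp.aestronglyMeasurable (b k)).enorm).pow_const 2)]
  refine lintegral_mono_ae ?_
  filter_upwards [h] with x hx
  rw [← mul_pow]
  gcongr

lemma lintegral_mul_le_right {M : ℝ≥0∞} (h : ∀ᵐ x, wnorm σ (fun k => ‖b k x‖ₑ) ≤ M) :
    ∫⁻ x, (wnorm 0 (fun k => ‖a k x‖ₑ) * wnorm σ (fun k => ‖b k x‖ₑ)) ^ 2 ≤ (wnorm 0 (fun k => ‖a k‖ₑ) * M) ^ 2 := by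
  rw [mul_pow, ← lintegral_wnorm_sq, ← lintegral_mul_const'' _ ((measurable_wnorm 0 fun k => (Lp.aestronglyMeasurable (a k)).enorm).pow_const 2)]
  refine lintegral_mono_ae ?_
  filter_upwards [h] with x hx
  rw [← mul_pow]
  gcongr

lemma memLp_mul_of_bes (h : IsLP χ φ) (ha : bes χ φ 0 a ≠ ⊤) (i : ℕ) (f : L2R) : MemLp (fun x => a i x * f x) 2 volume := by
  refine (Lp.memLp f).of_le_mul (c := (2 * bes χ φ 0 a).toReal) ((Lp.aestronglyMeasurable _).mul (Lp.aestronglyMeasurable _)) ?_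
  filter_upwards [ae_wnorm_apply_le h 0 a] with x hx
  rw [norm_mul]
  refine mul_le_mul_of_nonneg_right ?_ (norm_nonneg _)
  rw [← toReal_enorm]
  refine ENNReal.toReal_mono (mul_ne_top (by simp) ha) (le_trans ?_ hx)
  rw [← sq_le_sq_ennreal, wnorm_sq]
  exact le_trans (by simp) (le_tsum (f := fun i => weight 0 i * ‖a i x‖ₑ ^ 2) i)

lemma dblock_toL2_mul (h : IsLP χ φ) (j : ℕ) {f g : L2R} (hfg : MemLp (fun x => f x * g x) 2 volume) : dblock χ φ j (toL2 fun x => f x * g x)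
      = dblock χ φ j (toL2 fun x => lowPass χ φ (j - 2) f x * (g - lowPass χ φ (j - 2) g : L2R) x)
        + dblock χ φ j (toL2 fun x => (f - lowPass χ φ (j - 2) f : L2R) x * g x) := by
  have hb := isBump_lowPass h (j - 2)
  have m1 := memLp_mult_mul hb f (Lp.memLp (lowPass χ φ (j - 2) g))
  have m2 := memLp_mult_mul hb f (Lp.memLp (g - lowPass χ φ (j - 2) g))
  have m3 := memLp_mult_mul hb f (Lp.memLp g)
  have m4 : MemLp (fun x => (f - lowPass χ φ (j - 2) f : L2R) x * g x) 2 volume := by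
    refine (memLp_congr_ae ?_).1 (hfg.sub m3)
    filter_upwards [Lp.coeFn_sub f (lowPass χ φ (j - 2) f)] with x hx
    rw [hx, Pi.sub_apply, Pi.sub_apply, sub_mul]; rfl
  have e : toL2 (fun x => f x * g x) = toL2 (fun x => lowPass χ φ (j - 2) f x * lowPass χ φ (j - 2) g x)
      + (toL2 (fun x => lowPass χ φ (j - 2) f x * (g - lowPass χ φ (j - 2) g : L2R) x) + toL2 fun x => (f - lowPass χ φ (j - 2) f : L2R) x * g x) := by
    rw [← toL2_add (f := fun x => lowPass χ φ (j - 2) f x * (g - lowPass χ φ (j - 2) g : L2R) x) m2 m4,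
      ← toL2_add (f := fun x => lowPass χ φ (j - 2) f x * lowPass χ φ (j - 2) g x)
        (g := fun x => lowPass χ φ (j - 2) f x * (g - lowPass χ φ (j - 2) g : L2R) x + (f - lowPass χ φ (j - 2) f : L2R) x * g x) m1 (m2.add m4)]
    refine toL2_congr ?_
    filter_upwards [Lp.coeFn_sub f (lowPass χ φ (j - 2) f), Lp.coeFn_sub g (lowPass χ φ (j - 2) g)] with x h1 h2
    rw [h1, h2, Pi.sub_apply, Pi.sub_apply]; ring
  rw [e, map_add, map_add, dblock_lowPass_mul h, zero_add]

/-- The product estimate for a single dyadic block. -/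
lemma exists_blk_prodSeq_le (hs : s ∈ Ioo 0 1) : ∃ C : ℝ≥0∞, C ≠ ⊤ ∧ ∀ {χ φ : ℝ → ℝ}, IsLP χ φ → ∀ a b : ℕ → L2R, bes χ φ 0 a ≠ ⊤ → bes χ φ s b ≠ ⊤ →
    (wnorm (-s) (fun k => ‖prodSeq s a b k‖ₑ) ≤ C * (bes χ φ 0 a * wnorm s fun k => ‖b k‖ₑ)) ∧ ∀ j,
    blk χ φ (-s) (prodSeq s a b) j ≤ C * (bes χ φ 0 a * ∑' q, blk χ φ s b (j - 2 + q) + (∑' q, blk χ φ 0 a (j - 2 + q)) * bes χ φ s b) := by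
  obtain ⟨C, hC, hbd⟩ := exists_prodSeq_bound hs
  refine ⟨2 * C, mul_ne_top (by simp) hC, fun {χ φ} h a b hA hB => ?_⟩
  have hfin : ∀ {σ : ℝ} {c : ℕ → L2R}, bes χ φ σ c ≠ ⊤ → 2 * bes χ φ σ c ≠ ⊤ := fun hc => mul_ne_top (by simp) hc
  have hw : ∀ {σ : ℝ} {c : ℕ → L2R}, bes χ φ σ c ≠ ⊤ → wnorm σ (fun k => ‖c k‖ₑ) ≠ ⊤ := fun hc =>
    ne_top_of_le_ne_top (hfin hc) (wnorm_le_bes h _ _)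
  have hnorm : ∀ (L : L2R →L[ℂ] L2R), (∀ a, ‖L a‖ ≤ ‖a‖) → ∀ a, ‖L a‖ₑ ≤ ‖a‖ₑ := fun L hL a => by
    rw [← ofReal_norm, ← ofReal_norm]; exact ofReal_le_ofReal (hL a)
  have h0 := hbd a b _ (mul_ne_top (hfin hA) (hw hB)) (lintegral_mul_le_left (ae_wnorm_apply_le h 0 a))
  refine ⟨h0.2.trans (le_of_eq (by ring)), fun j => ?_⟩
  set P := lowPass χ φ (j - 2) with hP
  have hlow : ∀ᵐ x, wnorm 0 (fun k => ‖P (a k) x‖ₑ) ≤ 2 * bes χ φ 0 a := by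
    filter_upwards [ae_wnorm_le h 0 a, ae_all_iff.2 fun k => ae_enorm_lowPass_le h (j - 2) (a k)] with x h1 h2
    exact (wnorm_mono h2).trans h1
  have tail : ∀ (τ : ℝ) (c : ℕ → L2R), bes χ φ τ c ≠ ⊤ → wnorm τ (fun k => ‖c k - P (c k)‖ₑ) ≠ ⊤ := fun τ c hc => by
    refine ne_top_of_le_ne_top (hfin hc) ((wnorm_sub_lowPass_le h τ (j - 2) c).trans ?_)
    refine le_trans (ENNReal.tsum_comp_le_tsum_of_injective (add_right_injective (j - 2)) (blk χ φ τ c)) ?_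
    rw [bes, ← ENNReal.tsum_mul_left]
    refine tsum_le_tsum fun q => ?_
    rw [← mul_assoc]
    exact le_mul_of_one_le_left' (one_le_two_mul_dw q)
  have h1 := hbd (fun k => P (a k)) (fun k => b k - P (b k)) _ (mul_ne_top (hfin hA) (tail s b hB)) (lintegral_mul_le_left hlow)
  have h2 := hbd (fun k => a k - P (a k)) b _ (mul_ne_top (tail 0 a hA) (hfin hB)) (lintegral_mul_le_right (ae_wnorm_apply_le h s b))
  have e : ∀ k, dblock χ φ j (prodSeq s a b k) = dblock χ φ j (prodSeq s (fun k => P (a k)) (fun k => b k - P (b k)) k)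
      + dblock χ φ j (prodSeq s (fun k => a k - P (a k)) b k) := fun k => by
    simp only [prodSeq, map_sum, map_smul]; rw [← Finset.sum_add_distrib]
    refine sum_congr rfl fun p _ => ?_
    rw [dblock_toL2_mul h j (h0.1 p.1 p.2), smul_add]
  have hd := fun c => hnorm (dblock χ φ j) (norm_dblock_le h j) c
  calc blk χ φ (-s) (prodSeq s a b) j
      ≤ wnorm (-s) (fun k => ‖prodSeq s (fun k => P (a k)) (fun k => b k - P (b k)) k‖ₑ + ‖prodSeq s (fun k => a k - P (a k)) b k‖ₑ) := wnorm_mono fun k => by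
        rw [e]; exact (enorm_add_le _ _).trans (add_le_add (hd _) (hd _))
    _ ≤ C * (2 * bes χ φ 0 a * wnorm s fun k => ‖b k - P (b k)‖ₑ)
        + C * ((wnorm 0 fun k => ‖a k - P (a k)‖ₑ) * (2 * bes χ φ s b)) :=
        (wnorm_add_le _ _ _).trans (add_le_add h1.2 h2.2)
    _ ≤ C * (2 * bes χ φ 0 a * ∑' q, blk χ φ s b (j - 2 + q))
        + C * ((∑' q, blk χ φ 0 a (j - 2 + q)) * (2 * bes χ φ s b)) := by
        gcongr
        · exact wnorm_sub_lowPass_le h s (j - 2) b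
        · exact wnorm_sub_lowPass_le h 0 (j - 2) a
    _ = _ := by ring

end

section

/-! ## Joint measurability -/

section Joint

variable {α : Type*} [MeasurableSpace α] {ν : Measure α} [SFinite ν]

/-- A square integrable function on a product as a vector valued function. -/
def curryLp (f : Lp ℂ 2 (ν.prod vol)) : Lp L2R 2 ν :=
  (memLp_toL2 (F := fun a x => f (a, x)) (Lp.memLp f)).toLp _

lemma curryLp_add (f g : Lp ℂ 2 (ν.prod vol)) : curryLp (f + g) = curryLp f + curryLp g := by
  rw [curryLp, curryLp, curryLp, ← MemLp.toLp_add, MemLp.toLp_eq_toLp_iff]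
  filter_upwards [Measure.ae_ae_of_ae_prod (Lp.coeFn_add f g), ae_memLp_slice (F := fun a x => f (a, x)) (Lp.memLp f),
    ae_memLp_slice (F := fun a x => g (a, x)) (Lp.memLp g)] with a h1 h2 h3
  rw [Pi.add_apply, ← toL2_add h2 h3]
  exact toL2_congr h1

lemma isClosed_range_curryLp : IsClosed (range (curryLp (ν := ν))) := by
  have h : Isometry (AddMonoidHom.mk' (curryLp (ν := ν)) curryLp_add) :=
    AddMonoidHomClass.isometry_of_norm _ fun f => by
      rw [AddMonoidHom.mk'_apply, curryLp, Lp.norm_toLp, eLpNorm_toL2 (F := fun a x => f (a, x)) (Lp.memLp f), Lp.norm_def]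
  exact h.isClosedEmbedding.isClosed_range

lemma exists_joint {u : α → L2R} (hu : MemLp u 2 ν) : ∃ F : α → ℝ → ℂ,
    StronglyMeasurable (fun p : α × ℝ => F p.1 p.2) ∧ MemLp (fun p : α × ℝ => F p.1 p.2) 2 (ν.prod volume) ∧ ∀ᵐ a ∂ν, toL2 (F a) = u a := by
  have key : ∀ w : Lp L2R 2 ν, w ∈ range (curryLp (ν := ν)) := by
    refine Lp.induction (by simp) _ (fun c S hS hfin => ?_) (fun f g hf hg _ ⟨F, hF⟩ ⟨G, hG⟩ => ?_) isClosed_range_curryLp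
    · have hm : MemLp (fun p : α × ℝ => S.indicator (fun _ => (1 : ℂ)) p.1 * c p.2) 2 (ν.prod volume) :=
        memLp_mul_prod (memLp_indicator_const 2 hS 1 (Or.inr hfin.ne)) (Lp.memLp c)
      refine ⟨hm.toLp _, Lp.ext ?_⟩
      filter_upwards [MemLp.coeFn_toLp (memLp_toL2 (F := fun a x => hm.toLp _ (a, x)) (Lp.memLp _)),
        Measure.ae_ae_of_ae_prod hm.coeFn_toLp, indicatorConstLp_coeFn (p := 2) (hs := hS) (hμs := hfin.ne) (c := c)] with a h1 h2 h3
      refine h1.trans ((toL2_congr h2).trans ?_)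
      rw [Lp.simpleFunc.coe_indicatorConst, h3]
      by_cases ha : a ∈ S
      · simp [ha, toL2_coeFn]
      · simp only [ha, not_false_eq_true, indicator_of_notMem, zero_mul]
        exact (toL2_congr (Lp.coeFn_zero ℂ 2 volume).symm).trans (toL2_coeFn 0)
    · exact ⟨F + G, by rw [curryLp_add, hF, hG]⟩
  obtain ⟨f, hf⟩ := key (hu.toLp u)
  refine ⟨fun a x => f (a, x), Lp.stronglyMeasurable f, Lp.memLp f, ?_⟩
  filter_upwards [MemLp.coeFn_toLp (memLp_toL2 (F := fun a x => f (a, x)) (Lp.memLp f)), hu.coeFn_toLp] with a h1 h2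
  rw [← h1, ← h2, ← hf, curryLp]

end Joint

/-! ## The bilinear term in time -/

variable {σ : ℝ} {u w : ℕ → ℝ → L2R}

lemma dw_le (j q : ℕ) : dw j ≤ 2 * ofReal (2 ^ (-(1 / 2) : ℝ)) ^ q * dw (j - 2 + q) := by
  have h2 : (2 : ℝ≥0∞) = ofReal 2 := by simp
  rw [dw, dw, h2, ENNReal.ofReal_rpow_of_pos two_pos, ENNReal.ofReal_rpow_of_pos two_pos, ← ofReal_pow (by positivity),
    ← ofReal_mul two_pos.le, ← ofReal_mul (by positivity)]
  refine ofReal_le_ofReal ?_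
  rw [← Real.rpow_mul_natCast two_pos.le]
  have e : (2 : ℝ) * 2 ^ (-(1 / 2) * (q : ℝ)) = 2 ^ (1 + -(1 / 2) * (q : ℝ)) := by rw [rpow_add two_pos, rpow_one]
  rw [e, ← rpow_add two_pos]
  refine Real.rpow_le_rpow_of_exponent_le one_le_two ?_
  have : (j : ℝ) ≤ ((j - 2 : ℕ) : ℝ) + 2 := by exact_mod_cast (by omega : j ≤ j - 2 + 2)
  push_cast
  linarith

lemma tsum_sub_two_le (Y : ℕ → ℝ≥0∞) (q : ℕ) : ∑' j, Y (j - 2 + q) ≤ 3 * ∑' j, Y j := by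
  rw [tsum_eq_zero_add' ENNReal.summable, tsum_eq_zero_add' ENNReal.summable]
  have h1 := le_tsum (f := Y) q
  have h2 := ENNReal.tsum_comp_le_tsum_of_injective (add_left_injective q) Y
  simp only [zero_le, Nat.sub_eq_zero_of_le, zero_add, Nat.one_le_ofNat, show ∀ b : ℕ, b + 1 + 1 - 2 = b by omega]
  calc _ ≤ ∑' j, Y j + (∑' j, Y j + ∑' j, Y j) := add_le_add h1 (add_le_add h1 h2)
    _ = _ := by ring

/-- The constant of the summation of tails. -/
def tailC : ℝ≥0∞ := 6 * (1 - ofReal (2 ^ (-(1 / 2) : ℝ)))⁻¹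

lemma tailC_ne_top : tailC ≠ ⊤ := by
  refine mul_ne_top (by simp) (ENNReal.inv_ne_top.2 (tsub_pos_of_lt ?_).ne')
  rw [ENNReal.ofReal_lt_one]
  exact Real.rpow_lt_one_of_one_lt_of_neg one_lt_two (by norm_num)

lemma tsum_dw_tail_le (X : ℕ → ℝ≥0∞) : ∑' j, dw j * ∑' q, X (j - 2 + q) ≤ tailC * ∑' q, dw q * X q := by
  simp only [← ENNReal.tsum_mul_left]
  calc ∑' j, ∑' q, dw j * X (j - 2 + q)
      ≤ ∑' j, ∑' q, 2 * ofReal (2 ^ (-(1 / 2) : ℝ)) ^ q * (dw (j - 2 + q) * X (j - 2 + q)) :=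
        tsum_le_tsum fun j => tsum_le_tsum fun q => by
          rw [← mul_assoc]; exact mul_le_mul' (dw_le j q) le_rfl
    _ = ∑' q, 2 * ofReal (2 ^ (-(1 / 2) : ℝ)) ^ q * ∑' j, dw (j - 2 + q) * X (j - 2 + q) := by
        rw [ENNReal.tsum_comm]; simp only [ENNReal.tsum_mul_left]
    _ ≤ ∑' q, 2 * ofReal (2 ^ (-(1 / 2) : ℝ)) ^ q * (3 * ∑' j, dw j * X j) :=
        tsum_le_tsum fun q => mul_le_mul' le_rfl (tsum_sub_two_le (fun j => dw j * X j) q)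
    _ = _ := by
        rw [ENNReal.tsum_mul_right, ENNReal.tsum_mul_left, ENNReal.tsum_geometric, ENNReal.tsum_mul_left, tailC]; ring

lemma eLpNorm_const_mul_ennreal {ν : Measure ℝ} {f : ℝ → ℝ≥0∞} (hf : AEMeasurable f ν) (c : ℝ≥0∞) : eLpNorm (fun t => c * f t) 2 ν = c * eLpNorm f 2 ν := by
  refine sq_injective_ennreal ?_
  rw [mul_pow, eLpNorm_two_sq, eLpNorm_two_sq, ← lintegral_const_mul'' _ (hf.enorm.pow_const 2)]
  simp only [enorm_eq_self, mul_pow]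

lemma aemeasurable_blk (hu : MeasSeq T u) (σ : ℝ) (q : ℕ) : AEMeasurable (fun t => blk χ φ σ (fun k => u k t) q) (leb T) :=
  measurable_wnorm σ fun k => ((dblock χ φ q).continuous.comp_aestronglyMeasurable (hu k)).enorm

lemma aemeasurable_bes (hu : MeasSeq T u) (σ : ℝ) : AEMeasurable (fun t => bes χ φ σ fun k => u k t) (leb T) :=
  AEMeasurable.tsum fun q => (aemeasurable_blk hu σ q).const_mul _

lemma eLpNorm_bes_le (hu : MeasSeq T u) (σ : ℝ) : eLpNorm (fun t => bes χ φ σ fun k => u k t) 2 (leb T) ≤ cl χ φ T 2 σ u := by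
  refine (eLpNorm_tsum_le (fun q => (aemeasurable_blk hu σ q).const_mul (dw q)) (Or.inl rfl)).trans_eq ?_
  exact tsum_congr fun q => eLpNorm_const_mul_ennreal (aemeasurable_blk hu σ q) _

lemma ae_blk_le (σ : ℝ) (u : ℕ → ℝ → L2R) : ∀ᵐ t ∂leb T, ∀ q, blk χ φ σ (fun k => u k t) q ≤ eLpNorm (fun t => blk χ φ σ (fun k => u k t) q) ⊤ (leb T) :=
  ae_all_iff.2 fun q => by
    rw [eLpNorm_exponent_top]; exact ae_le_eLpNormEssSup (f := fun t => blk χ φ σ (fun k => u k t) q)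

lemma ae_bes_le (σ : ℝ) (u : ℕ → ℝ → L2R) : ∀ᵐ t ∂leb T, bes χ φ σ (fun k => u k t) ≤ cl χ φ T ⊤ σ u := by
  filter_upwards [ae_blk_le σ u] with t ht
  exact tsum_le_tsum fun q => mul_le_mul' le_rfl (ht q)

lemma ae_bes_ne_top (hu : MeasSeq T u) (hc : cl χ φ T 2 σ u ≠ ⊤) : ∀ᵐ t ∂leb T, bes χ φ σ (fun k => u k t) ≠ ⊤ := by
  have h := pow_ne_top (n := 2) (ne_top_of_le_ne_top hc (eLpNorm_bes_le hu σ))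
  rw [eLpNorm_two_sq] at h
  filter_upwards [ae_lt_top' ((aemeasurable_bes hu σ).enorm.pow_const 2) h] with t ht htop
  simp [htop] at ht

lemma eLpNorm_wnorm_le (h : IsLP χ φ) (hu : MeasSeq T u) (σ : ℝ) : eLpNorm (fun t => wnorm σ fun k => ‖u k t‖ₑ) 2 (leb T) ≤ 2 * cl χ φ T 2 σ u := by
  refine le_trans ?_ (mul_le_mul' le_rfl (eLpNorm_bes_le hu σ))
  rw [← eLpNorm_const_mul_ennreal (aemeasurable_bes hu σ)]
  exact eLpNorm_mono_enorm fun t => wnorm_le_bes h σ _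

lemma energy_ne_top_of_cl (h : IsLP χ φ) (hu : MeasSeq T u) (hc : cl χ φ T 2 σ u ≠ ⊤) : energy T σ u ≠ ⊤ := by
  rw [energy_eq hu]
  exact pow_ne_top (ne_top_of_le_mul (by simp) hc (eLpNorm_wnorm_le h hu σ))

/-- The bilinear term for time dependent sequences. -/
def bilin (s : ℝ) (u w : ℕ → ℝ → L2R) (k : ℕ) (t : ℝ) : L2R := prodSeq s (fun k => u k t) (fun k => w k t) k

lemma aestronglyMeasurable_toL2_mul (h : IsLP χ φ) {i : ℕ} (hui : MemLp (u i) 2 (leb T)) (hc : cl χ φ T ⊤ 0 u ≠ ⊤) {f : ℝ → L2R} (hf : MemLp f 2 (leb T)) :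
    AEStronglyMeasurable (fun t => toL2 fun x => u i t x * f t x) (leb T) := by
  obtain ⟨F, hFm, hF, hFu⟩ := exists_joint hui
  obtain ⟨G, hGm, hG, hGf⟩ := exists_joint hf
  have hFG : MemLp (fun p : ℝ × ℝ => F p.1 p.2 * G p.1 p.2) 2 ((leb T).prod volume) := by
    refine hG.of_le_mul (c := (2 * cl χ φ T ⊤ 0 u).toReal) (hFm.aestronglyMeasurable.mul hGm.aestronglyMeasurable) ?_
    have hm : Measurable fun p : ℝ × ℝ => F p.1 p.2 * G p.1 p.2 := hFm.measurable.mul hGm.measurable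
    rw [Measure.ae_prod_iff_ae_ae (measurableSet_le hm.norm (hGm.norm.measurable.const_mul _))]
    filter_upwards [ae_bes_le 0 u, hFu, ae_memLp_slice hF] with t h1 h2 h3
    filter_upwards [ae_wnorm_apply_le h 0 fun k => u k t, coeFn_toL2 h3] with x h4 h5
    rw [norm_mul]
    refine mul_le_mul_of_nonneg_right ?_ (norm_nonneg _)
    rw [← toReal_enorm, ← h5, h2]
    refine ENNReal.toReal_mono (mul_ne_top (by simp) hc) (le_trans ?_ (h4.trans (mul_le_mul' le_rfl h1)))
    rw [← sq_le_sq_ennreal, wnorm_sq]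
    exact le_trans (by simp) (le_tsum (f := fun i => weight 0 i * ‖u i t x‖ₑ ^ 2) i)
  refine (aestronglyMeasurable_toL2 (F := fun t x => F t x * G t x) hFG).congr ?_
  filter_upwards [hFu, hGf, ae_memLp_slice hF, ae_memLp_slice hG] with t h1 h2 h3 h4
  refine toL2_congr ?_
  filter_upwards [coeFn_toL2 h3, coeFn_toL2 h4] with x h5 h6
  rw [← h1, ← h2, h5, h6]

lemma memLp_of_cl (h : IsLP χ φ) (hu : MeasSeq T u) (hc : cl χ φ T 2 σ u ≠ ⊤) (k : ℕ) : MemLp (u k) 2 (leb T) :=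
  memLp_of_energy hu (energy_ne_top_of_cl h hu hc) k

/-- The product estimate in the Chemin-Lerner spaces. -/
lemma exists_cl_bilin_le (hs : s ∈ Ioo 0 1) : ∃ K : ℝ≥0∞, K ≠ ⊤ ∧ ∀ {χ φ : ℝ → ℝ}, IsLP χ φ →
    ∀ (T : ℝ) (u w : ℕ → ℝ → L2R), (∀ k, MemLp (u k) 2 (leb T)) → (MeasSeq T w) →
    cl χ φ T ⊤ 0 u ≠ ⊤ → cl χ φ T 2 s w ≠ ⊤ → (MeasSeq T (bilin s u w)) ∧
    energy T (-s) (bilin s u w) ≠ ⊤ ∧ cl χ φ T 2 (-s) (bilin s u w) ≤ K * (cl χ φ T ⊤ 0 u * cl χ φ T 2 s w) := by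
  obtain ⟨C, hC, hb⟩ := exists_blk_prodSeq_le hs
  refine ⟨C * (2 * tailC), mul_ne_top hC (mul_ne_top (by simp) tailC_ne_top),
    fun {χ φ} h T u w hu hw hA hB => ?_⟩
  have hm : MeasSeq T (bilin s u w) := fun k => by
    have h1 : ∀ p : ℕ × ℕ, AEStronglyMeasurable (fun t => (collCoef s p.1 p.2 : ℂ) • toL2 fun x => u p.1 t x * w p.2 t x)
      (leb T) := fun p => AEStronglyMeasurable.const_smul (aestronglyMeasurable_toL2_mul h (hu p.1) hA (memLp_of_cl h hw hB p.2)) (collCoef s p.1 p.2 : ℂ)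
    exact Finset.aestronglyMeasurable_fun_sum (antidiagonal k) fun p _ => h1 p
  set A := cl χ φ T ⊤ 0 u
  set B := cl χ φ T 2 s w
  set E := fun q => eLpNorm (fun t => blk χ φ 0 (fun k => u k t) q) ⊤ (leb T) with hE
  set F := fun q => eLpNorm (fun t => blk χ φ s (fun k => w k t) q) 2 (leb T) with hF
  have hae : ∀ᵐ t ∂leb T, (wnorm (-s) (fun k => ‖bilin s u w k t‖ₑ) ≤ C * A * wnorm s fun k => ‖w k t‖ₑ) ∧
      ∀ j, blk χ φ (-s) (fun k => bilin s u w k t) j ≤ C * (A * ∑' q, blk χ φ s (fun k => w k t) (j - 2 + q)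
        + (∑' q, E (j - 2 + q)) * bes χ φ s fun k => w k t) := by
    filter_upwards [ae_bes_le 0 u, ae_blk_le 0 u, ae_bes_ne_top hw hB] with t h1 h2 h3
    have h4 := hb h (fun k => u k t) (fun k => w k t) (ne_top_of_le_ne_top hA h1) h3
    refine ⟨h4.1.trans ?_, fun j => (h4.2 j).trans ?_⟩
    · rw [mul_assoc]; exact mul_le_mul' le_rfl (mul_le_mul' h1 le_rfl)
    · exact mul_le_mul' le_rfl (add_le_add (mul_le_mul' h1 le_rfl)
        (mul_le_mul' (tsum_le_tsum fun q => h2 _) le_rfl))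
  refine ⟨hm, ?_, ?_⟩
  · rw [energy_eq hm]
    refine pow_ne_top (ne_top_of_le_ne_top ?_ ((eLpNorm_mono_enorm_ae (hae.mono fun t ht => ht.1)).trans_eq
      (eLpNorm_const_mul_ennreal (measurable_wnorm s fun k => (hw k).enorm) (C * A))))
    exact mul_ne_top (mul_ne_top hC hA) (ne_top_of_le_mul (by simp) hB (eLpNorm_wnorm_le h hw s))
  · have hj : ∀ j, eLpNorm (fun t => blk χ φ (-s) (fun k => bilin s u w k t) j) 2 (leb T)
        ≤ C * (A * ∑' q, F (j - 2 + q) + (∑' q, E (j - 2 + q)) * B) := fun j => by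
      have m1 : AEMeasurable (fun t => ∑' q, blk χ φ s (fun k => w k t) (j - 2 + q)) (leb T) :=
        AEMeasurable.tsum fun q => aemeasurable_blk hw s _
      have m2 := aemeasurable_bes (χ := χ) (φ := φ) hw s
      refine (eLpNorm_mono_enorm_ae (g := fun t => C * (A * ∑' q, blk χ φ s (fun k => w k t) (j - 2 + q)
        + (∑' q, E (j - 2 + q)) * bes χ φ s fun k => w k t)) (hae.mono fun t ht => ht.2 j)).trans ?_
      refine (eLpNorm_const_mul_ennreal ((m1.const_mul _).add (m2.const_mul _)) C).trans_le (mul_le_mul' le_rfl ?_)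
      refine (eLpNorm_add_le (m1.const_mul A).aestronglyMeasurable (m2.const_mul _).aestronglyMeasurable (by norm_num)).trans (add_le_add ?_ ?_)
      · exact (eLpNorm_const_mul_ennreal m1 A).trans_le (mul_le_mul' le_rfl
          (eLpNorm_tsum_le (fun q => aemeasurable_blk hw s _) (Or.inl rfl)))
      · exact (eLpNorm_const_mul_ennreal m2 _).trans_le (mul_le_mul' le_rfl (eLpNorm_bes_le hw s))
    calc cl χ φ T 2 (-s) (bilin s u w) ≤ ∑' j, dw j * (C * (A * ∑' q, F (j - 2 + q) + (∑' q, E (j - 2 + q)) * B)) :=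
          tsum_le_tsum fun j => mul_le_mul' le_rfl (hj j)
      _ = C * (A * ∑' j, dw j * ∑' q, F (j - 2 + q) + (∑' j, dw j * ∑' q, E (j - 2 + q)) * B) := by
          rw [← ENNReal.tsum_mul_left, ← ENNReal.tsum_mul_right, ← tsum_add, ← ENNReal.tsum_mul_left]
          exact tsum_congr fun j => by ring
      _ ≤ C * (A * (tailC * B) + (tailC * A) * B) := by
          gcongr
          · exact tsum_dw_tail_le F
          · exact tsum_dw_tail_le E
      _ = _ := by ring

end

section

/-! ## The nonlinear problem for Hermite coefficients -/

variable {σ : ℝ} {u₀ a b : ℕ → L2R} {u w f f' : ℕ → ℝ → L2R}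

namespace IsSolution

lemma summable_residual (h : IsSolution s T u₀ u f) (hs : s ∈ Ioo 0 1) {F : ℝ × ℝ × ℝ → ℂ} (hF : IsBump₃ F) :
    Summable fun k => ∫ t in Icc 0 T, ⟪tcoef F k t, (rate s k : ℂ) • u k t - f k t⟫_ℂ := by
  refine summable_integral_inner (σ := -s) (fun k => (memLp_tcoef hF T k).1) (fun k => (h.memLp_residual k).1) ?_ (h.energy_residual hs)
  rw [neg_neg]; exact (energy_tcoef_lt_top hF T hs.1.le (by linarith [hs.2])).ne

lemma summable_inner (h : IsSolution s T u₀ u f) (hs : s ∈ Ioo 0 1) {F : ℝ × ℝ × ℝ → ℂ} (hF : IsBump₃ F) :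
    Summable fun k => ∫ t in Icc 0 T, ⟪tcoef F k t, u k t⟫_ℂ := by
  refine summable_integral_inner (σ := 0) (fun k => (memLp_tcoef hF T k).1) h.meas ?_ (h.energy_zero hs)
  rw [neg_zero]; exact (energy_tcoef_zero_lt_top hF T).ne

/-- The difference of two solutions with the same datum. -/
lemma sub (hs : s ∈ Ioo 0 1) (h : IsSolution s T u₀ u f) (h' : IsSolution s T u₀ w f') :
    IsSolution s T 0 (fun k t => u k t - w k t) fun k t => f k t - f' k t where
  initial := by simp
  meas k := (h.meas k).sub (h'.meas k)
  meas_source k := (h.meas_source k).sub (h'.meas_source k)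
  energy := ne_top_of_le_mul (by simp) (ENNReal.add_ne_top.2 ⟨h.energy, h'.energy⟩)
    (energy_sub_le h.meas h'.meas)
  energy_source := ne_top_of_le_mul (by simp) (ENNReal.add_ne_top.2 ⟨h.energy_source, h'.energy_source⟩)
    (energy_sub_le h.meas_source h'.meas_source)
  weak F hF := by
    have hB := hF.isBump
    have e1 := (h.summable_residual hs hB).tsum_sub (h'.summable_residual hs hB)
    have e2 := (h.summable_inner hs hB.transport).tsum_sub (h'.summable_inner hs hB.transport)
    rw [h.weak F hF, h'.weak F hF] at e1
    have d1 : ∀ k, ∫ t in Icc 0 T, ⟪tcoef F k t, (rate s k : ℂ) • (u k t - w k t) - (f k t - f' k t)⟫_ℂ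
        = (∫ t in Icc 0 T, ⟪tcoef F k t, (rate s k : ℂ) • u k t - f k t⟫_ℂ)
          - ∫ t in Icc 0 T, ⟪tcoef F k t, (rate s k : ℂ) • w k t - f' k t⟫_ℂ := fun k => by
      rw [← integral_sub (f := fun t => ⟪tcoef F k t, (rate s k : ℂ) • u k t - f k t⟫_ℂ) (g := fun t => ⟪tcoef F k t, (rate s k : ℂ) • w k t - f' k t⟫_ℂ)
        (integrable_inner_of_memLp (memLp_tcoef hB T k) (h.memLp_residual k)) (integrable_inner_of_memLp (memLp_tcoef hB T k) (h'.memLp_residual k))]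
      refine integral_ext fun t => ?_
      simp only [← inner_sub_right]; congr 1
      rw [smul_sub]; abel
    have d2 : ∀ k, ∫ t in Icc 0 T, ⟪tcoef (transport F) k t, u k t - w k t⟫_ℂ
        = (∫ t in Icc 0 T, ⟪tcoef (transport F) k t, u k t⟫_ℂ) - ∫ t in Icc 0 T, ⟪tcoef (transport F) k t, w k t⟫_ℂ := fun k => by
      rw [← integral_sub (f := fun t => ⟪tcoef (transport F) k t, u k t⟫_ℂ) (g := fun t => ⟪tcoef (transport F) k t, w k t⟫_ℂ)
        (integrable_inner_of_memLp (memLp_tcoef hB.transport T k) (h.memLp k))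
        (integrable_inner_of_memLp (memLp_tcoef hB.transport T k) (h'.memLp k))]
      simp only [inner_sub_right]
    simp only [d1, d2, Pi.zero_apply, inner_zero_right, tsum_zero, add_zero]
    rw [e2, e1]; ring

lemma congr_source (h : IsSolution s T u₀ u f) (hff : ∀ k, f k =ᵐ[leb T] f' k) : IsSolution s T u₀ u f' where
  initial := h.initial
  meas := h.meas
  meas_source k := (h.meas_source k).congr (hff k)
  energy := h.energy
  energy_source := by
    refine ne_of_eq_of_ne ?_ h.energy_source
    rw [Kac.energy, Kac.energy]
    exact tsum_congr fun k => by rw [eLpNorm_congr_ae (hff k)]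
  weak F hF := by
    rw [← h.weak F hF]
    refine tsum_congr fun k => integral_congr_ae ?_
    filter_upwards [hff k] with t ht
    rw [ht]

end IsSolution

lemma prodSeq_sub (h : IsLP χ φ) (ha : bes χ φ 0 a ≠ ⊤) (hb : bes χ φ 0 b ≠ ⊤) (k : ℕ) :
    prodSeq s a a k - prodSeq s b b k = prodSeq s (fun k => a k - b k) a k + prodSeq s b (fun k => a k - b k) k := by
  simp only [prodSeq]
  rw [← Finset.sum_sub_distrib, ← Finset.sum_add_distrib]
  refine sum_congr rfl fun p _ => ?_
  have m1 := memLp_mul_of_bes h ha p.1 (a p.2)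
  have m2 := memLp_mul_of_bes h hb p.1 (a p.2)
  have m3 := memLp_mul_of_bes h hb p.1 (b p.2)
  rw [← smul_sub, ← smul_add]
  congr 1
  have e1 : toL2 (fun x => (a p.1 - b p.1 : L2R) x * a p.2 x) = toL2 (fun x => a p.1 x * a p.2 x - b p.1 x * a p.2 x) := by
    refine toL2_congr ?_
    filter_upwards [Lp.coeFn_sub (a p.1) (b p.1)] with x hx
    rw [hx, Pi.sub_apply, sub_mul]
  have e2 : toL2 (fun x => b p.1 x * (a p.2 - b p.2 : L2R) x) = toL2 (fun x => b p.1 x * a p.2 x - b p.1 x * b p.2 x) := by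
    refine toL2_congr ?_
    filter_upwards [Lp.coeFn_sub (a p.2) (b p.2)] with x hx
    rw [hx, Pi.sub_apply, mul_sub]
  rw [e1, e2, toL2_sub m1 m2, toL2_sub m2 m3]
  abel

lemma cl_congr {p : ℝ≥0∞} (h : ∀ᵐ t ∂leb T, ∀ k, u k t = w k t) : cl χ φ T p σ u = cl χ φ T p σ w := by
  rw [cl_eq, cl_eq]
  refine tsum_congr fun q => congrArg₂ _ rfl (eLpNorm_congr_ae ?_)
  filter_upwards [h] with t ht
  simp only [ht]

lemma cl_tsum_le {d : ℕ → ℕ → ℝ → L2R} (hd : ∀ m k, AEStronglyMeasurable (d m k) (leb T))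
    (hs : ∀ᵐ t ∂leb T, ∀ k, Summable fun m => d m k t) {p : ℝ≥0∞} (hp : p = 2 ∨ p = ⊤) (σ : ℝ) :
    cl χ φ T p σ (fun k t => ∑' m, d m k t) ≤ ∑' m, cl χ φ T p σ (d m) := by
  simp only [cl_eq]
  rw [ENNReal.tsum_comm]
  refine tsum_le_tsum fun q => ?_
  rw [ENNReal.tsum_mul_left]
  refine mul_le_mul' le_rfl (le_trans ?_ (eLpNorm_tsum_le (fun m => aemeasurable_blk (hd m) σ q) hp))
  refine eLpNorm_mono_enorm_ae ?_
  filter_upwards [hs] with t ht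
  refine (wnorm_mono fun k => ?_).trans (wnorm_tsum_le σ fun m k => ‖dblock χ φ q (d m k t)‖ₑ)
  refine le_of_tendsto' (((dblock χ φ q).continuous.tendsto _).comp (ht k).hasSum.tendsto_sum_nat).enorm fun n => ?_
  rw [Function.comp_apply, map_sum]
  exact (enorm_sum_le _ _).trans (sum_le_tsum _)

end

section

/-! ## The fixed point -/

variable {σ : ℝ} {K : ℝ≥0∞} {u₀ : ℕ → L2R} {u w z v v' : ℕ → ℝ → L2R}

lemma cl_add_le (hu : MeasSeq T u) (hw : MeasSeq T w) {p : ℝ≥0∞} (hp : 1 ≤ p) (σ : ℝ) :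
    cl χ φ T p σ (fun k t => u k t + w k t) ≤ cl χ φ T p σ u + cl χ φ T p σ w := by
  rw [cl_eq, cl_eq, cl_eq, ← tsum_add]
  refine tsum_le_tsum fun q => ?_
  rw [← mul_add]
  refine mul_le_mul' le_rfl (le_trans (eLpNorm_mono_enorm fun t => ?_) (eLpNorm_add_le
    (aemeasurable_blk hu σ q).aestronglyMeasurable (aemeasurable_blk hw σ q).aestronglyMeasurable hp))
  refine (wnorm_mono fun k => ?_).trans (wnorm_add_le σ _ _)
  rw [map_add]; exact enorm_add_le _ _

lemma cl_neg (p : ℝ≥0∞) (σ : ℝ) : cl χ φ T p σ (fun k t => -u k t) = cl χ φ T p σ u := by simp only [cl, map_neg, enorm_neg]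

/-- The norm of the solution space. -/
def solNorm (χ φ : ℝ → ℝ) (s T : ℝ) (u : ℕ → ℝ → L2R) : ℝ≥0∞ := cl χ φ T ⊤ 0 u + cl χ φ T 2 s u

lemma solNorm_add_le (hu : MeasSeq T u) (hw : MeasSeq T w) : solNorm χ φ s T (fun k t => u k t + w k t) ≤ solNorm χ φ s T u + solNorm χ φ s T w :=
  (add_le_add (cl_add_le hu hw le_top 0) (cl_add_le hu hw (by norm_num) s)).trans_eq (add_add_add_comm _ _ _ _)

lemma solNorm_sub_comm : solNorm χ φ s T (fun k t => u k t - w k t) = solNorm χ φ s T fun k t => w k t - u k t := by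
  rw [solNorm, solNorm, ← cl_neg, ← cl_neg (p := 2)]; simp only [neg_sub]

lemma solNorm_sub_le (hu : MeasSeq T u) (hw : MeasSeq T w) : solNorm χ φ s T (fun k t => u k t - w k t) ≤ solNorm χ φ s T u + solNorm χ φ s T w := by
  have := solNorm_add_le (χ := χ) (φ := φ) (s := s) hu fun k => (hw k).neg
  simp only [Pi.neg_apply, ← sub_eq_add_neg] at this
  refine this.trans_eq (congrArg₂ _ rfl ?_)
  rw [solNorm, solNorm, ← cl_neg, ← cl_neg (p := 2)]
  simp only [Pi.neg_apply, neg_neg]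

lemma solNorm_congr (h : ∀ᵐ t ∂leb T, ∀ k, u k t = w k t) : solNorm χ φ s T u = solNorm χ φ s T w := by
  rw [solNorm, solNorm, cl_congr h, cl_congr h]

lemma ae_eq_of_solNorm (h : IsLP χ φ) (hu : MeasSeq T u) (hw : MeasSeq T w) (h0 : solNorm χ φ s T (fun k t => u k t - w k t) = 0) :
    ∀ᵐ t ∂leb T, ∀ k, u k t = w k t := by
  have hm : ∀ k, AEStronglyMeasurable (fun t => u k t - w k t) (leb T) := fun k => (hu k).sub (hw k)
  have h1 := eLpNorm_wnorm_le h hm s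
  rw [(add_eq_zero.1 h0).2, mul_zero, nonpos_iff_eq_zero] at h1
  have h2 := energy_eq (σ := s) hm
  rw [h1, energy, zero_pow two_ne_zero, ENNReal.tsum_eq_zero] at h2
  refine ae_all_iff.2 fun k => ?_
  have h3 := (mul_eq_zero.1 (h2 k)).resolve_left (weight_ne_zero s k)
  filter_upwards [(eLpNorm_eq_zero_iff (hm k) (by norm_num)).1 (pow_eq_zero_iff two_ne_zero |>.1 h3)] with t ht
  exact sub_eq_zero.1 ht

/-- The product estimate with constant `K`. -/
def BilinBound (χ φ : ℝ → ℝ) (s : ℝ) (K : ℝ≥0∞) : Prop :=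
  ∀ (T : ℝ) (u w : ℕ → ℝ → L2R), (∀ k, MemLp (u k) 2 (leb T)) → (MeasSeq T w) → cl χ φ T ⊤ 0 u ≠ ⊤ → cl χ φ T 2 s w ≠ ⊤ → (MeasSeq T (bilin s u w)) ∧
    energy T (-s) (bilin s u w) ≠ ⊤ ∧ cl χ φ T 2 (-s) (bilin s u w) ≤ K * (cl χ φ T ⊤ 0 u * cl χ φ T 2 s w)

/-- The constant of the nonlinear estimate. -/
def nonlinConst (K : ℝ≥0∞) (T : ℝ) : ℝ≥0∞ := 1281 * growth T ^ 2 * K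

lemma solNorm_ne_top (hu : solNorm χ φ s T u ≠ ⊤) : cl χ φ T ⊤ 0 u ≠ ⊤ ∧ cl χ φ T 2 s u ≠ ⊤ := ENNReal.add_ne_top.1 hu

lemma BilinBound.apply (hK : BilinBound χ φ s K) (h : IsLP χ φ) (hu : MeasSeq T u) (hw : MeasSeq T w)
    (hxu : solNorm χ φ s T u ≠ ⊤) (hxw : solNorm χ φ s T w ≠ ⊤) :
    (MeasSeq T (bilin s u w)) ∧ energy T (-s) (bilin s u w) ≠ ⊤ ∧ cl χ φ T 2 (-s) (bilin s u w) ≤ K * (solNorm χ φ s T u * solNorm χ φ s T w) := by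
  have h1 := hK T u w (memLp_of_cl h hu (solNorm_ne_top hxu).2) hw (solNorm_ne_top hxu).1 (solNorm_ne_top hxw).2
  exact ⟨h1.1, h1.2.1, h1.2.2.trans (mul_le_mul' le_rfl (mul_le_mul' le_self_add le_add_self))⟩

lemma solNorm_difference_le (hs : s ∈ Ioo 0 1) (hT : 0 ≤ T) (h : IsLP χ φ) (hK : BilinBound χ φ s K)
    (hv : IsSolution s T u₀ v (bilin s u u)) (hv' : IsSolution s T u₀ v' (bilin s w w))
    (hu : MeasSeq T u) (hw : MeasSeq T w)
    (hxu : solNorm χ φ s T u ≠ ⊤) (hxw : solNorm χ φ s T w ≠ ⊤) :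
    solNorm χ φ s T (fun k t => v k t - v' k t) ≤ nonlinConst K T * (solNorm χ φ s T u + solNorm χ φ s T w) * solNorm χ φ s T fun k t => u k t - w k t := by
  have hd : ∀ k, AEStronglyMeasurable (fun t => u k t - w k t) (leb T) := fun k => (hu k).sub (hw k)
  have hxd := ne_top_of_le_ne_top (ENNReal.add_ne_top.2 ⟨hxu, hxw⟩) (solNorm_sub_le (χ := χ) (φ := φ) (s := s) hu hw)
  have b1 := hK.apply h hd hu hxd hxu
  have b2 := hK.apply h hw hd hxw hxd
  have hsol := (hv.sub hs hv').congr_source (f' := fun k t => bilin s (fun k t => u k t - w k t) u k t + bilin s w (fun k t => u k t - w k t) k t) fun k => by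
    filter_upwards [ae_bes_le 0 u, ae_bes_le 0 w] with t h1 h2
    exact prodSeq_sub h (ne_top_of_le_ne_top (solNorm_ne_top hxu).1 h1) (ne_top_of_le_ne_top (solNorm_ne_top hxw).1 h2) k
  refine (hsol.linear_estimate h hs hT).trans ?_
  have h0 : besov χ φ 0 = 0 := by simp [besov, wnorm]
  rw [h0, mul_zero, zero_add]
  refine (mul_le_mul' le_rfl ((cl_add_le b1.1 b2.1 (by norm_num) (-s)).trans (add_le_add b1.2.2 b2.2.2))).trans_eq ?_
  rw [nonlinConst]; ring

lemma exists_step (hs : s ∈ Ioo 0 1) (hT : 0 ≤ T) (h : IsLP χ φ) (hK : BilinBound χ φ s K)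
    (hu₀ : besov χ φ u₀ ≠ ⊤) (hu : MeasSeq T u) (hxu : solNorm χ φ s T u ≠ ⊤) :
    ∃ v, IsSolution s T u₀ v (bilin s u u) ∧ solNorm χ φ s T v ≤ 37 * growth T * besov χ φ u₀ + nonlinConst K T * solNorm χ φ s T u ^ 2 := by
  have b := hK.apply h hu hu hxu hxu
  have hi : ∑' k, ‖u₀ k‖ₑ ^ 2 ≠ ⊤ := by
    have := wnorm_sq 0 fun k => ‖u₀ k‖ₑ
    simp only [weight_zero, one_mul] at this; rw [← this]
    exact pow_ne_top (ne_top_of_le_mul (by simp) hu₀ (wnorm_le_bes h 0 u₀))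
  obtain ⟨v, h1, h2, h3⟩ := exists_isWeakSeq hs hT hi b.1 b.2.1
  have hsol : IsSolution s T u₀ v (bilin s u u) := ⟨h3, hi, h1, h2, b.1, b.2.1⟩
  refine ⟨v, hsol, (hsol.linear_estimate h hs hT).trans (add_le_add le_rfl ((mul_le_mul' le_rfl b.2.2).trans_eq ?_))⟩
  rw [nonlinConst]; ring

lemma ae_summable_of_solNorm (h : IsLP χ φ) {d : ℕ → ℕ → ℝ → L2R} (hd : ∀ m k, AEStronglyMeasurable (d m k) (leb T)) (hs : ∑' m, solNorm χ φ s T (d m) ≠ ⊤) :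
    ∀ᵐ t ∂leb T, ∀ k, Summable fun m => d m k t := by
  have hmw : ∀ m, AEMeasurable (fun t => wnorm s fun k => ‖d m k t‖ₑ) (leb T) := fun m =>
    measurable_wnorm s fun k => (hd m k).enorm
  have h1 : eLpNorm (fun t => ∑' m, wnorm s fun k => ‖d m k t‖ₑ) 2 (leb T) ≤ 2 * ∑' m, solNorm χ φ s T (d m) := by
    rw [← ENNReal.tsum_mul_left]
    exact (eLpNorm_tsum_le hmw (Or.inl rfl)).trans (tsum_le_tsum fun m =>
      (eLpNorm_wnorm_le h (hd m) s).trans (mul_le_mul' le_rfl le_add_self))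
  have h2 := pow_ne_top (n := 2) (ne_top_of_le_mul (by simp) hs h1)
  rw [eLpNorm_two_sq] at h2
  filter_upwards [ae_lt_top' ((AEMeasurable.tsum hmw).enorm.pow_const 2) h2] with t ht k
  have h3 : ∑' m, ‖d m k t‖ₑ ≠ ⊤ := fun hc => by
    refine ht.ne ?_
    have h4 := wnorm_tsum_le s fun m k => ‖d m k t‖ₑ
    have h5 : wnorm s (fun k => ∑' m, ‖d m k t‖ₑ) ^ 2 = ⊤ := by
      rw [wnorm_sq]
      exact ENNReal.tsum_eq_top_of_eq_top ⟨k, by simp [hc, mul_top, weight_ne_zero]⟩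
    rw [enorm_eq_self, eq_top_iff, ← h5]; exact pow_le_pow_left₀ zero_le h4 2
  refine Summable.of_norm ?_
  simpa using summable_toReal h3

lemma tendsto_half_pow_mul {c : ℝ≥0∞} (hc : c ≠ ⊤) : Tendsto (fun M : ℕ => (2⁻¹ : ℝ≥0∞) ^ M * c) atTop (𝓝 0) := by
  have := ENNReal.Tendsto.mul_const (b := c) (ENNReal.tendsto_pow_atTop_nhds_zero_of_lt_one (r := 2⁻¹) ENNReal.one_half_lt_one) (Or.inr hc)
  rwa [zero_mul] at this

/-- Existence of a solution of the nonlinear problem. -/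
lemma exists_solution (hs : s ∈ Ioo 0 1) (hT : 0 ≤ T) (h : IsLP χ φ) (hK : BilinBound χ φ s K)
    (hu₀ : besov χ φ u₀ ≠ ⊤) (hsmall : nonlinConst K T * (4 * (37 * growth T * besov χ φ u₀)) ≤ 2⁻¹) :
    ∃ u, IsSolution s T u₀ u (bilin s u u) ∧ solNorm χ φ s T u ≤ 148 * growth T * besov χ φ u₀ := by
  set r := 37 * growth T * besov χ φ u₀ with hr
  have hrt : r ≠ ⊤ := mul_ne_top (mul_ne_top (by simp) ofReal_ne_top) hu₀
  set X := solNorm χ φ s T with hX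
  set L := nonlinConst K T with hL
  have h2r : 2 * r ≠ ⊤ := mul_ne_top (by simp) hrt
  have hstep : ∀ u : ℕ → ℝ → L2R, (MeasSeq T u) → X u ≠ ⊤ →
    ∃ v, IsSolution s T u₀ v (bilin s u u) ∧ X v ≤ r + L * X u ^ 2 := fun u hu hxu => exists_step hs hT h hK hu₀ hu hxu
  choose! Φ hΦ hΦX using hstep
  set g : ℕ → ℕ → ℝ → L2R := fun m => Φ^[m] 0 with hg
  have gsucc : ∀ m, g (m + 1) = Φ (g m) := fun m => Function.iterate_succ_apply' Φ m 0
  have ginv : ∀ m, (∀ k, AEStronglyMeasurable (g m k) (leb T)) ∧ X (g m) ≤ 2 * r := fun m => by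
    induction m with
    | zero =>
      refine ⟨fun k => aestronglyMeasurable_const, ?_⟩
      have : X (g 0) = 0 := by
        simp [hX, hg, solNorm, cl, wnorm]
        exact .of_forall fun _ => rfl
      rw [this]; exact zero_le
    | succ m ih =>
      have ht := ne_top_of_le_ne_top h2r ih.2
      rw [gsucc]
      refine ⟨(hΦ _ ih.1 ht).meas, (hΦX _ ih.1 ht).trans ?_⟩
      calc r + L * X (g m) ^ 2 ≤ r + L * (2 * r) ^ 2 := by gcongr; exact ih.2
        _ = r + L * (4 * r) * r := by ring
        _ ≤ r + 1 * r := by gcongr; exact hsmall.trans (by simp)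
        _ = 2 * r := by ring
  have gX : ∀ m, X (g m) ≠ ⊤ := fun m => ne_top_of_le_ne_top h2r (ginv m).2
  have gsol : ∀ m, IsSolution s T u₀ (g (m + 1)) (bilin s (g m) (g m)) := fun m => by
    rw [gsucc]; exact hΦ _ (ginv m).1 (gX m)
  set d : ℕ → ℕ → ℝ → L2R := fun m k t => g (m + 1) k t - g m k t with hd
  have dm : ∀ m k, AEStronglyMeasurable (d m k) (leb T) := fun m k => ((ginv (m + 1)).1 k).sub ((ginv m).1 k)
  have dX : ∀ m, X (d m) ≤ 2⁻¹ ^ m * (2 * r) := fun m => by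
    induction m with
    | zero =>
      rw [pow_zero, one_mul]
      refine le_of_eq_of_le (congrArg X ?_) (ginv 1).2
      ext1 k; ext1 t
      simp [hd, hg]
    | succ m ih =>
      refine (solNorm_difference_le hs hT h hK (gsol (m + 1)) (gsol m) (ginv _).1 (ginv _).1 (gX _) (gX _)).trans ?_
      calc L * (X (g (m + 1)) + X (g m)) * X (d m) ≤ L * (2 * r + 2 * r) * (2⁻¹ ^ m * (2 * r)) := by
            gcongr; exacts [(ginv _).2, (ginv _).2]
        _ = L * (4 * r) * (2⁻¹ ^ m * (2 * r)) := by ring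
        _ ≤ 2⁻¹ * (2⁻¹ ^ m * (2 * r)) := by gcongr
        _ = _ := by ring
  have dtail : ∀ M, ∑' m, X (d (m + M)) ≤ 2⁻¹ ^ M * (4 * r) := fun M => by
    refine (tsum_le_tsum fun m => dX (m + M)).trans_eq ?_
    simp only [pow_add, mul_assoc]
    rw [ENNReal.tsum_mul_right, ENNReal.tsum_geometric, ENNReal.one_sub_inv_two, inv_inv]; ring
  have hae := ae_summable_of_solNorm h dm (ne_top_of_le_mul (by simp) (mul_ne_top (by simp) hrt) (dtail 0))
  set G : ℕ → ℝ → L2R := fun k t => ∑' m, d m k t with hG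
  have gsum : ∀ n k t, ∑ m ∈ Finset.range n, d m k t = g n k t := fun n k t => by
    rw [Finset.sum_range_sub fun m => g m k t]; simp [hg]
  have Gm : MeasSeq T G := fun k => by
    refine aestronglyMeasurable_of_tendsto_ae atTop (fun n => (ginv n).1 k) ?_
    filter_upwards [hae] with t ht
    exact (ht k).hasSum.tendsto_sum_nat.congr fun n => gsum n k t
  have Gtail : ∀ M, X (fun k t => G k t - g M k t) ≤ 2⁻¹ ^ M * (4 * r) := fun M => by
    refine le_trans ?_ (dtail M)
    have e : X (fun k t => G k t - g M k t) = X fun k t => ∑' m, d (m + M) k t := by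
      refine solNorm_congr ?_
      filter_upwards [hae] with t ht k
      simp only [hG]; rw [← gsum, ← (ht k).sum_add_tsum_nat_add M, add_sub_cancel_left]
    have hs : ∀ᵐ t ∂leb T, ∀ k, Summable fun m => d (m + M) k t := by
      filter_upwards [hae] with t ht k
      exact (summable_nat_add_iff M).2 (ht k)
    rw [e]
    refine (add_le_add (cl_tsum_le (fun m => dm (m + M)) hs (Or.inr rfl) 0) (cl_tsum_le (fun m => dm (m + M)) hs (Or.inl rfl) s)).trans_eq tsum_add.symm
  have GX : X G ≤ 4 * r := by
    have := Gtail 0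
    rw [pow_zero, one_mul] at this
    refine le_of_eq_of_le (congrArg X ?_) this
    ext1 k; ext1 t
    simp [hg]
  have h4r : 4 * r ≠ ⊤ := mul_ne_top (by simp) hrt
  have GXt := ne_top_of_le_ne_top h4r GX
  have vsol := hΦ G Gm GXt
  have hle : ∀ M, X (fun k t => Φ G k t - G k t) ≤ 2⁻¹ ^ M * (8 * r) := fun M => by
    have h1 := solNorm_difference_le hs hT h hK vsol (gsol M) Gm (ginv M).1 GXt (gX M)
    have h2 := (solNorm_sub_comm (χ := χ) (φ := φ) (s := s) (T := T) (u := g (M + 1)) (w := G)).trans_le (Gtail (M + 1))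
    have h3 := solNorm_add_le (χ := χ) (φ := φ) (s := s) (fun k => (vsol.meas k).sub ((ginv (M + 1)).1 k)) fun k => ((ginv (M + 1)).1 k).sub (Gm k)
    simp only [Pi.sub_apply, sub_add_sub_cancel] at h3
    calc X (fun k t => Φ G k t - G k t)
        ≤ L * (4 * r + 2 * r) * (2⁻¹ ^ M * (4 * r)) + 2⁻¹ ^ (M + 1) * (4 * r) := by
          refine h3.trans (add_le_add (h1.trans ?_) h2)
          exact mul_le_mul' (mul_le_mul' le_rfl (add_le_add GX (ginv M).2)) (Gtail M)
      _ ≤ (L * (4 * r) + L * (4 * r)) * (2⁻¹ ^ M * (4 * r)) + 2⁻¹ ^ M * (4 * r) := by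
          refine add_le_add (mul_le_mul' ?_ le_rfl) (mul_le_mul' (pow_le_pow_right_of_le_one' (by simp) (Nat.le_succ M)) le_rfl)
          rw [← mul_add]; gcongr; norm_num
      _ ≤ (2⁻¹ + 2⁻¹) * (2⁻¹ ^ M * (4 * r)) + 2⁻¹ ^ M * (4 * r) := by gcongr
      _ = _ := by rw [ENNReal.inv_two_add_inv_two]; ring
  have hzero : X (fun k t => Φ G k t - G k t) = 0 :=
    nonpos_iff_eq_zero.1 (ge_of_tendsto' (tendsto_half_pow_mul (mul_ne_top (by simp) hrt)) hle)
  have heq := ae_eq_of_solNorm h vsol.meas Gm hzero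
  refine ⟨Φ G, vsol.congr_source fun k => ?_, ?_⟩
  · filter_upwards [heq] with t ht
    simp only [bilin, ht]
  · refine (solNorm_congr heq).trans_le ?_
    refine GX.trans_eq ?_
    rw [hr]; ring

/-- Uniqueness of small solutions of the nonlinear problem. -/
lemma ae_eq_of_isSolution (hs : s ∈ Ioo 0 1) (hT : 0 ≤ T) (h : IsLP χ φ) (hK : BilinBound χ φ s K)
    (hu : IsSolution s T u₀ u (bilin s u u)) (hw : IsSolution s T u₀ w (bilin s w w)) {R : ℝ≥0∞} (hR : R ≠ ⊤)
    (hxu : solNorm χ φ s T u ≤ R) (hxw : solNorm χ φ s T w ≤ R) (hsmall : nonlinConst K T * (2 * R) ≤ 2⁻¹) :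
    ∀ᵐ t ∂leb T, ∀ k, u k t = w k t := by
  refine ae_eq_of_solNorm h hu.meas hw.meas (s := s) ?_
  have hut := ne_top_of_le_ne_top hR hxu
  have hwt := ne_top_of_le_ne_top hR hxw
  have hd := ne_top_of_le_ne_top (ENNReal.add_ne_top.2 ⟨hut, hwt⟩) (solNorm_sub_le (χ := χ) (φ := φ) (s := s) hu.meas hw.meas)
  have h1 := solNorm_difference_le hs hT h hK hu hw hu.meas hw.meas hut hwt
  set x := solNorm χ φ s T fun k t => u k t - w k t
  have h2 : x ≤ 2⁻¹ * x := h1.trans (mul_le_mul' (le_trans (mul_le_mul' le_rfl ((add_le_add hxu hxw).trans_eq (two_mul R).symm)) hsmall) le_rfl)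
  by_contra hx
  refine absurd h2 (not_le.2 ?_)
  rw [mul_comm, ← div_eq_mul_inv]
  exact ENNReal.half_lt_self hx hd

end

section

/-! ## The weak formulation in physical space -/

variable {σ : ℝ} {F : ℝ × ℝ × ℝ → ℂ}

lemma IsTest.star (hF : IsTest T F) : IsTest T fun p => conj (F p) where
  smooth := hF.isBump.star.smooth
  compact := hF.isBump.star.compact
  before p hp := hF.before p (tsupport_comp_subset (map_zero (starRingEnd ℂ)) F hp)

lemma conj_transport_conj (hF : IsBump₃ F) (t x v : ℝ) : conj (transport (fun p => conj (F p)) (t, x, v))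
    = deriv (fun τ => F (τ, x, v)) t + (v : ℂ) * deriv (fun y => F (t, y, v)) x := by
  have h1 := (hF.star.hasDerivAt_fst t x v).unique (hF.hasDerivAt_fst t x v).star
  have h2 := (hF.star.hasDerivAt_snd t x v).unique (hF.hasDerivAt_snd t x v).star
  rw [← transport_eq hF, transport, transport, h1, h2]
  simp

lemma hasSum_pairing (hs : s ∈ Ioo 0 1) (hf : MemLp f 2 volume) (hh : IsBump h) (hfin : ∑' k, ‖coef k h‖ₑ * ∑ p ∈ antidiagonal k,
      ‖collCoef s p.1 p.2‖ₑ * (‖coef p.1 f‖ₑ * ‖coef p.2 f‖ₑ) ≠ ⊤) :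
    HasSum (fun k => coef k h * ((rate s k : ℂ) * coef k f - ∑ p ∈ antidiagonal k,
      (collCoef s p.1 p.2 : ℂ) * (coef p.1 f * coef p.2 f))) (linearPairing s f h - gammaPairing s f f h) := by
  set z : ℕ × ℕ → ℂ := fun p => coef p.2 f * (coef p.1 f * ((collCoef s p.1 p.2 : ℂ) * coef (p.1 + p.2) h)) with hz
  have e : ∀ k, ∀ p ∈ Finset.HasAntidiagonal.antidiagonal k, z p = coef k h * ((collCoef s p.1 p.2 : ℂ) * (coef p.1 f * coef p.2 f)) := fun k p hp => by
    rw [hz, ← Finset.HasAntidiagonal.mem_antidiagonal.1 hp]; ring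
  have hzs : Summable z := by
    refine summable_of_tsum_enorm ?_
    rw [← Finset.HasAntidiagonal.sigmaAntidiagonalEquivProd.tsum_eq, ENNReal.tsum_sigma']
    refine ne_of_eq_of_ne (tsum_congr fun k => ?_) hfin
    refine (Finset.tsum_subtype (antidiagonal k) fun p => ‖z p‖ₑ).trans ?_
    rw [mul_sum]
    refine sum_congr rfl fun p hp => ?_
    rw [e k p hp, enorm_mul, enorm_mul, enorm_mul, ← ofReal_norm (collCoef s p.1 p.2 : ℂ), norm_real, ofReal_norm]
  have h1 : HasSum (fun k => coef k h * ∑ p ∈ antidiagonal k, (collCoef s p.1 p.2 : ℂ) * (coef p.1 f * coef p.2 f)) (∑' p, z p) := by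
    refine (((Finset.HasAntidiagonal.sigmaAntidiagonalEquivProd.hasSum_iff).2 hzs.hasSum).sigma fun k =>
      (antidiagonal k).hasSum z).congr_fun fun k => ?_
    rw [mul_sum]
    exact (sum_congr rfl (e k)).symm
  have h2 := hasSum_gammaPairing hs hf hf hh
  have h3 := (((Equiv.prodComm ℕ ℕ).hasSum_iff).2 hzs.hasSum).prod_fiberwise fun j => (h2.2 j).hasSum.mul_left (coef j f)
  rw [h3.unique h2.1] at h1
  refine ((hasSum_linearPairing hs hf hh).sub h1).congr_fun fun k => ?_
  ring

lemma integral_tsum_conj_mul {a b : ℕ → L2R} (h : ∑' k, ‖a k‖ₑ * ‖b k‖ₑ ≠ ⊤) : ∫ x, ∑' k, conj (a k x) * b k x = ∑' k, ⟪a k, b k⟫_ℂ := by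
  rw [integral_tsum (f := fun k x => conj (a k x) * b k x) fun k => (RCLike.continuous_conj.comp_aestronglyMeasurable (Lp.aestronglyMeasurable (a k))).mul
    (Lp.aestronglyMeasurable (b k))]
  · refine tsum_congr fun k => ?_
    rw [← inner_toL2 (Lp.memLp (a k)) (Lp.memLp (b k)), toL2_coeFn, toL2_coeFn]
  · refine ne_top_of_le_ne_top h (tsum_le_tsum fun k => ?_)
    have h1 := ENNReal.lintegral_mul_le_Lp_mul_Lq volume Real.HolderConjugate.two_two
      (Lp.aestronglyMeasurable (a k)).enorm (Lp.aestronglyMeasurable (b k)).enorm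
    rw [Lp.enorm_def, Lp.enorm_def, eLpNorm_eq_lintegral_rpow_enorm_toReal (by norm_num) (by norm_num),
      eLpNorm_eq_lintegral_rpow_enorm_toReal (by norm_num) (by norm_num)]
    refine le_of_eq_of_le (lintegral_congr fun x => ?_) h1
    rw [enorm_mul, RCLike.enorm_conj, Pi.mul_apply]

lemma ae_wnorm_ne_top {u : ℕ → ℝ → L2R} (hu : MeasSeq T u) (h : energy T σ u ≠ ⊤) : ∀ᵐ t ∂leb T, wnorm σ (fun k => ‖u k t‖ₑ) ≠ ⊤ := by
  rw [energy_eq hu, eLpNorm_two_sq] at h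
  filter_upwards [ae_lt_top' ((measurable_wnorm σ fun k => (hu k).enorm).enorm.pow_const 2) h] with t ht hc
  simp [hc] at ht

lemma ae_wnorm_apply_ne_top {a : ℕ → L2R} (h : wnorm σ (fun k => ‖a k‖ₑ) ≠ ⊤) : ∀ᵐ x, wnorm σ (fun k => ‖a k x‖ₑ) ≠ ⊤ := by
  have h1 := pow_ne_top (n := 2) h
  rw [← lintegral_wnorm_sq] at h1
  filter_upwards [ae_lt_top' ((measurable_wnorm σ fun k => (Lp.aestronglyMeasurable (a k)).enorm).pow_const 2) h1] with t ht hc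
  simp [hc] at ht

/-- The Hermite coefficients of a function of `(t, x, v)`, as functions of time. -/
def hcoef (g : ℝ → ℝ → ℝ → ℂ) (k : ℕ) (t : ℝ) : L2R := seq (g t) k

/-- The collision terms of the weak formulation in terms of Hermite coefficients. -/
lemma integral_pairing_eq (hs : s ∈ Ioo 0 1) (h : IsLP χ φ) {g : ℝ → ℝ → ℝ → ℂ} (hg : SqIntT T g)
    (hx : solNorm χ φ s T (hcoef g) ≠ ⊤) {K : ℝ≥0∞} (hK : BilinBound χ φ s K) (hF : IsBump₃ F) :
    ∫ t in Icc 0 T, ∫ x : ℝ, (linearPairing s (g t x) (fun v => F (t, x, v))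
        - gammaPairing s (g t x) (g t x) (fun v => F (t, x, v)))
      = ∑' k, ∫ t in Icc 0 T, ⟪tcoef (fun p => conj (F p)) k t, (rate s k : ℂ) • hcoef g k t - bilin s (hcoef g) (hcoef g) k t⟫_ℂ := by
  have hum : ∀ k, AEStronglyMeasurable (hcoef g k) (leb T) := fun k => (hg.memLp_seq k).1
  obtain ⟨hNm, hNe, -⟩ := hK.apply h hum hum hx hx
  obtain ⟨C, hC, hrel⟩ := exists_energy_relax_le hs
  have hue := energy_ne_top_of_cl h hum (solNorm_ne_top hx).2
  set r : ℕ → ℝ → L2R := fun k t => (rate s k : ℂ) • hcoef g k t - bilin s (hcoef g) (hcoef g) k t with hr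
  have hlm : ∀ k, AEStronglyMeasurable (fun t => (rate s k : ℂ) • hcoef g k t) (leb T) := fun k =>
    (memLp_smul (hg.memLp_seq k) _).1
  have hrm : MeasSeq T r := fun k => (hlm k).sub (hNm k)
  have hre : energy T (-s) r ≠ ⊤ := ne_top_of_le_ne_top (mul_ne_top (by simp)
    (ENNReal.add_ne_top.2 ⟨ne_top_of_le_mul hC hue (hrel T _), hNe⟩)) (energy_sub_le hlm hNm)
  have hφm := fun k => (memLp_tcoef hF.star T k).1
  have hφe := (energy_tcoef_lt_top hF.star T hs.1.le (by linarith [hs.2])).ne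
  obtain ⟨D, hD, hb⟩ := exists_bilinear_bound hs
  have hin : ∀ᵐ t ∂leb T, ∫ x : ℝ, (linearPairing s (g t x) (fun v => F (t, x, v))
      - gammaPairing s (g t x) (g t x) (fun v => F (t, x, v))) = ∑' k, ⟪tcoef (fun p => conj (F p)) k t, r k t⟫_ℂ := by
    filter_upwards [hg.ae_sqInt, ae_bes_le 0 (hcoef g), ae_bes_ne_top hum (solNorm_ne_top hx).2, ae_wnorm_ne_top hφm hφe,
      ae_wnorm_ne_top hrm hre] with t h1 h2 h3 h4 h5
    have h2' := ne_top_of_le_ne_top (solNorm_ne_top hx).1 h2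
    rw [← integral_tsum_conj_mul]
    · refine integral_congr_ae ?_
      filter_upwards [ae_memLp_slice h1, ae_all_iff.2 fun k => coeFn_toL2 (memLp_coef h1 k),
        ae_all_iff.2 fun k => coeFn_toL2 (memLp_coef (F := fun x v => conj (F (t, x, v))) (hF.star.sqInt t) k),
        ae_all_iff.2 fun k => coeFn_prodSeq (s := s) (a := fun k => hcoef g k t) (b := fun k => hcoef g k t)
          (fun i j => memLp_mul_of_bes h h2' i (hcoef g j t)) k,
        ae_all_iff.2 fun k => Lp.coeFn_sub ((rate s k : ℂ) • hcoef g k t) (bilin s (hcoef g) (hcoef g) k t),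
        ae_all_iff.2 fun k => Lp.coeFn_smul (rate s k : ℂ) (hcoef g k t),
        ae_wnorm_apply_le h 0 (fun k => hcoef g k t), ae_wnorm_apply_le h s (fun k => hcoef g k t),
        ae_wnorm_apply_ne_top h4] with x m1 m2 m3 m4 m5 m6 m7 m8 m9
      have c1 : ∀ k, hcoef g k t x = coef k (g t x) := m2
      have c2 : ∀ k, tcoef (fun p => conj (F p)) k t x = conj (coef k fun v => F (t, x, v)) := fun k => by
        rw [← coef_conj]; exact m3 k
      have c3 : ∀ k, r k t x = (rate s k : ℂ) * coef k (g t x) - ∑ p ∈ antidiagonal k,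
          (collCoef s p.1 p.2 : ℂ) * (coef p.1 (g t x) * coef p.2 (g t x)) := fun k => by
        refine (m5 k).trans ?_
        rw [Pi.sub_apply, m6 k, Pi.smul_apply, smul_eq_mul, c1]
        refine congrArg₂ _ rfl ((m4 k).trans ?_)
        simp only [c1]
      refine ((hasSum_pairing hs m1 (hF.isBump_third t x) ?_).tsum_eq.symm).trans ?_
      · simp only [c1] at m7 m8
        simp only [c2, RCLike.enorm_conj] at m9
        have n7 := pow_ne_top (n := 2) (ne_top_of_le_mul (by simp) h2' m7)
        have n8 := pow_ne_top (n := 2) (ne_top_of_le_mul (by simp) h3 m8)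
        rw [wnorm_sq] at n7 n8
        simp only [weight_zero, one_mul] at n7
        have h6 := hb (fun k => ‖coef k (g t x)‖ₑ) fun k => ‖coef k (g t x)‖ₑ
        rw [← wnorm_sq] at h6
        have h7 := hoelder_wnorm s (fun k => ∑ p ∈ antidiagonal k, ‖collCoef s p.1 p.2‖ₑ *
          (‖coef p.1 (g t x)‖ₑ * ‖coef p.2 (g t x)‖ₑ)) fun k => ‖coef k fun v => F (t, x, v)‖ₑ
        simp only [mul_comm ‖coef _ fun v => F (t, x, v)‖ₑ]
        refine ne_top_of_le_mul (fun hc => ?_) m9 h7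
        rw [hc] at h6
        refine ne_top_of_le_mul ofReal_ne_top (mul_ne_top n7 n8) h6 (by simp)
      · exact tsum_congr fun k => by rw [c2, c3, conj_conj]
    · refine ne_top_of_le_mul h5 h4 (le_trans (le_of_eq ?_) (hoelder_wnorm s _ _))
      exact tsum_congr fun k => mul_comm _ _
  rw [integral_congr_ae hin]
  refine integral_tsum (fun k => (hφm k).inner (hrm k)) ?_
  have h6 := tsum_lintegral_mul_le (σ := -s) hφm hrm
  rw [neg_neg] at h6
  refine ne_top_of_le_ne_top (fun hc => ?_) (tsum_le_tsum fun k => lintegral_mono fun t => enorm_inner_le _ _)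
  rw [hc] at h6
  exact ne_top_of_le_mul hφe hre h6 (by simp)

lemma isWeakSolution_iff (hs : s ∈ Ioo 0 1) (h : IsLP χ φ) {g₀ : ℝ → ℝ → ℂ} (hg₀ : SqInt g₀)
    {g : ℝ → ℝ → ℝ → ℂ} (hg : MemTime T ⊤ g) (hx : solNorm χ φ s T (hcoef g) ≠ ⊤) {K : ℝ≥0∞} (hK : BilinBound χ φ s K) :
    IsWeakSolution s T g₀ g ↔ IsWeakSeq s T (seq g₀) (hcoef g) (bilin s (hcoef g) (hcoef g)) := by
  have hgs := hg.sqIntT le_top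
  have key : ∀ F : ℝ × ℝ × ℝ → ℂ, IsTest T F → (((∫ t in Icc 0 T, ∫ x : ℝ, ∫ v : ℝ,
          g t x v * (deriv (fun τ => F (τ, x, v)) t + (v : ℂ) * deriv (fun y => F (t, y, v)) x))
        + (∫ x : ℝ, ∫ v : ℝ, g₀ x v * F (0, x, v))
      = ∫ t in Icc 0 T, ∫ x : ℝ, (linearPairing s (g t x) (fun v => F (t, x, v))
          - gammaPairing s (g t x) (g t x) (fun v => F (t, x, v)))) ↔
      ∑' k, ∫ t in Icc 0 T, ⟪tcoef (fun p => conj (F p)) k t, (rate s k : ℂ) • hcoef g k t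
          - bilin s (hcoef g) (hcoef g) k t⟫_ℂ
        = (∑' k, ∫ t in Icc 0 T, ⟪tcoef (transport fun p => conj (F p)) k t, hcoef g k t⟫_ℂ)
          + ∑' k, ⟪tcoef (fun p => conj (F p)) k 0, seq g₀ k⟫_ℂ) := fun F hF => by
    have e1 := (hasSum_integral_inner_seq (hF.isBump.star.transport.sqIntT T) hgs).tsum_eq
    have e2 := (hasSum_inner_seq (hF.isBump.star.sqInt 0) hg₀).tsum_eq
    simp only [conj_transport_conj hF.isBump] at e1; simp only [conj_conj] at e2
    rw [integral_pairing_eq hs h hgs hx hK hF.isBump]; simp only [mul_comm (g _ _ _), mul_comm (g₀ _ _)]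
    rw [← e1, ← e2]; exact eq_comm
  refine ⟨fun hw F hF => ?_, fun hw => ⟨hg, fun F hF => (key F hF).2 (hw _ hF.star)⟩⟩
  have := (key _ hF.star).1 (hw.2 _ hF.star)
  simpa only [conj_conj] using this

end

section

/-! ## Functions with prescribed Hermite coefficients -/

variable {g g' : ℝ → ℝ → ℝ → ℂ}

lemma exists_of_coef {F : ℕ → ℝ × ℝ → ℂ} (hF : ∀ k, MemLp (F k) 2 ((leb T).prod volume))
    (hs : ∑' k, eLpNorm (F k) 2 ((leb T).prod volume) ^ 2 ≠ ⊤) : ∃ g : ℝ → ℝ → ℝ → ℂ, SqIntT T g ∧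
      ∀ k, ∀ᵐ p ∂(leb T).prod vol, coef k (g p.1 p.2) = F k p := by
  simp only [eLpNorm_two_sq] at hs
  have hmeas : ∀ k, AEMeasurable (fun p => ‖F k p‖ₑ ^ 2) ((leb T).prod volume) := fun k => (hF k).1.enorm.pow_const 2
  rw [← lintegral_tsum hmeas] at hs
  have hae : ∀ᵐ p ∂(leb T).prod vol, HasSum (fun k => F k p • hermiteBasis k) (∑' k, F k p • hermiteBasis k) := by
    filter_upwards [ae_lt_top' (AEMeasurable.tsum hmeas) hs] with p hp
    have hm : Memℓp (fun k => F k p) 2 := by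
      refine memℓp_gen ?_
      have := summable_toReal hp.ne
      simpa using this
    exact (hermiteBasis.hasSum_repr_symm ⟨_, hm⟩).summable.hasSum
  set w : ℝ × ℝ → L2R := fun p => ∑' k, F k p • hermiteBasis k with hw
  have hcoef : ∀ᵐ p ∂(leb T).prod vol, ∀ k, coef k (w p) = F k p := by
    filter_upwards [hae] with p hp k
    rw [← inner_hermiteBasis k (Lp.memLp (w p)), toL2_coeFn]
    have h1 := hp.mapL (innerSL ℂ (hermiteBasis k))
    refine h1.unique ((hasSum_ite_eq k (F k p)).congr_fun fun j => ?_)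
    rw [innerSL_apply_apply, inner_smul_right, orthonormal_iff_ite.1 hermiteBasis.orthonormal]
    by_cases hj : j = k
    · simp [hj]
    · simp [hj, Ne.symm hj]
  have hwm : AEStronglyMeasurable w ((leb T).prod volume) := by
    refine aestronglyMeasurable_of_tendsto_ae atTop (f := fun n p => ∑ k ∈ Finset.range n, F k p • hermiteBasis k) (fun n => ?_) ?_
    · exact Finset.aestronglyMeasurable_fun_sum _ fun k _ => (hF k).1.smul_const _
    · filter_upwards [hae] with p hp
      exact hp.tendsto_sum_nat
  have hwL : MemLp w 2 ((leb T).prod volume) := by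
    refine ⟨hwm, ?_⟩
    refine (ENNReal.pow_lt_top_iff.1 (lt_of_eq_of_lt ?_ (lt_top_iff_ne_top.2 hs))).resolve_right two_ne_zero
    rw [eLpNorm_two_sq]
    refine lintegral_congr_ae ?_
    filter_upwards [hcoef] with p hp
    rw [Lp.enorm_def, ← tsum_enorm_coef_sq (Lp.memLp (w p))]; simp only [hp]
  obtain ⟨G, -, hG, hGw⟩ := exists_joint hwL
  refine ⟨fun t x v => G (t, x) v, ?_, fun k => ?_⟩
  · exact hG.comp_measurePreserving (measurePreserving_prodAssoc (leb T) volume volume).symm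
  · filter_upwards [hGw, hcoef, ae_memLp_slice hG] with p h1 h2 h3
    rw [← h2, ← h1]
    exact coef_congr k (coeFn_toL2 h3).symm

lemma memTime_top (h : IsLP χ φ) (hg : SqIntT T g) (hx : cl χ φ T ⊤ 0 (hcoef g) ≠ ⊤) : MemTime T ⊤ g := by
  refine ⟨hg.1, lt_of_le_of_lt ?_ (mul_ne_top (by simp : (2 : ℝ≥0∞) ≠ ⊤) hx).lt_top⟩
  rw [normTVX, eLpNorm_exponent_top]
  refine essSup_le_of_ae_le _ ?_
  filter_upwards [hg.ae_sqInt, ae_bes_le 0 (hcoef g)] with t h1 h2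
  rw [enorm_eq_self, h1.normVX_eq]
  exact (wnorm_le_bes h 0 _).trans (mul_le_mul' le_rfl h2)

lemma memTime_two (hg : SqIntT T g) : MemTime T 2 g := by
  refine ⟨hg.1, (ENNReal.pow_lt_top_iff.1 (lt_of_eq_of_lt ?_ (pow_lt_top (n := 2) hg.2))).resolve_right two_ne_zero⟩
  rw [normTVX, eLpNorm_congr_ae (ae_normVX_eq hg.1), eLpNorm_two_sq]
  exact (eLpNorm_prod_sq (F := fun t (q : ℝ × ℝ) => g t q.1 q.2) hg.1).symm

/-- A function with given Hermite coefficients, together with its image under `𝓗^{s/2}`. -/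
lemma exists_function (hs : s ∈ Ioo 0 1) {u : ℕ → ℝ → L2R} (hu : MeasSeq T u)
    (hue : energy T s u ≠ ⊤) : ∃ g h : ℝ → ℝ → ℝ → ℂ, SqIntT T g ∧ IsHarmonicPower T (s / 2) g h ∧ ∀ᵐ t ∂leb T, ∀ k, hcoef g k t = u k t := by
  choose F _ hF hFu using fun k => exists_joint (memLp_of_energy hu hue k)
  have hn : ∀ k, eLpNorm (fun p : ℝ × ℝ => F k p.1 p.2) 2 ((leb T).prod volume) = eLpNorm (u k) 2 (leb T) :=
    fun k => (eLpNorm_toL2 (hF k)).symm.trans (eLpNorm_congr_ae (hFu k))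
  have hu0 : ∑' k, eLpNorm (u k) 2 (leb T) ^ 2 ≠ ⊤ := by
    have := ne_top_of_le_mul (by simp) hue (energy_mono_weight hs.1.le (by linarith [hs.2]) u)
    simpa only [energy, weight_zero, one_mul] using this
  obtain ⟨g, hg, hgF⟩ := exists_of_coef hF (by simpa only [hn] using hu0)
  obtain ⟨h, hh, hhF⟩ := exists_of_coef (T := T) (F := fun k p => ((((k : ℝ) + 1 / 2) ^ (s / 2) : ℝ) : ℂ) * F k p.1 p.2) (fun k => (hF k).const_mul _) (by
      refine ne_of_eq_of_ne (tsum_congr fun k => ?_) hue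
      have e := eLpNorm_const_smul ((((k : ℝ) + 1 / 2) ^ (s / 2) : ℝ) : ℂ) (fun p : ℝ × ℝ => F k p.1 p.2) 2 ((leb T).prod volume)
      rw [hn] at e; rw [← weight_half_sq, ← mul_pow, ← e]
      rfl)
  refine ⟨g, h, hg, ⟨memTime_two hh, fun k => ?_⟩, ae_all_iff.2 fun k => ?_⟩
  · filter_upwards [hgF k, hhF k] with p h1 h2
    exact h2.trans (congrArg _ h1.symm)
  · filter_upwards [Measure.ae_ae_of_ae_prod (hgF k), hFu k] with t h1 h2
    rw [← h2]; exact toL2_congr h1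

lemma ae_eq_of_hcoef (hg : SqIntT T g) (hg' : SqIntT T g') (h : ∀ᵐ t ∂leb T, ∀ k, hcoef g k t = hcoef g' k t) :
    ∀ᵐ p ∂slab T, g p.1 p.2.1 p.2.2 = g' p.1 p.2.1 p.2.2 := by
  have hd : SqIntT T fun t x v => g t x v - g' t x v := hg.sub hg'
  have h1 := tsum_eLpNorm_seq_sq hd
  have h2 : ∀ k, eLpNorm (fun t => seq (fun x v => g t x v - g' t x v) k) 2 (leb T) = 0 := fun k => by
    rw [eLpNorm_eq_zero_iff (hd.memLp_seq k).1 (by norm_num)]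
    filter_upwards [h, hg.ae_sqInt, hg'.ae_sqInt] with t h3 h4 h5
    have h6 : seq (fun x v => g t x v - g' t x v) k = seq (g t) k - seq (g' t) k := by
      rw [seq, seq, seq, ← toL2_sub (memLp_coef h4 k) (memLp_coef h5 k)]
      refine toL2_congr ?_
      filter_upwards [ae_memLp_slice h4, ae_memLp_slice h5] with x h7 h8
      exact coef_sub k h7 h8
    exact h6.trans (sub_eq_zero.2 (h3 k))
  simp only [h2, ne_eq, OfNat.ofNat_ne_zero, not_false_eq_true, zero_pow, tsum_zero] at h1
  have h3 := (eLpNorm_eq_zero_iff hd.1 (by norm_num)).1 (pow_eq_zero_iff two_ne_zero |>.1 h1.symm)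
  filter_upwards [h3] with p hp
  exact sub_eq_zero.1 hp

lemma satisfiesBound_norm (hχφ : IsLP χ φ) (hg : SqIntT T g) {h : ℝ → ℝ → ℝ → ℂ} (hh : IsHarmonicPower T (s / 2) g h) :
    cheminLernerNorm χ φ T ⊤ 2 2 (1 / 2) g + cheminLernerNorm χ φ T 2 2 2 (1 / 2) h = solNorm χ φ s T (hcoef g) := by
  rw [cheminLernerNorm_eq hχφ hg, cheminLernerNorm_harmonicPower hχφ hg hh]; rfl

lemma growth_le_exp (hT : 0 ≤ T) : growth T ≤ ofReal (Real.exp T) := by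
  refine ofReal_le_ofReal (Real.sqrt_le_iff.2 ⟨(Real.exp_pos T).le, ?_⟩)
  have := Real.add_one_le_exp T
  nlinarith

lemma exists_pos_mul_le {D : ℝ≥0∞} (hD : D ≠ ⊤) : ∃ ε : ℝ, 0 < ε ∧ D * ofReal ε ≤ 2⁻¹ := by
  have h0 : 0 ≤ D.toReal := ENNReal.toReal_nonneg
  refine ⟨(2 * (D.toReal + 1))⁻¹, by positivity, ?_⟩
  rw [← ENNReal.ofReal_toReal hD, ← ofReal_mul h0, toReal_ofReal h0, show (2⁻¹ : ℝ≥0∞) = ofReal 2⁻¹ by rw [ENNReal.ofReal_inv_of_pos two_pos, ofReal_ofNat]]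
  refine ofReal_le_ofReal ?_
  rw [mul_inv, mul_left_comm]
  refine mul_le_of_le_one_right (by positivity) ?_
  rw [← div_eq_mul_inv, div_le_one (by positivity)]
  linarith

/-- A weak solution satisfying the a priori bound solves the problem for Hermite coefficients. -/
lemma isSolution_of_isWeakSolution (hs : s ∈ Ioo 0 1) (h : IsLP χ φ) {g₀ : ℝ → ℝ → ℂ}
    (hg₀ : SqInt g₀) (hg : IsWeakSolution s T g₀ g) (hx : solNorm χ φ s T (hcoef g) ≠ ⊤) {K : ℝ≥0∞} (hK : BilinBound χ φ s K) :
    IsSolution s T (seq g₀) (hcoef g) (bilin s (hcoef g) (hcoef g)) := by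
  have hm : ∀ k, AEStronglyMeasurable (hcoef g k) (leb T) := fun k => ((hg.1.sqIntT le_top).memLp_seq k).1
  have b := hK.apply h hm hm hx hx
  refine ⟨(isWeakSolution_iff hs h hg₀ hg.1 hx hK).1 hg, ?_, hm, energy_ne_top_of_cl h hm (solNorm_ne_top hx).2, b.1, b.2.1⟩
  have := wnorm_sq 0 fun k => ‖seq g₀ k‖ₑ
  simp only [weight_zero, one_mul] at this
  rw [← this, wnorm_seq hg₀]
  exact pow_ne_top hg₀.2.ne

end

end

end Kac

open Kac

theorem theorem3p1 (s : ℝ) (hs₀ : 0 < s) (hs₁ : s < 1)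
    (χ φ : ℝ → ℝ) (hχφ : Kac.IsLittlewoodPaleyPair χ φ) :
    ∃ c₀ : ℝ, 1 < c₀ ∧ ∀ T : ℝ, 0 < T → ∃ ε₀ : ℝ, 0 < ε₀ ∧
      ∀ g₀ : ℝ → ℝ → ℂ,
        MemLp (fun p : ℝ × ℝ => g₀ p.1 p.2) 2 volume →
        Kac.besovNorm χ φ 2 2 (1 / 2) g₀ ≤ ENNReal.ofReal ε₀ →
        (∃ g : ℝ → ℝ → ℝ → ℂ,
          Kac.IsWeakSolution s T g₀ g ∧ Kac.SatisfiesBound χ φ s T c₀ g₀ g) ∧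
        (∀ g g' : ℝ → ℝ → ℝ → ℂ,
          Kac.IsWeakSolution s T g₀ g → Kac.SatisfiesBound χ φ s T c₀ g₀ g →
          Kac.IsWeakSolution s T g₀ g' → Kac.SatisfiesBound χ φ s T c₀ g₀ g' →
          ∀ᵐ p : ℝ × ℝ × ℝ ∂(Kac.slab T), g p.1 p.2.1 p.2.2 = g' p.1 p.2.1 p.2.2) := by
  have hs : s ∈ Ioo 0 1 := ⟨hs₀, hs₁⟩
  obtain ⟨K, hKt, hK'⟩ := exists_cl_bilin_le hs
  have hK : BilinBound χ φ s K := fun T u w => hK' hχφ T u w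
  refine ⟨148, by norm_num, fun T hT => ?_⟩
  have hL : nonlinConst K T ≠ ⊤ := ENNReal.mul_ne_top
    (ENNReal.mul_ne_top (by simp) (ENNReal.pow_ne_top ENNReal.ofReal_ne_top)) hKt
  obtain ⟨ε, hε, hsmall⟩ := exists_pos_mul_le
    (ENNReal.mul_ne_top hL (ENNReal.mul_ne_top (by simp : (2 : ℝ≥0∞) ≠ ⊤) (ENNReal.ofReal_ne_top (r := 148 * Real.exp T))))
  refine ⟨ε, hε, fun g₀ hg₀ hb => ?_⟩
  have hg₀' : SqInt g₀ := hg₀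
  rw [besovNorm_eq hχφ hg₀'] at hb
  have hbt : besov χ φ (seq g₀) ≠ ⊤ := ne_top_of_le_ne_top ENNReal.ofReal_ne_top hb
  set R : ℝ≥0∞ := ENNReal.ofReal (148 * Real.exp T) * besov χ φ (seq g₀) with hR
  have hRt : R ≠ ⊤ := ENNReal.mul_ne_top ENNReal.ofReal_ne_top hbt
  have hR2 : nonlinConst K T * (2 * R) ≤ 2⁻¹ := by
    refine le_trans (le_of_eq_of_le ?_ (mul_le_mul' le_rfl hb)) hsmall
    rw [hR]; ring
  have hgrow : 148 * growth T * besov χ φ (seq g₀) ≤ R := by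
    refine mul_le_mul' ?_ le_rfl
    rw [ENNReal.ofReal_mul (by norm_num), ENNReal.ofReal_ofNat]
    exact mul_le_mul' le_rfl (growth_le_exp hT.le)
  have hbound : ∀ g, SqIntT T g → SatisfiesBound χ φ s T 148 g₀ g → solNorm χ φ s T (hcoef g) ≤ R := by
    rintro g hg ⟨h, hh, hle⟩
    rwa [satisfiesBound_norm hχφ hg hh, besovNorm_eq hχφ hg₀'] at hle
  refine ⟨?_, fun g g' hg hgb hg' hgb' => ?_⟩
  · obtain ⟨u, hu, hux⟩ := exists_solution (u₀ := seq g₀) hs hT.le hχφ hK hbt (by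
      refine le_trans (mul_le_mul' le_rfl ?_) hR2
      calc 4 * (37 * growth T * besov χ φ (seq g₀)) = 148 * growth T * besov χ φ (seq g₀) := by ring
        _ ≤ 1 * R := by rwa [one_mul]
        _ ≤ 2 * R := by gcongr; norm_num)
    obtain ⟨g, h, hg, hh, hgu⟩ := exists_function hs hu.meas hu.energy
    have hx : solNorm χ φ s T (hcoef g) ≤ R := (solNorm_congr hgu).trans_le (hux.trans hgrow)
    have hxt := ne_top_of_le_ne_top hRt hx
    refine ⟨g, (isWeakSolution_iff hs hχφ hg₀' (memTime_top hχφ hg (solNorm_ne_top hxt).1) hxt hK).2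
      fun F hF => ?_, h, hh, ?_⟩
    · have hw := hu.weak F hF
      have e1 : ∀ k, ∀ᵐ t ∂leb T, hcoef g k t = u k t := fun k => hgu.mono fun t ht => ht k
      have e2 : ∀ k, ∀ᵐ t ∂leb T, bilin s (hcoef g) (hcoef g) k t = bilin s u u k t := fun k =>
        hgu.mono fun t ht => by simp only [bilin, ht]
      refine Eq.trans (tsum_congr fun k => integral_congr_ae ?_) (hw.trans (congrArg₂ _ (tsum_congr fun k => integral_congr_ae ?_) rfl))
      · filter_upwards [e1 k, e2 k] with t h1 h2
        rw [h1, h2]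
      · filter_upwards [e1 k] with t h1
        rw [h1]
    · rw [satisfiesBound_norm hχφ hg hh, besovNorm_eq hχφ hg₀']; exact hx
  · have hq := hg.1.sqIntT le_top
    have hq' := hg'.1.sqIntT le_top
    have hx := hbound g hq hgb
    have hx' := hbound g' hq' hgb'
    exact ae_eq_of_hcoef hq hq' (ae_eq_of_isSolution hs hT.le hχφ hK
      (isSolution_of_isWeakSolution hs hχφ hg₀' hg (ne_top_of_le_ne_top hRt hx) hK)
      (isSolution_of_isWeakSolution hs hχφ hg₀' hg' (ne_top_of_le_ne_top hRt hx') hK) hRt hx hx' hR2)
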